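/- Let $d\in\{2,3\}$, $T>0$, $p>d$, $\gamma\in(\frac dp,1)$, $A>0$ and $\beta\in(0,1]$. Let $\mathbb T^d=\mathbb R^d/\mathbb Z^d$. Let $\|f\|_{\gamma,p}=\|(I-\Delta)^{\gamma/2}f\|_{L^p(\mathbb T^d)}$, where $(I-\Delta)^{\gamma/2}$ is the Fourier multiplier $(1+|k|^2)^{\gamma/2}$, $k\in\mathbb Z^d$, and let $H^\gamma_p$ be the corresponding Bessel space of vector fields; since $\gamma>\frac dp$, its elements are identified with their continuous representatives. Let $P$ be the Leray projector and $e^{t\Delta}$ the heat semigroup on $\mathbb T^d$. Let $\chi\in\mathcal C^2_b(\mathbb R)$ satisfy $\chi(x)=x$ on $[-A,A]$, $\chi(x)=A$ for $x>1+A$, $\chi(x)=-A$ for $x<-(1+A)$, $\|\chi'\|_\infty\le 1$ and $\|\chi''\|_\infty<\infty$, and put $\boldsymbol\chi(x)=(\chi(x_1),\dots,\chi(x_d))$. Let $\vartheta^1:\mathbb R^d\to\mathbb R_+$ be a smooth probability density with support in $(-\frac12,\frac12)^d$ and, for $N\in\mathbb N^*$, let $\vartheta^{1,N}:\mathbb T^d\to\mathbb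 R_+$ be the periodisation of $x\mapsto N^{d\beta}\vartheta^1(N^\beta x)$, $x\in[-\frac12,\frac12)^d$; for $X\in\mathbb T^d$ write $\delta^N_X(x)=\vartheta^{1,N}(x-X)$. Let $\sigma_N>0$ for all $N\in\mathbb N^*$. Let $(\Omega,\mathcal F,(\mathcal F_t)_{t\ge0},\mathbb P)$ be a filtered probability space satisfying the usual conditions, $(B^i)_{i\in\mathbb N}$ a family of independent $d$-dimensional $(\mathcal F_t)$-Brownian motions, $(X^i_0,V^i_0)_{i\in\mathbb N}$ $\mathcal F_0$-measurable random variables in $\mathbb T^d\times\mathbb R^d$, and, for $N\in\mathbb N^*$, $u^{\circ,N}$ an $\mathcal F_0$-measurable random vector field on $\mathbb T^d$, almost surely divergence free, such that for every $q\ge1$ $$\sup_{N}\mathbb E\|u^{\circ,N}\|_{L^2}^q<\infty\quad\text{and}\quad \sup_{N}\mathbb E\|u^{\circ,N}\|_{\gamma,p}^q<\infty .$$ Fix $N\in\mathbb N^*$ and consider on $[0,T]$ the system $$u_t = e^{t\Delta}u^{\circ,N}-\int_0^t e^{(t-s)\Delta}P\big[(u_s\cdot\nabla)\boldsymbol\chi(u_s)\big]\,ds-\int_0^t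 e^{(t-s)\Delta}P\Big[\frac1N\sum_{i=1}^N\big(\boldsymbol\chi(u_s(X^i_s))-V^i_s\big)\,\delta^N_{X^i_s}\Big]ds,\qquad(1)$$ $$X^i_t=X^i_0+\int_0^tV^i_s\,ds \pmod{\mathbb Z^d},\qquad V^i_t=V^i_0+\int_0^t\big(\boldsymbol\chi(u_s(X^i_s))-V^i_s\big)\,ds+\sigma_NB^i_t,\quad 1\le i\le N,\qquad(2)$$ where $u$ is divergence free and belongs to $L^\infty([0,T];H^\gamma_p(\mathbb T^d)^d)$, the paths $(X^i,V^i)$ belong to $\mathcal C([0,T];\mathbb T^d\times\mathbb R^d)$, and $(u_s\cdot\nabla)\boldsymbol\chi(u_s)$ is understood in the sense of distributions, that is, as $\sum_l\partial_l\big((u_s)_l\,\boldsymbol\chi(u_s)\big)$. Then there exist $\Omega_N\in\mathcal F$ with $\mathbb P(\Omega_N)=1$ and a process $(u^N,X^{1,N},V^{1,N},\dots,X^{N,N},V^{N,N})$ on $[0,T]$ such that * for every $\omega\in\Omega_N$, $u^N(\omega)$ is the unique solution of the mild equation (1) with particle paths $(X^{i,N}(\omega),V^{i,N}(\omega))_{1\le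 i\le N}$; moreover, for almost every $s$, $\boldsymbol\chi(u^N_s)$ has a weak gradient in $L^2$ and the distribution $(u^N_s\cdot\nabla)\boldsymbol\chi(u^N_s)$ is the function $\sum_l (u^N_s)_l\,\partial_l\boldsymbol\chi(u^N_s)\in L^2$; * for every $\omega\in\Omega_N$ and every $i\in\{1,\dots,N\}$, $(X^{i,N},V^{i,N})$ solves (2); * for every $\omega\in\Omega_N$, the solution of the coupled system (1)-(2) is unique (in particular the process is unique up to indistinguishability); * $(u^N,X^{1,N},V^{1,N},\dots,X^{N,N},V^{N,N})$ is jointly measurable in $(t,\omega)$ and adapted to $(\mathcal F_t)_{t\ge0}$. -/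

import Mathlib

open MeasureTheory ProbabilityTheory Set
open scoped NNReal ENNReal

noncomputable section

namespace FluidParticle

/-- The velocity space `ℝ^d` with its Euclidean norm. -/
abbrev Vel (d : ℕ) : Type := EuclideanSpace ℝ (Fin d)

/-- The flat torus `𝕋^d = (ℝ/ℤ)^d`. -/
abbrev Torus (d : ℕ) : Type := UnitAddTorus (Fin d)

/-- The normalised Lebesgue (Haar) measure on the torus. -/
def torusMeasure (d : ℕ) : Measure (Torus d) :=
  Measure.pi fun _ => AddCircle.haarAddCircle

/-- The canonical projection `ℝ^d → 𝕋^d`. -/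
def toTorus {d : ℕ} (y : Vel d) : Torus d := fun j => ((y j : ℝ) : UnitAddCircle)

/-- The representative in `[-1/2, 1/2)^d` of a point of the torus. -/
def torusRep {d : ℕ} (x : Torus d) : Vel d :=
  WithLp.toLp 2 fun j => (AddCircle.equivIco (1 : ℝ) (-(1 / 2)) (x j) : ℝ)

/-! ### Fourier coefficients, Bessel norms, Leray projector and heat semigroup -/

/-- Fourier coefficients of a vector-valued periodic distribution: the `j`-th component has
coefficient `c k j` at the frequency `k ∈ ℤ^d`. -/
abbrev Coeffs (d : ℕ) : Type := (Fin d → ℤ) → Fin d → ℂ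

/-- `|k|²` for `k ∈ ℤ^d`. -/
def freqSq {d : ℕ} (k : Fin d → ℤ) : ℝ := ∑ l, (k l : ℝ) ^ 2

/-- Fourier coefficients of a vector field on the torus. -/
def vecCoeff {d : ℕ} (f : Torus d → Vel d) : Coeffs d :=
  fun k j => UnitAddTorus.mFourierCoeff (fun x => ((f x j : ℝ) : ℂ)) k

/-- `g` is the function `(I - Δ)^{γ/2} f` (it has the right Fourier coefficients) and it belongs
to `L^p`. -/
def IsBesselPotential {d : ℕ} (γ p : ℝ) (f g : Torus d → Vel d) : Prop :=
  MemLp g (ENNReal.ofReal p) (torusMeasure d) ∧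
    ∀ k j, vecCoeff g k j = (((1 + freqSq k) ^ (γ / 2) : ℝ) : ℂ) * vecCoeff f k j

/-- The norm `‖f‖_{γ,p} = ‖(I - Δ)^{γ/2} f‖_{L^p}`, equal to `∞` if `(I - Δ)^{γ/2} f` is not in
`L^p`. (The function `g` is unique up to null sets when it exists.) -/
def besselNorm {d : ℕ} (γ p : ℝ) (f : Torus d → Vel d) : ℝ≥0∞ :=
  ⨅ (g : Torus d → Vel d) (_ : IsBesselPotential γ p f g),
    eLpNorm g (ENNReal.ofReal p) (torusMeasure d)

/-- `f` is divergence free: `⟨k, f̂(k)⟩ = 0` for all `k`. -/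
def IsDivFree {d : ℕ} (f : Torus d → Vel d) : Prop :=
  ∀ k : Fin d → ℤ, ∑ l, (k l : ℂ) * vecCoeff f k l = 0

/-- The Leray projector, on Fourier coefficients. -/
def leray {d : ℕ} (c : Coeffs d) : Coeffs d := fun k j =>
  if k = 0 then c k j else c k j - (∑ l, (k l : ℂ) * c k l) / ((freqSq k : ℝ) : ℂ) * (k j : ℂ)

/-- The heat semigroup `e^{tΔ}`, for `t > 0`, applied to the periodic distribution with Fourier
coefficients `c`; the result is the smooth function `∑_k e^{-4π²|k|²t} c_k e^{2iπ⟨k,x⟩}`. The real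
part removes nothing for coefficients of real distributions. -/
def heat {d : ℕ} (t : ℝ) (c : Coeffs d) (x : Torus d) : Vel d :=
  WithLp.toLp 2 fun j =>
    (∑' k : Fin d → ℤ, ((Real.exp (-(4 * Real.pi ^ 2 * freqSq k * t)) : ℝ) : ℂ) * c k j *
      UnitAddTorus.mFourier k x).re

/-- Fourier coefficients of `(u · ∇) w = ∇ · (w ⊗ u) = ∑_l ∂_l (u_l w)` in the sense of
distributions, for a divergence-free field `u`. -/
def convection {d : ℕ} (u w : Torus d → Vel d) : Coeffs d := fun k j =>
  ∑ l, 2 * (Real.pi : ℂ) * Complex.I * (k l : ℂ) *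
    UnitAddTorus.mFourierCoeff (fun x => ((u x l * w x j : ℝ) : ℂ)) k

/-- `G l` is the weak partial derivative `∂_l w`, and it belongs to `L²`, for every `l`. -/
def IsWeakGradient {d : ℕ} (w : Torus d → Vel d) (G : Fin d → Torus d → Vel d) : Prop :=
  ∀ l, MemLp (G l) 2 (torusMeasure d) ∧
    ∀ k j, vecCoeff (G l) k j = 2 * (Real.pi : ℂ) * Complex.I * (k l : ℂ) * vecCoeff w k j

/-- `w` has a weak gradient in `L²` and the distribution `(u · ∇) w` is the function
`x ↦ ∑_l u_l(x) ∂_l w(x)` of `L²`. -/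
def IsConvectionFunction {d : ℕ} (u w : Torus d → Vel d) : Prop :=
  ∃ G : Fin d → Torus d → Vel d, IsWeakGradient w G ∧
    MemLp (fun x => ∑ l, u x l • G l x) 2 (torusMeasure d) ∧
    convection u w = vecCoeff (fun x => ∑ l, u x l • G l x)

/-! ### Cut-off and mollifier -/

/-- `χ` is a cut-off function at level `A`. -/
structure IsCutoff (A : ℝ) (χ : ℝ → ℝ) : Prop where
  contDiff : ContDiff ℝ 2 χ
  eq_id : ∀ x ∈ Icc (-A) A, χ x = x
  eq_right : ∀ x, 1 + A < x → χ x = A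
  eq_left : ∀ x, x < -(1 + A) → χ x = -A
  deriv_le : ∀ x, |deriv χ x| ≤ 1
  deriv_two_bdd : ∃ C : ℝ, ∀ x, |deriv (deriv χ) x| ≤ C

/-- The cut-off acting on each component of a vector. -/
def vecCutoff {d : ℕ} (χ : ℝ → ℝ) (y : Vel d) : Vel d := WithLp.toLp 2 fun j => χ (y j)

/-- `θ` is a smooth probability density on `ℝ^d` with support in `(-1/2, 1/2)^d`. -/
structure IsMollifierProfile {d : ℕ} (θ : Vel d → ℝ) : Prop where
  smooth : ContDiff ℝ ((⊤ : ℕ∞) : WithTop ℕ∞) θ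
  nonneg : ∀ y, 0 ≤ θ y
  integral_eq_one : ∫ y, θ y = 1
  support_subset : tsupport θ ⊆ {y | ∀ j, |y j| < 1 / 2}

/-- The mollified Dirac mass at the origin of the torus: the periodisation of
`y ↦ N^{dβ} θ(N^β y)`, `y ∈ [-1/2, 1/2)^d`. -/
def mollifier {d : ℕ} (θ : Vel d → ℝ) (β : ℝ) (N : ℕ) (x : Torus d) : ℝ :=
  (N : ℝ) ^ ((d : ℝ) * β) * θ ((N : ℝ) ^ β • torusRep x)

/-! ### The fluid-particle system along one path of the noise -/

/-- The drag force `(1/N) ∑_i (χ(u(x^i)) - v^i) δ(· - x^i)` exerted on the fluid. -/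
def dragForce {d N : ℕ} (χ : ℝ → ℝ) (δ : Torus d → ℝ) (u : Torus d → Vel d)
    (x : Fin N → Torus d) (v : Fin N → Vel d) (y : Torus d) : Vel d :=
  (1 / (N : ℝ)) • ∑ i, δ (y - x i) • (vecCutoff χ (u (x i)) - v i)

/-- `u` is a mild solution on `[0, T]`, in the class `L^∞([0, T]; H^γ_p)`, of the fluid equation
with initial datum `u₀` and particle paths `(x, v)`. Fields in `H^γ_p` are represented by their
continuous versions (`γ > d/p`). -/
structure IsMildSolution {d N : ℕ} (γ p T : ℝ) (χ : ℝ → ℝ) (δ : Torus d → ℝ)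
    (u₀ : C(Torus d, Vel d)) (x : Fin N → ℝ → Torus d) (v : Fin N → ℝ → Vel d)
    (u : ℝ → C(Torus d, Vel d)) : Prop where
  aestronglyMeasurable : AEStronglyMeasurable u (volume.restrict (Icc 0 T))
  bounded : ∃ C : ℝ≥0, ∀ t ∈ Icc 0 T, besselNorm γ p (u t) ≤ C
  divFree : ∀ t ∈ Icc 0 T, IsDivFree (u t)
  initial : u 0 = u₀
  integrable_convection : ∀ t ∈ Ioc 0 T, ∀ y, IntervalIntegrable
    (fun s => heat (t - s) (leray (convection (u s) fun z => vecCutoff χ (u s z))) y) volume 0 t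
  integrable_drag : ∀ t ∈ Ioc 0 T, ∀ y, IntervalIntegrable
    (fun s => heat (t - s)
      (leray (vecCoeff (dragForce χ δ (u s) (fun i => x i s) fun i => v i s))) y) volume 0 t
  mild : ∀ t ∈ Ioc 0 T, ∀ y, u t y = heat t (vecCoeff u₀) y
    - (∫ s in 0..t, heat (t - s) (leray (convection (u s) fun z => vecCutoff χ (u s z))) y)
    - ∫ s in 0..t, heat (t - s)
        (leray (vecCoeff (dragForce χ δ (u s) (fun i => x i s) fun i => v i s))) y

/-- `(x, v)` is a continuous path on `[0, T]` which solves, with noise path `b`,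
`dx = v dt`, `dv = (χ(u_t(x)) - v) dt + σ db`, in integrated form. -/
structure IsParticleSolution {d : ℕ} (T : ℝ) (χ : ℝ → ℝ) (σ : ℝ) (u : ℝ → C(Torus d, Vel d))
    (x₀ : Torus d) (v₀ : Vel d) (b : ℝ → Vel d) (x : ℝ → Torus d) (v : ℝ → Vel d) : Prop where
  continuousOn_position : ContinuousOn x (Icc 0 T)
  continuousOn_velocity : ContinuousOn v (Icc 0 T)
  position : ∀ t ∈ Icc 0 T, x t = x₀ + toTorus (∫ s in 0..t, v s)
  integrable_drift : ∀ t ∈ Icc 0 T,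
    IntervalIntegrable (fun s => vecCutoff χ (u s (x s)) - v s) volume 0 t
  velocity : ∀ t ∈ Icc 0 T,
    v t = v₀ + (∫ s in 0..t, (vecCutoff χ (u s (x s)) - v s)) + σ • b t

/-- The coupled system, for one realisation of the initial data and of the noise. -/
def IsSystemSolution {d N : ℕ} (γ p T : ℝ) (χ : ℝ → ℝ) (δ : Torus d → ℝ) (σ : ℝ)
    (u₀ : C(Torus d, Vel d)) (x₀ : Fin N → Torus d) (v₀ : Fin N → Vel d)
    (b : Fin N → ℝ → Vel d) (u : ℝ → C(Torus d, Vel d)) (x : Fin N → ℝ → Torus d)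
    (v : Fin N → ℝ → Vel d) : Prop :=
  IsMildSolution γ p T χ δ u₀ x v u ∧
    ∀ i, IsParticleSolution T χ σ u (x₀ i) (v₀ i) (b i) (x i) (v i)

/-! ### Probabilistic setting -/

/-- The usual conditions: the filtration is right-continuous, and `𝓕 0` contains every null set
(in particular the space is complete). -/
structure UsualConditions {Ω : Type*} {mΩ : MeasurableSpace Ω} (𝓕 : Filtration ℝ≥0 mΩ)
    (P : Measure Ω) : Prop where
  rightContinuous : 𝓕.IsRightContinuous
  complete : ∀ s : Set Ω, P s = 0 → MeasurableSet[𝓕 0] s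

/-- `B` is a standard `d`-dimensional Brownian motion with respect to the filtration `𝓕`. -/
structure IsFiltrationBrownian {Ω : Type*} {mΩ : MeasurableSpace Ω} {d : ℕ}
    (𝓕 : Filtration ℝ≥0 mΩ) (P : Measure Ω) (B : ℝ≥0 → Ω → Vel d) : Prop where
  adapted : ∀ t, Measurable[𝓕 t] (B t)
  start_zero : ∀ᵐ ω ∂P, B 0 ω = 0
  continuous_paths : ∀ᵐ ω ∂P, Continuous fun t => B t ω
  indep_increments : ∀ s t, s ≤ t →
    Indep (MeasurableSpace.comap (fun ω => B t ω - B s ω) inferInstance) (𝓕 s) P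
  law_increments : ∀ s t, s ≤ t → P.map (fun ω => B t ω - B s ω) =
    multivariateGaussian 0 (((t : ℝ) - s) • (1 : Matrix (Fin d) (Fin d) ℝ))

/-- Moment assumption on the random initial velocities of the fluid: the moments of all orders
`q ≥ 1` of their `L²` and `H^γ_p` norms are bounded uniformly in `N ≥ 1`. -/
def InitialMoments {Ω : Type*} {mΩ : MeasurableSpace Ω} {d : ℕ} (γ p : ℝ) (P : Measure Ω)
    (u₀ : ℕ → Ω → C(Torus d, Vel d)) : Prop :=
  ∀ q : ℝ, 1 ≤ q → ∃ C : ℝ≥0, ∀ N : ℕ, 1 ≤ N →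
    ∫⁻ ω, eLpNorm (u₀ N ω) 2 (torusMeasure d) ^ q ∂P ≤ C ∧
    ∫⁻ ω, besselNorm γ p (u₀ N ω) ^ q ∂P ≤ C

end FluidParticle

end

noncomputable section

namespace FluidParticle

open UnitAddTorus Filter Topology

variable {d : ℕ}

/-! ### Fourier series on the torus -/

/-! The noise is additive, so the system is solved path by path and no stochastic integral is
needed. The unknown is the pair z = (u, v) of a continuous field, in the sup norm, and the particle
velocities; positions are primitives of v. The system becomes a Volterra equation z =
`freeEvolution` + `duhamel` z, whose integrand is singular like (t - s)^(-κ) with κ = (3 + γ)/4 < 1.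

Three estimates on `duhamel` carry the argument, each with an exponential weight e^(lt) that makes
the singular Volterra operator as small as desired (`exists_exp_weight`). The cut-off makes the
convection u χ(u) grow linearly, so bounds are global on [0, T]
(`IsForcing.exists_norm_duhamel_le`). The heat semigroup produces fields with Lipschitz constant A
t^(-κ'), where κ' = (κ + 1)/2 < 1 (`IsForcing.exists_isLip_duhamel`). Comparing u at a particle
position with u' at another one only needs a Lipschitz bound on one of the two fields, and positions
differ by at most t times the velocity difference, which compensates t^(-κ'); hence a contraction
(`IsForcing.exists_norm_duhamel_sub_le`).

Picard iterates therefore converge to a Lipschitz solution (`IsForcing.picard`), and every bounded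
measurable solution coincides with it (`IsForcing.eq_of_norm_sub_le_duhamel`). Solutions in
L^∞(H^γ_p) are bounded by the Sobolev embedding (`exists_norm_le_bessel`), whence both uniqueness
claims.

The operators e^(τΔ)P and e^(τΔ)P∂_l, with or without (I - Δ)^(γ/2), are bounded on continuous
fields by O(τ^(-κ)) (`exists_smoothing_bound`). This is read off the explicit heat kernel, a product
of one-dimensional theta functions. The version with the Bessel multiplier puts the constructed
solution in H^γ_p. Divergence-freeness turns the distribution ∇·(u ⊗ χ(u)) into a function
(`IsDivFree.isConvectionFunction`).

Measurability passes to the limit of the Picard iterates. These are causal, so the limit is adapted.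
The Bessel norm of the random initial datum, an infimum not known to be measurable, is controlled by
its mollifications (`ae_besselNorm_lt_top`). -/

instance (d : ℕ) : IsProbabilityMeasure (torusMeasure d) := by
  unfold torusMeasure; infer_instance

instance (d : ℕ) : (torusMeasure d).IsAddHaarMeasure := by
  unfold torusMeasure; infer_instance

instance (d : ℕ) : (torusMeasure d).IsNegInvariant :=
  Measure.IsAddHaarMeasure.isNegInvariant_of_regular _

lemma coeff_def (f : Torus d → ℂ) (k : Fin d → ℤ) :
    mFourierCoeff f k = ∫ t, mFourier (-k) t * f t ∂torusMeasure d := rfl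

lemma norm_mFourier_apply (k : Fin d → ℤ) (x : Torus d) : ‖mFourier k x‖ = 1 := by
  simp only [mFourier, ContinuousMap.coe_mk, fourier_apply, norm_prod]
  exact Finset.prod_eq_one fun j _ => Circle.norm_coe _

lemma mFourier_apply_add (k : Fin d → ℤ) (x y : Torus d) :
    mFourier k (x + y) = mFourier k x * mFourier k y := by
  simp only [mFourier, ContinuousMap.coe_mk, Pi.add_apply, ← Finset.prod_mul_distrib]
  refine Finset.prod_congr rfl fun j _ => ?_
  simp [fourier_apply, AddCircle.toCircle_add]

lemma mFourier_apply_neg (k : Fin d → ℤ) (x : Torus d) :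
    mFourier k (-x) = mFourier (-k) x := by
  simp only [mFourier, ContinuousMap.coe_mk, Pi.neg_apply]
  refine Finset.prod_congr rfl fun j _ => ?_
  simp [fourier_apply]

lemma mFourier_toTorus (k : Fin d → ℤ) (y : Vel d) :
    mFourier k (toTorus y) = Complex.exp (2 * Real.pi * Complex.I * ((∑ l, (k l : ℝ) * y l : ℝ) : ℂ)) := by
  simp only [mFourier, ContinuousMap.coe_mk, toTorus]
  push_cast
  rw [Finset.mul_sum, Complex.exp_sum]
  refine Finset.prod_congr rfl fun j _ => ?_
  rw [fourier_coe_apply]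
  congr 1
  push_cast
  ring

lemma toTorus_add (x y : Vel d) : toTorus (x + y) = toTorus x + toTorus y := by
  ext j; simp [toTorus]

lemma toTorus_neg (x : Vel d) : toTorus (-x) = -toTorus x := by
  ext j; simp [toTorus]

lemma toTorus_sub (x y : Vel d) : toTorus (x - y) = toTorus x - toTorus y := by
  ext j; simp [toTorus]

lemma continuous_toTorus : Continuous (toTorus : Vel d → Torus d) := by
  unfold toTorus
  refine continuous_pi fun j => (AddCircle.continuous_mk' 1).comp ?_
  fun_prop

lemma toTorus_torusRep (x : Torus d) : toTorus (torusRep x) = x := by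
  ext j
  simp only [toTorus, torusRep]
  exact (AddCircle.equivIco (1 : ℝ) (-(1 / 2))).symm_apply_apply (x j)

lemma integrable_mFourier_mul {f : Torus d → ℂ} (hf : Integrable f (torusMeasure d))
    (k : Fin d → ℤ) : Integrable (fun t => mFourier k t * f t) (torusMeasure d) := by
  refine hf.bdd_mul (c := 1) (mFourier k).continuous.aestronglyMeasurable ?_
  exact Eventually.of_forall fun x => (norm_mFourier_apply k x).le

lemma norm_coeff_le {f : Torus d → ℂ} (k : Fin d → ℤ) :
    ‖mFourierCoeff f k‖ ≤ ∫ x, ‖f x‖ ∂torusMeasure d := by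
  rw [coeff_def]
  refine (norm_integral_le_integral_norm _).trans_eq ?_
  simp [norm_mFourier_apply]

lemma integrable_continuousMap {E : Type*} [NormedAddCommGroup E] (f : C(Torus d, E)) :
    Integrable f (torusMeasure d) :=
  f.continuous.integrable_of_hasCompactSupport (HasCompactSupport.of_compactSpace _)

lemma norm_coeff_continuousMap_le (f : C(Torus d, ℂ)) (k : Fin d → ℤ) :
    ‖mFourierCoeff f k‖ ≤ ‖f‖ := by
  refine (norm_coeff_le k).trans ?_
  refine (integral_mono (integrable_continuousMap f).norm (integrable_const ‖f‖)
    fun x => f.norm_coe_le_norm x).trans ?_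
  simp

/-- The `k`-th Fourier coefficient as a continuous linear functional on continuous functions. -/
def coeffCLM (k : Fin d → ℤ) : C(Torus d, ℂ) →L[ℂ] ℂ :=
  LinearMap.mkContinuous
    { toFun := fun f => mFourierCoeff f k
      map_add' := fun f g => by
        simp only [coeff_def, ContinuousMap.coe_add, Pi.add_apply, mul_add]
        exact integral_add (integrable_mFourier_mul (integrable_continuousMap f) _)
          (integrable_mFourier_mul (integrable_continuousMap g) _)
      map_smul' := fun c f => by
        simp only [coeff_def, ContinuousMap.coe_smul, Pi.smul_apply, smul_eq_mul,
          RingHom.id_apply, ← integral_const_mul]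
        congr 1; ext x; ring } 1
    fun f => by simpa using norm_coeff_continuousMap_le f k

lemma coeffCLM_apply (k : Fin d → ℤ) (f : C(Torus d, ℂ)) :
    coeffCLM k f = mFourierCoeff f k := rfl

lemma coeff_mFourier (k l : Fin d → ℤ) :
    mFourierCoeff (mFourier l) k = if k = l then 1 else 0 := by
  have h := orthonormal_iff_ite.1 (orthonormal_mFourier (d := Fin d)) k l
  rw [← h]
  simp only [ContinuousMap.inner_toLp, ← mFourier_neg]
  rw [coeff_def]
  refine integral_congr_ae (Eventually.of_forall fun x => ?_)
  simp [mul_comm]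

lemma summable_series {a : (Fin d → ℤ) → ℂ} (ha : Summable fun k => ‖a k‖) :
    Summable fun k => a k • (mFourier k : C(Torus d, ℂ)) :=
  .of_norm (by simpa [norm_smul, mFourier_norm] using ha)

lemma series_apply {a : (Fin d → ℤ) → ℂ} (ha : Summable fun k => ‖a k‖) (x : Torus d) :
    (∑' k, a k • (mFourier k : C(Torus d, ℂ))) x = ∑' k, a k * mFourier k x := by
  have h := (ContinuousMap.evalCLM ℂ x).hasSum (summable_series ha).hasSum
  simpa using h.tsum_eq.symm

lemma coeff_series {a : (Fin d → ℤ) → ℂ} (ha : Summable fun k => ‖a k‖) (k : Fin d → ℤ) :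
    mFourierCoeff (∑' k, a k • (mFourier k : C(Torus d, ℂ)) : C(Torus d, ℂ)) k = a k := by
  have h := (coeffCLM k).hasSum (summable_series ha).hasSum
  rw [← coeffCLM_apply, ← h.tsum_eq, tsum_eq_single k]
  · simp [coeffCLM_apply, coeff_mFourier]
  · intro l hl
    simp [coeffCLM_apply, coeff_mFourier, hl.symm]

lemma coeff_tsum {a : (Fin d → ℤ) → ℂ} (ha : Summable fun k => ‖a k‖) (k : Fin d → ℤ) :
    mFourierCoeff (fun x : Torus d => ∑' k, a k * mFourier k x) k = a k := by
  rw [← coeff_series ha k]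
  congr 1; ext x; rw [series_apply ha]

lemma summable_mul_bdd {ι : Type*} {a b : ι → ℂ} (ha : Summable fun k => ‖a k‖) {C : ℝ}
    (hb : ∀ k, ‖b k‖ ≤ C) : Summable fun k => ‖a k * b k‖ := by
  refine Summable.of_nonneg_of_le (fun _ => norm_nonneg _) (fun k => ?_) (ha.mul_right C)
  rw [norm_mul]
  exact mul_le_mul_of_nonneg_left (hb k) (norm_nonneg _)

/-- Convolution with an absolutely convergent Fourier series. -/
lemma integral_series_mul {a : (Fin d → ℤ) → ℂ} (ha : Summable fun k => ‖a k‖)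
    {f : Torus d → ℂ} (hf : Integrable f (torusMeasure d)) (x : Torus d) :
    ∫ y, (∑' k, a k * mFourier k (x - y)) * f y ∂torusMeasure d =
      ∑' k, a k * mFourierCoeff f k * mFourier k x := by
  have key : ∀ k y, a k * mFourier k (x - y) * f y
      = (a k * mFourier k x) * (mFourier (-k) y * f y) := by
    intro k y
    rw [sub_eq_add_neg, mFourier_apply_add, mFourier_apply_neg]; ring
  have h := integral_tsum_of_summable_integral_norm (μ := torusMeasure d)
    (F := fun k y => a k * mFourier k (x - y) * f y) ?_ ?_
  · simp_rw [tsum_mul_right] at h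
    rw [← h]
    refine tsum_congr fun k => ?_
    simp_rw [key]
    rw [integral_const_mul, ← coeff_def]; ring
  · intro k
    simp_rw [key]
    exact (integrable_mFourier_mul hf _).const_mul _
  · refine (ha.mul_right (∫ y, ‖f y‖ ∂torusMeasure d)).congr fun k => ?_
    simp_rw [norm_mul, norm_mFourier_apply]
    rw [integral_const_mul]; ring_nf

/-! ### Multipliers -/

/-- `m` is an absolutely summable Fourier multiplier of norm at most `C` on continuous functions. -/
def IsMultiplier (m : (Fin d → ℤ) → ℂ) (C : ℝ) : Prop :=
  Summable (fun k => ‖m k‖) ∧ ∀ (f : C(Torus d, ℂ)) (x : Torus d),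
    ‖∑' k, m k * mFourierCoeff f k * mFourier k x‖ ≤ C * ‖f‖

lemma summable_mul_coeff {m : (Fin d → ℤ) → ℂ} (hm : Summable fun k => ‖m k‖)
    (f : C(Torus d, ℂ)) : Summable fun k => ‖m k * mFourierCoeff f k‖ :=
  summable_mul_bdd hm fun k => norm_coeff_continuousMap_le f k

lemma summable_mul_coeff_mul {m : (Fin d → ℤ) → ℂ} (hm : Summable fun k => ‖m k‖)
    (f : C(Torus d, ℂ)) (x : Torus d) :
    Summable fun k => m k * mFourierCoeff f k * mFourier k x :=
  .of_norm (summable_mul_bdd (summable_mul_coeff hm f) fun k => (norm_mFourier_apply k x).le)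

lemma IsMultiplier.mono {m : (Fin d → ℤ) → ℂ} {C C' : ℝ} (h : IsMultiplier m C) (hC : C ≤ C') :
    IsMultiplier m C' :=
  ⟨h.1, fun f x => (h.2 f x).trans (mul_le_mul_of_nonneg_right hC (norm_nonneg _))⟩

/-- Multiplying symbols composes operators: the bound for `m` is applied to the continuous function
`g` whose coefficients are those of `f` times `n`. -/
lemma IsMultiplier.mul {m n : (Fin d → ℤ) → ℂ} {C D : ℝ} (hm : IsMultiplier m C)
    (hn : IsMultiplier n D) (hC : 0 ≤ C) : IsMultiplier (fun k => m k * n k) (C * D) := by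
  obtain ⟨B, hB⟩ : ∃ B, ∀ k, ‖n k‖ ≤ B :=
    ⟨∑' k, ‖n k‖, fun k => hn.1.le_tsum k fun _ _ => norm_nonneg _⟩
  refine ⟨summable_mul_bdd hm.1 hB, fun f x => ?_⟩
  set g : C(Torus d, ℂ) := ∑' k, (n k * mFourierCoeff f k) • (mFourier k : C(Torus d, ℂ)) with hg
  have hc := coeff_series (summable_mul_coeff hn.1 f)
  have h1 := hm.2 g x
  have h2 : ‖g‖ ≤ D * ‖f‖ := by
    refine (ContinuousMap.norm_le_of_nonempty g).2 fun y => ?_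
    rw [hg, series_apply (summable_mul_coeff hn.1 f)]
    exact hn.2 f y
  simp_rw [hg, hc, ← mul_assoc] at h1
  exact h1.trans ((mul_le_mul_of_nonneg_left h2 hC).trans_eq (mul_assoc _ _ _).symm)

lemma IsMultiplier.add {m n : (Fin d → ℤ) → ℂ} {C D : ℝ} (hm : IsMultiplier m C)
    (hn : IsMultiplier n D) : IsMultiplier (fun k => m k + n k) (C + D) := by
  refine ⟨Summable.of_nonneg_of_le (fun _ => norm_nonneg _) (fun k => norm_add_le _ _)
    (hm.1.add hn.1), fun f x => ?_⟩
  simp_rw [add_mul]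
  rw [(summable_mul_coeff_mul hm.1 f x).tsum_add (summable_mul_coeff_mul hn.1 f x)]
  exact (norm_add_le _ _).trans (add_le_add (hm.2 f x) (hn.2 f x))

lemma IsMultiplier.const_mul {m : (Fin d → ℤ) → ℂ} {C : ℝ} (hm : IsMultiplier m C) (c : ℂ) :
    IsMultiplier (fun k => c * m k) (‖c‖ * C) := by
  refine ⟨by simpa [norm_mul] using hm.1.mul_left ‖c‖, fun f x => ?_⟩
  have h : ∑' k, c * m k * mFourierCoeff f k * mFourier k x =
      c * ∑' k, m k * mFourierCoeff f k * mFourier k x := by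
    rw [← tsum_mul_left]
    exact tsum_congr fun k => by ring
  rw [h, norm_mul, mul_assoc]
  exact mul_le_mul_of_nonneg_left (hm.2 f x) (norm_nonneg c)

lemma isMultiplier_zero : IsMultiplier (fun _ : Fin d → ℤ => (0 : ℂ)) 0 :=
  ⟨by simp, by simp⟩

lemma IsMultiplier.sum {ι : Type*} (s : Finset ι) {m : ι → (Fin d → ℤ) → ℂ} {C : ι → ℝ}
    (hm : ∀ i ∈ s, IsMultiplier (m i) (C i)) :
    IsMultiplier (fun k => ∑ i ∈ s, m i k) (∑ i ∈ s, C i) := by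
  classical
  induction s using Finset.induction_on with
  | empty => simpa using isMultiplier_zero
  | insert i s hi ih =>
    simp_rw [Finset.sum_insert hi]
    exact (hm i (by simp)).add (ih fun j hj => hm j (by simp [hj]))

/-- Crude ℓ¹ bound, for the symbols whose constant may depend on the time. -/
lemma isMultiplier_of_summable {m : (Fin d → ℤ) → ℂ} (hm : Summable fun k => ‖m k‖) :
    IsMultiplier m (∑' k, ‖m k‖) := by
  refine ⟨hm, fun f x => ?_⟩
  have h := summable_mul_bdd (summable_mul_coeff hm f) (b := fun k => mFourier k x)
    fun k => (norm_mFourier_apply k x).le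
  refine (norm_tsum_le_tsum_norm h).trans ?_
  rw [← tsum_mul_right]
  refine h.tsum_le_tsum (fun k => ?_) (hm.mul_right _)
  rw [norm_mul, norm_mul, norm_mFourier_apply, mul_one]
  exact mul_le_mul_of_nonneg_left (norm_coeff_continuousMap_le f k) (norm_nonneg _)

/-- Multiplication of the coefficients by characters is a translation. -/
lemma IsMultiplier.translate {m : (Fin d → ℤ) → ℂ} {C : ℝ} (hm : IsMultiplier m C)
    (y : Torus d) : IsMultiplier (fun k => m k * mFourier k y) C := by
  refine ⟨summable_mul_bdd hm.1 fun k => (norm_mFourier_apply k y).le, fun f x => ?_⟩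
  refine le_trans (le_of_eq ?_) (hm.2 f (x + y))
  congr 2; ext k
  rw [mFourier_apply_add]; ring

/-- Young's inequality: the operator is convolution with the kernel of symbol `m`, so its sup-norm
bound is the L¹ norm of that kernel. -/
lemma isMultiplier_of_kernel {m : (Fin d → ℤ) → ℂ} (hm : Summable fun k => ‖m k‖) {C : ℝ}
    (hC : ∫ x, ‖∑' k, m k * mFourier k x‖ ∂torusMeasure d ≤ C) : IsMultiplier m C := by
  refine ⟨hm, fun f x => ?_⟩
  rw [← integral_series_mul hm (integrable_continuousMap f)]
  have hK : Integrable (fun x => ‖∑' k, m k * mFourier k x‖) (torusMeasure d) := by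
    simp_rw [← series_apply hm]
    exact (integrable_continuousMap _).norm
  have hK' : Integrable (fun y => ‖∑' k, m k * mFourier k (x - y)‖) (torusMeasure d) :=
    hK.comp_sub_left x
  refine (norm_integral_le_of_norm_le (hK'.mul_const ‖f‖) (Eventually.of_forall fun y => ?_)).trans ?_
  · rw [norm_mul]
    exact mul_le_mul_of_nonneg_left (f.norm_coe_le_norm y) (norm_nonneg _)
  · rw [integral_mul_const, integral_sub_left_eq_self (fun y => ‖∑' k, m k * mFourier k y‖)]
    exact mul_le_mul_of_nonneg_right hC (norm_nonneg _)

/-- Bound for a series whose terms are integrals of the terms of bounded series. -/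
lemma norm_tsum_integral_le {α ι : Type*} [Countable ι] {mα : MeasurableSpace α} {μ : Measure α}
    {a : α → ι → ℂ} {C : α → ℝ} (ha : ∀ k, Integrable (fun s => a s k) μ)
    (hs : Summable fun k => ∫ s, ‖a s k‖ ∂μ) (hC : Integrable C μ)
    (h : ∀ᵐ s ∂μ, ‖∑' k, a s k‖ ≤ C s) : ‖∑' k, ∫ s, a s k ∂μ‖ ≤ ∫ s, C s ∂μ := by
  rw [integral_tsum_of_summable_integral_norm ha hs]
  exact norm_integral_le_of_norm_le hC h

/-- Superposition of operators: bounds integrate along with the symbols. Riesz transforms,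
fractional powers and translation increments are all obtained in this way from heat derivatives. -/
lemma IsMultiplier.integral {α : Type*} {mα : MeasurableSpace α} {μ : Measure α}
    {m : α → (Fin d → ℤ) → ℂ} {C : α → ℝ} (hm : ∀ k, Integrable (fun s => m s k) μ)
    (hs : Summable fun k => ∫ s, ‖m s k‖ ∂μ) (hC : Integrable C μ)
    (h : ∀ᵐ s ∂μ, IsMultiplier (m s) (C s)) :
    IsMultiplier (fun k => ∫ s, m s k ∂μ) (∫ s, C s ∂μ) := by
  refine ⟨Summable.of_nonneg_of_le (fun _ => norm_nonneg _)
    (fun k => norm_integral_le_integral_norm _) hs, fun f x => ?_⟩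
  rw [← integral_mul_const]
  simp_rw [← integral_mul_const]
  refine norm_tsum_integral_le (fun k => ((hm k).mul_const _).mul_const _) ?_ (hC.mul_const _)
    (h.mono fun s hs => hs.2 f x)
  simp_rw [norm_mul, norm_mFourier_apply, mul_one, integral_mul_const]
  refine Summable.of_nonneg_of_le (fun k => by positivity) (fun k => ?_) (hs.mul_right ‖f‖)
  exact mul_le_mul_of_nonneg_left (norm_coeff_continuousMap_le f k) (by positivity)

section Zeta

open HurwitzZeta

/-! ### One-dimensional theta kernels -/

lemma evenKernel_nonneg (a : UnitAddCircle) {t : ℝ} (ht : 0 < t) : 0 ≤ evenKernel a t := by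
  induction a using QuotientAddGroup.induction_on with
  | H a => exact (hasSum_int_evenKernel a ht).nonneg fun n => (Real.exp_pos _).le

/-- Poisson summation turns the Fourier series of the heat kernel into a sum of Gaussians, on which
positivity and small-time behaviour are visible. -/
lemma cosKernel_eq_evenKernel (a : UnitAddCircle) {t : ℝ} (ht : 0 < t) :
    cosKernel a t = t ^ (-(1 / 2) : ℝ) * evenKernel a (1 / t) := by
  have h : 1 / (1 / t) ^ (1 / 2 : ℝ) = t ^ (1 / 2 : ℝ) := by
    rw [one_div t, Real.inv_rpow ht.le, one_div, inv_inv]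
  rw [evenKernel_functional_equation, one_div_one_div, h, ← mul_assoc, ← Real.rpow_add ht]
  norm_num

lemma cosKernel_nonneg (a : UnitAddCircle) {t : ℝ} (ht : 0 < t) : 0 ≤ cosKernel a t := by
  rw [cosKernel_eq_evenKernel a ht]
  exact mul_nonneg (Real.rpow_nonneg ht.le _) (evenKernel_nonneg a (by positivity))

lemma sinKernel_eq_oddKernel (a : UnitAddCircle) {t : ℝ} (ht : 0 < t) :
    sinKernel a t = t ^ (-(3 / 2) : ℝ) * oddKernel a (1 / t) := by
  have h : 1 / (1 / t) ^ (3 / 2 : ℝ) = t ^ (3 / 2 : ℝ) := by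
    rw [one_div t, Real.inv_rpow ht.le, one_div, inv_inv]
  rw [oddKernel_functional_equation, one_div_one_div, h, ← mul_assoc, ← Real.rpow_add ht]
  norm_num

lemma abs_mul_exp_neg_sq_le (y : ℝ) {x : ℝ} (hx : 0 < x) :
    |y| * Real.exp (-Real.pi * y ^ 2 * x) ≤
      x ^ (-(1 / 2) : ℝ) * Real.exp (-Real.pi * y ^ 2 * (x / 2)) := by
  have hs : 0 < Real.sqrt x := Real.sqrt_pos.2 hx
  have h1 : x ^ (-(1 / 2) : ℝ) = (Real.sqrt x)⁻¹ := by
    rw [Real.rpow_neg hx.le, Real.sqrt_eq_rpow]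
  have h2 : Real.exp (-Real.pi * y ^ 2 * x) = Real.exp (-Real.pi * y ^ 2 * (x / 2)) *
      Real.exp (-Real.pi * y ^ 2 * (x / 2)) := by
    rw [← Real.exp_add]; ring_nf
  have h3 : |y| * Real.sqrt x * Real.exp (-Real.pi * y ^ 2 * (x / 2)) ≤ 1 := by
    set z := |y| * Real.sqrt x with hz
    have hz2 : z ^ 2 = y ^ 2 * x := by rw [hz, mul_pow, sq_abs, Real.sq_sqrt hx.le]
    have h4 : -Real.pi * y ^ 2 * (x / 2) = -(Real.pi / 2 * z ^ 2) := by rw [hz2]; ring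
    rw [h4, Real.exp_neg, ← div_eq_mul_inv, div_le_one (Real.exp_pos _)]
    -- Since π > 3, one has z ≤ 1 + (π/2) z² ≤ exp((π/2) z²): half of the Gaussian absorbs the
    -- linear factor.
    have := Real.add_one_le_exp (Real.pi / 2 * z ^ 2)
    have hpi := Real.pi_gt_three
    nlinarith [sq_nonneg (z - 1), sq_nonneg z]
  rw [h1, h2, ← mul_assoc]
  refine mul_le_mul_of_nonneg_right ?_ (Real.exp_pos _).le
  rw [← one_div, le_div_iff₀ hs]
  linarith

lemma abs_oddKernel_le (a : UnitAddCircle) {x : ℝ} (hx : 0 < x) :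
    |oddKernel a x| ≤ x ^ (-(1 / 2) : ℝ) * evenKernel a (x / 2) := by
  induction a using QuotientAddGroup.induction_on with
  | H a =>
    have h1 := hasSum_int_oddKernel a hx
    have h2 := (hasSum_int_evenKernel a (half_pos hx)).mul_left (x ^ (-(1 / 2) : ℝ))
    have hb : ∀ n : ℤ, ‖(n + a) * Real.exp (-Real.pi * (n + a) ^ 2 * x)‖ ≤
        x ^ (-(1 / 2) : ℝ) * Real.exp (-Real.pi * (n + a) ^ 2 * (x / 2)) := fun n => by
      rw [norm_mul, Real.norm_eq_abs, Real.norm_eq_abs, abs_of_pos (Real.exp_pos _)]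
      exact abs_mul_exp_neg_sq_le _ hx
    rw [← h1.tsum_eq, ← Real.norm_eq_abs]
    exact tsum_of_norm_bounded h2 hb

/-- Up to normalisation `sinKernel` is the space derivative of `cosKernel`. Spending half of each
Gaussian on the linear factor gives |∂K_t| ≤ C t^(-1/2) K_(2t); halving the parameter of the
Gaussians, which is 1/t, doubles the time. -/
lemma abs_sinKernel_le (a : UnitAddCircle) {t : ℝ} (ht : 0 < t) :
    |sinKernel a t| ≤ 2 * t ^ (-(1 / 2) : ℝ) * cosKernel a (2 * t) := by
  rw [sinKernel_eq_oddKernel a ht, abs_mul, abs_of_pos (Real.rpow_pos_of_pos ht _),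
    cosKernel_eq_evenKernel a (by positivity : 0 < 2 * t)]
  have h := abs_oddKernel_le a (one_div_pos.2 ht)
  have h0 := evenKernel_nonneg a (by positivity : 0 < 1 / (2 * t))
  have e1 : 1 / t / 2 = 1 / (2 * t) := by rw [div_div]; ring_nf
  rw [e1] at h
  refine (mul_le_mul_of_nonneg_left h (Real.rpow_nonneg ht.le _)).trans ?_
  rw [← mul_assoc, ← mul_assoc]
  refine mul_le_mul_of_nonneg_right ?_ h0
  rw [Real.mul_rpow (by norm_num) ht.le, one_div, Real.inv_rpow ht.le, ← Real.rpow_neg ht.le,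
    ← Real.rpow_add ht]
  have h5 : (2 : ℝ) ^ (-(1 / 2) : ℝ) ≥ 1 / 2 := by
    calc (1 / 2 : ℝ) = (2 : ℝ) ^ (-1 : ℝ) := by rw [Real.rpow_neg_one]; norm_num
      _ ≤ _ := Real.rpow_le_rpow_of_exponent_le (by norm_num) (by norm_num)
  have h6 : t ^ (-(1 / 2) : ℝ) * t ^ (-(1 / 2) : ℝ) = t ^ (-1 : ℝ) := by
    rw [← Real.rpow_add ht]; norm_num
  have h7 : (0 : ℝ) < t ^ (-1 : ℝ) := Real.rpow_pos_of_pos ht _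
  have h8 : (-(3 / 2) + -(-(1 / 2)) : ℝ) = -1 := by norm_num
  rw [h8]
  calc t ^ (-1 : ℝ) ≤ 2 * 2 ^ (-(1 / 2) : ℝ) * t ^ (-1 : ℝ) := by nlinarith
    _ = _ := by rw [← h6]; ring

/-- On the Gaussian side, `evenKernel 0` is decreasing, so for t ≤ 1 its value at 1/t is at most its
value at 1; the factor t^(-1/2) comes from the functional equation. -/
lemma cosKernel_zero_le : ∃ C : ℝ, 0 < C ∧ ∀ t, 0 < t → t ≤ 1 →
    cosKernel 0 t ≤ C * t ^ (-(1 / 2) : ℝ) := by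
  refine ⟨evenKernel 0 1 + 1, by linarith [evenKernel_nonneg 0 one_pos], fun t ht ht1 => ?_⟩
  rw [cosKernel_eq_evenKernel 0 ht, mul_comm]
  refine mul_le_mul_of_nonneg_right ?_ (Real.rpow_nonneg ht.le _)
  have h1 := hasSum_int_evenKernel 0 one_pos
  have h2 := hasSum_int_evenKernel 0 (one_div_pos.2 ht)
  have h := hasSum_le (fun n : ℤ => ?_) h2 h1
  · have e : ((0 : ℝ) : UnitAddCircle) = 0 := rfl
    rw [e] at h
    linarith
  · refine Real.exp_le_exp.2 ?_
    have : 1 ≤ 1 / t := by rw [le_div_iff₀ ht]; linarith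
    have hpi := Real.pi_pos
    have hn : 0 ≤ Real.pi * ((n : ℝ) + 0) ^ 2 := by positivity
    nlinarith

lemma hasSum_cosKernel (x : UnitAddCircle) {t : ℝ} (ht : 0 < t) :
    HasSum (fun n : ℤ => (Real.exp (-Real.pi * n ^ 2 * t) : ℂ) * fourier n x) (cosKernel x t) := by
  induction x using QuotientAddGroup.induction_on with
  | H a =>
    refine (hasSum_int_cosKernel a ht).congr_fun fun n => ?_
    rw [fourier_coe_apply, mul_comm]
    congr 2
    push_cast
    ring

lemma hasSum_sinKernel (x : UnitAddCircle) {t : ℝ} (ht : 0 < t) :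
    HasSum (fun n : ℤ => (-Complex.I * n * Real.exp (-Real.pi * n ^ 2 * t)) * fourier n x)
      (sinKernel x t) := by
  induction x using QuotientAddGroup.induction_on with
  | H a =>
    refine (hasSum_int_sinKernel a ht).congr_fun fun n => ?_
    rw [fourier_coe_apply, mul_right_comm]
    congr 3
    push_cast
    ring

/-! ### Products of one-dimensional series -/

lemma hasSum_mul_of_norm {ι κ : Type*} {f : ι → ℂ} {g : κ → ℂ} {s t : ℂ} (hf : HasSum f s)
    (hf' : Summable fun i => ‖f i‖) (hg : HasSum g t) (hg' : Summable fun i => ‖g i‖) :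
    HasSum (fun p : ι × κ => f p.1 * g p.2) (s * t) ∧
      Summable fun p : ι × κ => ‖f p.1 * g p.2‖ :=
  ⟨hf.mul hg (summable_mul_of_summable_norm hf' hg'), hf'.mul_norm hg'⟩

/-- Absolutely convergent series multiply coordinate by coordinate; this transfers the
one-dimensional theta kernels to the torus. -/
lemma hasSum_prod_pi : ∀ {n : ℕ} {a : Fin n → ℤ → ℂ} {s : Fin n → ℂ},
    (∀ j, HasSum (a j) (s j)) → (∀ j, Summable fun i => ‖a j i‖) →
    HasSum (fun k : Fin n → ℤ => ∏ j, a j (k j)) (∏ j, s j) ∧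
      Summable fun k : Fin n → ℤ => ‖∏ j, a j (k j)‖ := by
  intro n
  induction n with
  | zero =>
    intro a s _ _
    refine ⟨?_, ?_⟩
    · simp
    · exact (hasSum_unique _).summable
  | succ n ih =>
    intro a s h hs
    obtain ⟨h1, h2⟩ := ih (a := fun j => a j.succ) (s := fun j => s j.succ)
      (fun j => h j.succ) (fun j => hs j.succ)
    obtain ⟨h3, h4⟩ := hasSum_mul_of_norm (h 0) (hs 0) h1 h2
    let E : ℤ × (Fin n → ℤ) ≃ (Fin (n + 1) → ℤ) := Fin.consEquiv fun _ => ℤ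
    have e : ∀ p, ∏ j, a j (E p j) = a 0 p.1 * ∏ j : Fin n, a j.succ (p.2 j) := fun p => by
      rw [Fin.prod_univ_succ]; rfl
    constructor
    · rw [← E.hasSum_iff, Fin.prod_univ_succ]
      exact h3.congr_fun fun p => e p
    · rw [← E.summable_iff]
      exact h4.congr fun p => congrArg norm (e p).symm

end Zeta

section Zeta

open HurwitzZeta

/-! ### The heat multiplier and its kernel -/

lemma freqSq_nonneg (k : Fin d → ℤ) : 0 ≤ freqSq k :=
  Finset.sum_nonneg fun _ _ => sq_nonneg _

lemma sq_le_freqSq (k : Fin d → ℤ) (l : Fin d) : (k l : ℝ) ^ 2 ≤ freqSq k :=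
  Finset.single_le_sum (f := fun l => (k l : ℝ) ^ 2) (fun _ _ => sq_nonneg _) (Finset.mem_univ l)

lemma abs_le_one_add_freqSq (k : Fin d → ℤ) (l : Fin d) : |(k l : ℝ)| ≤ 1 + freqSq k := by
  have h := sq_le_freqSq k l
  rw [← sq_abs] at h
  nlinarith [sq_nonneg (|(k l : ℝ)| - 1)]

lemma abs_mul_le_freqSq (k : Fin d → ℤ) (i j : Fin d) : |(k i : ℝ) * k j| ≤ freqSq k := by
  rw [abs_mul]
  have h1 := sq_le_freqSq k i
  have h2 := sq_le_freqSq k j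
  rw [← sq_abs] at h1 h2
  nlinarith [sq_nonneg (|(k i : ℝ)| - |(k j : ℝ)|)]

lemma freqSq_neg (k : Fin d → ℤ) : freqSq (-k) = freqSq k := by
  simp [freqSq]

/-- The multiplier of `e^{τΔ}` for `τ > 0`, extended by zero. -/
def heatMul (τ : ℝ) (k : Fin d → ℤ) : ℝ :=
  if 0 < τ then Real.exp (-(4 * Real.pi ^ 2 * freqSq k * τ)) else 0

lemma heatMul_of_pos {τ : ℝ} (hτ : 0 < τ) (k : Fin d → ℤ) :
    heatMul τ k = Real.exp (-(4 * Real.pi ^ 2 * freqSq k * τ)) := if_pos hτ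

lemma heatMul_nonneg (τ : ℝ) (k : Fin d → ℤ) : 0 ≤ heatMul τ k := by
  unfold heatMul; split_ifs
  · exact (Real.exp_pos _).le
  · exact le_rfl

lemma heatMul_neg (τ : ℝ) (k : Fin d → ℤ) : heatMul τ (-k) = heatMul τ k := by
  unfold heatMul; rw [freqSq_neg]

lemma measurable_heatMul (k : Fin d → ℤ) : Measurable fun τ => heatMul τ k :=
  Measurable.ite measurableSet_Ioi (by fun_prop) measurable_const

lemma heatMul_antitone {s t : ℝ} (hs : 0 < s) (hst : s ≤ t) (k : Fin d → ℤ) :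
    heatMul t k ≤ heatMul s k := by
  rw [heatMul_of_pos hs, heatMul_of_pos (hs.trans_le hst)]
  refine Real.exp_le_exp.2 (neg_le_neg ?_)
  exact mul_le_mul_of_nonneg_left hst (mul_nonneg (by positivity) (freqSq_nonneg k))

lemma heatMul_add {s t : ℝ} (hs : 0 < s) (ht : 0 < t) (k : Fin d → ℤ) :
    heatMul (s + t) k = heatMul s k * heatMul t k := by
  rw [heatMul_of_pos hs, heatMul_of_pos ht, heatMul_of_pos (add_pos hs ht), ← Real.exp_add]
  ring_nf

lemma prod_exp_eq (t : ℝ) (k : Fin d → ℤ) :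
    ∏ j, Real.exp (-Real.pi * k j ^ 2 * t) = Real.exp (-(Real.pi * freqSq k * t)) := by
  rw [← Real.exp_sum]
  congr 1
  rw [freqSq, Finset.mul_sum, Finset.sum_mul, ← Finset.sum_neg_distrib]
  exact Finset.sum_congr rfl fun j _ => by ring

/-- Time change between two normalisations: the theta kernels have symbol exp(-π n² t), so t = 4πτ.
-/
lemma heatMul_eq_prod {τ : ℝ} (hτ : 0 < τ) (k : Fin d → ℤ) :
    heatMul τ k = ∏ j, Real.exp (-Real.pi * k j ^ 2 * (4 * Real.pi * τ)) := by
  rw [prod_exp_eq, heatMul_of_pos hτ]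
  ring_nf

lemma summable_norm_cosKernel {t : ℝ} (ht : 0 < t) (x : UnitAddCircle) :
    Summable fun n : ℤ => ‖(Real.exp (-Real.pi * n ^ 2 * t) : ℂ) * fourier n x‖ := by
  have h := (hasSum_int_evenKernel 0 ht).summable
  refine h.congr fun n => ?_
  rw [norm_mul, fourier_apply, Circle.norm_coe, mul_one, Complex.norm_real, Real.norm_eq_abs,
    abs_of_pos (Real.exp_pos _), add_zero]

lemma hasSum_prod_cosKernel {t : Fin d → ℝ} (ht : ∀ j, 0 < t j) (x : Torus d) :
    HasSum (fun k : Fin d → ℤ => ((∏ j, Real.exp (-Real.pi * k j ^ 2 * t j) : ℝ) : ℂ) *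
      mFourier k x) ((∏ j, cosKernel (x j) (t j) : ℝ) : ℂ) ∧
    Summable fun k : Fin d → ℤ => ‖((∏ j, Real.exp (-Real.pi * k j ^ 2 * t j) : ℝ) : ℂ)‖ := by
  obtain ⟨h1, h2⟩ := hasSum_prod_pi (fun j => hasSum_cosKernel (x j) (ht j))
    (fun j => summable_norm_cosKernel (ht j) (x j))
  constructor
  · push_cast
    convert h1 using 2 with k
    simp [mFourier, Finset.prod_mul_distrib]
  · refine h2.congr fun k => ?_
    rw [Finset.prod_mul_distrib, norm_mul]
    have := norm_mFourier_apply k x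
    simp only [mFourier, ContinuousMap.coe_mk] at this
    rw [this, mul_one]
    push_cast; rfl

lemma prod_cosKernel_nonneg {t : Fin d → ℝ} (ht : ∀ j, 0 < t j) (x : Torus d) :
    0 ≤ ∏ j, cosKernel (x j) (t j) :=
  Finset.prod_nonneg fun j _ => cosKernel_nonneg _ (ht j)

/-- The Fourier series converges in sup norm, hence to a continuous function. -/
lemma continuous_prod_cosKernel {t : Fin d → ℝ} (ht : ∀ j, 0 < t j) :
    Continuous fun x : Torus d => ∏ j, cosKernel (x j) (t j) := by
  have h : (fun x : Torus d => ∏ j, cosKernel (x j) (t j)) = fun x => Complex.re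
      ((∑' k : Fin d → ℤ, ((∏ j, Real.exp (-Real.pi * k j ^ 2 * t j) : ℝ) : ℂ) •
        (mFourier k : C(Torus d, ℂ)) : C(Torus d, ℂ)) x) := by
    ext x
    rw [series_apply (hasSum_prod_cosKernel ht x).2, (hasSum_prod_cosKernel ht x).1.tsum_eq,
      Complex.ofReal_re]
  rw [h]
  exact Complex.continuous_re.comp (ContinuousMap.continuous _)

lemma integral_prod_cosKernel {t : Fin d → ℝ} (ht : ∀ j, 0 < t j) :
    ∫ x : Torus d, ∏ j, cosKernel (x j) (t j) ∂torusMeasure d = 1 := by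
  have h := coeff_tsum (hasSum_prod_cosKernel ht 0).2 0
  rw [coeff_def] at h
  simp_rw [fun x => (hasSum_prod_cosKernel ht x).1.tsum_eq] at h
  rw [← Complex.ofReal_inj, ← integral_complex_ofReal]
  simpa [mFourier_zero] using h

/-- The heat kernel of the torus. -/
def heatKernel (τ : ℝ) (x : Torus d) : ℝ := ∏ j, cosKernel (x j) (4 * Real.pi * τ)

lemma four_pi_mul_pos {τ : ℝ} (hτ : 0 < τ) : 0 < 4 * Real.pi * τ := by positivity

lemma heatKernel_nonneg {τ : ℝ} (hτ : 0 < τ) (x : Torus d) : 0 ≤ heatKernel τ x :=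
  prod_cosKernel_nonneg (fun _ => four_pi_mul_pos hτ) x

lemma continuous_heatKernel {τ : ℝ} (hτ : 0 < τ) :
    Continuous (heatKernel τ : Torus d → ℝ) :=
  continuous_prod_cosKernel fun _ => four_pi_mul_pos hτ

lemma integral_heatKernel {τ : ℝ} (hτ : 0 < τ) :
    ∫ x : Torus d, heatKernel τ x ∂torusMeasure d = 1 :=
  integral_prod_cosKernel fun _ => four_pi_mul_pos hτ

lemma hasSum_heatKernel {τ : ℝ} (hτ : 0 < τ) (x : Torus d) :
    HasSum (fun k : Fin d → ℤ => (heatMul τ k : ℂ) * mFourier k x) (heatKernel τ x) := by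
  simp_rw [heatMul_eq_prod hτ]
  exact (hasSum_prod_cosKernel (fun _ => four_pi_mul_pos hτ) x).1

lemma summable_heatMul (τ : ℝ) : Summable fun k : Fin d → ℤ => heatMul τ k := by
  by_cases hτ : 0 < τ
  · have h := (hasSum_prod_cosKernel (fun _ : Fin d => four_pi_mul_pos hτ) 0).2
    refine h.congr fun k => ?_
    rw [heatMul_eq_prod hτ, Complex.norm_real, Real.norm_eq_abs, abs_of_nonneg]
    exact Finset.prod_nonneg fun _ _ => (Real.exp_pos _).le
  · simp [heatMul, hτ]

lemma norm_heatMul (τ : ℝ) (k : Fin d → ℤ) : ‖(heatMul τ k : ℂ)‖ = heatMul τ k := by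
  rw [Complex.norm_real, Real.norm_eq_abs, abs_of_nonneg (heatMul_nonneg τ k)]

/-- Nonnegative Fourier coefficients force the maximum to be at the origin. -/
lemma heatKernel_le_zero {τ : ℝ} (hτ : 0 < τ) (x : Torus d) :
    heatKernel τ x ≤ heatKernel τ (0 : Torus d) := by
  have h0 : HasSum (fun k : Fin d → ℤ => heatMul τ k) (heatKernel τ (0 : Torus d)) := by
    have := hasSum_heatKernel hτ (0 : Torus d)
    rw [← Complex.hasSum_ofReal]
    simpa [mFourier] using this
  have h := hasSum_heatKernel hτ x
  have h2 : ‖(heatKernel τ x : ℂ)‖ ≤ heatKernel τ (0 : Torus d) := by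
    rw [← h.tsum_eq]
    refine tsum_of_norm_bounded h0 fun k => ?_
    rw [norm_mul, norm_mFourier_apply, mul_one, norm_heatMul]
  rw [Complex.norm_real] at h2
  exact (le_abs_self _).trans h2

lemma heatKernel_le : ∃ C : ℝ, 0 < C ∧ ∀ τ, 0 < τ → ∀ x : Torus d,
    heatKernel τ x ≤ C * (1 + τ ^ (-(d : ℝ) / 2)) := by
  obtain ⟨C, hC, h⟩ := cosKernel_zero_le
  have hpi := Real.pi_gt_three
  have key : ∀ τ, 0 < τ → 4 * Real.pi * τ ≤ 1 → heatKernel τ (0 : Torus d) ≤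
      C ^ d * τ ^ (-(d : ℝ) / 2) := fun τ hτ h1 => by
    have h2 : cosKernel 0 (4 * Real.pi * τ) ≤ C * τ ^ (-(1 / 2) : ℝ) := by
      refine (h _ (four_pi_mul_pos hτ) h1).trans (mul_le_mul_of_nonneg_left ?_ hC.le)
      exact Real.rpow_le_rpow_of_nonpos hτ (by nlinarith) (by norm_num)
    have h3 := pow_le_pow_left₀ (cosKernel_nonneg 0 (four_pi_mul_pos hτ)) h2 d
    simp only [heatKernel, Pi.zero_apply, Finset.prod_const, Finset.card_univ, Fintype.card_fin]
    refine h3.trans_eq ?_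
    rw [mul_pow, ← Real.rpow_natCast (τ ^ _) d, ← Real.rpow_mul hτ.le]
    congr 2; ring
  -- The theta bound holds up to 4πτ = 1. Beyond this threshold the value at the origin is a sum of
  -- decreasing exponentials and is dominated by the value at `τ₀`.
  set τ₀ : ℝ := 1 / (4 * Real.pi) with hτ₀
  have hτ₀pos : 0 < τ₀ := by positivity
  refine ⟨C ^ d * (1 + τ₀ ^ (-(d : ℝ) / 2)), by positivity, fun τ hτ x =>
    (heatKernel_le_zero hτ x).trans ?_⟩
  rcases le_or_gt (4 * Real.pi * τ) 1 with h1 | h1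
  · refine (key τ hτ h1).trans ?_
    rw [mul_assoc]
    refine mul_le_mul_of_nonneg_left ?_ (by positivity)
    have a1 : 0 ≤ τ ^ (-(d : ℝ) / 2) := by positivity
    have a2 : 0 ≤ τ₀ ^ (-(d : ℝ) / 2) := by positivity
    nlinarith
  · have h2 : heatKernel τ (0 : Torus d) ≤ heatKernel τ₀ (0 : Torus d) := by
      have e : ∀ s, 0 < s → HasSum (fun k : Fin d → ℤ => heatMul s k)
          (heatKernel s (0 : Torus d)) := fun s hs => by
        have := hasSum_heatKernel hs (0 : Torus d)
        rw [← Complex.hasSum_ofReal]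
        simpa [mFourier] using this
      refine hasSum_le (fun k => heatMul_antitone hτ₀pos ?_ k) (e τ hτ) (e τ₀ hτ₀pos)
      rw [hτ₀, div_le_iff₀ (by positivity)]; linarith
    refine (h2.trans (key τ₀ hτ₀pos (by rw [hτ₀]; field_simp; rfl))).trans ?_
    rw [mul_assoc]
    refine mul_le_mul_of_nonneg_left ?_ (by positivity)
    have a1 : 0 ≤ τ ^ (-(d : ℝ) / 2) := by positivity
    have a2 : 0 ≤ τ₀ ^ (-(d : ℝ) / 2) := by positivity
    nlinarith

/-- Polynomial factors are absorbed by the heat multiplier. -/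
lemma one_add_pow_mul_heatMul_le (n : ℕ) {τ : ℝ} (hτ : 0 < τ) : ∃ C : ℝ, 0 ≤ C ∧
    ∀ k : Fin d → ℤ, (1 + freqSq k) ^ n * heatMul τ k ≤ C * heatMul (τ / 2) k := by
  set c : ℝ := 4 * Real.pi ^ 2 * (τ / 2) with hc
  have hcpos : 0 < c := by positivity
  -- From y^n / n! ≤ e^y with y = c(1 + |k|²); the factor e^c pays for the 1 in 1 + |k|².
  refine ⟨(n.factorial : ℝ) / c ^ n * Real.exp c, by positivity, fun k => ?_⟩
  have e : heatMul τ k = heatMul (τ / 2) k * heatMul (τ / 2) k := by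
    rw [← heatMul_add (half_pos hτ) (half_pos hτ), add_halves]
  rw [e, ← mul_assoc]
  refine mul_le_mul_of_nonneg_right ?_ (heatMul_nonneg _ _)
  have h1 := Real.pow_div_factorial_le_exp (c * (1 + freqSq k))
    (mul_nonneg hcpos.le (by linarith [freqSq_nonneg k])) n
  rw [heatMul_of_pos (half_pos hτ), Real.exp_neg, ← div_eq_mul_inv, div_le_iff₀ (Real.exp_pos _),
    mul_assoc, ← Real.exp_add]
  have e2 : c + 4 * Real.pi ^ 2 * freqSq k * (τ / 2) = c * (1 + freqSq k) := by rw [hc]; ring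
  rw [e2, div_mul_eq_mul_div, le_div_iff₀ (by positivity)]
  rw [div_le_iff₀ (by positivity), mul_pow] at h1
  linarith

lemma summable_pow_mul_heatMul (n : ℕ) (τ : ℝ) :
    Summable fun k : Fin d → ℤ => (1 + freqSq k) ^ n * heatMul τ k := by
  by_cases hτ : 0 < τ
  · obtain ⟨C, hC, h⟩ := one_add_pow_mul_heatMul_le (d := d) n hτ
    refine Summable.of_nonneg_of_le (fun k => mul_nonneg ?_ (heatMul_nonneg _ _)) h
      ((summable_heatMul _).mul_left C)
    exact pow_nonneg (by linarith [freqSq_nonneg k]) _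
  · simp [heatMul, hτ]

lemma summable_norm_mul_heatMul {m : (Fin d → ℤ) → ℂ} {C : ℝ} {n : ℕ}
    (hm : ∀ k, ‖m k‖ ≤ C * (1 + freqSq k) ^ n) (τ : ℝ) :
    Summable fun k => ‖m k * heatMul τ k‖ := by
  refine Summable.of_nonneg_of_le (fun _ => norm_nonneg _) (fun k => ?_)
    ((summable_pow_mul_heatMul n τ).mul_left C)
  rw [norm_mul, norm_heatMul, ← mul_assoc]
  exact mul_le_mul_of_nonneg_right (hm k) (heatMul_nonneg _ _)

/-- The heat kernel is nonnegative with mass one, so the semigroup is a contraction. For τ ≤ 0 the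
symbol is zero by convention. -/
lemma isMultiplier_heatMul (τ : ℝ) : IsMultiplier (fun k : Fin d → ℤ => (heatMul τ k : ℂ)) 1 := by
  have hs : Summable fun k : Fin d → ℤ => ‖(heatMul τ k : ℂ)‖ := by
    simp_rw [norm_heatMul]; exact summable_heatMul τ
  by_cases hτ : 0 < τ
  · refine isMultiplier_of_kernel hs ?_
    simp_rw [fun x => (hasSum_heatKernel hτ x).tsum_eq, Complex.norm_real, Real.norm_eq_abs,
      fun x : Torus d => abs_of_nonneg (heatKernel_nonneg hτ x)]
    exact (integral_heatKernel hτ).le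
  · refine ⟨hs, fun f x => ?_⟩
    simp [heatMul, hτ]

lemma summable_norm_sinKernel {t : ℝ} (ht : 0 < t) (x : UnitAddCircle) :
    Summable fun n : ℤ => ‖(-Complex.I * n * Real.exp (-Real.pi * n ^ 2 * t)) * fourier n x‖ := by
  have h := (hasSum_int_evenKernel 0 (half_pos ht)).summable.mul_left (t ^ (-(1 / 2) : ℝ))
  refine Summable.of_nonneg_of_le (fun _ => norm_nonneg _) (fun n => ?_) h
  rw [norm_mul, fourier_apply, Circle.norm_coe, mul_one, norm_mul, norm_mul, norm_neg,
    Complex.norm_I, one_mul, Complex.norm_real, Real.norm_eq_abs, abs_of_pos (Real.exp_pos _),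
    add_zero, Complex.norm_intCast]
  exact abs_mul_exp_neg_sq_le n ht

/-- The multiplier of `∂_l e^{τΔ}`. -/
def gradMul (τ : ℝ) (l : Fin d) (k : Fin d → ℤ) : ℂ :=
  2 * Real.pi * Complex.I * k l * heatMul τ k

lemma norm_grad_symbol_le (l : Fin d) (k : Fin d → ℤ) :
    ‖(2 * Real.pi * Complex.I * k l : ℂ)‖ ≤ (2 * Real.pi) * (1 + freqSq k) ^ 1 := by
  have := abs_le_one_add_freqSq k l
  simp only [norm_mul, Complex.norm_ofNat, Complex.norm_real, Complex.norm_I, mul_one,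
    Complex.norm_intCast, Real.norm_eq_abs, abs_of_pos Real.pi_pos, pow_one]
  exact mul_le_mul_of_nonneg_left this (by positivity)

/-- The kernel is a product with one factor `sinKernel` in the variable `l`. By `abs_sinKernel_le`
it is dominated by t^(-1/2) times a product of heat kernels, with doubled time in the variable `l`,
which still has mass one. -/
lemma isMultiplier_gradMul {τ : ℝ} (hτ : 0 < τ) (l : Fin d) :
    IsMultiplier (gradMul τ l) (4 * Real.pi * τ ^ (-(1 / 2) : ℝ)) := by
  classical
  have hs : Summable fun k => ‖gradMul τ l k‖ :=
    summable_norm_mul_heatMul (norm_grad_symbol_le l) τ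
  refine isMultiplier_of_kernel hs ?_
  have ht := four_pi_mul_pos hτ
  set t := 4 * Real.pi * τ with ht_def
  have hsum : ∀ x : Torus d, HasSum (fun k => gradMul τ l k * mFourier k x)
      (-(2 * Real.pi) * ∏ j, ((if j = l then sinKernel (x j) t else cosKernel (x j) t : ℝ) : ℂ)) := by
    intro x
    have h := (hasSum_prod_pi
      (a := fun j n => if j = l then (-Complex.I * n * Real.exp (-Real.pi * n ^ 2 * t)) *
        fourier n (x j) else (Real.exp (-Real.pi * n ^ 2 * t) : ℂ) * fourier n (x j))
      (s := fun j => ((if j = l then sinKernel (x j) t else cosKernel (x j) t : ℝ) : ℂ))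
      (fun j => by
        split_ifs
        · exact hasSum_sinKernel _ ht
        · exact hasSum_cosKernel _ ht)
      (fun j => by
        split_ifs
        · exact summable_norm_sinKernel ht _
        · exact summable_norm_cosKernel ht _)).1.mul_left (-(2 * Real.pi) : ℂ)
    refine h.congr_fun fun k => ?_
    have e : ∀ j, (if j = l then (-Complex.I * k j * Real.exp (-Real.pi * k j ^ 2 * t)) *
        fourier (k j) (x j) else (Real.exp (-Real.pi * k j ^ 2 * t) : ℂ) * fourier (k j) (x j))
        = (if j = l then -Complex.I * k j else 1) *
          ((Real.exp (-Real.pi * k j ^ 2 * t) : ℂ) * fourier (k j) (x j)) := fun j => by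
      split_ifs <;> ring
    simp_rw [e]
    rw [Finset.prod_mul_distrib, Finset.prod_mul_distrib, Finset.prod_ite_eq' Finset.univ l]
    have e2 : heatMul τ k = ∏ j, Real.exp (-Real.pi * k j ^ 2 * t) := heatMul_eq_prod hτ k
    simp only [Finset.mem_univ, if_true, gradMul, e2, mFourier, ContinuousMap.coe_mk]
    push_cast
    ring
  simp_rw [fun x => (hsum x).tsum_eq]
  -- This anisotropic time is the reason why the product kernels allow a different time in each
  -- variable.
  set t' : Fin d → ℝ := fun j => if j = l then 2 * t else t with ht'
  have ht'pos : ∀ j, 0 < t' j := fun j => by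
    change 0 < if j = l then 2 * t else t
    split_ifs <;> positivity
  have hbound : ∀ x : Torus d, ‖(-(2 * Real.pi) * ∏ j, ((if j = l then sinKernel (x j) t else
      cosKernel (x j) t : ℝ) : ℂ))‖ ≤
      (2 * Real.pi) * (2 * t ^ (-(1 / 2) : ℝ)) * ∏ j, cosKernel (x j) (t' j) := by
    intro x
    rw [norm_mul, norm_neg, norm_mul, Complex.norm_ofNat, Complex.norm_real, Real.norm_eq_abs,
      abs_of_pos Real.pi_pos, mul_assoc (2 * Real.pi)]
    refine mul_le_mul_of_nonneg_left ?_ (by positivity)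
    rw [norm_prod]
    have e : (2 * t ^ (-(1 / 2) : ℝ)) = ∏ j : Fin d, if j = l then 2 * t ^ (-(1 / 2) : ℝ) else 1 := by
      rw [Finset.prod_ite_eq' Finset.univ l]; simp
    rw [e, ← Finset.prod_mul_distrib]
    refine Finset.prod_le_prod (fun _ _ => norm_nonneg _) fun j _ => ?_
    rw [Complex.norm_real, Real.norm_eq_abs]
    change _ ≤ _ * cosKernel (x j) (if j = l then 2 * t else t)
    split_ifs
    · exact abs_sinKernel_le _ ht
    · rw [one_mul, abs_of_nonneg (cosKernel_nonneg _ ht)]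
  have hint : Integrable (fun x : Torus d => ∏ j, cosKernel (x j) (t' j)) (torusMeasure d) :=
    integrable_continuousMap ⟨_, continuous_prod_cosKernel ht'pos⟩
  refine (integral_mono_of_nonneg (Eventually.of_forall fun _ => norm_nonneg _)
    (hint.const_mul _) (Eventually.of_forall hbound)).trans ?_
  rw [integral_const_mul, integral_prod_cosKernel ht'pos, mul_one]
  have h1 : t ^ (-(1 / 2) : ℝ) ≤ τ ^ (-(1 / 2) : ℝ) :=
    Real.rpow_le_rpow_of_nonpos hτ (by rw [ht_def]; nlinarith [Real.pi_gt_three]) (by norm_num)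
  have := Real.pi_pos
  nlinarith

end Zeta

/-! ### Bounds for the Leray, convection and Bessel multipliers -/

lemma rpow_neg_le_of_le {s t a : ℝ} (hs : 0 < s) (hst : s ≤ t) (ha : 0 ≤ a) :
    t ^ (-a) ≤ s ^ (-a) :=
  Real.rpow_le_rpow_of_nonpos hs hst (by linarith)

lemma one_le_mul_rpow_neg {τ T a : ℝ} (hτ : 0 < τ) (hT : τ ≤ T) (ha : 0 ≤ a) :
    1 ≤ T ^ a * τ ^ (-a) := by
  rw [Real.rpow_neg hτ.le, ← div_eq_mul_inv, one_le_div (Real.rpow_pos_of_pos hτ _)]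
  exact Real.rpow_le_rpow hτ.le hT ha

/-- On (0, T] a weaker singularity is absorbed into a stronger one, so that all smoothing bounds can
share a single exponent. -/
lemma rpow_neg_le_mul_rpow_neg {τ T a b : ℝ} (hτ : 0 < τ) (hT : τ ≤ T) (hab : a ≤ b) :
    τ ^ (-a) ≤ T ^ (b - a) * τ ^ (-b) := by
  have h := one_le_mul_rpow_neg hτ hT (sub_nonneg.2 hab)
  have e : τ ^ (-b) = τ ^ (-(b - a)) * τ ^ (-a) := by
    rw [← Real.rpow_add hτ]; ring_nf
  rw [e, ← mul_assoc]
  exact le_mul_of_one_le_left (Real.rpow_nonneg hτ.le _) h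

/-- The multiplier `4π² k_i k_j e^{-4π²|k|²τ}`. -/
def hessMul (τ : ℝ) (i j : Fin d) (k : Fin d → ℤ) : ℂ :=
  ((4 * Real.pi ^ 2 * (k i * k j) * heatMul τ k : ℝ) : ℂ)

/-- Split the time into halves and compose two gradients; the sign comes from I² = -1. -/
lemma isMultiplier_hessMul {τ : ℝ} (hτ : 0 < τ) (i j : Fin d) :
    IsMultiplier (hessMul τ i j) (32 * Real.pi ^ 2 * τ⁻¹) := by
  have h := ((isMultiplier_gradMul (half_pos hτ) i).mul (isMultiplier_gradMul (half_pos hτ) j)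
    (by positivity)).const_mul (-1)
  have e : (fun k : Fin d → ℤ => -1 * (gradMul (τ / 2) i k * gradMul (τ / 2) j k)) =
      hessMul τ i j := by
    ext k
    have e1 : heatMul τ k = heatMul (τ / 2) k * heatMul (τ / 2) k := by
      rw [← heatMul_add (half_pos hτ) (half_pos hτ), add_halves]
    simp only [gradMul, hessMul, e1]
    push_cast
    linear_combination (-4 * (Real.pi : ℂ) ^ 2 * k i * k j * (heatMul (τ / 2) k : ℂ) ^ 2) *
      Complex.I_sq
  rw [e] at h
  refine h.mono (le_of_eq ?_)
  have e2 : (τ / 2) ^ (-(1 / 2) : ℝ) * (τ / 2) ^ (-(1 / 2) : ℝ) = 2 * τ⁻¹ := by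
    rw [← Real.rpow_add (half_pos hτ)]
    norm_num
    rw [Real.rpow_neg_one]; field_simp
  rw [norm_neg, norm_one, one_mul]
  calc _ = 16 * Real.pi ^ 2 * ((τ / 2) ^ (-(1 / 2) : ℝ) * (τ / 2) ^ (-(1 / 2) : ℝ)) := by ring
    _ = _ := by rw [e2]; ring

/-- The multiplier `k_i k_j |k|⁻² e^{-4π²|k|²τ}`. -/
def rieszMul (τ : ℝ) (i j : Fin d) (k : Fin d → ℤ) : ℂ :=
  ((k i * k j / freqSq k * heatMul τ k : ℝ) : ℂ)

/-- At k = 0 the quotient is 0/0 = 0, so no exception is needed. -/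
lemma abs_riesz_symbol_le (i j : Fin d) (k : Fin d → ℤ) :
    |(k i : ℝ) * k j / freqSq k| ≤ 1 := by
  rw [abs_div, abs_of_nonneg (freqSq_nonneg k)]
  exact div_le_one_of_le₀ (abs_mul_le_freqSq k i j) (freqSq_nonneg k)

lemma hasDerivAt_exp_freq (c s : ℝ) :
    HasDerivAt (fun s => -Real.exp (-(c * s))) (c * Real.exp (-(c * s))) s := by
  have h : HasDerivAt (fun s => -Real.exp (-(c * s))) (-(Real.exp (-(c * s)) * -(c * 1))) s :=
    (((hasDerivAt_id s).const_mul c).fun_neg.exp).fun_neg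
  convert h using 1
  ring

/-- Differentiating in time cancels |k|⁻²: the derivative of `rieszMul` is minus `hessMul`, and the
identity is the fundamental theorem of calculus on [τ, T]. -/
lemma rieszMul_eq {τ T : ℝ} (hτ : 0 < τ) (hT : τ ≤ T) (i j : Fin d) (k : Fin d → ℤ) :
    rieszMul τ i j k = rieszMul T i j k + ∫ s in Ioc τ T, hessMul s i j k := by
  have h1 : ∫ s in Ioc τ T, hessMul s i j k =
      ((∫ s in τ..T, 4 * Real.pi ^ 2 * (k i * k j) *
        Real.exp (-(4 * Real.pi ^ 2 * freqSq k * s)) : ℝ) : ℂ) := by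
    rw [intervalIntegral.integral_of_le hT, ← integral_complex_ofReal]
    refine setIntegral_congr_fun measurableSet_Ioc fun s hs => ?_
    simp only [hessMul, heatMul_of_pos (hτ.trans hs.1)]
  rw [h1]
  simp only [rieszMul]
  rw [← Complex.ofReal_add]
  congr 1
  rw [heatMul_of_pos hτ, heatMul_of_pos (hτ.trans_le hT)]
  by_cases hk : freqSq k = 0
  · have h0 : (k i : ℝ) * k j = 0 := by
      have := abs_mul_le_freqSq k i j
      rw [hk] at this
      exact abs_nonpos_iff.1 this
    simp [h0]
  · set c := 4 * Real.pi ^ 2 * freqSq k with hc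
    have h2 : ∫ s in τ..T, 4 * Real.pi ^ 2 * (k i * k j) * Real.exp (-(c * s)) =
        k i * k j / freqSq k * (-Real.exp (-(c * T)) - -Real.exp (-(c * τ))) := by
      rw [← intervalIntegral.integral_eq_sub_of_hasDerivAt (fun s _ => hasDerivAt_exp_freq c s)
        (Continuous.intervalIntegrable (by fun_prop) _ _), ← intervalIntegral.integral_const_mul]
      congr 1; ext s
      rw [hc]; field_simp
    rw [h2]; ring

lemma integrable_hessMul {τ T : ℝ} (hτ : 0 < τ) (i j : Fin d) (k : Fin d → ℤ) :
    IntegrableOn (fun s => hessMul s i j k) (Ioc τ T) := by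
  have h : IntegrableOn (fun s => ((4 * Real.pi ^ 2 * (k i * k j) *
      Real.exp (-(4 * Real.pi ^ 2 * freqSq k * s)) : ℝ) : ℂ)) (Ioc τ T) :=
    (Continuous.integrableOn_Icc (by fun_prop)).mono_set Ioc_subset_Icc_self
  refine h.congr_fun (fun s hs => ?_) measurableSet_Ioc
  simp only [hessMul, heatMul_of_pos (hτ.trans hs.1)]

lemma summable_norm_rieszMul (τ : ℝ) (i j : Fin d) :
    Summable fun k : Fin d → ℤ => ‖rieszMul τ i j k‖ := by
  refine Summable.of_nonneg_of_le (fun _ => norm_nonneg _) (fun k => ?_) (summable_heatMul τ)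
  rw [rieszMul, Complex.norm_real, Real.norm_eq_abs, abs_mul, abs_of_nonneg (heatMul_nonneg τ k)]
  exact mul_le_of_le_one_left (heatMul_nonneg τ k) (abs_riesz_symbol_le i j k)

/-- Riesz transforms are not bounded on continuous functions, so a loss as τ → 0 is expected. The
Hessian is O(1/s) and its integral over [τ, T] is logarithmic, which is absorbed in τ^(-ε); the term
left at time T is smooth. -/
lemma isMultiplier_rieszMul {T ε : ℝ} (hT : 0 < T) (hε : 0 < ε) (hε1 : ε < 1) :
    ∃ C : ℝ, 0 ≤ C ∧ ∀ τ, 0 < τ → τ ≤ T → ∀ i j : Fin d,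
      IsMultiplier (rieszMul τ i j) (C * τ ^ (-ε)) := by
  set C₁ : ℝ := ∑' k : Fin d → ℤ, heatMul T k with hC₁
  have hC₁0 : 0 ≤ C₁ := tsum_nonneg fun k => heatMul_nonneg T k
  refine ⟨C₁ * T ^ ε + 32 * Real.pi ^ 2 * (T ^ ε / ε), by positivity, fun τ hτ hτT i j => ?_⟩
  have h1 : IsMultiplier (rieszMul T i j) (C₁ * T ^ ε * τ ^ (-ε)) := by
    refine (isMultiplier_of_summable (summable_norm_rieszMul T i j)).mono ?_
    have : ∑' k, ‖rieszMul T i j k‖ ≤ C₁ := by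
      refine (summable_norm_rieszMul T i j).tsum_le_tsum (fun k => ?_) (summable_heatMul T)
      rw [rieszMul, Complex.norm_real, Real.norm_eq_abs, abs_mul,
        abs_of_nonneg (heatMul_nonneg T k)]
      exact mul_le_of_le_one_left (heatMul_nonneg T k) (abs_riesz_symbol_le i j k)
    refine this.trans ?_
    rw [mul_assoc]
    exact le_mul_of_one_le_right hC₁0 (one_le_mul_rpow_neg hτ hτT hε.le)
  have hIntε : IntegrableOn (fun s : ℝ => s ^ (ε - 1)) (Ioc τ T) :=
    ((intervalIntegral.intervalIntegrable_rpow' (a := τ) (b := T)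
      (r := ε - 1) (by linarith)).1 : IntegrableOn _ (Ioc τ T))
  have hval : ∫ s in Ioc τ T, s ^ (ε - 1) ≤ T ^ ε / ε := by
    rw [← intervalIntegral.integral_of_le hτT, integral_rpow (Or.inl (by linarith)),
      sub_add_cancel]
    have := Real.rpow_nonneg hτ.le ε
    gcongr
    linarith
  have h2 : IsMultiplier (fun k => ∫ s in Ioc τ T, hessMul s i j k)
      (∫ s in Ioc τ T, 32 * Real.pi ^ 2 * (τ ^ (-ε) * s ^ (ε - 1))) := by
    refine IsMultiplier.integral (fun k => integrable_hessMul hτ i j k) ?_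
      ((hIntε.const_mul _).const_mul _) ?_
    · refine Summable.of_nonneg_of_le (fun k => by positivity) (fun k => ?_)
        (((summable_pow_mul_heatMul 1 τ).mul_left (4 * Real.pi ^ 2)).mul_left (T - τ))
      have hb : ∀ s ∈ Ioc τ T, ‖hessMul s i j k‖ ≤
          4 * Real.pi ^ 2 * ((1 + freqSq k) ^ 1 * heatMul τ k) := fun s hs => by
        rw [hessMul, Complex.norm_real, Real.norm_eq_abs, abs_mul, abs_mul,
          abs_of_nonneg (heatMul_nonneg s k), abs_of_pos (by positivity : 0 < 4 * Real.pi ^ 2),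
          mul_assoc]
        refine mul_le_mul_of_nonneg_left ?_ (by positivity)
        refine mul_le_mul ?_ (heatMul_antitone hτ hs.1.le k) (heatMul_nonneg s k)
          (by have := freqSq_nonneg k; positivity)
        have := abs_mul_le_freqSq k i j
        linarith
      refine (setIntegral_mono_on (integrable_hessMul hτ i j k).norm (integrable_const _)
        measurableSet_Ioc hb).trans_eq ?_
      simp [hτT]
    · refine (ae_restrict_mem measurableSet_Ioc).mono fun s hs => ?_
      have hs0 := hτ.trans hs.1
      refine (isMultiplier_hessMul hs0 i j).mono ?_
      refine mul_le_mul_of_nonneg_left ?_ (by positivity)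
      -- Here s^(-ε) ≤ τ^(-ε), and s^(ε-1) is integrable at 0, with an integral bounded
      -- independently of τ.
      have e : s⁻¹ = s ^ (-ε) * s ^ (ε - 1) := by
        rw [← Real.rpow_add hs0, ← Real.rpow_neg_one]; ring_nf
      rw [e]
      exact mul_le_mul_of_nonneg_right (rpow_neg_le_of_le hτ hs.1.le hε.le)
        (Real.rpow_nonneg hs0.le _)
  have h3 := h1.add h2
  have e : (fun k => rieszMul T i j k + ∫ s in Ioc τ T, hessMul s i j k) = rieszMul τ i j := by
    ext k; rw [rieszMul_eq hτ hτT]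
  rw [e] at h3
  refine h3.mono ?_
  rw [integral_const_mul, integral_const_mul, add_mul]
  have h4 : 0 ≤ τ ^ (-ε) := Real.rpow_nonneg hτ.le _
  have h5 : τ ^ (-ε) * ∫ s in Ioc τ T, s ^ (ε - 1) ≤ τ ^ (-ε) * (T ^ ε / ε) :=
    mul_le_mul_of_nonneg_left hval h4
  have h6 : 0 ≤ 32 * Real.pi ^ 2 := by positivity
  nlinarith

/-- The multiplier of the `(j, i)` entry of the matrix `P e^{τΔ}`. -/
def lerayMul (τ : ℝ) (j i : Fin d) (k : Fin d → ℤ) : ℂ :=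
  (if i = j then (heatMul τ k : ℂ) else 0) - rieszMul τ i j k

lemma isMultiplier_lerayMul {T ε : ℝ} (hT : 0 < T) (hε : 0 < ε) (hε1 : ε < 1) :
    ∃ C : ℝ, 0 ≤ C ∧ ∀ τ, 0 < τ → τ ≤ T → ∀ j i : Fin d,
      IsMultiplier (lerayMul τ j i) (C * τ ^ (-ε)) := by
  obtain ⟨C, hC, h⟩ := isMultiplier_rieszMul (d := d) hT hε hε1
  refine ⟨T ^ ε + C, by positivity, fun τ hτ hτT j i => ?_⟩
  have h1 : IsMultiplier (fun k : Fin d → ℤ => if i = j then (heatMul τ k : ℂ) else 0)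
      (T ^ ε * τ ^ (-ε)) := by
    have := one_le_mul_rpow_neg hτ hτT hε.le
    split_ifs
    · exact (isMultiplier_heatMul τ).mono this
    · exact isMultiplier_zero.mono (by linarith)
  have h2 := h1.add ((h τ hτ hτT i j).const_mul (-1))
  rw [norm_neg, norm_one, one_mul, ← add_mul] at h2
  convert h2 using 2
  simp [lerayMul, sub_eq_add_neg]

/-- The multiplier of `(1 - Δ/4π²)^{γ/2}`, in the normalisation of `besselNorm`. -/
def besselMul (γ : ℝ) (k : Fin d → ℤ) : ℝ := (1 + freqSq k) ^ (γ / 2)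

/-- |k|² is the trace of the Hessian symbol divided by 4π²; the constant is d · 32π²/(4π²) = 8d. -/
lemma isMultiplier_one_add_freqSq {τ : ℝ} (hτ : 0 < τ) :
    IsMultiplier (fun k : Fin d → ℤ => (((1 + freqSq k) * heatMul τ k : ℝ) : ℂ))
      (1 + 8 * d * τ⁻¹) := by
  have h := (isMultiplier_heatMul (d := d) τ).add ((IsMultiplier.sum Finset.univ
    fun i _ => isMultiplier_hessMul hτ i i).const_mul ((1 / (4 * Real.pi ^ 2) : ℝ) : ℂ))
  have hpi := Real.pi_ne_zero
  convert h using 1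
  · ext k
    simp only [hessMul]
    rw [← Complex.ofReal_sum, ← Complex.ofReal_mul, ← Complex.ofReal_add]
    congr 1
    rw [← Finset.sum_mul, ← Finset.mul_sum]
    simp_rw [← sq]
    rw [← freqSq]
    field_simp
  · rw [Complex.norm_real, Real.norm_eq_abs, abs_of_nonneg (by positivity)]
    simp
    field_simp
    ring

/-- A positive power is not a superposition of exponentials, but x^(γ/2) = x · x^(-(1-γ/2)), and the
negative power is a Gamma integral of exponentials. The spare factor x costs one Hessian. -/
lemma besselMul_eq {γ : ℝ} (hγ2 : γ < 2) (k : Fin d → ℤ) :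
    besselMul γ k = (Real.Gamma (1 - γ / 2))⁻¹ * ∫ r in Ioi (0 : ℝ),
      (1 + freqSq k) * (r ^ ((1 - γ / 2) - 1) * Real.exp (-((1 + freqSq k) * r))) := by
  have hk : 0 < 1 + freqSq k := by linarith [freqSq_nonneg k]
  have hG : 0 < Real.Gamma (1 - γ / 2) := Real.Gamma_pos_of_pos (by linarith)
  rw [integral_const_mul, Real.integral_rpow_mul_exp_neg_mul_Ioi (by linarith) hk, one_div,
    Real.inv_rpow hk.le, ← Real.rpow_neg hk.le, besselMul]
  have e : (1 + freqSq k) ^ (γ / 2) = (1 + freqSq k) * (1 + freqSq k) ^ (-(1 - γ / 2)) := by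
    nth_rewrite 2 [← Real.rpow_one (1 + freqSq k)]
    rw [← Real.rpow_add hk]; ring_nf
  rw [e]
  have := hG.ne'
  generalize Real.Gamma (1 - γ / 2) = g at *
  field_simp

/-- The Bessel symbol contains |k|² without the 4π² of the heat symbol, hence the heat time r/4π².
-/
lemma exp_mul_heatMul {r τ : ℝ} (hr : 0 < r) (hτ : 0 < τ) (k : Fin d → ℤ) :
    Real.exp (-((1 + freqSq k) * r)) * heatMul τ k =
      Real.exp (-r) * heatMul (r / (4 * Real.pi ^ 2) + τ) k := by
  have h1 : 0 < r / (4 * Real.pi ^ 2) := by positivity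
  rw [heatMul_add h1 hτ, ← mul_assoc, heatMul_of_pos h1, ← Real.exp_add]
  congr 2
  have := Real.pi_ne_zero
  field_simp
  ring

/-- Integrating the bound of `isMultiplier_one_add_freqSq` against e^(-r) r^(-γ/2) in the Gamma
representation. The exponent `a` exceeds γ/2 so that the integral converges at r = 0. -/
lemma isMultiplier_bessel_heatMul {γ a : ℝ} (hγ : 0 ≤ γ) (ha : γ / 2 < a) (ha1 : a < 1)
    {T : ℝ} (hT : 0 < T) :
    ∃ C : ℝ, 0 ≤ C ∧ ∀ τ, 0 < τ → τ ≤ T →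
      IsMultiplier (fun k : Fin d → ℤ => ((besselMul γ k * heatMul τ k : ℝ) : ℂ))
        (C * τ ^ (-a)) := by
  set G := Real.Gamma (1 - γ / 2) with hGdef
  have hG : 0 < G := Real.Gamma_pos_of_pos (by linarith)
  set c : ℝ := 8 * d * (4 * Real.pi ^ 2) ^ (1 - a) with hc
  have hc0 : 0 ≤ c := by positivity
  have hI1 := Real.GammaIntegral_convergent (s := 1 - γ / 2) (by linarith)
  have hI2 := Real.GammaIntegral_convergent (s := a - γ / 2) (by linarith)
  have hG2 : 0 ≤ Real.Gamma (a - γ / 2) := (Real.Gamma_pos_of_pos (by linarith)).le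
  refine ⟨G⁻¹ * (G * T ^ a + c * Real.Gamma (a - γ / 2)), by positivity, fun τ hτ hτT => ?_⟩
  have hmeas : ∀ k : Fin d → ℤ, IntegrableOn (fun r : ℝ => (((1 + freqSq k) *
      (r ^ ((1 - γ / 2) - 1) * Real.exp (-((1 + freqSq k) * r))) * heatMul τ k : ℝ) : ℂ))
      (Ioi 0) := fun k => by
    have hk : 0 < 1 + freqSq k := by linarith [freqSq_nonneg k]
    have h := integrableOn_rpow_mul_exp_neg_mul_rpow (p := 1) (s := 1 - γ / 2 - 1)
      (by linarith) one_pos hk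
    refine ((h.congr_fun (fun r _ => ?_) measurableSet_Ioi).const_mul _ |>.mul_const _).ofReal
    simp only [Real.rpow_one]
    ring_nf
  have h := IsMultiplier.integral (μ := volume.restrict (Ioi (0 : ℝ)))
    (m := fun r (k : Fin d → ℤ) => (((1 + freqSq k) *
      (r ^ ((1 - γ / 2) - 1) * Real.exp (-((1 + freqSq k) * r))) * heatMul τ k : ℝ) : ℂ))
    (C := fun r => Real.exp (-r) * r ^ ((1 - γ / 2) - 1) +
      c * τ ^ (-a) * (Real.exp (-r) * r ^ ((a - γ / 2) - 1))) hmeas ?_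
      (hI1.add (hI2.const_mul _)) ?_
  · have h2 := h.const_mul ((G⁻¹ : ℝ) : ℂ)
    convert h2.mono ?_ using 1
    · ext k
      rw [besselMul_eq (by linarith), integral_complex_ofReal, integral_mul_const]
      push_cast
      ring
    · rw [Complex.norm_real, Real.norm_eq_abs, abs_of_pos (inv_pos.2 hG), integral_add hI1
        (hI2.const_mul _), integral_const_mul, ← Real.Gamma_eq_integral (by linarith),
        ← Real.Gamma_eq_integral (by linarith), mul_assoc G⁻¹]
      refine mul_le_mul_of_nonneg_left ?_ (inv_pos.2 hG).le
      rw [add_mul, ← hGdef]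
      have := one_le_mul_rpow_neg hτ hτT (by linarith : 0 ≤ a)
      nlinarith
  · refine ((summable_pow_mul_heatMul (d := d) 1 τ).mul_left G).of_nonneg_of_le
      (fun k => by positivity) fun k => ?_
    have hk : 0 ≤ freqSq k := freqSq_nonneg k
    have e : ∫ r in Ioi (0 : ℝ), ‖(((1 + freqSq k) *
        (r ^ ((1 - γ / 2) - 1) * Real.exp (-((1 + freqSq k) * r))) * heatMul τ k : ℝ) : ℂ)‖ =
        G * (besselMul γ k * heatMul τ k) := by
      rw [besselMul_eq (by linarith), ← hGdef, mul_assoc G⁻¹, mul_inv_cancel_left₀ hG.ne',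
        ← integral_mul_const]
      refine setIntegral_congr_fun measurableSet_Ioi fun r hr => ?_
      have hr' : (0 : ℝ) < r := hr
      simp only [Complex.norm_real, Real.norm_eq_abs]
      have := heatMul_nonneg τ k
      exact abs_of_nonneg (by positivity)
    rw [e]
    refine mul_le_mul_of_nonneg_left (mul_le_mul_of_nonneg_right ?_ (heatMul_nonneg τ k)) hG.le
    rw [besselMul, pow_one]
    exact Real.rpow_le_self_of_one_le (by linarith) (by linarith)
  · refine (ae_restrict_mem measurableSet_Ioi).mono fun r hr => ?_
    have hr' : (0 : ℝ) < r := hr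
    set s := r / (4 * Real.pi ^ 2) + τ with hs
    have hr1 : 0 < r / (4 * Real.pi ^ 2) := by positivity
    have hs0 : 0 < s := by positivity
    have h2 := (isMultiplier_one_add_freqSq (d := d) hs0).const_mul
      ((r ^ ((1 - γ / 2) - 1) * Real.exp (-r) : ℝ) : ℂ)
    convert h2.mono ?_ using 1
    · ext k
      rw [← Complex.ofReal_mul]
      congr 1
      have := exp_mul_heatMul hr' hτ k
      rw [← hs] at this
      linear_combination (1 + freqSq k) * r ^ ((1 - γ / 2) - 1) * this
    · rw [Complex.norm_real, Real.norm_eq_abs, abs_of_pos (by positivity), mul_add, mul_one,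
        mul_comm (r ^ _) (Real.exp _)]
      refine add_le_add_right ?_ _ |>.trans_eq' rfl
      -- As s dominates both τ and r/4π², the factor 1/s can be shared between them with exponents a
      -- and 1 - a.
      have e1 : s⁻¹ ≤ τ ^ (-a) * (r / (4 * Real.pi ^ 2)) ^ (-(1 - a)) := by
        have : s⁻¹ = s ^ (-a) * s ^ (-(1 - a)) := by
          rw [← Real.rpow_add hs0, ← Real.rpow_neg_one]; ring_nf
        rw [this]
        exact mul_le_mul (rpow_neg_le_of_le hτ (by linarith) (by linarith))
          (rpow_neg_le_of_le hr1 (by linarith) (by linarith)) (by positivity) (by positivity)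
      have e2 : (r / (4 * Real.pi ^ 2)) ^ (-(1 - a)) = (4 * Real.pi ^ 2) ^ (1 - a) * r ^ (a - 1) := by
        rw [Real.div_rpow hr'.le (by positivity), Real.rpow_neg (by positivity : 0 ≤ 4 * Real.pi ^ 2),
          div_inv_eq_mul, mul_comm, neg_sub]
      have e3 : r ^ ((a - γ / 2) - 1) = r ^ ((1 - γ / 2) - 1) * r ^ (a - 1) := by
        rw [← Real.rpow_add hr']; ring_nf
      rw [e2] at e1
      rw [e3, hc]
      have h8 : 0 ≤ Real.exp (-r) * r ^ ((1 - γ / 2) - 1) * (8 * d) := by positivity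
      calc _ = Real.exp (-r) * r ^ ((1 - γ / 2) - 1) * (8 * d) * s⁻¹ := by ring
        _ ≤ _ := mul_le_mul_of_nonneg_left e1 h8
        _ = _ := by ring

/-! ### Matrix-valued multipliers acting on continuous vector fields -/

/-- The `i`-th component of a vector field, as a complex function. -/
def ccomp (i : Fin d) : C(Torus d, Vel d) →L[ℝ] C(Torus d, ℂ) :=
  (Complex.ofRealCLM.comp (EuclideanSpace.proj i : Vel d →L[ℝ] ℝ)).compLeftContinuous ℝ (Torus d)

@[simp] lemma ccomp_apply (i : Fin d) (f : C(Torus d, Vel d)) (x : Torus d) :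
    ccomp i f x = ((f x i : ℝ) : ℂ) := rfl

lemma norm_apply_le (v : Vel d) (i : Fin d) : |v i| ≤ ‖v‖ := by
  have := EuclideanSpace.norm_eq v
  rw [this]
  refine Real.le_sqrt_of_sq_le ?_
  rw [sq_abs]
  have h := Finset.single_le_sum (f := fun i => ‖v i‖ ^ 2) (fun _ _ => sq_nonneg _)
    (Finset.mem_univ i)
  simpa using h

lemma norm_le_sum (v : Vel d) : ‖v‖ ≤ ∑ i, |v i| := by
  have h : v = ∑ i, EuclideanSpace.single i (v i) := by
    ext j; simp
  nth_rewrite 1 [h]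
  refine (norm_sum_le _ _).trans_eq ?_
  simp

lemma norm_ccomp_le (i : Fin d) (f : C(Torus d, Vel d)) : ‖ccomp i f‖ ≤ ‖f‖ := by
  refine (ContinuousMap.norm_le_of_nonempty _).2 fun x => ?_
  rw [ccomp_apply, Complex.norm_real, Real.norm_eq_abs]
  exact (norm_apply_le _ i).trans (f.norm_coe_le_norm x)

/-- The vector field with `j`-th component the real part of a given function. -/
def reField (j : Fin d) : C(Torus d, ℂ) →L[ℝ] C(Torus d, Vel d) :=
  (Complex.reCLM.smulRight (EuclideanSpace.single j 1 : Vel d)).compLeftContinuous ℝ (Torus d)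

lemma reField_apply (j : Fin d) (g : C(Torus d, ℂ)) (x : Torus d) (i : Fin d) :
    reField j g x i = if i = j then (g x).re else 0 := by
  simp [reField]

/-- The Fourier multiplier operator on continuous functions. -/
def mulOp (m : (Fin d → ℤ) → ℂ) (f : C(Torus d, ℂ)) : C(Torus d, ℂ) :=
  ∑' k, (m k * mFourierCoeff f k) • (mFourier k : C(Torus d, ℂ))

lemma mulOp_apply {m : (Fin d → ℤ) → ℂ} (hm : Summable fun k => ‖m k‖) (f : C(Torus d, ℂ))
    (x : Torus d) : mulOp m f x = ∑' k, m k * mFourierCoeff f k * mFourier k x :=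
  series_apply (summable_mul_coeff hm f) x

lemma IsMultiplier.norm_mulOp_le {m : (Fin d → ℤ) → ℂ} {C : ℝ} (hm : IsMultiplier m C)
    (f : C(Torus d, ℂ)) : ‖mulOp m f‖ ≤ C * ‖f‖ := by
  refine (ContinuousMap.norm_le_of_nonempty _).2 fun x => ?_
  rw [mulOp_apply hm.1]
  exact hm.2 f x

lemma mulOp_sub {m : (Fin d → ℤ) → ℂ} (hm : Summable fun k => ‖m k‖) (f g : C(Torus d, ℂ)) :
    mulOp m (f - g) = mulOp m f - mulOp m g := by
  simp only [mulOp]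
  rw [← (summable_series (summable_mul_coeff hm f)).tsum_sub
    (summable_series (summable_mul_coeff hm g))]
  refine tsum_congr fun k => ?_
  simp only [← coeffCLM_apply, map_sub, mul_sub]
  exact sub_smul (m k * coeffCLM k f) (m k * coeffCLM k g) (mFourier k : C(Torus d, ℂ))

/-- The multiplier maps real functions to real functions. -/
def IsHermitianSymbol (m : (Fin d → ℤ) → ℂ) : Prop :=
  ∀ k, m (-k) = (starRingEnd ℂ) (m k)

lemma coeff_neg_of_real (f : Torus d → ℝ) (k : Fin d → ℤ) :
    mFourierCoeff (fun x => (f x : ℂ)) (-k) =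
      (starRingEnd ℂ) (mFourierCoeff (fun x => (f x : ℂ)) k) := by
  rw [coeff_def, coeff_def, ← integral_conj]
  refine integral_congr_ae (Eventually.of_forall fun x => ?_)
  simp only [map_mul, Complex.conj_ofReal, mFourier_neg, Complex.conj_conj]

/-- The change of variable k ↦ -k shows that the sum is its own conjugate. Hence the real parts
taken in `heat` and `vecOp` discard nothing for Hermitian symbols. -/
lemma ofReal_re_tsum_of_hermitian {a : (Fin d → ℤ) → ℂ} (ha : IsHermitianSymbol a)
    (x : Torus d) : (((∑' k, a k * mFourier k x).re : ℝ) : ℂ) = ∑' k, a k * mFourier k x := by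
  rw [← Complex.conj_eq_iff_re, Complex.conj_tsum, ← (Equiv.neg (Fin d → ℤ)).tsum_eq]
  refine tsum_congr fun k => ?_
  simp only [Equiv.neg_apply, map_mul, ha k, mFourier_neg, Complex.conj_conj]

/-- A matrix of multipliers of norm at most `C`, acting on real vector fields. -/
structure IsMatrixMultiplier (M : Fin d → Fin d → (Fin d → ℤ) → ℂ) (C : ℝ) : Prop where
  nonneg : 0 ≤ C
  isMultiplier : ∀ j i, IsMultiplier (M j i) C
  hermitian : ∀ j i, IsHermitianSymbol (M j i)

/-- The operator associated with a matrix of multipliers. -/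
def vecOp (M : Fin d → Fin d → (Fin d → ℤ) → ℂ) (f : C(Torus d, Vel d)) : C(Torus d, Vel d) :=
  ∑ j, ∑ i, reField j (mulOp (M j i) (ccomp i f))

lemma vecOp_apply (M : Fin d → Fin d → (Fin d → ℤ) → ℂ) (f : C(Torus d, Vel d)) (x : Torus d)
    (j : Fin d) : vecOp M f x j = ∑ i, (mulOp (M j i) (ccomp i f) x).re := by
  simp only [vecOp, ContinuousMap.coe_sum, Finset.sum_apply, WithLp.ofLp_sum, reField_apply]
  simp

lemma vecOp_apply_eq_tsum {M : Fin d → Fin d → (Fin d → ℤ) → ℂ}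
    (hM : ∀ j i, Summable fun k => ‖M j i k‖) (f : C(Torus d, Vel d)) (x : Torus d) (j : Fin d) :
    vecOp M f x j = (∑' k, (∑ i, M j i k * vecCoeff f k i) * mFourier k x).re := by
  rw [vecOp_apply, ← Complex.re_sum]
  congr 1
  simp_rw [mulOp_apply (hM j _), Finset.sum_mul]
  exact (Summable.tsum_finsetSum fun i _ => summable_mul_coeff_mul (hM j i) (ccomp i f) x).symm

lemma summable_sum_mul_coeff {M : Fin d → Fin d → (Fin d → ℤ) → ℂ}
    (hM : ∀ j i, Summable fun k => ‖M j i k‖) (f : C(Torus d, Vel d)) (j : Fin d) :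
    Summable fun k => ‖∑ i, M j i k * vecCoeff f k i‖ :=
  Summable.of_nonneg_of_le (fun _ => norm_nonneg _) (fun _ => norm_sum_le _ _)
    (summable_sum fun i _ => summable_mul_coeff (hM j i) (ccomp i f))

lemma IsMatrixMultiplier.vecCoeff_vecOp {M : Fin d → Fin d → (Fin d → ℤ) → ℂ} {C : ℝ}
    (hM : IsMatrixMultiplier M C) (f : C(Torus d, Vel d)) (k : Fin d → ℤ) (j : Fin d) :
    vecCoeff (vecOp M f) k j = ∑ i, M j i k * vecCoeff f k i := by
  have hs := fun j i => (hM.isMultiplier j i).1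
  -- Without this symmetry the real part in `vecOp` would change the Fourier coefficients.
  have hh : IsHermitianSymbol fun k => ∑ i, M j i k * vecCoeff f k i := fun k => by
    rw [map_sum]
    refine Finset.sum_congr rfl fun i _ => ?_
    rw [map_mul, hM.hermitian j i k]
    congr 1
    exact coeff_neg_of_real (fun x => f x i) k
  have h : (fun x => ((vecOp M f x j : ℝ) : ℂ)) =
      fun x => ∑' k, (∑ i, M j i k * vecCoeff f k i) * mFourier k x := by
    ext x
    rw [vecOp_apply_eq_tsum hs, ofReal_re_tsum_of_hermitian hh]
  change mFourierCoeff (fun x => ((vecOp M f x j : ℝ) : ℂ)) k = _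
  rw [h, coeff_tsum (summable_sum_mul_coeff hs f j)]

lemma norm_vecOp_le {M : Fin d → Fin d → (Fin d → ℤ) → ℂ} {C : ℝ} (hC : 0 ≤ C)
    (hM : ∀ j i, IsMultiplier (M j i) C) (f : C(Torus d, Vel d)) :
    ‖vecOp M f‖ ≤ (d : ℝ) ^ 2 * C * ‖f‖ := by
  refine (ContinuousMap.norm_le _ (by positivity)).2 fun x => ?_
  refine (norm_le_sum _).trans ?_
  have h : ∀ j, |vecOp M f x j| ≤ d * (C * ‖f‖) := fun j => by
    rw [vecOp_apply]
    refine (Finset.abs_sum_le_sum_abs _ _).trans ?_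
    refine (Finset.sum_le_card_nsmul _ _ (C * ‖f‖) fun i _ => ?_).trans_eq (by simp)
    refine (Complex.abs_re_le_norm _).trans ((ContinuousMap.norm_coe_le_norm _ x).trans ?_)
    refine ((hM j i).norm_mulOp_le _).trans ?_
    exact mul_le_mul_of_nonneg_left (norm_ccomp_le i f) hC
  refine (Finset.sum_le_card_nsmul _ _ _ fun j _ => h j).trans_eq ?_
  simp; ring

lemma IsMatrixMultiplier.norm_vecOp_le {M : Fin d → Fin d → (Fin d → ℤ) → ℂ} {C : ℝ}
    (hM : IsMatrixMultiplier M C) (f : C(Torus d, Vel d)) :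
    ‖vecOp M f‖ ≤ (d : ℝ) ^ 2 * C * ‖f‖ :=
  FluidParticle.norm_vecOp_le hM.nonneg hM.isMultiplier f

lemma vecOp_sub {M : Fin d → Fin d → (Fin d → ℤ) → ℂ}
    (hM : ∀ j i, Summable fun k => ‖M j i k‖) (f g : C(Torus d, Vel d)) :
    vecOp M (f - g) = vecOp M f - vecOp M g := by
  simp only [vecOp, map_sub, mulOp_sub (hM _ _), Finset.sum_sub_distrib]

/-- Lipschitz continuity of a function on the torus, with lifted increments. -/
def IsLip {F : Type*} [NormedAddCommGroup F] (L : ℝ) (f : Torus d → F) : Prop :=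
  ∀ x y, ‖f (x + toTorus y) - f x‖ ≤ L * ‖y‖

/-- Translation of a vector field. -/
def translate {F : Type*} [TopologicalSpace F] (h : Torus d) (f : C(Torus d, F)) :
    C(Torus d, F) := f.comp ⟨fun x => x + h, by fun_prop⟩

@[simp] lemma translate_apply {F : Type*} [TopologicalSpace F] (h : Torus d) (f : C(Torus d, F))
    (x : Torus d) : translate h f x = f (x + h) := rfl

lemma coeff_translate (f : Torus d → ℂ) (h : Torus d) (k : Fin d → ℤ) :
    mFourierCoeff (fun x => f (x + h)) k = mFourier k h * mFourierCoeff f k := by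
  rw [coeff_def, coeff_def, ← integral_add_right_eq_self _ h, ← integral_const_mul,
    ← integral_add_right_eq_self (fun x => mFourier k h * (mFourier (-k) x * f x)) h,
    ← integral_add_right_eq_self _ (-h)]
  refine integral_congr_ae (Eventually.of_forall fun x => ?_)
  have e : mFourier k h * mFourier (-k) h = 1 := by
    rw [← mFourier_add, add_neg_cancel, mFourier_zero]; rfl
  simp only [neg_add_cancel_right]
  rw [mFourier_apply_add]
  linear_combination -(mFourier (-k) x * f (x + h)) * e

lemma vecOp_translate {M : Fin d → Fin d → (Fin d → ℤ) → ℂ}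
    (hM : ∀ j i, Summable fun k => ‖M j i k‖) (h : Torus d) (f : C(Torus d, Vel d)) :
    vecOp M (translate h f) = translate h (vecOp M f) := by
  ext x j
  rw [translate_apply, vecOp_apply_eq_tsum hM, vecOp_apply_eq_tsum hM]
  congr 1
  refine tsum_congr fun k => ?_
  rw [mFourier_apply_add, Finset.sum_mul, Finset.sum_mul]
  refine Finset.sum_congr rfl fun i _ => ?_
  have e : vecCoeff (translate h f) k i = mFourier k h * vecCoeff f k i :=
    coeff_translate (fun x => ((f x i : ℝ) : ℂ)) h k
  rw [e]; ring

lemma IsLip.mono {F : Type*} [NormedAddCommGroup F] {L L' : ℝ} {f : Torus d → F}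
    (h : IsLip L f) (hL : L ≤ L') : IsLip L' f :=
  fun x y => (h x y).trans (mul_le_mul_of_nonneg_right hL (norm_nonneg _))

lemma isLip_iff_translate {F : Type*} [NormedAddCommGroup F] {L : ℝ} (hL : 0 ≤ L)
    {f : C(Torus d, F)} : IsLip L f ↔ ∀ y : Vel d, ‖translate (toTorus y) f - f‖ ≤ L * ‖y‖ := by
  constructor
  · intro h y
    exact (ContinuousMap.norm_le _ (by positivity)).2 fun x => h x y
  · intro h x y
    exact (ContinuousMap.norm_coe_le_norm (translate (toTorus y) f - f) x).trans (h y)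

/-- Multiplier operators commute with translations, so an increment of `vecOp M f` is `vecOp M`
applied to an increment of `f`. -/
lemma IsMatrixMultiplier.isLip_vecOp {M : Fin d → Fin d → (Fin d → ℤ) → ℂ} {C L : ℝ}
    (hM : IsMatrixMultiplier M C) (hL : 0 ≤ L) {f : C(Torus d, Vel d)} (hf : IsLip L f) :
    IsLip ((d : ℝ) ^ 2 * C * L) (vecOp M f) := by
  have hC := hM.nonneg
  have hs := fun j i => (hM.isMultiplier j i).1
  rw [isLip_iff_translate (by positivity)]
  intro y
  rw [← vecOp_translate hs, ← vecOp_sub hs, mul_assoc _ L]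
  refine (hM.norm_vecOp_le _).trans (mul_le_mul_of_nonneg_left ?_ (by positivity))
  exact (isLip_iff_translate hL).1 hf y

/-! ### Measurable dependence of multiplier operators on a parameter -/

lemma stronglyMeasurable_mulOp {α : Type*} [MeasurableSpace α] {m : α → (Fin d → ℤ) → ℂ}
    {f : α → C(Torus d, ℂ)} (hm : ∀ k, Measurable fun a => m a k)
    (hs : ∀ a, Summable fun k => ‖m a k‖) (hf : StronglyMeasurable f) :
    StronglyMeasurable fun a => mulOp (m a) (f a) := by
  refine stronglyMeasurable_of_tendsto (atTop : Filter (Finset (Fin d → ℤ)))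
    (f := fun s a => ∑ k ∈ s, (m a k * mFourierCoeff (f a) k) • (mFourier k : C(Torus d, ℂ)))
    (fun s => ?_) ?_
  · refine Finset.stronglyMeasurable_fun_sum s fun k _ => ?_
    exact ((hm k).stronglyMeasurable.mul
      ((coeffCLM k).continuous.comp_stronglyMeasurable hf)).smul_const _
  · rw [tendsto_pi_nhds]
    exact fun a => (summable_series (summable_mul_coeff (hs a) (f a))).hasSum

lemma stronglyMeasurable_vecOp {α : Type*} [MeasurableSpace α]
    {M : α → Fin d → Fin d → (Fin d → ℤ) → ℂ} {f : α → C(Torus d, Vel d)}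
    (hm : ∀ j i k, Measurable fun a => M a j i k)
    (hs : ∀ a j i, Summable fun k => ‖M a j i k‖) (hf : StronglyMeasurable f) :
    StronglyMeasurable fun a => vecOp (M a) (f a) := by
  refine Finset.stronglyMeasurable_fun_sum _ fun j _ =>
    Finset.stronglyMeasurable_fun_sum _ fun i _ => ?_
  exact (reField j).continuous.comp_stronglyMeasurable (stronglyMeasurable_mulOp (hm j i)
    (fun a => hs a j i) ((ccomp i).continuous.comp_stronglyMeasurable hf))

/-! ### The heat, Leray and convection operators -/

/-- The matrix of multipliers of `e^{τΔ}`. -/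
def heatMat (τ : ℝ) (j i : Fin d) (k : Fin d → ℤ) : ℂ := if i = j then (heatMul τ k : ℂ) else 0

/-- The matrices of multipliers of `e^{τΔ} P ∂_l`. -/
def convMat (τ : ℝ) (l j i : Fin d) (k : Fin d → ℤ) : ℂ :=
  2 * Real.pi * Complex.I * k l * lerayMul τ j i k

/-- Composition of a matrix of multipliers with the Bessel multiplier. -/
def besselMat (γ : ℝ) (M : Fin d → Fin d → (Fin d → ℤ) → ℂ) (j i : Fin d) (k : Fin d → ℤ) : ℂ :=
  (besselMul γ k : ℂ) * M j i k

lemma besselMul_neg (γ : ℝ) (k : Fin d → ℤ) : besselMul γ (-k) = besselMul γ k := by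
  simp [besselMul, freqSq_neg]

lemma rieszMul_neg (τ : ℝ) (i j : Fin d) (k : Fin d → ℤ) :
    rieszMul τ i j (-k) = rieszMul τ i j k := by
  simp [rieszMul, freqSq_neg, heatMul_neg]

lemma isHermitian_heatMat (τ : ℝ) (j i : Fin d) : IsHermitianSymbol (heatMat τ j i) := fun k => by
  simp only [heatMat, heatMul_neg]
  split_ifs <;> simp

lemma isHermitian_lerayMul (τ : ℝ) (j i : Fin d) : IsHermitianSymbol (lerayMul τ j i) := by
  intro k
  simp only [lerayMul, heatMul_neg, rieszMul_neg, map_sub]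
  congr 1
  · split_ifs <;> simp
  · simp [rieszMul]

lemma isHermitian_convMat (τ : ℝ) (l j i : Fin d) : IsHermitianSymbol (convMat τ l j i) := by
  intro k
  simp [convMat, isHermitian_lerayMul τ j i k, map_ofNat]

lemma isHermitian_besselMat {γ : ℝ} {M : Fin d → Fin d → (Fin d → ℤ) → ℂ} {j i : Fin d}
    (h : IsHermitianSymbol (M j i)) : IsHermitianSymbol (besselMat γ M j i) := by
  intro k
  simp [besselMat, besselMul_neg, h k]

lemma isMatrixMultiplier_heatMat (τ : ℝ) : IsMatrixMultiplier (d := d) (heatMat τ) 1 where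
  nonneg := zero_le_one
  isMultiplier j i := by
    change IsMultiplier (fun k => if i = j then (heatMul τ k : ℂ) else 0) 1
    by_cases h : i = j
    · simpa only [h, if_true] using isMultiplier_heatMul τ
    · simpa only [h, if_false] using isMultiplier_zero.mono zero_le_one
  hermitian := isHermitian_heatMat τ

lemma lerayMul_add {s t : ℝ} (hs : 0 < s) (ht : 0 < t) (j i : Fin d) (k : Fin d → ℤ) :
    lerayMul (s + t) j i k = heatMul s k * lerayMul t j i k := by
  simp only [lerayMul, rieszMul, heatMul_add hs ht]
  split_ifs <;> push_cast <;> ring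

/-- Half of the time pays for the derivative, the other half for the projector. -/
lemma isMultiplier_convMat {τ C : ℝ} (hτ : 0 < τ) {j i : Fin d} (l : Fin d)
    (h : IsMultiplier (lerayMul (τ / 2) j i) C) :
    IsMultiplier (convMat τ l j i) (4 * Real.pi * (τ / 2) ^ (-(1 / 2) : ℝ) * C) := by
  convert (isMultiplier_gradMul (half_pos hτ) l).mul h (by positivity) using 1
  ext k
  have e := lerayMul_add (half_pos hτ) (half_pos hτ) j i k
  rw [add_halves] at e
  rw [convMat, e, gradMul]
  ring

/-- Bounds of the smoothing operators, with an integrable singularity at the initial time. -/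
lemma exists_smoothing_bound {γ T : ℝ} (hγ : 0 ≤ γ) (hγ1 : γ < 1) (hT : 0 < T) :
    ∃ C : ℝ, 0 ≤ C ∧ ∀ τ, 0 < τ → τ ≤ T →
      IsMatrixMultiplier (d := d) (lerayMul τ) (C * τ ^ (-((3 + γ) / 4))) ∧
      IsMatrixMultiplier (d := d) (besselMat γ (lerayMul τ)) (C * τ ^ (-((3 + γ) / 4))) ∧
      (∀ l, IsMatrixMultiplier (d := d) (convMat τ l) (C * τ ^ (-((3 + γ) / 4)))) ∧
      ∀ l, IsMatrixMultiplier (d := d) (besselMat γ (convMat τ l)) (C * τ ^ (-((3 + γ) / 4))) := by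
  -- ε is the loss of the projector, a > γ/2 the cost of the Bessel multiplier and 1/2 the cost of
  -- the derivative. They are tuned so that a + 1/2 + ε = κ, which is below 1 exactly because γ < 1.
  set ε : ℝ := (1 - γ) / 8 with hε
  set a : ℝ := γ / 2 + (1 - γ) / 8 with ha
  set κ : ℝ := (3 + γ) / 4 with hκ
  have hκ0 : 0 ≤ κ := by rw [hκ]; linarith
  obtain ⟨C₁, hC₁, h₁⟩ := isMultiplier_lerayMul (d := d) hT (by linarith : 0 < ε) (by linarith)
  obtain ⟨C₂, hC₂, h₂⟩ := isMultiplier_bessel_heatMul (d := d) (γ := γ) (a := a) hγ (by linarith)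
    (by linarith) hT
  have hpi := Real.pi_pos
  -- the four constants
  set D₁ := C₁ * T ^ (κ - ε) with hD₁
  set D₂ := C₂ * C₁ * (2 ^ κ * T ^ (κ - (a + ε))) with hD₂
  set D₃ := 4 * Real.pi * C₁ * (2 ^ κ * T ^ (κ - (1 / 2 + ε))) with hD₃
  set D₄ := C₂ * (4 * Real.pi * C₁) * 4 ^ κ with hD₄
  have hD₁0 : 0 ≤ D₁ := by positivity
  have hD₂0 : 0 ≤ D₂ := by positivity
  have hD₃0 : 0 ≤ D₃ := by positivity
  have hD₄0 : 0 ≤ D₄ := by positivity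
  refine ⟨D₁ + D₂ + D₃ + D₄, by positivity, fun τ hτ hτT => ?_⟩
  have hτκ : 0 ≤ τ ^ (-κ) := Real.rpow_nonneg hτ.le _
  have mono : ∀ {D : ℝ}, D ≤ D₁ + D₂ + D₃ + D₄ →
      D * τ ^ (-κ) ≤ (D₁ + D₂ + D₃ + D₄) * τ ^ (-κ) := fun h => mul_le_mul_of_nonneg_right h hτκ
  have hτ2 : 0 < τ / 2 := half_pos hτ
  have half : ∀ b, b ≤ κ → (τ / 2) ^ (-b) ≤ 2 ^ κ * T ^ (κ - b) * τ ^ (-κ) := fun b hb => by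
    refine (rpow_neg_le_mul_rpow_neg (T := T) hτ2 (by linarith) hb).trans_eq ?_
    rw [Real.div_rpow hτ.le (by norm_num), Real.rpow_neg (by norm_num : (0:ℝ) ≤ 2), div_inv_eq_mul]
    ring
  refine ⟨⟨by positivity, fun j i => ?_, isHermitian_lerayMul τ⟩,
    ⟨by positivity, fun j i => ?_, fun j i => isHermitian_besselMat (isHermitian_lerayMul τ j i)⟩,
    fun l => ⟨by positivity, fun j i => ?_, isHermitian_convMat τ l⟩,
    fun l => ⟨by positivity, fun j i => ?_,
      fun j i => isHermitian_besselMat (isHermitian_convMat τ l j i)⟩⟩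
  · refine ((h₁ τ hτ hτT j i).mono ?_).mono (mono (by linarith : D₁ ≤ _))
    rw [hD₁, mul_assoc]
    exact mul_le_mul_of_nonneg_left (rpow_neg_le_mul_rpow_neg hτ hτT (by linarith)) hC₁
  · have h := (h₂ (τ / 2) hτ2 (by linarith)).mul (h₁ (τ / 2) hτ2 (by linarith) j i)
      (by positivity)
    have e : (fun k : Fin d → ℤ => ((besselMul γ k * heatMul (τ / 2) k : ℝ) : ℂ) *
        lerayMul (τ / 2) j i k) = besselMat γ (lerayMul τ) j i := by
      ext k
      have e := lerayMul_add hτ2 hτ2 j i k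
      rw [add_halves] at e
      rw [besselMat, e]; push_cast; ring
    rw [e] at h
    refine (h.mono ?_).mono (mono (by linarith : D₂ ≤ _))
    have e2 : (τ / 2) ^ (-a) * (τ / 2) ^ (-ε) = (τ / 2) ^ (-(a + ε)) := by
      rw [← Real.rpow_add hτ2]; ring_nf
    calc _ = C₂ * C₁ * ((τ / 2) ^ (-a) * (τ / 2) ^ (-ε)) := by ring
      _ ≤ C₂ * C₁ * (2 ^ κ * T ^ (κ - (a + ε)) * τ ^ (-κ)) := by
        rw [e2]; exact mul_le_mul_of_nonneg_left (half _ (by linarith)) (by positivity)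
      _ = _ := by rw [hD₂]; ring
  · refine ((isMultiplier_convMat hτ l (h₁ (τ / 2) hτ2 (by linarith) j i)).mono ?_).mono
      (mono (by linarith : D₃ ≤ _))
    have e2 : (τ / 2) ^ (-(1 / 2) : ℝ) * (τ / 2) ^ (-ε) = (τ / 2) ^ (-(1 / 2 + ε)) := by
      rw [← Real.rpow_add hτ2]; ring_nf
    calc _ = 4 * Real.pi * C₁ * ((τ / 2) ^ (-(1 / 2) : ℝ) * (τ / 2) ^ (-ε)) := by ring
      _ ≤ 4 * Real.pi * C₁ * (2 ^ κ * T ^ (κ - (1 / 2 + ε)) * τ ^ (-κ)) := by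
        rw [e2]; exact mul_le_mul_of_nonneg_left (half _ (by linarith)) (by positivity)
      _ = _ := by rw [hD₃]; ring
  · have hτ4 : 0 < τ / 2 / 2 := half_pos hτ2
    -- Bessel multiplier, derivative and projector each use a quarter of the time. The last quarter
    -- goes to the heat contraction; all powers are then taken at τ/4, whence the factor 4^κ.
    have h := (h₂ (τ / 2 / 2) hτ4 (by linarith)).mul
      ((isMultiplier_convMat hτ2 l (h₁ (τ / 2 / 2) hτ4 (by linarith) j i))) (by positivity)
    have h' := h
    have e : ∀ k : Fin d → ℤ, ((besselMul γ k * heatMul (τ / 2 / 2) k : ℝ) : ℂ) *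
        convMat (τ / 2) l j i k = besselMat γ (convMat (τ / 2 / 2 + τ / 2) l) j i k := by
      intro k
      rw [besselMat, convMat, convMat, lerayMul_add hτ4 hτ2]; push_cast; ring
    -- split the remaining time
    have hrest : IsMultiplier (besselMat γ (convMat τ l) j i)
        (C₂ * (τ / 2 / 2) ^ (-a) *
          (4 * Real.pi * (τ / 2 / 2) ^ (-(1 / 2) : ℝ) * (C₁ * (τ / 2 / 2) ^ (-ε)))) := by
      have h3 := (isMultiplier_heatMul (d := d) (τ / 2 / 2)).mul h zero_le_one
      rw [one_mul] at h3
      convert h3 using 1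
      ext k
      have e3 : τ = τ / 2 / 2 + (τ / 2 / 2 + τ / 2) := by ring
      rw [e k, besselMat, besselMat, convMat, convMat]
      nth_rewrite 1 [e3]
      rw [lerayMul_add hτ4 (by positivity)]
      ring
    refine (hrest.mono ?_).mono (mono (by linarith : D₄ ≤ _))
    have e2 : (τ / 2 / 2) ^ (-a) * (τ / 2 / 2) ^ (-(1 / 2) : ℝ) * (τ / 2 / 2) ^ (-ε) =
        4 ^ κ * τ ^ (-κ) := by
      rw [← Real.rpow_add hτ4, ← Real.rpow_add hτ4]
      have e4 : -a + -(1 / 2) + -ε = -κ := by rw [ha, hε, hκ]; ring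
      have e5 : τ / 2 / 2 = τ / 4 := by ring
      rw [e4, e5, Real.div_rpow hτ.le (by norm_num), Real.rpow_neg (by norm_num : (0:ℝ) ≤ 4),
        div_inv_eq_mul, mul_comm]
    calc _ = C₂ * (4 * Real.pi * C₁) * ((τ / 2 / 2) ^ (-a) * (τ / 2 / 2) ^ (-(1 / 2) : ℝ) *
        (τ / 2 / 2) ^ (-ε)) := by ring
      _ ≤ _ := by rw [e2, hD₄]; exact le_of_eq (by ring)

lemma summable_norm_lerayMul (τ : ℝ) (j i : Fin d) :
    Summable fun k => ‖lerayMul τ j i k‖ := by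
  have h1 := ((isMatrixMultiplier_heatMat (d := d) τ).isMultiplier j i).1
  exact Summable.of_nonneg_of_le (fun _ => norm_nonneg _) (fun k => norm_sub_le _ _)
    (h1.add (summable_norm_rieszMul τ i j))

lemma norm_lerayMul_le (τ : ℝ) (j i : Fin d) (k : Fin d → ℤ) :
    ‖lerayMul τ j i k‖ ≤ 2 * heatMul τ k := by
  have h1 : ‖rieszMul τ i j k‖ ≤ heatMul τ k := by
    rw [rieszMul, Complex.norm_real, Real.norm_eq_abs, abs_mul, abs_of_nonneg (heatMul_nonneg τ k)]
    exact mul_le_of_le_one_left (heatMul_nonneg τ k) (abs_riesz_symbol_le i j k)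
  have h2 : ‖(if i = j then (heatMul τ k : ℂ) else 0)‖ ≤ heatMul τ k := by
    split_ifs
    · exact (norm_heatMul τ k).le
    · simpa using heatMul_nonneg τ k
  exact (norm_sub_le _ _).trans (by linarith)

lemma summable_norm_convMat (τ : ℝ) (l j i : Fin d) :
    Summable fun k => ‖convMat τ l j i k‖ := by
  refine Summable.of_nonneg_of_le (fun _ => norm_nonneg _) (fun k => ?_)
    ((summable_pow_mul_heatMul 1 τ).mul_left (2 * Real.pi * 2))
  rw [convMat, norm_mul]
  calc _ ≤ (2 * Real.pi) * (1 + freqSq k) ^ 1 * (2 * heatMul τ k) :=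
        mul_le_mul (norm_grad_symbol_le l k) (norm_lerayMul_le τ j i k) (norm_nonneg _)
          (by have := freqSq_nonneg k; have := Real.pi_pos; positivity)
    _ = _ := by ring

lemma measurable_lerayMul (j i : Fin d) (k : Fin d → ℤ) : Measurable fun τ => lerayMul τ j i k := by
  have h := measurable_heatMul k
  unfold lerayMul rieszMul
  split_ifs <;> fun_prop

lemma measurable_convMat (l j i : Fin d) (k : Fin d → ℤ) : Measurable fun τ => convMat τ l j i k :=
  (measurable_lerayMul j i k).const_mul _

lemma measurable_heatMat (j i : Fin d) (k : Fin d → ℤ) : Measurable fun τ => heatMat τ j i k := by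
  have h := measurable_heatMul k
  unfold heatMat
  split_ifs <;> fun_prop

lemma measurable_besselMat {γ : ℝ} {M : ℝ → Fin d → Fin d → (Fin d → ℤ) → ℂ} {j i : Fin d}
    {k : Fin d → ℤ} (h : Measurable fun τ => M τ j i k) :
    Measurable fun τ => besselMat γ (M τ) j i k :=
  h.const_mul _

/-- Bridge between `heat`, a series defined for arbitrary coefficients, and operators on continuous
fields: the smoothing factor makes the symbols `M` summable even when the distribution with
coefficients `c` is not a function. -/
lemma heat_eq_vecOp {τ : ℝ} (hτ : 0 < τ) {M : Fin d → Fin d → (Fin d → ℤ) → ℂ}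
    (hM : ∀ j i, Summable fun k => ‖M j i k‖) (f : C(Torus d, Vel d)) {c : Coeffs d}
    (hc : ∀ j k, heatMul τ k * c k j = ∑ i, M j i k * vecCoeff f k i) (x : Torus d) :
    heat τ c x = vecOp M f x := by
  ext j
  rw [vecOp_apply_eq_tsum hM]
  simp only [heat, ← hc, heatMul_of_pos hτ]

lemma heat_vecCoeff {τ : ℝ} (hτ : 0 < τ) (f : C(Torus d, Vel d)) (x : Torus d) :
    heat τ (vecCoeff f) x = vecOp (heatMat τ) f x :=
  heat_eq_vecOp hτ (fun j i => ((isMatrixMultiplier_heatMat τ).isMultiplier j i).1) f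
    (fun j k => by simp [heatMat]) x

/-- At k = 0 the projector is the identity, which agrees with the Riesz symbol 0/0 = 0; the two
cases of `leray` are thus a single formula. -/
lemma heatMul_mul_leray (τ : ℝ) (c : Coeffs d) (k : Fin d → ℤ) (j : Fin d) :
    heatMul τ k * leray c k j = ∑ i, lerayMul τ j i k * c k i := by
  simp only [lerayMul, sub_mul, Finset.sum_sub_distrib, ite_mul, zero_mul, Finset.sum_ite_eq',
    Finset.mem_univ, if_true]
  have h : leray c k j = c k j - ∑ i, (((k i : ℝ) * k j / freqSq k : ℝ) : ℂ) * c k i := by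
    by_cases hk : k = 0
    · simp [leray, hk]
    · simp only [leray, hk, if_false, Finset.sum_div, Finset.sum_mul]
      congr 1
      refine Finset.sum_congr rfl fun i _ => ?_
      push_cast; ring
  rw [h, mul_sub, Finset.mul_sum]
  congr 1
  refine Finset.sum_congr rfl fun i _ => ?_
  simp only [rieszMul]
  push_cast; ring

lemma heat_leray_vecCoeff {τ : ℝ} (hτ : 0 < τ) (f : C(Torus d, Vel d)) (x : Torus d) :
    heat τ (leray (vecCoeff f)) x = vecOp (lerayMul τ) f x :=
  heat_eq_vecOp hτ (summable_norm_lerayMul τ) f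
    (fun j k => heatMul_mul_leray τ _ k j) x

/-- The vector field `u_l w`. -/
def compSmul (l : Fin d) (u w : C(Torus d, Vel d)) : C(Torus d, Vel d) :=
  ⟨fun x => u x l • w x, by fun_prop⟩

@[simp] lemma compSmul_apply (l : Fin d) (u w : C(Torus d, Vel d)) (x : Torus d) :
    compSmul l u w x = u x l • w x := rfl

/-- The operator `(u, w) ↦ e^{τΔ} P ∑_l ∂_l (u_l w)`. -/
def convOp (τ : ℝ) (u w : C(Torus d, Vel d)) : C(Torus d, Vel d) :=
  ∑ l, vecOp (convMat τ l) (compSmul l u w)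

lemma heatMul_mul_leray_convection (τ : ℝ) (u w : C(Torus d, Vel d)) (k : Fin d → ℤ) (j : Fin d) :
    heatMul τ k * leray (convection u w) k j =
      ∑ l, ∑ i, convMat τ l j i k * vecCoeff (compSmul l u w) k i := by
  rw [heatMul_mul_leray]
  simp only [convection, Finset.mul_sum]
  rw [Finset.sum_comm]
  refine Finset.sum_congr rfl fun l _ => Finset.sum_congr rfl fun i _ => ?_
  simp only [convMat, vecCoeff, compSmul_apply, PiLp.smul_apply, smul_eq_mul]
  ring

lemma heat_leray_convection {τ : ℝ} (hτ : 0 < τ) (u w : C(Torus d, Vel d)) (x : Torus d) :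
    heat τ (leray (convection u w)) x = convOp τ u w x := by
  ext j
  simp only [convOp, ContinuousMap.coe_sum, Finset.sum_apply, WithLp.ofLp_sum]
  simp_rw [vecOp_apply_eq_tsum (summable_norm_convMat τ _)]
  rw [← Complex.re_sum, ← Summable.tsum_finsetSum fun l _ => Summable.of_norm (summable_mul_bdd
    (summable_sum_mul_coeff (summable_norm_convMat τ l) (compSmul l u w) j)
      fun k => (norm_mFourier_apply k x).le)]
  simp only [heat, ← Finset.sum_mul]
  congr 1
  refine tsum_congr fun k => ?_
  rw [← heatMul_mul_leray_convection, heatMul_of_pos hτ]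

/-! ### Lipschitz regularisation by the heat semigroup -/

/-- Fundamental theorem of calculus for the character along the segment r ↦ r y. -/
lemma mFourier_toTorus_sub_one (y : Vel d) (k : Fin d → ℤ) :
    mFourier k (toTorus y) - 1 = ∫ r in Ioc (0 : ℝ) 1,
      (∑ l, (y l : ℂ) * (2 * Real.pi * Complex.I * k l)) * mFourier k (toTorus (r • y)) := by
  set c : ℂ := ∑ l, (y l : ℂ) * (2 * Real.pi * Complex.I * k l) with hc
  have e : ∀ r : ℝ, mFourier k (toTorus (r • y)) = Complex.exp (r * c) := fun r => by
    rw [mFourier_toTorus]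
    congr 1
    push_cast
    rw [hc, Finset.mul_sum, Finset.mul_sum]
    refine Finset.sum_congr rfl fun l _ => ?_
    simp only [PiLp.smul_apply, smul_eq_mul]
    push_cast; ring
  have hd : ∀ r : ℝ, HasDerivAt (fun r : ℝ => Complex.exp (r * c)) (c * Complex.exp (r * c)) r :=
    fun r => by
      have := ((hasDerivAt_id (r : ℂ)).mul_const c).cexp.comp_ofReal
      exact this.congr_deriv (by simp [mul_comm])
  simp_rw [e]
  rw [← intervalIntegral.integral_of_le zero_le_one,
    intervalIntegral.integral_eq_sub_of_hasDerivAt (fun r _ => hd r)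
      (Continuous.intervalIntegrable (by fun_prop) _ _)]
  have := e 1
  rw [one_smul] at this
  rw [this]; simp

/-- The increment is an average over r of translates of the derivative of the heat operator along
`y`, and translating a multiplier does not change its bound. -/
lemma isMultiplier_heat_increment {τ : ℝ} (hτ : 0 < τ) (y : Vel d) :
    IsMultiplier (fun k => heatMul τ k * (mFourier k (toTorus y) - 1))
      (d * (4 * Real.pi * τ ^ (-(1 / 2) : ℝ)) * ‖y‖) := by
  have hcont : ∀ k : Fin d → ℤ, Continuous fun r : ℝ => mFourier k (toTorus (r • y)) := fun k =>
    (mFourier k).continuous.comp (continuous_toTorus.comp (by fun_prop))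
  set m : ℝ → (Fin d → ℤ) → ℂ := fun r k =>
    (∑ l, (y l : ℂ) * gradMul τ l k) * mFourier k (toTorus (r • y)) with hm
  set B := d * (4 * Real.pi * τ ^ (-(1 / 2) : ℝ)) * ‖y‖ with hB
  have hbase : IsMultiplier (fun k => ∑ l, (y l : ℂ) * gradMul τ l k) B := by
    refine (IsMultiplier.sum Finset.univ fun l _ =>
      (isMultiplier_gradMul hτ l).const_mul (y l : ℂ)).mono ?_
    refine (Finset.sum_le_card_nsmul _ _ (‖y‖ * (4 * Real.pi * τ ^ (-(1 / 2) : ℝ)))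
      fun l _ => ?_).trans_eq ?_
    · rw [Complex.norm_real, Real.norm_eq_abs]
      exact mul_le_mul_of_nonneg_right (norm_apply_le y l) (by positivity)
    · simp [hB]; ring
  have hmul : ∀ r, IsMultiplier (m r) B := fun r => hbase.translate _
  have h := IsMultiplier.integral (μ := volume.restrict (Ioc (0 : ℝ) 1)) (m := m)
    (C := fun _ => B) (fun k => ?_) ?_ (integrable_const _) (Eventually.of_forall hmul)
  · convert h using 1
    · ext k
      rw [mFourier_toTorus_sub_one, ← integral_const_mul]
      congr 1; ext r
      simp only [hm, gradMul]
      rw [← mul_assoc, Finset.mul_sum]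
      congr 1
      exact Finset.sum_congr rfl fun l _ => by ring
    · simp
  · exact ((Continuous.integrableOn_Icc (by fun_prop)).mono_set Ioc_subset_Icc_self)
  · refine hbase.1.congr fun k => ?_
    simp [hm, norm_mFourier_apply]

lemma isLip_heat {τ : ℝ} (hτ : 0 < τ) (f : C(Torus d, Vel d)) :
    IsLip ((d : ℝ) ^ 2 * (d * (4 * Real.pi * τ ^ (-(1 / 2) : ℝ))) * ‖f‖) (vecOp (heatMat τ) f) := by
  rw [isLip_iff_translate (by positivity)]
  intro y
  set M : Fin d → Fin d → (Fin d → ℤ) → ℂ := fun j i k =>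
    heatMat τ j i k * (mFourier k (toTorus y) - 1) with hM
  have hs := fun j i => ((isMatrixMultiplier_heatMat (d := d) τ).isMultiplier j i).1
  have hMm : ∀ j i, IsMultiplier (M j i) (d * (4 * Real.pi * τ ^ (-(1 / 2) : ℝ)) * ‖y‖) := by
    intro j i
    by_cases h : i = j
    · simpa only [hM, heatMat, h, if_true] using isMultiplier_heat_increment hτ y
    · simpa only [hM, heatMat, h, if_false, zero_mul] using isMultiplier_zero.mono (by positivity)
  have e : translate (toTorus y) (vecOp (heatMat τ) f) - vecOp (heatMat τ) f = vecOp M f := by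
    ext x j
    simp only [ContinuousMap.coe_sub, Pi.sub_apply, translate_apply, PiLp.sub_apply, vecOp_apply]
    rw [← Finset.sum_sub_distrib]
    refine Finset.sum_congr rfl fun i _ => ?_
    rw [← Complex.sub_re, mulOp_apply (hs j i), mulOp_apply (hs j i), mulOp_apply (hMm j i).1,
      ← (summable_mul_coeff_mul (hs j i) _ _).tsum_sub (summable_mul_coeff_mul (hs j i) _ _)]
    congr 1
    refine tsum_congr fun k => ?_
    rw [mFourier_apply_add]; simp only [hM]; ring
  rw [e]
  refine (norm_vecOp_le (by positivity) hMm f).trans_eq (by ring)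

/-! ### The heat semigroup on `L^p` -/

lemma integrable_of_continuous {E : Type*} [NormedAddCommGroup E] {f : Torus d → E}
    (hf : Continuous f) : Integrable f (torusMeasure d) :=
  integrable_continuousMap ⟨f, hf⟩

lemma integrable_component {g : Torus d → Vel d} (hg : Integrable g (torusMeasure d)) (j : Fin d) :
    Integrable (fun x => ((g x j : ℝ) : ℂ)) (torusMeasure d) :=
  ((EuclideanSpace.proj j : Vel d →L[ℝ] ℝ).integrable_comp hg).ofReal

lemma integrable_heatKernel_smul {τ : ℝ} (hτ : 0 < τ) {g : Torus d → Vel d}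
    (hg : Integrable g (torusMeasure d)) (x : Torus d) :
    Integrable (fun y => heatKernel τ (x - y) • g y) (torusMeasure d) := by
  have hc : Continuous fun y : Torus d => heatKernel τ (x - y) :=
    (continuous_heatKernel hτ).comp (by fun_prop)
  refine hg.bdd_smul (heatKernel τ (0 : Torus d)) hc.aestronglyMeasurable
    (Eventually.of_forall fun y => ?_)
  rw [Real.norm_eq_abs, abs_of_nonneg (heatKernel_nonneg hτ _)]
  exact heatKernel_le_zero hτ _

lemma tsum_heatMul_vecCoeff {τ : ℝ} (hτ : 0 < τ) {g : Torus d → Vel d}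
    (hg : Integrable g (torusMeasure d)) (x : Torus d) (j : Fin d) :
    ∑' k, (heatMul τ k : ℂ) * vecCoeff g k j * mFourier k x =
      (((∫ y, heatKernel τ (x - y) • g y ∂torusMeasure d) j : ℝ) : ℂ) := by
  change ∑' k, (heatMul τ k : ℂ) * mFourierCoeff (fun x => ((g x j : ℝ) : ℂ)) k * mFourier k x = _
  rw [← integral_series_mul ((isMultiplier_heatMul τ).1) (integrable_component hg j) x]
  have h := (EuclideanSpace.proj j : Vel d →L[ℝ] ℝ).integral_comp_comm
    (integrable_heatKernel_smul hτ hg x)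
  have h' : (∫ y, heatKernel τ (x - y) • g y ∂torusMeasure d) j =
      ∫ y, heatKernel τ (x - y) * g y j ∂torusMeasure d := h.symm
  rw [h', ← integral_complex_ofReal]
  refine integral_congr_ae (Eventually.of_forall fun y => ?_)
  simp only [(hasSum_heatKernel hτ (x - y)).tsum_eq, Complex.ofReal_mul]

lemma heat_eq_integral {τ : ℝ} (hτ : 0 < τ) {g : Torus d → Vel d}
    (hg : Integrable g (torusMeasure d)) (x : Torus d) :
    heat τ (vecCoeff g) x = ∫ y, heatKernel τ (x - y) • g y ∂torusMeasure d := by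
  ext j
  have h := tsum_heatMul_vecCoeff hτ hg x j
  simp only [heat]
  simp_rw [← heatMul_of_pos hτ, h, Complex.ofReal_re]

/-- Jensen's inequality for the probability measure of density `heatKernel τ (x - ·)`. -/
lemma enorm_heat_rpow_le {τ p : ℝ} (hτ : 0 < τ) (hp : 1 ≤ p) {g : Torus d → Vel d}
    (hgm : StronglyMeasurable g) (hg : MemLp g (ENNReal.ofReal p) (torusMeasure d)) (x : Torus d) :
    ‖heat τ (vecCoeff g) x‖ₑ ^ p ≤
      ∫⁻ y, ENNReal.ofReal (heatKernel τ (x - y)) * ‖g y‖ₑ ^ p ∂torusMeasure d := by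
  have hp0 : 0 < p := by linarith
  have hint : Integrable g (torusMeasure d) := hg.integrable (by simpa using hp)
  have hc : Continuous fun y : Torus d => heatKernel τ (x - y) :=
    (continuous_heatKernel hτ).comp (by fun_prop)
  have hm : Measurable fun y : Torus d => ENNReal.ofReal (heatKernel τ (x - y)) :=
    hc.measurable.ennreal_ofReal
  set ν := (torusMeasure d).withDensity fun y => ENNReal.ofReal (heatKernel τ (x - y)) with hν
  have hprob : IsProbabilityMeasure ν := by
    refine ⟨?_⟩
    rw [hν, withDensity_apply _ MeasurableSet.univ, Measure.restrict_univ,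
      ← ofReal_integral_eq_lintegral_ofReal (integrable_of_continuous hc)
        (Eventually.of_forall fun y => heatKernel_nonneg hτ _),
      integral_sub_left_eq_self (fun y : Torus d => heatKernel τ y), integral_heatKernel hτ]
    simp
  have h1 : ‖heat τ (vecCoeff g) x‖ₑ ≤ eLpNorm g 1 ν := by
    rw [heat_eq_integral hτ hint, eLpNorm_one_eq_lintegral_enorm, hν,
      lintegral_withDensity_eq_lintegral_mul _ hm hgm.enorm]
    refine (enorm_integral_le_lintegral_enorm _).trans_eq ?_
    refine lintegral_congr fun y => ?_
    rw [enorm_smul, Real.enorm_of_nonneg (heatKernel_nonneg hτ _)]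
    rfl
  have h2 : eLpNorm g 1 ν ≤ eLpNorm g (ENNReal.ofReal p) ν :=
    eLpNorm_le_eLpNorm_of_exponent_le (by simpa using hp) hgm.aestronglyMeasurable
  have h3 : eLpNorm g (ENNReal.ofReal p) ν ^ p = ∫⁻ y, ENNReal.ofReal (heatKernel τ (x - y)) *
      ‖g y‖ₑ ^ p ∂torusMeasure d := by
    rw [eLpNorm_eq_lintegral_rpow_enorm_toReal (by simpa using hp0) ENNReal.ofReal_ne_top,
      ENNReal.toReal_ofReal hp0.le, one_div, ENNReal.rpow_inv_rpow hp0.ne', hν,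
      lintegral_withDensity_eq_lintegral_mul _ hm (hgm.enorm.pow_const p)]
    rfl
  rw [← h3]
  exact ENNReal.rpow_le_rpow (h1.trans h2) hp0.le

lemma eLpNorm_rpow_eq {p : ℝ} (hp : 0 < p) (g : Torus d → Vel d) :
    eLpNorm g (ENNReal.ofReal p) (torusMeasure d) ^ p = ∫⁻ y, ‖g y‖ₑ ^ p ∂torusMeasure d := by
  rw [eLpNorm_eq_lintegral_rpow_enorm_toReal (by simpa using hp) ENNReal.ofReal_ne_top,
    ENNReal.toReal_ofReal hp.le, one_div, ENNReal.rpow_inv_rpow hp.ne']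

lemma vecCoeff_congr_ae {f g : Torus d → Vel d} (h : f =ᵐ[torusMeasure d] g) :
    vecCoeff f = vecCoeff g := by
  ext k j
  exact integral_congr_ae (h.mono fun x hx => by simp [hx])

/-- Integrate the pointwise Jensen bound in x and exchange the integrals; the kernel has mass one in
x too. -/
lemma eLpNorm_heat_le {τ p : ℝ} (hτ : 0 < τ) (hp : 1 ≤ p) {g : Torus d → Vel d}
    (hg : MemLp g (ENNReal.ofReal p) (torusMeasure d)) :
    eLpNorm (heat τ (vecCoeff g)) (ENNReal.ofReal p) (torusMeasure d) ≤
      eLpNorm g (ENNReal.ofReal p) (torusMeasure d) := by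
  have hp0 : 0 < p := by linarith
  obtain ⟨g', hg'm, hgg'⟩ := hg.1
  rw [vecCoeff_congr_ae hgg', eLpNorm_congr_ae hgg']
  have hg' : MemLp g' (ENNReal.ofReal p) (torusMeasure d) := hg.ae_eq hgg'
  rw [← ENNReal.rpow_le_rpow_iff hp0, eLpNorm_rpow_eq hp0, eLpNorm_rpow_eq hp0]
  refine (lintegral_mono fun x => enorm_heat_rpow_le hτ hp hg'm hg' x).trans ?_
  have hc : Continuous fun z : Torus d × Torus d => heatKernel τ (z.1 - z.2) :=
    (continuous_heatKernel hτ).comp (by fun_prop)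
  rw [lintegral_lintegral_swap]
  · refine lintegral_mono fun y => ?_
    have hy : Continuous fun x : Torus d => heatKernel τ (x - y) :=
      (continuous_heatKernel hτ).comp (by fun_prop)
    rw [lintegral_mul_const _ hy.measurable.ennreal_ofReal, ← ofReal_integral_eq_lintegral_ofReal
      (integrable_of_continuous hy)
      (Eventually.of_forall fun x => heatKernel_nonneg hτ _),
      integral_sub_right_eq_self (fun x : Torus d => heatKernel τ x), integral_heatKernel hτ]
    simp
  · exact (hc.measurable.ennreal_ofReal.mul
      ((hg'm.enorm.pow_const p).comp measurable_snd)).aemeasurable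

/-- The L^p to L^∞ smoothing: in the Jensen bound the kernel is replaced by its maximum, leaving
K^(1/p). -/
lemma heat_enorm_le {τ p K : ℝ} (hτ : 0 < τ) (hp : 1 ≤ p) {g : Torus d → Vel d}
    (hg : MemLp g (ENNReal.ofReal p) (torusMeasure d)) (hK : ∀ x : Torus d, heatKernel τ x ≤ K)
    (x : Torus d) : ‖heat τ (vecCoeff g) x‖ ≤
      K ^ (1 / p) * (eLpNorm g (ENNReal.ofReal p) (torusMeasure d)).toReal := by
  have hp0 : 0 < p := by linarith
  have hK0 : 0 ≤ K := (heatKernel_nonneg hτ x).trans (hK x)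
  obtain ⟨g', hg'm, hgg'⟩ := hg.1
  have hfin := hg.2.ne
  rw [vecCoeff_congr_ae hgg']
  rw [eLpNorm_congr_ae hgg'] at hfin ⊢
  have hg' : MemLp g' (ENNReal.ofReal p) (torusMeasure d) := hg.ae_eq hgg'
  have h : ‖heat τ (vecCoeff g') x‖ₑ ^ p ≤ ENNReal.ofReal K *
      eLpNorm g' (ENNReal.ofReal p) (torusMeasure d) ^ p := by
    refine (enorm_heat_rpow_le hτ hp hg'm hg' x).trans ?_
    rw [eLpNorm_rpow_eq hp0, ← lintegral_const_mul _ (hg'm.enorm.pow_const p)]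
    exact lintegral_mono fun y => mul_le_mul_left (ENNReal.ofReal_le_ofReal (hK _)) _
  have h2 : ‖heat τ (vecCoeff g') x‖ₑ ≤ ENNReal.ofReal (K ^ (1 / p)) *
      eLpNorm g' (ENNReal.ofReal p) (torusMeasure d) := by
    rw [← ENNReal.rpow_le_rpow_iff hp0, ENNReal.mul_rpow_of_nonneg _ _ hp0.le,
      ENNReal.ofReal_rpow_of_nonneg (by positivity) hp0.le, ← Real.rpow_mul hK0, one_div,
      inv_mul_cancel₀ hp0.ne', Real.rpow_one]
    exact h
  have h3 := ENNReal.toReal_mono (ENNReal.mul_ne_top ENNReal.ofReal_ne_top hfin) h2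
  rwa [ENNReal.toReal_mul, ENNReal.toReal_ofReal (by positivity), toReal_enorm] at h3

/-! ### Continuity of the heat semigroup at the initial time -/

lemma mulOp_add {m : (Fin d → ℤ) → ℂ} (hm : Summable fun k => ‖m k‖) (f g : C(Torus d, ℂ)) :
    mulOp m (f + g) = mulOp m f + mulOp m g := by
  have h0 : mulOp m (-g) = -mulOp m g := by
    have h := mulOp_sub hm 0 g
    have h' := mulOp_sub hm (0 : C(Torus d, ℂ)) 0
    rw [sub_self, sub_self] at h'
    rwa [zero_sub, h', zero_sub] at h
  rw [← sub_neg_eq_add, mulOp_sub hm, h0, sub_neg_eq_add]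

lemma mulOp_mFourier (m : (Fin d → ℤ) → ℂ) (k : Fin d → ℤ) :
    mulOp m (mFourier k) = m k • (mFourier k : C(Torus d, ℂ)) := by
  rw [mulOp, tsum_eq_single k]
  · simp [coeff_mFourier]
  · intro l hl
    simp only [coeff_mFourier, hl, if_false, mul_zero]
    exact zero_smul ℂ (mFourier l : C(Torus d, ℂ))

lemma mulOp_smul (m : (Fin d → ℤ) → ℂ) (c : ℂ) (f : C(Torus d, ℂ)) :
    mulOp m (c • f) = c • mulOp m f := by
  simp only [mulOp]
  rw [← tsum_const_smul'']
  refine tsum_congr fun k => ?_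
  rw [smul_smul, ← coeffCLM_apply, ← coeffCLM_apply, map_smul, smul_eq_mul]
  congr 1
  ring

lemma tendsto_heat_of_mem_span {q : C(Torus d, ℂ)}
    (hq : q ∈ Submodule.span ℂ (range (mFourier (d := Fin d)))) :
    Tendsto (fun ε : ℝ => mulOp (fun k => (heatMul ε k : ℂ)) q) (𝓝[>] 0) (𝓝 q) := by
  have hs : ∀ ε : ℝ, Summable fun k : Fin d → ℤ => ‖(heatMul ε k : ℂ)‖ :=
    fun ε => (isMultiplier_heatMul ε).1
  induction hq using Submodule.span_induction with
  | mem q hq =>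
    obtain ⟨k, rfl⟩ := hq
    simp_rw [mulOp_mFourier]
    have h : Tendsto (fun ε : ℝ => (heatMul ε k : ℂ)) (𝓝[>] 0) (𝓝 1) := by
      have h1 : Tendsto (fun ε : ℝ => ((Real.exp (-(4 * Real.pi ^ 2 * freqSq k * ε)) : ℝ) : ℂ))
          (𝓝[>] 0) (𝓝 1) := by
        have hc : Continuous fun ε : ℝ =>
          ((Real.exp (-(4 * Real.pi ^ 2 * freqSq k * ε)) : ℝ) : ℂ) := by fun_prop
        have := hc.tendsto 0
        simp only [mul_zero, neg_zero, Real.exp_zero, Complex.ofReal_one] at this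
        exact this.mono_left nhdsWithin_le_nhds
      refine h1.congr' ?_
      filter_upwards [self_mem_nhdsWithin] with ε hε
      rw [heatMul_of_pos hε]
    simpa using h.smul_const (mFourier k : C(Torus d, ℂ))
  | zero =>
    have : ∀ ε : ℝ, mulOp (fun k => (heatMul ε k : ℂ)) (0 : C(Torus d, ℂ)) = 0 := fun ε => by
      simpa using mulOp_sub (hs ε) (0 : C(Torus d, ℂ)) 0
    simp_rw [this]
    exact tendsto_const_nhds
  | add f g _ _ hf hg =>
    simp_rw [fun ε => mulOp_add (hs ε) f g]
    exact hf.add hg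
  | smul c f _ hf =>
    simp_rw [mulOp_smul]
    exact hf.const_smul c

/-- e^(εΔ) tends to the identity on trigonometric polynomials, and by contraction and density it is
close to the identity on `f`. This removes a mollification from a uniform bound. -/
lemma norm_le_of_heat_le {f : C(Torus d, ℂ)} {M : ℝ}
    (h : ∀ ε : ℝ, 0 < ε → ‖mulOp (fun k => (heatMul ε k : ℂ)) f‖ ≤ M) : ‖f‖ ≤ M := by
  refine le_of_forall_pos_le_add fun δ hδ => ?_
  have hf : f ∈ (Submodule.span ℂ (range (mFourier (d := Fin d)))).topologicalClosure := by
    rw [span_mFourier_closure_eq_top]; trivial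
  obtain ⟨q, hq, hfq⟩ := Metric.mem_closure_iff.1 hf (δ / 3) (by positivity)
  have hT := tendsto_heat_of_mem_span hq
  have hev := (Metric.tendsto_nhds.1 hT (δ / 3) (by positivity)).and self_mem_nhdsWithin
  obtain ⟨ε, hε, hε0⟩ := hev.exists
  set H : C(Torus d, ℂ) → C(Torus d, ℂ) := mulOp (fun k => (heatMul ε k : ℂ)) with hH
  have h1 : ‖H q - H f‖ ≤ δ / 3 := by
    rw [hH, ← mulOp_sub (isMultiplier_heatMul ε).1]
    refine ((isMultiplier_heatMul ε).norm_mulOp_le _).trans ?_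
    rw [one_mul, ← dist_eq_norm, dist_comm]; exact hfq.le
  have h2 : ‖f - q‖ ≤ δ / 3 := by rw [← dist_eq_norm]; exact hfq.le
  have h3 : ‖q - H q‖ ≤ δ / 3 := by rw [← dist_eq_norm, dist_comm]; exact hε.le
  have h4 := h ε hε0
  have e : f = (f - q) + ((q - H q) + ((H q - H f) + H f)) := by abel
  rw [e]
  have := norm_add_le (f - q) ((q - H q) + ((H q - H f) + H f))
  have := norm_add_le (q - H q) ((H q - H f) + H f)
  have := norm_add_le (H q - H f) (H f)
  linarith

/-! ### Bessel potentials -/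

/-- The Sobolev embedding `H^γ_p ⊂ C` for `γ > d/p`. -/
lemma exists_norm_le_bessel {p γ : ℝ} (hp : (d : ℝ) < p) (hp1 : 1 ≤ p)
    (hγ : γ ∈ Set.Ioo ((d : ℝ) / p) 1) :
    ∃ K : ℝ, 0 ≤ K ∧ ∀ (f : C(Torus d, Vel d)) (g : Torus d → Vel d),
      IsBesselPotential γ p f g →
        ‖f‖ ≤ K * (eLpNorm g (ENNReal.ofReal p) (torusMeasure d)).toReal := by
  have hp0 : 0 < p := by linarith
  have hγ0 : 0 < γ := lt_of_le_of_lt (by positivity) hγ.1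
  obtain ⟨C, hC, hker⟩ := heatKernel_le (d := d)
  -- The heat kernel maps L^p to L^∞ with norm O(1 + s^(-b)). The condition γ > d/p says b < γ/2,
  -- which makes r^(γ/2 - b - 1) integrable at 0.
  set b : ℝ := d / 2 / p with hb
  have hbγ : b < γ / 2 := by
    have := hγ.1
    rw [hb]
    have e : (d : ℝ) / 2 / p = d / p / 2 := by ring
    rw [e]; linarith
  have hb0 : 0 ≤ b := by positivity
  set G := Real.Gamma (γ / 2) with hGdef
  have hG : 0 < G := Real.Gamma_pos_of_pos (by linarith)
  have hI1 := Real.GammaIntegral_convergent (s := γ / 2) (by linarith)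
  have hI2 := Real.GammaIntegral_convergent (s := γ / 2 - b) (by linarith)
  set c : ℝ := (4 * Real.pi ^ 2) ^ b with hc
  set Cp : ℝ := C ^ (1 / p) with hCp
  have hCp0 : 0 ≤ Cp := by positivity
  set J : ℝ := ∫ r in Ioi (0 : ℝ), (Cp * (Real.exp (-r) * r ^ (γ / 2 - 1)) +
    Cp * c * (Real.exp (-r) * r ^ (γ / 2 - b - 1))) with hJ
  have hJ0 : 0 ≤ J := by
    refine setIntegral_nonneg measurableSet_Ioi fun r hr => ?_
    have : (0 : ℝ) < r := hr
    positivity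
  -- pointwise bound for the smoothed potential
  have hheat : ∀ (g : Torus d → Vel d), MemLp g (ENNReal.ofReal p) (torusMeasure d) →
      ∀ s r : ℝ, 0 < r → r / (4 * Real.pi ^ 2) ≤ s → ∀ x, ‖heat s (vecCoeff g) x‖ ≤
        (Cp + Cp * c * r ^ (-b)) * (eLpNorm g (ENNReal.ofReal p) (torusMeasure d)).toReal := by
    intro g hg s r hr hs x
    have hr1 : 0 < r / (4 * Real.pi ^ 2) := by positivity
    have hs0 : 0 < s := hr1.trans_le hs
    refine (heat_enorm_le hs0 hp1 hg (hker s hs0) x).trans ?_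
    refine mul_le_mul_of_nonneg_right ?_ ENNReal.toReal_nonneg
    rw [Real.mul_rpow hC.le (by positivity), mul_assoc, ← hCp]
    have h1 : (1 + s ^ (-(d : ℝ) / 2)) ^ (1 / p) ≤ 1 + c * r ^ (-b) := by
      refine (Real.rpow_add_le_add_rpow zero_le_one (by positivity) (by positivity)
        ((div_le_one hp0).2 hp1)).trans ?_
      rw [Real.one_rpow, ← Real.rpow_mul hs0.le]
      have e : -(d : ℝ) / 2 * (1 / p) = -b := by rw [hb]; ring
      rw [e]
      refine add_le_add_right ((rpow_neg_le_of_le hr1 hs hb0).trans_eq ?_) _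
      rw [Real.div_rpow hr.le (by positivity), Real.rpow_neg (by positivity : 0 ≤ 4 * Real.pi ^ 2),
        div_inv_eq_mul, mul_comm]
    calc _ ≤ Cp * (1 + c * r ^ (-b)) := mul_le_mul_of_nonneg_left h1 hCp0
      _ = _ := by ring
  refine ⟨d * (G⁻¹ * J), by positivity, fun f g hfg => ?_⟩
  set E := (eLpNorm g (ENNReal.ofReal p) (torusMeasure d)).toReal with hE
  have hE0 : 0 ≤ E := ENNReal.toReal_nonneg
  have hgint : Integrable g (torusMeasure d) := hfg.1.integrable (by simpa using hp1)
  have hcomp : ∀ j, ‖ccomp j f‖ ≤ G⁻¹ * J * E := fun j => by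
    -- The Fourier series of `f` need not converge absolutely. After smoothing by e^(εΔ) the sum and
    -- the Gamma integral may be exchanged, and the resulting bound does not depend on ε.
    refine norm_le_of_heat_le fun ε hε => ?_
    refine (ContinuousMap.norm_le_of_nonempty _).2 fun x => ?_
    rw [mulOp_apply (isMultiplier_heatMul ε).1]
    have hcoef : ∀ k : Fin d → ℤ, mFourierCoeff (ccomp j f) k =
        (((1 + freqSq k) ^ (-(γ / 2)) : ℝ) : ℂ) * vecCoeff g k j := fun k => by
      rw [hfg.2 k j, ← mul_assoc, ← Complex.ofReal_mul, ← Real.rpow_add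
        (by linarith [freqSq_nonneg k])]
      simp
      rfl
    -- Gamma representation of the negative power: f is a superposition over r of e^(-r) r^(γ/2-1)
    -- times the heat flow of g at time r/4π².
    have hgam : ∀ k : Fin d → ℤ, (1 + freqSq k) ^ (-(γ / 2)) = G⁻¹ * ∫ r in Ioi (0 : ℝ),
        r ^ (γ / 2 - 1) * Real.exp (-((1 + freqSq k) * r)) := fun k => by
      have hk : 0 < 1 + freqSq k := by linarith [freqSq_nonneg k]
      rw [Real.integral_rpow_mul_exp_neg_mul_Ioi (by linarith) hk, one_div, Real.inv_rpow hk.le,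
        ← Real.rpow_neg hk.le, ← hGdef]
      field_simp
    set a : ℝ → (Fin d → ℤ) → ℂ := fun r k =>
      ((r ^ (γ / 2 - 1) * Real.exp (-((1 + freqSq k) * r)) * heatMul ε k : ℝ) : ℂ) *
        vecCoeff g k j * mFourier k x with ha
    have hterm : ∀ k, (heatMul ε k : ℂ) * mFourierCoeff (ccomp j f) k * mFourier k x =
        (G⁻¹ : ℝ) * ∫ r in Ioi (0 : ℝ), a r k := fun k => by
      simp only [ha]
      rw [hcoef, hgam, integral_mul_const, integral_mul_const, integral_complex_ofReal,
        integral_mul_const]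
      push_cast
      ring
    simp_rw [hterm]
    rw [tsum_mul_left, norm_mul, Complex.norm_real, Real.norm_eq_abs,
      abs_of_pos (inv_pos.2 hG), mul_assoc]
    refine mul_le_mul_of_nonneg_left ?_ (inv_pos.2 hG).le
    rw [hJ, ← integral_mul_const]
    have hreal : ∀ k : Fin d → ℤ, IntegrableOn (fun r : ℝ =>
        r ^ (γ / 2 - 1) * Real.exp (-((1 + freqSq k) * r)) * heatMul ε k) (Ioi 0) := fun k => by
      have hk : 0 < 1 + freqSq k := by linarith [freqSq_nonneg k]
      have h := integrableOn_rpow_mul_exp_neg_mul_rpow (p := 1) (s := γ / 2 - 1)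
        (by linarith) one_pos hk
      refine ((h.congr_fun (fun r _ => ?_) measurableSet_Ioi).mul_const _)
      simp only [Real.rpow_one]
      ring_nf
    refine norm_tsum_integral_le (fun k => ((hreal k).ofReal.mul_const _).mul_const _) ?_
      (((hI1.const_mul _).add (hI2.const_mul _)).mul_const _) ?_
    · refine ((summable_heatMul (d := d) ε).mul_left
        (G * ∫ y, ‖((g y j : ℝ) : ℂ)‖ ∂torusMeasure d)).of_nonneg_of_le
        (fun k => by positivity) fun k => ?_
      have hk := freqSq_nonneg k
      simp only [ha, norm_mul, norm_mFourier_apply, mul_one]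
      rw [integral_mul_const]
      have e : ∫ r in Ioi (0 : ℝ), ‖((r ^ (γ / 2 - 1) * Real.exp (-((1 + freqSq k) * r)) *
          heatMul ε k : ℝ) : ℂ)‖ = G * (1 + freqSq k) ^ (-(γ / 2)) * heatMul ε k := by
        rw [hgam, mul_inv_cancel_left₀ hG.ne', ← integral_mul_const]
        refine setIntegral_congr_fun measurableSet_Ioi fun r hr => ?_
        have hr' : (0 : ℝ) < r := hr
        have := heatMul_nonneg ε k
        simp only [Complex.norm_real, Real.norm_eq_abs]
        exact abs_of_nonneg (by positivity)
      rw [e]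
      have h1 : (1 + freqSq k) ^ (-(γ / 2)) ≤ 1 :=
        Real.rpow_le_one_of_one_le_of_nonpos (by linarith) (by linarith)
      have h2 : ‖vecCoeff g k j‖ ≤ ∫ y, ‖((g y j : ℝ) : ℂ)‖ ∂torusMeasure d := norm_coeff_le k
      have h3 := heatMul_nonneg ε k
      calc G * (1 + freqSq k) ^ (-(γ / 2)) * heatMul ε k * ‖vecCoeff g k j‖
          ≤ G * 1 * heatMul ε k * ∫ y, ‖((g y j : ℝ) : ℂ)‖ ∂torusMeasure d := by gcongr
        _ = _ := by ring
    · refine (ae_restrict_mem measurableSet_Ioi).mono fun r hr => ?_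
      have hr' : (0 : ℝ) < r := hr
      have hr1 : 0 < r / (4 * Real.pi ^ 2) := by positivity
      set s := r / (4 * Real.pi ^ 2) + ε with hs
      have hs0 : 0 < s := by positivity
      have e : ∀ k, a r k = ((r ^ (γ / 2 - 1) * Real.exp (-r) : ℝ) : ℂ) *
          ((heatMul s k : ℂ) * vecCoeff g k j * mFourier k x) := fun k => by
        have := exp_mul_heatMul hr' hε k
        simp only [ha]
        rw [mul_assoc (r ^ _), this, ← hs]
        push_cast; ring
      simp_rw [e]
      rw [tsum_mul_left, tsum_heatMul_vecCoeff hs0 hgint, norm_mul, Complex.norm_real,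
        Real.norm_eq_abs, abs_of_pos (by positivity), Complex.norm_real, Real.norm_eq_abs,
        ← heat_eq_integral hs0 hgint]
      refine (mul_le_mul_of_nonneg_left ((norm_apply_le _ j).trans
        (hheat g hfg.1 s r hr' (by rw [hs]; linarith) x)) (by positivity)).trans_eq ?_
      have e3 : r ^ (γ / 2 - b - 1) = r ^ (γ / 2 - 1) * r ^ (-b) := by
        rw [← Real.rpow_add hr']; ring_nf
      rw [e3, ← hE]; ring
  refine (ContinuousMap.norm_le _ (by positivity)).2 fun x => ?_
  refine (norm_le_sum _).trans ?_
  refine (Finset.sum_le_card_nsmul _ _ (G⁻¹ * J * E) fun j _ => ?_).trans_eq (by simp; ring)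
  have := (ContinuousMap.norm_coe_le_norm (ccomp j f) x).trans (hcomp j)
  rwa [ccomp_apply, Complex.norm_real] at this

lemma exists_norm_le_of_besselNorm_le {p γ : ℝ} (hp : (d : ℝ) < p) (hp1 : 1 ≤ p)
    (hγ : γ ∈ Set.Ioo ((d : ℝ) / p) 1) (C : ℝ≥0) :
    ∃ M : ℝ, 0 ≤ M ∧ ∀ f : C(Torus d, Vel d), besselNorm γ p f ≤ C → ‖f‖ ≤ M := by
  obtain ⟨K, hK, h⟩ := exists_norm_le_bessel hp hp1 hγ
  -- The infimum in `besselNorm` is not assumed to be attained; C + 1 leaves room for an actual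
  -- potential.
  refine ⟨K * (C + 1), by positivity, fun f hf => ?_⟩
  have hlt : besselNorm γ p f < ((C + 1 : ℝ≥0) : ℝ≥0∞) :=
    hf.trans_lt (by exact_mod_cast lt_add_one C)
  simp only [besselNorm, iInf_lt_iff] at hlt
  obtain ⟨g, hg, hgC⟩ := hlt
  refine (h f g hg).trans (mul_le_mul_of_nonneg_left ?_ hK)
  have := ENNReal.toReal_mono ENNReal.coe_ne_top hgC.le
  exact this.trans_eq (by rw [ENNReal.coe_toReal]; push_cast; rfl)

/-! ### Bessel norms and divergence of the mild formula -/

lemma vecCoeff_heat {τ : ℝ} (hτ : 0 < τ) {g : Torus d → Vel d}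
    (hg : Integrable g (torusMeasure d)) (k : Fin d → ℤ) (j : Fin d) :
    vecCoeff (heat τ (vecCoeff g)) k j = heatMul τ k * vecCoeff g k j := by
  have hs : Summable fun k => ‖(heatMul τ k : ℂ) * vecCoeff g k j‖ :=
    summable_mul_bdd (isMultiplier_heatMul τ).1 fun k => norm_coeff_le k
  rw [← coeff_tsum hs k]
  change mFourierCoeff (fun x => ((heat τ (vecCoeff g) x j : ℝ) : ℂ)) k = _
  congr 1
  ext x
  rw [heat_eq_integral hτ hg, tsum_heatMul_vecCoeff hτ hg]

lemma continuous_heat {τ : ℝ} (hτ : 0 < τ) {g : Torus d → Vel d} :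
    Continuous (heat τ (vecCoeff g)) := by
  have hs : ∀ j, Summable fun k => ‖(heatMul τ k : ℂ) * vecCoeff g k j‖ := fun j =>
    summable_mul_bdd (isMultiplier_heatMul τ).1 fun k => norm_coeff_le k
  have h : heat τ (vecCoeff g) = ⇑(∑ j, reField j
      (∑' k, ((heatMul τ k : ℂ) * vecCoeff g k j) • (mFourier k : C(Torus d, ℂ)))) := by
    ext x i
    simp only [ContinuousMap.coe_sum, Finset.sum_apply, WithLp.ofLp_sum, reField_apply,
      Finset.sum_ite_eq, Finset.mem_univ, if_true, series_apply (hs _)]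
    simp only [heat, heatMul_of_pos hτ]
  rw [h]
  exact ContinuousMap.continuous _

lemma IsBesselPotential.heat {γ p t : ℝ} (hp : 1 ≤ p) (ht : 0 < t) {f : C(Torus d, Vel d)}
    {g : Torus d → Vel d} (h : IsBesselPotential γ p f g) :
    IsBesselPotential γ p (vecOp (heatMat t) f) (FluidParticle.heat t (vecCoeff g)) := by
  have hgint : Integrable g (torusMeasure d) := h.1.integrable (by simpa using hp)
  refine ⟨⟨(continuous_heat ht).aestronglyMeasurable,
    (eLpNorm_heat_le ht hp h.1).trans_lt h.1.2⟩, fun k j => ?_⟩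
  rw [vecCoeff_heat ht hgint, (isMatrixMultiplier_heatMat t).vecCoeff_vecOp, h.2]
  simp [heatMat]
  ring

/-- The `k`-th Fourier coefficient of the `j`-th component, as a continuous linear functional. -/
def vecCoeffCLM (k : Fin d → ℤ) (j : Fin d) : C(Torus d, Vel d) →L[ℝ] ℂ :=
  ((coeffCLM k).restrictScalars ℝ).comp (ccomp j)

lemma vecCoeffCLM_apply (k : Fin d → ℤ) (j : Fin d) (f : C(Torus d, Vel d)) :
    vecCoeffCLM k j f = vecCoeff f k j := rfl

lemma eLpNorm_continuousMap_le (p : ℝ) (B : C(Torus d, Vel d)) :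
    eLpNorm B (ENNReal.ofReal p) (torusMeasure d) ≤ ENNReal.ofReal ‖B‖ := by
  refine (eLpNorm_le_of_ae_bound (C := ‖B‖) (Eventually.of_forall B.norm_coe_le_norm)).trans ?_
  simp

/-- Shaped for the mild formula: `A` is the integral term and `B` its Bessel potential, whose L^p
norm is at most its sup norm on a probability space; the free evolution is handled by L^p
contraction. -/
lemma besselNorm_heat_sub_le {γ p t : ℝ} (hp : 1 ≤ p) (ht : 0 < t) {f A B : C(Torus d, Vel d)}
    {g : Torus d → Vel d} (h : IsBesselPotential γ p f g)
    (hB : ∀ k j, vecCoeff B k j = (besselMul γ k : ℂ) * vecCoeff A k j) :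
    besselNorm γ p (vecOp (heatMat t) f - A : C(Torus d, Vel d)) ≤
      eLpNorm g (ENNReal.ofReal p) (torusMeasure d) + ENNReal.ofReal ‖B‖ := by
  have h1 := h.heat hp ht
  have hBp : MemLp B (ENNReal.ofReal p) (torusMeasure d) :=
    ⟨B.continuous.aestronglyMeasurable,
      (eLpNorm_continuousMap_le p B).trans_lt ENNReal.ofReal_lt_top⟩
  have h2 : IsBesselPotential γ p (vecOp (heatMat t) f - A : C(Torus d, Vel d))
      (fun x => heat t (vecCoeff g) x - B x) := by
    refine ⟨h1.1.sub hBp, fun k j => ?_⟩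
    let H : C(Torus d, Vel d) := ⟨_, continuous_heat (g := g) ht⟩
    have e1 : vecCoeff (fun x => heat t (vecCoeff g) x - B x) k j =
        vecCoeffCLM k j (H - B) := rfl
    rw [e1, ← vecCoeffCLM_apply, map_sub, map_sub, mul_sub]
    congr 1
    · exact h1.2 k j
    · exact hB k j
  refine (iInf₂_le _ h2).trans ?_
  refine (eLpNorm_sub_le h1.1.1 hBp.1 (by simpa using hp)).trans ?_
  exact add_le_add (eLpNorm_heat_le ht hp h.1) (eLpNorm_continuousMap_le p B)

lemma isDivFree_iff (f : C(Torus d, Vel d)) :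
    IsDivFree f ↔ ∀ k : Fin d → ℤ, ∑ l, (k l : ℂ) * vecCoeffCLM k l f = 0 := Iff.rfl

lemma IsDivFree.sub {f g : C(Torus d, Vel d)} (hf : IsDivFree f) (hg : IsDivFree g) :
    IsDivFree (f - g : C(Torus d, Vel d)) := by
  rw [isDivFree_iff] at *
  intro k
  simp only [map_sub, mul_sub, Finset.sum_sub_distrib, hf k, hg k, sub_zero]

/-- Each condition is the vanishing of a continuous linear functional, which commutes with the
integral. -/
lemma isDivFree_integral {α : Type*} [MeasurableSpace α] {μ : Measure α}
    {F : α → C(Torus d, Vel d)} (hF : Integrable F μ) (h : ∀ᵐ s ∂μ, IsDivFree (F s)) :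
    IsDivFree (∫ s, F s ∂μ : C(Torus d, Vel d)) := by
  rw [isDivFree_iff]
  intro k
  simp_rw [← ContinuousLinearMap.integral_comp_comm _ hF, ← integral_const_mul]
  rw [← integral_finsetSum _ fun l _ => ((vecCoeffCLM k l).integrable_comp hF).const_mul _]
  exact integral_eq_zero_of_ae (h.mono fun s hs => (isDivFree_iff _).1 hs k)

lemma isDivFree_heat {f : C(Torus d, Vel d)} (hf : IsDivFree f) (τ : ℝ) :
    IsDivFree (vecOp (heatMat τ) f) := by
  intro k
  simp_rw [(isMatrixMultiplier_heatMat τ).vecCoeff_vecOp]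
  have := hf k
  simp only [heatMat, ite_mul, zero_mul, Finset.sum_ite_eq', Finset.mem_univ, if_true]
  simp_rw [mul_left_comm _ (heatMul τ k : ℂ)]
  rw [← Finset.mul_sum, this, mul_zero]

/-- The identity k · (c - (k · c) k/|k|²) = 0, column by column. If |k|² = 0 all components of k
vanish. -/
lemma sum_mul_lerayMul (τ : ℝ) (i : Fin d) (k : Fin d → ℤ) :
    ∑ j, (k j : ℂ) * lerayMul τ j i k = 0 := by
  simp only [lerayMul, mul_sub, Finset.sum_sub_distrib, mul_ite, mul_zero, Finset.sum_ite_eq,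
    Finset.mem_univ, if_true]
  have e : ∀ j, (k j : ℂ) * rieszMul τ i j k =
      (((k j : ℝ) ^ 2 * (k i / freqSq k * heatMul τ k) : ℝ) : ℂ) := fun j => by
    simp only [rieszMul]; push_cast; ring
  simp_rw [e]
  rw [← Complex.ofReal_sum, ← Finset.sum_mul, ← freqSq, sub_eq_zero]
  by_cases hk : freqSq k = 0
  · have h0 : (k i : ℝ) = 0 := by
      have := sq_le_freqSq k i
      rw [hk] at this
      exact pow_eq_zero_iff two_ne_zero |>.1 (le_antisymm this (sq_nonneg _))
    have h0' : (k i : ℂ) = 0 := by exact_mod_cast h0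
    simp [h0', hk]
  · push_cast
    have : (freqSq k : ℂ) ≠ 0 := by exact_mod_cast hk
    field_simp

lemma isDivFree_vecOp {M : Fin d → Fin d → (Fin d → ℤ) → ℂ} {C : ℝ}
    (hM : IsMatrixMultiplier M C) (h : ∀ i k, ∑ j, (k j : ℂ) * M j i k = 0)
    (f : C(Torus d, Vel d)) : IsDivFree (vecOp M f) := by
  intro k
  simp_rw [hM.vecCoeff_vecOp, Finset.mul_sum, ← mul_assoc]
  rw [Finset.sum_comm]
  refine Finset.sum_eq_zero fun i _ => ?_
  rw [← Finset.sum_mul, h i k, zero_mul]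

lemma IsDivFree.add {f g : C(Torus d, Vel d)} (hf : IsDivFree f) (hg : IsDivFree g) :
    IsDivFree (f + g : C(Torus d, Vel d)) := by
  rw [isDivFree_iff] at *
  intro k
  simp only [map_add, mul_add, Finset.sum_add_distrib, hf k, hg k, add_zero]

lemma isDivFree_sum {ι : Type*} (s : Finset ι) {f : ι → C(Torus d, Vel d)}
    (hf : ∀ i ∈ s, IsDivFree (f i)) : IsDivFree (∑ i ∈ s, f i : C(Torus d, Vel d)) := by
  simp_rw [isDivFree_iff] at *
  intro k
  simp only [map_sum, Finset.mul_sum]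
  rw [Finset.sum_comm]
  exact Finset.sum_eq_zero fun i hi => hf i hi k

/-! ### The nonlinear terms -/

/-- The cut-off of a vector field. -/
def cutField (χ : C(ℝ, ℝ)) (u : C(Torus d, Vel d)) : C(Torus d, Vel d) :=
  ⟨fun y => vecCutoff χ (u y), by unfold vecCutoff; fun_prop⟩

/-- The drag force as a continuous field. -/
def dragField {N : ℕ} (χ : C(ℝ, ℝ)) (δ : C(Torus d, ℝ)) (u : C(Torus d, Vel d))
    (x : Fin N → Torus d) (v : Fin N → Vel d) : C(Torus d, Vel d) :=
  ⟨dragForce χ δ u x v, by unfold dragForce; fun_prop⟩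

lemma dragField_apply {N : ℕ} (χ : C(ℝ, ℝ)) (δ : C(Torus d, ℝ)) (u : C(Torus d, Vel d))
    (x : Fin N → Torus d) (v : Fin N → Vel d) (y : Torus d) : dragField χ δ u x v y =
      (1 / (N : ℝ)) • ∑ i, δ (y - x i) • (vecCutoff χ (u (x i)) - v i) := rfl

/-- The nonlinear terms of the fluid equation, composed with given matrices of multipliers. -/
def nonlin {N : ℕ} (χ : C(ℝ, ℝ)) (δ : C(Torus d, ℝ))
    (Mc : Fin d → Fin d → Fin d → (Fin d → ℤ) → ℂ) (Ml : Fin d → Fin d → (Fin d → ℤ) → ℂ)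
    (u : C(Torus d, Vel d)) (x : Fin N → Torus d) (v : Fin N → Vel d) : C(Torus d, Vel d) :=
  ∑ l, vecOp (Mc l) (compSmul l u (cutField χ u)) + vecOp Ml (dragField χ δ u x v)

/-- The drift of the particle velocities. -/
def drift {N : ℕ} (χ : C(ℝ, ℝ)) (u : C(Torus d, Vel d)) (x : Fin N → Torus d)
    (v : Fin N → Vel d) : Fin N → Vel d := fun i => vecCutoff χ (u (x i)) - v i

/-- Bounds on the cut-off and on the mollifier. -/
structure IsAdmissible (χ : C(ℝ, ℝ)) (δ : C(Torus d, ℝ)) (K L : ℝ) : Prop where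
  bdd : ∀ x, |χ x| ≤ K
  lip : ∀ x y, |χ x - χ y| ≤ |x - y|
  lip_nonneg : 0 ≤ L
  isLip : IsLip L δ

/-! ### Growth, Lipschitz and difference bounds for drag, drift and convection -/

section Estimates

variable {N : ℕ} {χ : C(ℝ, ℝ)} {δ : C(Torus d, ℝ)} {K L : ℝ}

lemma IsAdmissible.bdd_nonneg (h : IsAdmissible χ δ K L) : 0 ≤ K :=
  (abs_nonneg _).trans (h.bdd 0)

lemma IsAdmissible.norm_vecCutoff_le (h : IsAdmissible χ δ K L) (y : Vel d) :
    ‖vecCutoff χ y‖ ≤ d * K := by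
  refine (norm_le_sum _).trans ?_
  refine (Finset.sum_le_card_nsmul _ _ K fun i _ => h.bdd _).trans_eq (by simp)

lemma IsAdmissible.norm_vecCutoff_sub_le (h : IsAdmissible χ δ K L) (y z : Vel d) :
    ‖vecCutoff χ y - vecCutoff χ z‖ ≤ d * ‖y - z‖ := by
  refine (norm_le_sum _).trans ?_
  refine (Finset.sum_le_card_nsmul _ _ ‖y - z‖ fun i _ => ?_).trans_eq (by simp)
  exact (h.lip _ _).trans (norm_apply_le (y - z) i)

lemma IsAdmissible.norm_cutField_le (h : IsAdmissible χ δ K L) (u : C(Torus d, Vel d)) :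
    ‖cutField χ u‖ ≤ d * K :=
  (ContinuousMap.norm_le_of_nonempty _).2 fun _ => h.norm_vecCutoff_le _

lemma IsAdmissible.norm_cutField_sub_le (h : IsAdmissible χ δ K L) (u u' : C(Torus d, Vel d)) :
    ‖cutField χ u - cutField χ u'‖ ≤ d * ‖u - u'‖ :=
  (ContinuousMap.norm_le_of_nonempty _).2 fun x => (h.norm_vecCutoff_sub_le _ _).trans
    (mul_le_mul_of_nonneg_left ((u - u').norm_coe_le_norm x) (by positivity))

lemma IsAdmissible.isLip_cutField (h : IsAdmissible χ δ K L) {ℓ : ℝ} {u : C(Torus d, Vel d)}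
    (hu : IsLip ℓ u) : IsLip (d * ℓ) (cutField χ u) := fun x y =>
  (h.norm_vecCutoff_sub_le _ _).trans
    ((mul_le_mul_of_nonneg_left (hu x y) (by positivity)).trans_eq (mul_assoc _ _ _).symm)

lemma norm_compSmul_le (l : Fin d) (u w : C(Torus d, Vel d)) : ‖compSmul l u w‖ ≤ ‖u‖ * ‖w‖ := by
  refine (ContinuousMap.norm_le_of_nonempty _).2 fun x => ?_
  rw [compSmul_apply, norm_smul, Real.norm_eq_abs]
  exact mul_le_mul ((norm_apply_le _ l).trans (u.norm_coe_le_norm x)) (w.norm_coe_le_norm x)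
    (norm_nonneg _) (norm_nonneg _)

lemma norm_compSmul_sub_le (l : Fin d) (u w u' w' : C(Torus d, Vel d)) :
    ‖compSmul l u w - compSmul l u' w'‖ ≤ ‖u - u'‖ * ‖w‖ + ‖u'‖ * ‖w - w'‖ := by
  have e : compSmul l u w - compSmul l u' w' =
      compSmul l (u - u') w + compSmul l u' (w - w') := by
    ext x i
    simp
    ring
  rw [e]
  exact (norm_add_le _ _).trans (add_le_add (norm_compSmul_le _ _ _) (norm_compSmul_le _ _ _))

lemma isLip_compSmul (l : Fin d) {u w : C(Torus d, Vel d)} {ℓ ℓ' : ℝ} (hℓ : 0 ≤ ℓ) (hℓ' : 0 ≤ ℓ')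
    (hu : IsLip ℓ u) (hw : IsLip ℓ' w) :
    IsLip (ℓ * ‖w‖ + ‖u‖ * ℓ') (compSmul l u w) := by
  rw [isLip_iff_translate (by positivity)]
  intro y
  have e : translate (toTorus y) (compSmul l u w) =
      compSmul l (translate (toTorus y) u) (translate (toTorus y) w) := rfl
  have hn : ‖translate (toTorus y) w‖ ≤ ‖w‖ :=
    (ContinuousMap.norm_le_of_nonempty _).2 fun x => w.norm_coe_le_norm _
  rw [e]
  refine (norm_compSmul_sub_le _ _ _ _ _).trans ?_
  have h1 := (isLip_iff_translate hℓ).1 hu y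
  have h2 := (isLip_iff_translate hℓ').1 hw y
  calc _ ≤ (ℓ * ‖y‖) * ‖w‖ + ‖u‖ * (ℓ' * ‖y‖) := by gcongr
    _ = _ := by ring

/-- An average is at most the maximum, so drag bounds do not grow with N; for N = 0 the value 1/0 =
0 is harmless. -/
lemma inv_mul_sum_le {a : Fin N → ℝ} {c : ℝ} (hc : 0 ≤ c) (ha : ∀ i, a i ≤ c) :
    (1 / (N : ℝ)) * ∑ i, a i ≤ c := by
  rcases Nat.eq_zero_or_pos N with rfl | hN
  · simpa using hc
  · have : (0 : ℝ) < N := by exact_mod_cast hN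
    rw [one_div, inv_mul_le_iff₀ this]
    exact (Finset.sum_le_card_nsmul _ _ c fun i _ => ha i).trans_eq (by simp)

lemma norm_inv_smul_sum_le {a : Fin N → Vel d} {c : ℝ} (hc : 0 ≤ c) (ha : ∀ i, ‖a i‖ ≤ c) :
    ‖(1 / (N : ℝ)) • ∑ i, a i‖ ≤ c := by
  rw [norm_smul, Real.norm_eq_abs, abs_of_nonneg (by positivity)]
  exact (mul_le_mul_of_nonneg_left (norm_sum_le _ _) (by positivity)).trans
    (inv_mul_sum_le hc ha)

lemma IsAdmissible.norm_drift_le (h : IsAdmissible χ δ K L) (u : C(Torus d, Vel d))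
    (x : Fin N → Torus d) (v : Fin N → Vel d) : ‖drift χ u x v‖ ≤ d * K + ‖v‖ := by
  have := h.bdd_nonneg
  refine (pi_norm_le_iff_of_nonneg (by positivity)).2 fun i => ?_
  exact (norm_sub_le _ _).trans (add_le_add (h.norm_vecCutoff_le _) (norm_le_pi_norm v i))

/-- Writing u(x + η) - u'(x) = (u(x + η) - u(x)) + (u - u')(x) only uses a Lipschitz bound on `u`.
This asymmetry is what makes uniqueness hold among fields that are merely bounded. The displacement
`η` is kept as a vector of ℝ^d, so that no distance on the torus is needed. -/
lemma IsAdmissible.norm_drift_apply_sub_le (h : IsAdmissible χ δ K L) {ℓ : ℝ} (hℓ : 0 ≤ ℓ)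
    {u u' : C(Torus d, Vel d)} (hu : IsLip ℓ u) (x : Fin N → Torus d) (η v v' : Fin N → Vel d)
    (i : Fin N) :
    ‖drift χ u (fun i => x i + toTorus (η i)) v i - drift χ u' x v' i‖ ≤
      d * (ℓ * ‖η‖ + ‖u - u'‖) + ‖v - v'‖ := by
  have e : drift χ u (fun i => x i + toTorus (η i)) v i - drift χ u' x v' i =
      (vecCutoff χ (u (x i + toTorus (η i))) - vecCutoff χ (u' (x i))) - (v i - v' i) := by
    simp only [drift]; abel
  rw [e]
  refine (norm_sub_le _ _).trans (add_le_add ?_ (norm_le_pi_norm (v - v') i))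
  refine (h.norm_vecCutoff_sub_le _ _).trans (mul_le_mul_of_nonneg_left ?_ (by positivity))
  have e2 : u (x i + toTorus (η i)) - u' (x i) =
      (u (x i + toTorus (η i)) - u (x i)) + (u - u') (x i) := by simp
  rw [e2]
  refine (norm_add_le _ _).trans (add_le_add ((hu _ _).trans ?_) ((u - u').norm_coe_le_norm _))
  exact mul_le_mul_of_nonneg_left (norm_le_pi_norm η i) hℓ

lemma IsAdmissible.norm_drift_sub_le (h : IsAdmissible χ δ K L) {ℓ : ℝ} (hℓ : 0 ≤ ℓ)
    {u u' : C(Torus d, Vel d)} (hu : IsLip ℓ u) (x : Fin N → Torus d) (η v v' : Fin N → Vel d) :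
    ‖drift χ u (fun i => x i + toTorus (η i)) v - drift χ u' x v'‖ ≤
      d * (ℓ * ‖η‖ + ‖u - u'‖) + ‖v - v'‖ :=
  (pi_norm_le_iff_of_nonneg (by positivity)).2 fun i =>
    h.norm_drift_apply_sub_le hℓ hu x η v v' i

lemma IsAdmissible.norm_dragField_le (h : IsAdmissible χ δ K L) (u : C(Torus d, Vel d))
    (x : Fin N → Torus d) (v : Fin N → Vel d) :
    ‖dragField χ δ u x v‖ ≤ ‖δ‖ * (d * K + ‖v‖) := by
  have := h.bdd_nonneg
  refine (ContinuousMap.norm_le_of_nonempty _).2 fun y => ?_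
  rw [dragField_apply]
  refine norm_inv_smul_sum_le (by positivity) fun i => ?_
  rw [norm_smul]
  exact mul_le_mul (δ.norm_coe_le_norm _) ((norm_le_pi_norm (drift χ u x v) i).trans
    (h.norm_drift_le u x v)) (norm_nonneg _) (norm_nonneg _)

lemma IsAdmissible.isLip_dragField (h : IsAdmissible χ δ K L) (u : C(Torus d, Vel d))
    (x : Fin N → Torus d) (v : Fin N → Vel d) :
    IsLip (L * (d * K + ‖v‖)) (dragField χ δ u x v) := by
  have := h.bdd_nonneg
  have := h.lip_nonneg
  intro z y
  rw [dragField_apply, dragField_apply, ← smul_sub, ← Finset.sum_sub_distrib]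
  refine norm_inv_smul_sum_le (by positivity) fun i => ?_
  rw [← sub_smul, norm_smul]
  have h1 := h.isLip (z - x i) y
  rw [sub_add_eq_add_sub] at h1
  calc _ ≤ (L * ‖y‖) * (d * K + ‖v‖) := mul_le_mul h1
        ((norm_le_pi_norm (drift χ u x v) i).trans (h.norm_drift_le u x v)) (norm_nonneg _)
        (by positivity)
    _ = _ := by ring

lemma IsAdmissible.norm_dragField_sub_le (h : IsAdmissible χ δ K L) {ℓ : ℝ} (hℓ : 0 ≤ ℓ)
    {u u' : C(Torus d, Vel d)} (hu : IsLip ℓ u) (x : Fin N → Torus d) (η v v' : Fin N → Vel d) :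
    ‖dragField χ δ u (fun i => x i + toTorus (η i)) v - dragField χ δ u' x v'‖ ≤
      ‖δ‖ * (d * (ℓ * ‖η‖ + ‖u - u'‖) + ‖v - v'‖) + L * ‖η‖ * (d * K + ‖v'‖) := by
  have := h.bdd_nonneg
  have := h.lip_nonneg
  refine (ContinuousMap.norm_le_of_nonempty _).2 fun y => ?_
  rw [ContinuousMap.sub_apply, dragField_apply, dragField_apply, ← smul_sub,
    ← Finset.sum_sub_distrib]
  refine norm_inv_smul_sum_le (by positivity) fun i => ?_
  set a := drift χ u (fun i => x i + toTorus (η i)) v i with ha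
  set a' := drift χ u' x v' i with ha'
  -- The change of velocity difference is weighted by the size of δ, and the displacement of the
  -- mollifier by the bounded term `a'`.
  have e : δ (y - (x i + toTorus (η i))) • (vecCutoff χ (u (x i + toTorus (η i))) - v i) -
      δ (y - x i) • (vecCutoff χ (u' (x i)) - v' i) =
      δ (y - (x i + toTorus (η i))) • (a - a') +
        (δ (y - x i + toTorus (-η i)) - δ (y - x i)) • a' := by
    have e1 : y - (x i + toTorus (η i)) = y - x i + toTorus (-η i) := by
      rw [toTorus_neg]; abel
    rw [e1]
    simp only [ha, ha', drift, smul_sub, sub_smul]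
    abel
  rw [e]
  refine (norm_add_le _ _).trans (add_le_add ?_ ?_)
  · rw [norm_smul]
    exact mul_le_mul (δ.norm_coe_le_norm _) (h.norm_drift_apply_sub_le hℓ hu x η v v' i)
      (norm_nonneg _) (norm_nonneg _)
  · rw [norm_smul]
    refine mul_le_mul ((h.isLip _ _).trans ?_) ((norm_le_pi_norm (drift χ u' x v') i).trans
      (h.norm_drift_le u' x v')) (norm_nonneg _) (by positivity)
    rw [norm_neg]
    exact mul_le_mul_of_nonneg_left (norm_le_pi_norm η i) this

variable {Mc : Fin d → Fin d → Fin d → (Fin d → ℤ) → ℂ} {Ml : Fin d → Fin d → (Fin d → ℤ) → ℂ}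

/-- Linear growth of the nonlinear terms. -/
lemma IsAdmissible.norm_nonlin_le (h : IsAdmissible χ δ K L) {C : ℝ}
    (hc : ∀ l, IsMatrixMultiplier (Mc l) C) (hl : IsMatrixMultiplier Ml C)
    (u : C(Torus d, Vel d)) (x : Fin N → Torus d) (v : Fin N → Vel d) :
    ‖nonlin χ δ Mc Ml u x v‖ ≤
      (d : ℝ) ^ 2 * C * ((d : ℝ) ^ 2 * K * ‖u‖ + ‖δ‖ * (d * K + ‖v‖)) := by
  have hC := hl.nonneg
  refine (norm_add_le _ _).trans ?_
  have h1 : ‖∑ l, vecOp (Mc l) (compSmul l u (cutField χ u))‖ ≤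
      d * ((d : ℝ) ^ 2 * C * (‖u‖ * (d * K))) := by
    refine (norm_sum_le _ _).trans ?_
    refine (Finset.sum_le_card_nsmul _ _ ((d : ℝ) ^ 2 * C * (‖u‖ * (d * K)))
      fun l _ => ?_).trans_eq (by simp)
    refine ((hc l).norm_vecOp_le _).trans (mul_le_mul_of_nonneg_left ?_ (by positivity))
    exact (norm_compSmul_le _ _ _).trans
      (mul_le_mul_of_nonneg_left (h.norm_cutField_le u) (norm_nonneg _))
  have h2 := (hl.norm_vecOp_le (dragField χ δ u x v)).trans
    (mul_le_mul_of_nonneg_left (h.norm_dragField_le u x v) (by positivity))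
  refine (add_le_add h1 h2).trans_eq (by ring)

/-- The nonlinear terms are Lipschitz if the field is. -/
lemma IsAdmissible.isLip_nonlin (h : IsAdmissible χ δ K L) {C : ℝ}
    (hc : ∀ l, IsMatrixMultiplier (Mc l) C) (hl : IsMatrixMultiplier Ml C) {ℓ : ℝ} (hℓ : 0 ≤ ℓ)
    {u : C(Torus d, Vel d)} (hu : IsLip ℓ u) (x : Fin N → Torus d) (v : Fin N → Vel d) :
    IsLip ((d : ℝ) ^ 2 * C * ((d : ℝ) ^ 2 * (K + ‖u‖) * ℓ + L * (d * K + ‖v‖)))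
      (nonlin χ δ Mc Ml u x v) := by
  have hC := hl.nonneg
  have hK := h.bdd_nonneg
  have hL := h.lip_nonneg
  intro z y
  have h1 : ∀ l, IsLip ((d : ℝ) ^ 2 * C * (ℓ * (d * K) + ‖u‖ * (d * ℓ)))
      (vecOp (Mc l) (compSmul l u (cutField χ u))) := fun l => by
    refine (hc l).isLip_vecOp (by positivity) ?_
    refine (isLip_compSmul l hℓ (by positivity) hu (h.isLip_cutField hu)).mono ?_
    exact add_le_add (mul_le_mul_of_nonneg_left (h.norm_cutField_le u) hℓ) le_rfl
  have h2 := hl.isLip_vecOp (by positivity) (h.isLip_dragField u x v)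
  simp only [nonlin, ContinuousMap.add_apply, ContinuousMap.coe_sum, Finset.sum_apply]
  rw [add_sub_add_comm, ← Finset.sum_sub_distrib]
  refine (norm_add_le _ _).trans ?_
  refine (add_le_add ((norm_sum_le _ _).trans (Finset.sum_le_card_nsmul _ _ _
    fun l _ => h1 l z y)) (h2 z y)).trans_eq ?_
  simp; ring

/-- Local Lipschitz continuity of the nonlinear terms. -/
lemma IsAdmissible.norm_nonlin_sub_le (h : IsAdmissible χ δ K L) {C : ℝ}
    (hc : ∀ l, IsMatrixMultiplier (Mc l) C) (hl : IsMatrixMultiplier Ml C) {ℓ : ℝ} (hℓ : 0 ≤ ℓ)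
    {u u' : C(Torus d, Vel d)} (hu : IsLip ℓ u) (x : Fin N → Torus d) (η v v' : Fin N → Vel d) :
    ‖nonlin χ δ Mc Ml u (fun i => x i + toTorus (η i)) v - nonlin χ δ Mc Ml u' x v'‖ ≤
      (d : ℝ) ^ 2 * C * ((d : ℝ) ^ 2 * (K + ‖u'‖) * ‖u - u'‖ +
        (‖δ‖ * (d * (ℓ * ‖η‖ + ‖u - u'‖) + ‖v - v'‖) + L * ‖η‖ * (d * K + ‖v'‖))) := by
  have hC := hl.nonneg
  have e : nonlin χ δ Mc Ml u (fun i => x i + toTorus (η i)) v - nonlin χ δ Mc Ml u' x v' =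
      ∑ l, vecOp (Mc l) (compSmul l u (cutField χ u) - compSmul l u' (cutField χ u')) +
      vecOp Ml (dragField χ δ u (fun i => x i + toTorus (η i)) v - dragField χ δ u' x v') := by
    simp only [nonlin, vecOp_sub (fun j i => ((hc _).isMultiplier j i).1),
      vecOp_sub (fun j i => (hl.isMultiplier j i).1), Finset.sum_sub_distrib]
    abel
  rw [e]
  refine (norm_add_le _ _).trans ?_
  have h1 : ‖∑ l, vecOp (Mc l) (compSmul l u (cutField χ u) - compSmul l u' (cutField χ u'))‖ ≤
      d * ((d : ℝ) ^ 2 * C * (‖u - u'‖ * (d * K) + ‖u'‖ * (d * ‖u - u'‖))) := by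
    refine (norm_sum_le _ _).trans ?_
    refine (Finset.sum_le_card_nsmul _ _
      ((d : ℝ) ^ 2 * C * (‖u - u'‖ * (d * K) + ‖u'‖ * (d * ‖u - u'‖)))
      fun l _ => ?_).trans_eq (by simp)
    refine ((hc l).norm_vecOp_le _).trans (mul_le_mul_of_nonneg_left ?_ (by positivity))
    refine (norm_compSmul_sub_le _ _ _ _ _).trans (add_le_add ?_ ?_)
    · exact mul_le_mul_of_nonneg_left (h.norm_cutField_le u) (norm_nonneg _)
    · exact mul_le_mul_of_nonneg_left (h.norm_cutField_sub_le u u') (norm_nonneg _)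
  have h2 := (hl.norm_vecOp_le
      (dragField χ δ u (fun i => x i + toTorus (η i)) v - dragField χ δ u' x v')).trans
    (mul_le_mul_of_nonneg_left (h.norm_dragField_sub_le hℓ hu (u' := u') x η v v')
      (by positivity))
  exact (add_le_add h1 h2).trans_eq (by ring)

end Estimates

/-! ### Measurability of the nonlinear terms -/

/-- Continuity into the space of continuous functions follows from joint continuity in the field and
the point. -/
lemma continuous_cutField (χ : C(ℝ, ℝ)) :
    Continuous (cutField χ : C(Torus d, Vel d) → C(Torus d, Vel d)) := by
  refine ContinuousMap.continuous_of_continuous_uncurry _ ?_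
  change Continuous fun p : C(Torus d, Vel d) × Torus d => vecCutoff χ (p.1 p.2)
  unfold vecCutoff
  fun_prop

lemma continuous_compSmul (l : Fin d) :
    Continuous fun p : C(Torus d, Vel d) × C(Torus d, Vel d) => compSmul l p.1 p.2 := by
  refine ContinuousMap.continuous_of_continuous_uncurry _ ?_
  change Continuous fun p : (C(Torus d, Vel d) × C(Torus d, Vel d)) × Torus d =>
    p.1.1 p.2 l • p.1.2 p.2
  fun_prop

lemma continuous_dragField {N : ℕ} (χ : C(ℝ, ℝ)) (δ : C(Torus d, ℝ)) :
    Continuous fun p : C(Torus d, Vel d) × (Fin N → Torus d) × (Fin N → Vel d) =>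
      dragField χ δ p.1 p.2.1 p.2.2 := by
  refine ContinuousMap.continuous_of_continuous_uncurry _ ?_
  change Continuous fun p : (C(Torus d, Vel d) × (Fin N → Torus d) × (Fin N → Vel d)) × Torus d =>
    (1 / (N : ℝ)) • ∑ i, δ (p.2 - p.1.2.1 i) • (vecCutoff χ (p.1.1 (p.1.2.1 i)) - p.1.2.2 i)
  unfold vecCutoff
  fun_prop

lemma continuous_drift {N : ℕ} (χ : C(ℝ, ℝ)) :
    Continuous fun p : C(Torus d, Vel d) × (Fin N → Torus d) × (Fin N → Vel d) =>
      drift χ p.1 p.2.1 p.2.2 := by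
  unfold drift vecCutoff
  fun_prop

lemma stronglyMeasurable_comp {α E F : Type*} [MeasurableSpace α] [TopologicalSpace E]
    [TopologicalSpace F] {g : E → F} {f : α → E} (hg : Continuous g) (hf : StronglyMeasurable f) :
    StronglyMeasurable fun a => g (f a) :=
  hg.comp_stronglyMeasurable hf

lemma stronglyMeasurable_compSmul {α : Type*} [MeasurableSpace α] (l : Fin d)
    {u w : α → C(Torus d, Vel d)} (hu : StronglyMeasurable u) (hw : StronglyMeasurable w) :
    StronglyMeasurable fun a => compSmul l (u a) (w a) :=
  stronglyMeasurable_comp (continuous_compSmul l) (hu.prodMk hw)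

lemma stronglyMeasurable_dragField {α : Type*} [MeasurableSpace α] {N : ℕ} (χ : C(ℝ, ℝ))
    (δ : C(Torus d, ℝ)) {u : α → C(Torus d, Vel d)} {x : α → Fin N → Torus d}
    {v : α → Fin N → Vel d} (hu : StronglyMeasurable u) (hx : StronglyMeasurable x)
    (hv : StronglyMeasurable v) :
    StronglyMeasurable fun a => dragField χ δ (u a) (x a) (v a) := by
  have hf : StronglyMeasurable fun a => (u a, x a, v a) := hu.prodMk (hx.prodMk hv)
  exact stronglyMeasurable_comp (f := fun a => (u a, x a, v a))
    (g := fun p : C(Torus d, Vel d) × (Fin N → Torus d) × (Fin N → Vel d) =>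
      dragField χ δ p.1 p.2.1 p.2.2) (continuous_dragField χ δ) hf

lemma stronglyMeasurable_drift {α : Type*} [MeasurableSpace α] {N : ℕ} (χ : C(ℝ, ℝ))
    {u : α → C(Torus d, Vel d)} {x : α → Fin N → Torus d}
    {v : α → Fin N → Vel d} (hu : StronglyMeasurable u) (hx : StronglyMeasurable x)
    (hv : StronglyMeasurable v) :
    StronglyMeasurable fun a => drift χ (u a) (x a) (v a) := by
  have hf : StronglyMeasurable fun a => (u a, x a, v a) := hu.prodMk (hx.prodMk hv)
  exact stronglyMeasurable_comp (f := fun a => (u a, x a, v a))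
    (g := fun p : C(Torus d, Vel d) × (Fin N → Torus d) × (Fin N → Vel d) =>
      drift χ p.1 p.2.1 p.2.2) (continuous_drift χ) hf

lemma stronglyMeasurable_nonlin {α : Type*} [MeasurableSpace α] {N : ℕ} (χ : C(ℝ, ℝ))
    (δ : C(Torus d, ℝ)) {Mc : α → Fin d → Fin d → Fin d → (Fin d → ℤ) → ℂ}
    {Ml : α → Fin d → Fin d → (Fin d → ℤ) → ℂ}
    (hMc : ∀ l j i k, Measurable fun a => Mc a l j i k)
    (hMl : ∀ j i k, Measurable fun a => Ml a j i k)
    (hsc : ∀ a l j i, Summable fun k => ‖Mc a l j i k‖)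
    (hsl : ∀ a j i, Summable fun k => ‖Ml a j i k‖)
    {u : α → C(Torus d, Vel d)} {x : α → Fin N → Torus d} {v : α → Fin N → Vel d}
    (hu : StronglyMeasurable u) (hx : StronglyMeasurable x) (hv : StronglyMeasurable v) :
    StronglyMeasurable fun a => nonlin χ δ (Mc a) (Ml a) (u a) (x a) (v a) := by
  have hw : StronglyMeasurable fun a => cutField χ (u a) :=
    stronglyMeasurable_comp (continuous_cutField χ) hu
  have h1 : ∀ l, StronglyMeasurable fun a =>
      vecOp (Mc a l) (compSmul l (u a) (cutField χ (u a))) := fun l =>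
    stronglyMeasurable_vecOp (M := fun a => Mc a l) (hMc l) (fun a => hsc a l)
      (stronglyMeasurable_compSmul l hu hw)
  have h2 : StronglyMeasurable fun a => vecOp (Ml a) (dragField χ δ (u a) (x a) (v a)) :=
    stronglyMeasurable_vecOp (M := Ml) hMl hsl (stronglyMeasurable_dragField χ δ hu hx hv)
  exact (Finset.stronglyMeasurable_fun_sum _ fun l _ => h1 l).add h2

/-! ### Singular Volterra integrals with exponential weights -/

lemma integrableOn_sub_rpow {a t : ℝ} (ha : a < 1) (ht : 0 ≤ t) :
    IntegrableOn (fun s => (t - s) ^ (-a)) (Ioo 0 t) := by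
  have h : IntervalIntegrable (fun s : ℝ => s ^ (-a)) volume 0 t :=
    intervalIntegral.intervalIntegrable_rpow' (by linarith)
  have h2 := h.comp_sub_left t
  simp only [sub_zero, sub_self] at h2
  rw [intervalIntegrable_iff_integrableOn_Ioo_of_le ht] at *
  exact ((intervalIntegrable_iff_integrableOn_Ioo_of_le ht).1 h2.symm)

lemma integrableOn_rpow {a t : ℝ} (ha : a < 1) (ht : 0 ≤ t) :
    IntegrableOn (fun s : ℝ => s ^ (-a)) (Ioo 0 t) :=
  (intervalIntegrable_iff_integrableOn_Ioo_of_le ht).1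
    (intervalIntegral.intervalIntegrable_rpow' (by linarith))

lemma setIntegral_rpow {a t : ℝ} (ha : a < 1) (ht : 0 ≤ t) :
    ∫ s in Ioo 0 t, s ^ (-a) = t ^ (1 - a) / (1 - a) := by
  rw [← integral_Ioc_eq_integral_Ioo, ← intervalIntegral.integral_of_le ht,
    integral_rpow (Or.inl (by linarith)), Real.zero_rpow (by linarith), sub_zero]
  rw [neg_add_eq_sub]

lemma setIntegral_sub_rpow {a t : ℝ} (ha : a < 1) (ht : 0 ≤ t) :
    ∫ s in Ioo 0 t, (t - s) ^ (-a) = t ^ (1 - a) / (1 - a) := by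
  rw [← setIntegral_rpow ha ht]
  simp_rw [← integral_Ioc_eq_integral_Ioo, ← intervalIntegral.integral_of_le ht]
  rw [intervalIntegral.integral_comp_sub_left (fun s => s ^ (-a)) t, sub_self, sub_zero]

/-- Divide the subadditivity t^a ≤ (t - s)^a + s^a by the product of the three powers. It extracts
the factor t^(-a) from a singularity at both ends. -/
lemma rpow_neg_mul_rpow_neg_le {a s t : ℝ} (ha : 0 ≤ a) (ha1 : a ≤ 1) (hs : 0 < s) (hst : s < t) :
    (t - s) ^ (-a) * s ^ (-a) ≤ t ^ (-a) * ((t - s) ^ (-a) + s ^ (-a)) := by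
  have h1 : 0 < t - s := sub_pos.2 hst
  have ht : 0 < t := hs.trans hst
  have h := Real.rpow_add_le_add_rpow h1.le hs.le ha ha1
  rw [sub_add_cancel] at h
  have p1 := Real.rpow_pos_of_pos h1 a
  have p2 := Real.rpow_pos_of_pos hs a
  have p3 := Real.rpow_pos_of_pos ht a
  rw [Real.rpow_neg h1.le, Real.rpow_neg hs.le, Real.rpow_neg ht.le]
  have e : ((t - s) ^ a)⁻¹ + (s ^ a)⁻¹ = ((t - s) ^ a + s ^ a) * (((t - s) ^ a)⁻¹ * (s ^ a)⁻¹) := by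
    field_simp; ring
  rw [e, ← mul_assoc]
  refine le_mul_of_one_le_left (by positivity) ?_
  rw [inv_mul_eq_div, one_le_div p3]
  exact h

/-- The gain of the exponential weight: a spare positive power of t - s is converted into l^(-η),
which tends to 0 as l grows. -/
lemma rpow_mul_exp_neg_le {η l r : ℝ} (hη : 0 ≤ η) (hη1 : η ≤ 1) (hl : 0 < l) (hr : 0 ≤ r) :
    r ^ η * Real.exp (-(l * r)) ≤ l ^ (-η) := by
  have h0 : 0 ≤ l * r := by positivity
  have h1 : (l * r) ^ η ≤ Real.exp (l * r) := by
    calc (l * r) ^ η ≤ (1 + l * r) ^ η := Real.rpow_le_rpow h0 (by linarith) hη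
      _ ≤ (1 + l * r) ^ (1 : ℝ) := Real.rpow_le_rpow_of_exponent_le (by linarith) hη1
      _ ≤ Real.exp (l * r) := by
        rw [Real.rpow_one, add_comm]; exact Real.add_one_le_exp _
  rw [Real.mul_rpow hl.le hr] at h1
  rw [Real.exp_neg, Real.rpow_neg hl.le, ← div_eq_mul_inv, div_le_iff₀ (Real.exp_pos _),
    inv_mul_eq_div, le_div_iff₀ (Real.rpow_pos_of_pos hl _)]
  linarith

/-- An exponential weight makes singular Volterra operators small. -/
lemma exists_exp_weight {κ : ℝ} (hκ : 0 ≤ κ) (hκ1 : κ < 1) (T : ℝ) {ρ : ℝ} (hρ : 0 < ρ) :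
    ∃ l : ℝ, 0 ≤ l ∧ ∀ t, 0 ≤ t → t ≤ T →
      (IntegrableOn (fun s => (t - s) ^ (-κ) * Real.exp (l * s)) (Ioo 0 t) ∧
        ∫ s in Ioo 0 t, (t - s) ^ (-κ) * Real.exp (l * s) ≤ ρ * Real.exp (l * t)) ∧
      (IntegrableOn (fun s => (t - s) ^ (-κ) * (s ^ (-((κ + 1) / 2)) * Real.exp (l * s)))
          (Ioo 0 t) ∧
        ∫ s in Ioo 0 t, (t - s) ^ (-κ) * (s ^ (-((κ + 1) / 2)) * Real.exp (l * s)) ≤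
          ρ * (t ^ (-((κ + 1) / 2)) * Real.exp (l * t))) := by
  -- κ' is halfway between κ and 1 and η = κ' - κ: the singularity is worsened to κ', still
  -- integrable, to free the power η that produces l^(-η).
  set κ' := (κ + 1) / 2 with hκ'
  set η := (1 - κ) / 2 with hη
  have hκ'1 : κ' < 1 := by rw [hκ']; linarith
  have hκ'0 : 0 ≤ κ' := by rw [hκ']; linarith
  have hη0 : 0 < η := by rw [hη]; linarith
  -- The factor 2 accounts for the singularities at both ends of (0, t) in the second integral.
  set J := 2 * |T| ^ (1 - κ') / (1 - κ') with hJ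
  have hT0 : 0 ≤ |T| ^ (1 - κ') := Real.rpow_nonneg (abs_nonneg _) _
  have hJ0 : 0 ≤ J := div_nonneg (by positivity) (by linarith)
  have hlim : Tendsto (fun l : ℝ => l ^ (-η) * J) atTop (𝓝 0) := by
    simpa using (tendsto_rpow_neg_atTop hη0).mul_const J
  obtain ⟨l, hl, hl0⟩ := ((hlim.eventually (eventually_lt_nhds hρ)).and
    (eventually_gt_atTop 0)).exists
  refine ⟨l, hl0.le, fun t ht htT => ?_⟩
  have hle : t ^ (1 - κ') / (1 - κ') ≤ |T| ^ (1 - κ') / (1 - κ') := by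
    refine div_le_div_of_nonneg_right ?_ (by linarith)
    exact Real.rpow_le_rpow ht (htT.trans (le_abs_self T)) (by linarith)
  have hpt : ∀ s ∈ Ioo 0 t, (t - s) ^ (-κ) * Real.exp (l * s) ≤
      l ^ (-η) * Real.exp (l * t) * (t - s) ^ (-κ') := fun s hs => by
    have h1 : 0 < t - s := sub_pos.2 hs.2
    have e1 : (t - s) ^ (-κ) = (t - s) ^ (-κ') * (t - s) ^ η := by
      rw [← Real.rpow_add h1]; congr 1; rw [hκ', hη]; ring
    have e2 : Real.exp (l * s) = Real.exp (l * t) * Real.exp (-(l * (t - s))) := by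
      rw [← Real.exp_add]; congr 1; ring
    have := rpow_mul_exp_neg_le hη0.le (by rw [hη]; linarith) hl0 h1.le
    calc _ = Real.exp (l * t) * (t - s) ^ (-κ') * ((t - s) ^ η * Real.exp (-(l * (t - s)))) := by
          rw [e1, e2]; ring
      _ ≤ Real.exp (l * t) * (t - s) ^ (-κ') * l ^ (-η) := by
          have := Real.rpow_nonneg h1.le (-κ')
          gcongr
      _ = _ := by ring
  have hnn : ∀ s ∈ Ioo 0 t, 0 ≤ (t - s) ^ (-κ) * Real.exp (l * s) := fun s hs =>
    mul_nonneg (Real.rpow_nonneg (sub_pos.2 hs.2).le _) (Real.exp_nonneg _)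
  have hlη := Real.rpow_nonneg hl0.le (-η)
  have i1 : IntegrableOn (fun s => l ^ (-η) * Real.exp (l * t) * (t - s) ^ (-κ')) (Ioo 0 t) :=
    (integrableOn_sub_rpow hκ'1 ht).const_mul _
  have hpt2 : ∀ s ∈ Ioo 0 t, (t - s) ^ (-κ) * (s ^ (-κ') * Real.exp (l * s)) ≤
      l ^ (-η) * Real.exp (l * t) * t ^ (-κ') * ((t - s) ^ (-κ') + s ^ (-κ')) := fun s hs => by
    have hs' := Real.rpow_nonneg hs.1.le (-κ')
    calc _ = ((t - s) ^ (-κ) * Real.exp (l * s)) * s ^ (-κ') := by ring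
      _ ≤ (l ^ (-η) * Real.exp (l * t) * (t - s) ^ (-κ')) * s ^ (-κ') :=
          mul_le_mul_of_nonneg_right (hpt s hs) hs'
      _ = l ^ (-η) * Real.exp (l * t) * ((t - s) ^ (-κ') * s ^ (-κ')) := by ring
      _ ≤ l ^ (-η) * Real.exp (l * t) * (t ^ (-κ') * ((t - s) ^ (-κ') + s ^ (-κ'))) :=
          mul_le_mul_of_nonneg_left (rpow_neg_mul_rpow_neg_le hκ'0 hκ'1.le hs.1 hs.2)
            (by positivity)
      _ = _ := by ring
  have hnn2 : ∀ s ∈ Ioo 0 t, 0 ≤ (t - s) ^ (-κ) * (s ^ (-κ') * Real.exp (l * s)) := fun s hs =>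
    mul_nonneg (Real.rpow_nonneg (sub_pos.2 hs.2).le _)
      (mul_nonneg (Real.rpow_nonneg hs.1.le _) (Real.exp_nonneg _))
  have i2 : IntegrableOn (fun s => l ^ (-η) * Real.exp (l * t) * t ^ (-κ') *
      ((t - s) ^ (-κ') + s ^ (-κ'))) (Ioo 0 t) :=
    ((integrableOn_sub_rpow hκ'1 ht).add (integrableOn_rpow hκ'1 ht)).const_mul _
  have j1 : IntegrableOn (fun s => (t - s) ^ (-κ) * Real.exp (l * s)) (Ioo 0 t) := by
    refine i1.mono' (Measurable.aestronglyMeasurable (by fun_prop)) ?_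
    refine (ae_restrict_iff' measurableSet_Ioo).2 (Eventually.of_forall fun s hs => ?_)
    rw [Real.norm_eq_abs, abs_of_nonneg (hnn s hs)]
    exact hpt s hs
  have j2 : IntegrableOn (fun s => (t - s) ^ (-κ) * (s ^ (-κ') * Real.exp (l * s))) (Ioo 0 t) := by
    refine i2.mono' (Measurable.aestronglyMeasurable (by fun_prop)) ?_
    refine (ae_restrict_iff' measurableSet_Ioo).2 (Eventually.of_forall fun s hs => ?_)
    rw [Real.norm_eq_abs, abs_of_nonneg (hnn2 s hs)]
    exact hpt2 s hs
  have hfin : l ^ (-η) * (2 * (t ^ (1 - κ') / (1 - κ'))) ≤ ρ := by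
    refine le_trans (mul_le_mul_of_nonneg_left ?_ hlη) hl.le
    rw [hJ, mul_div_assoc]; linarith
  have hq : 0 ≤ t ^ (1 - κ') / (1 - κ') :=
    div_nonneg (Real.rpow_nonneg ht _) (by linarith)
  refine ⟨⟨j1, (setIntegral_mono_on j1 i1 measurableSet_Ioo hpt).trans ?_⟩,
    ⟨j2, (setIntegral_mono_on j2 i2 measurableSet_Ioo hpt2).trans ?_⟩⟩
  · rw [integral_const_mul, setIntegral_sub_rpow hκ'1 ht, mul_right_comm]
    refine mul_le_mul_of_nonneg_right (le_trans ?_ hfin) (Real.exp_nonneg _)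
    exact mul_le_mul_of_nonneg_left (by linarith) hlη
  · rw [integral_const_mul, integral_add (integrableOn_sub_rpow hκ'1 ht)
      (integrableOn_rpow hκ'1 ht), setIntegral_sub_rpow hκ'1 ht, setIntegral_rpow hκ'1 ht]
    calc _ = (l ^ (-η) * (2 * (t ^ (1 - κ') / (1 - κ')))) * (t ^ (-κ') * Real.exp (l * t)) := by
          ring
      _ ≤ _ := mul_le_mul_of_nonneg_right hfin
          (mul_nonneg (Real.rpow_nonneg ht _) (Real.exp_nonneg _))

lemma norm_setIntegral_Ioo_le {F : Type*} [NormedAddCommGroup F] [NormedSpace ℝ F] {t c B : ℝ}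
    (hc : 0 ≤ c) {f : ℝ → F} {g : ℝ → ℝ} (hg : IntegrableOn g (Ioo 0 t))
    (hB : ∫ s in Ioo 0 t, g s ≤ B) (h : ∀ s ∈ Ioo 0 t, ‖f s‖ ≤ c * g s) :
    ‖∫ s in Ioo 0 t, f s‖ ≤ c * B := by
  refine (norm_integral_le_of_norm_le (hg.const_mul c)
    ((ae_restrict_iff' measurableSet_Ioo).2 (Eventually.of_forall h))).trans ?_
  rw [integral_const_mul]
  exact mul_le_mul_of_nonneg_left hB hc

/-! ### The forcing of the coupled system -/

/-- Fluid velocity and particle velocities. -/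
abbrev State (d N : ℕ) : Type := C(Torus d, Vel d) × (Fin N → Vel d)

/-- The integrand of the mild formulation of the coupled system. -/
def forcing {N : ℕ} (χ : C(ℝ, ℝ)) (δ : C(Torus d, ℝ)) (τ : ℝ) (u : C(Torus d, Vel d))
    (x : Fin N → Torus d) (v : Fin N → Vel d) : State d N :=
  (-nonlin χ δ (convMat τ) (lerayMul τ) u x v, drift χ u x v)

/-- Bounds on the forcing, singular of order `κ < 1` at `τ = 0`. -/
structure IsForcing (N : ℕ) (χ : C(ℝ, ℝ)) (δ : C(Torus d, ℝ)) (κ T : ℝ) : Prop where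
  nonneg : 0 ≤ κ
  lt_one : κ < 1
  growth : ∃ C : ℝ, 0 ≤ C ∧ ∀ τ, 0 < τ → τ ≤ T → ∀ (u : C(Torus d, Vel d))
    (x : Fin N → Torus d) (v : Fin N → Vel d),
    ‖forcing χ δ τ u x v‖ ≤ C * τ ^ (-κ) * (1 + ‖(u, v)‖)
  isLip : ∀ R : ℝ, 0 ≤ R → ∃ C : ℝ, 0 ≤ C ∧ ∀ τ, 0 < τ → τ ≤ T → ∀ (ℓ : ℝ), 0 ≤ ℓ →
    ∀ (u : C(Torus d, Vel d)) (x : Fin N → Torus d) (v : Fin N → Vel d),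
    IsLip ℓ u → ‖(u, v)‖ ≤ R → IsLip (C * τ ^ (-κ) * (1 + ℓ)) (forcing χ δ τ u x v).1
  lip : ∀ R : ℝ, 0 ≤ R → ∃ C : ℝ, 0 ≤ C ∧ ∀ τ, 0 < τ → τ ≤ T → ∀ (ℓ : ℝ), 0 ≤ ℓ →
    ∀ (u u' : C(Torus d, Vel d)) (x : Fin N → Torus d) (η v v' : Fin N → Vel d),
    IsLip ℓ u → ‖(u', v')‖ ≤ R →
    ‖forcing χ δ τ u (fun i => x i + toTorus (η i)) v - forcing χ δ τ u' x v'‖ ≤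
      C * τ ^ (-κ) * (‖((u, v) : State d N) - (u', v')‖ + (1 + ℓ) * ‖η‖)

lemma one_le_rpow_mul_rpow_neg {κ τ T : ℝ} (hκ : 0 ≤ κ) (hτ : 0 < τ) (hT : τ ≤ T) :
    1 ≤ T ^ κ * τ ^ (-κ) := by
  rw [Real.rpow_neg hτ.le, ← div_eq_mul_inv, one_le_div (Real.rpow_pos_of_pos hτ _)]
  exact Real.rpow_le_rpow hτ.le hT hκ

/-- As χ is bounded, the convection term is controlled by the first power of the norm of u, which
gives global growth bounds. Its differences are only locally Lipschitz, hence the radius `R` in the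
other two estimates. -/
lemma IsAdmissible.isForcing {χ : C(ℝ, ℝ)} {δ : C(Torus d, ℝ)} {K L : ℝ}
    (h : IsAdmissible χ δ K L) (N : ℕ) {γ T : ℝ} (hγ : 0 ≤ γ) (hγ1 : γ < 1) (hT : 0 < T) :
    IsForcing N χ δ ((3 + γ) / 4) T := by
  obtain ⟨C, hC, hsm⟩ := exists_smoothing_bound (d := d) hγ hγ1 hT
  set κ := (3 + γ) / 4 with hκ
  have hκ0 : 0 ≤ κ := by rw [hκ]; linarith
  have hK := h.bdd_nonneg
  have hL := h.lip_nonneg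
  have hTκ : 0 ≤ T ^ κ := Real.rpow_nonneg hT.le _
  refine ⟨hκ0, by rw [hκ]; linarith, ?_, fun R hR => ?_, fun R hR => ?_⟩
  · refine ⟨(d : ℝ) ^ 2 * C * ((d : ℝ) ^ 2 * K + ‖δ‖ * (d * K + 1)) + (d * K + 1) * T ^ κ,
      by positivity, fun τ hτ hτT u x v => ?_⟩
    obtain ⟨hl, -, hc, -⟩ := hsm τ hτ hτT
    have h1 := one_le_rpow_mul_rpow_neg hκ0 hτ hτT
    have hp := Real.rpow_nonneg hτ.le (-κ)
    have hu : ‖u‖ ≤ ‖(u, v)‖ := norm_fst_le (u, v)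
    have hv : ‖v‖ ≤ ‖(u, v)‖ := norm_snd_le (u, v)
    have hz := norm_nonneg (u, v)
    set z := ‖(u, v)‖
    refine max_le ?_ ?_
    · rw [forcing, norm_neg]
      refine (h.norm_nonlin_le hc hl u x v).trans ?_
      calc _ ≤ (d : ℝ) ^ 2 * (C * τ ^ (-κ)) * ((d : ℝ) ^ 2 * K * (1 + z) +
            ‖δ‖ * ((d * K + 1) * (1 + z))) := by
            gcongr
            · linarith
            · nlinarith [mul_nonneg (mul_nonneg (Nat.cast_nonneg (α := ℝ) d) hK) hz]
        _ = (d : ℝ) ^ 2 * C * ((d : ℝ) ^ 2 * K + ‖δ‖ * (d * K + 1)) * τ ^ (-κ) * (1 + z) := by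
            ring
        _ ≤ _ := by gcongr; exact le_add_of_nonneg_right (by positivity)
    · refine (h.norm_drift_le u x v).trans ?_
      -- The drift is not singular; it is put in the common form by 1 ≤ T^κ τ^(-κ).
      calc d * K + ‖v‖ ≤ (d * K + 1) * (1 + z) * 1 := by
            nlinarith [mul_nonneg (mul_nonneg (Nat.cast_nonneg (α := ℝ) d) hK) hz]
        _ ≤ (d * K + 1) * (1 + z) * (T ^ κ * τ ^ (-κ)) := by gcongr
        _ = (d * K + 1) * T ^ κ * τ ^ (-κ) * (1 + z) := by ring
        _ ≤ _ := by gcongr; exact le_add_of_nonneg_left (by positivity)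
  · refine ⟨(d : ℝ) ^ 2 * C * ((d : ℝ) ^ 2 * (K + R) + L * (d * K + R)), by positivity,
      fun τ hτ hτT ℓ hℓ u x v hu hz => ?_⟩
    obtain ⟨hl, -, hc, -⟩ := hsm τ hτ hτT
    have hp := Real.rpow_nonneg hτ.le (-κ)
    have hu' : ‖u‖ ≤ R := (norm_fst_le (u, v)).trans hz
    have hv' : ‖v‖ ≤ R := (norm_snd_le (u, v)).trans hz
    intro y η
    have h1 := h.isLip_nonlin hc hl hℓ hu x v y η
    simp only [forcing, ContinuousMap.neg_apply]
    rw [← norm_neg, neg_sub_neg, neg_sub]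
    refine h1.trans (mul_le_mul_of_nonneg_right ?_ (norm_nonneg _))
    calc _ ≤ (d : ℝ) ^ 2 * (C * τ ^ (-κ)) * ((d : ℝ) ^ 2 * (K + R) * (1 + ℓ) +
            L * (d * K + R) * (1 + ℓ)) := by
            refine mul_le_mul_of_nonneg_left (add_le_add ?_ ?_) (by positivity)
            · gcongr; linarith
            · calc L * (d * K + ‖v‖) ≤ L * (d * K + R) := by gcongr
                _ ≤ _ := le_mul_of_one_le_right (by positivity) (by linarith)
      _ = _ := by ring
  · refine ⟨(d : ℝ) ^ 2 * C * ((d : ℝ) ^ 2 * (K + R) + ‖δ‖ * (d + 1) + L * (d * K + R)) +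
      (d + 1) * T ^ κ, by positivity, fun τ hτ hτT ℓ hℓ u u' x η v v' hu hz => ?_⟩
    obtain ⟨hl, -, hc, -⟩ := hsm τ hτ hτT
    have hp := Real.rpow_nonneg hτ.le (-κ)
    have h1 := one_le_rpow_mul_rpow_neg hκ0 hτ hτT
    have hu' : ‖u'‖ ≤ R := (norm_fst_le (u', v')).trans hz
    have hv' : ‖v'‖ ≤ R := (norm_snd_le (u', v')).trans hz
    have hm1 : ‖u - u'‖ ≤ ‖((u, v) : State d N) - (u', v')‖ :=
      norm_fst_le (((u, v) : State d N) - (u', v'))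
    have hm2 : ‖v - v'‖ ≤ ‖((u, v) : State d N) - (u', v')‖ :=
      norm_snd_le (((u, v) : State d N) - (u', v'))
    set m := ‖((u, v) : State d N) - (u', v')‖ with hm
    have hm0 : 0 ≤ m := norm_nonneg _
    have hη := norm_nonneg η
    have hS : 0 ≤ m + (1 + ℓ) * ‖η‖ := by positivity
    have hA : d * (ℓ * ‖η‖ + ‖u - u'‖) + ‖v - v'‖ ≤ (d + 1) * (m + (1 + ℓ) * ‖η‖) := by
      calc _ ≤ d * (ℓ * ‖η‖ + m) + m := by gcongr
        _ ≤ d * (m + (1 + ℓ) * ‖η‖) + (m + (1 + ℓ) * ‖η‖) := by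
            refine add_le_add (mul_le_mul_of_nonneg_left ?_ (by positivity)) ?_
            · nlinarith
            · exact le_add_of_nonneg_right (by positivity)
        _ = _ := by ring
    refine max_le ?_ ?_
    · change ‖-nonlin χ δ (convMat τ) (lerayMul τ) u (fun i => x i + toTorus (η i)) v -
        -nonlin χ δ (convMat τ) (lerayMul τ) u' x v'‖ ≤ _
      rw [← norm_neg, neg_sub_neg, neg_sub]
      refine (h.norm_nonlin_sub_le hc hl hℓ hu x η v v').trans ?_
      calc _ ≤ (d : ℝ) ^ 2 * (C * τ ^ (-κ)) * ((d : ℝ) ^ 2 * (K + R) * (m + (1 + ℓ) * ‖η‖) +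
            (‖δ‖ * ((d + 1) * (m + (1 + ℓ) * ‖η‖)) +
              L * (m + (1 + ℓ) * ‖η‖) * (d * K + R))) := by
            gcongr
            · exact hm1.trans (le_add_of_nonneg_right (by positivity))
            · nlinarith
        _ = (d : ℝ) ^ 2 * C * ((d : ℝ) ^ 2 * (K + R) + ‖δ‖ * (d + 1) + L * (d * K + R)) *
            τ ^ (-κ) * (m + (1 + ℓ) * ‖η‖) := by ring
        _ ≤ _ := by gcongr; exact le_add_of_nonneg_right (by positivity)
    · refine ((h.norm_drift_sub_le hℓ hu x η v v').trans hA).trans ?_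
      calc (d + 1) * (m + (1 + ℓ) * ‖η‖) ≤
          (d + 1) * (m + (1 + ℓ) * ‖η‖) * (T ^ κ * τ ^ (-κ)) :=
            le_mul_of_one_le_right (by positivity) h1
        _ = (d + 1) * T ^ κ * τ ^ (-κ) * (m + (1 + ℓ) * ‖η‖) := by ring
        _ ≤ _ := by gcongr; exact le_add_of_nonneg_left (by positivity)

lemma stronglyMeasurable_forcing {α : Type*} [MeasurableSpace α] {N : ℕ} (χ : C(ℝ, ℝ))
    (δ : C(Torus d, ℝ)) {τ : α → ℝ}
    {u : α → C(Torus d, Vel d)} {x : α → Fin N → Torus d} {v : α → Fin N → Vel d}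
    (hτ : Measurable τ)
    (hu : StronglyMeasurable u) (hx : StronglyMeasurable x) (hv : StronglyMeasurable v) :
    StronglyMeasurable fun a => forcing χ δ (τ a) (u a) (x a) (v a) := by
  have h1 : StronglyMeasurable fun a =>
      nonlin χ δ (convMat (τ a)) (lerayMul (τ a)) (u a) (x a) (v a) :=
    stronglyMeasurable_nonlin χ δ (Mc := fun a => convMat (τ a)) (Ml := fun a => lerayMul (τ a))
      (fun l j i k => (measurable_convMat l j i k).comp hτ)
      (fun j i k => (measurable_lerayMul j i k).comp hτ)
      (fun a l j i => summable_norm_convMat (τ a) l j i)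
      (fun a j i => summable_norm_lerayMul (τ a) j i) hu hx hv
  exact h1.neg.prodMk (stronglyMeasurable_drift χ hu hx hv)

/-! ### The Duhamel operator -/

/-- The domain depends on the parameter, so the integral is rewritten over the whole line with an
indicator that is jointly measurable. -/
lemma stronglyMeasurable_integral_Ioo {α F : Type*} [MeasurableSpace α] [NormedAddCommGroup F]
    [NormedSpace ℝ F] {τ : α → ℝ} (hτ : Measurable τ) {f : α → ℝ → F}
    (hf : StronglyMeasurable (Function.uncurry f)) :
    StronglyMeasurable fun a => ∫ s in Ioo 0 (τ a), f a s := by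
  have hS : MeasurableSet {p : α × ℝ | p.2 ∈ Ioo 0 (τ p.1)} :=
    (measurableSet_lt measurable_const measurable_snd).inter
      (measurableSet_lt measurable_snd (hτ.comp measurable_fst))
  have h := (hf.indicator hS).integral_prod_right' (ν := volume)
  convert h using 2 with a
  rw [← integral_indicator measurableSet_Ioo]
  rfl

/-- Positions of the particles with velocities `(z s).2`. -/
def position {N : ℕ} (x₀ : Fin N → Torus d) (z : ℝ → State d N) (t : ℝ) : Fin N → Torus d :=
  fun i => x₀ i + toTorus ((∫ s in Ioo 0 t, (z s).2) i)

/-- The integral term of the mild formulation of the coupled system. -/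
def duhamel {N : ℕ} (χ : C(ℝ, ℝ)) (δ : C(Torus d, ℝ)) (x₀ : Fin N → Torus d)
    (z : ℝ → State d N) (t : ℝ) : State d N :=
  ∫ s in Ioo 0 t, forcing χ δ (t - s) (z s).1 (position x₀ z s) (z s).2

/-! ### Joint measurability of positions and of the Duhamel term in time and randomness -/

section Measurability

variable {N : ℕ} {Ω : Type*} [MeasurableSpace Ω]

lemma stronglyMeasurable_position {x₀ : Ω → Fin N → Torus d} (hx₀ : StronglyMeasurable x₀)
    {z : ℝ → Ω → State d N} (hz : StronglyMeasurable fun p : ℝ × Ω => z p.1 p.2) :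
    StronglyMeasurable fun p : ℝ × Ω => position (x₀ p.2) (fun s => z s p.2) p.1 := by
  have h1 : StronglyMeasurable fun p : ℝ × Ω => ∫ s in Ioo 0 p.1, (z s p.2).2 := by
    refine stronglyMeasurable_integral_Ioo (f := fun (p : ℝ × Ω) s => (z s p.2).2) measurable_fst ?_
    exact (hz.comp_measurable
      (measurable_snd.prodMk (measurable_snd.comp measurable_fst))).snd
  have hc : Continuous fun q : (Fin N → Torus d) × (Fin N → Vel d) =>
      fun i => q.1 i + toTorus (q.2 i) := by
    have := continuous_toTorus (d := d)
    fun_prop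
  exact stronglyMeasurable_comp (f := fun p : ℝ × Ω => (x₀ p.2, ∫ s in Ioo 0 p.1, (z s p.2).2)) hc
    ((hx₀.comp_measurable measurable_snd).prodMk h1)

lemma stronglyMeasurable_duhamel (χ : C(ℝ, ℝ)) (δ : C(Torus d, ℝ)) {x₀ : Ω → Fin N → Torus d}
    (hx₀ : StronglyMeasurable x₀) {z : ℝ → Ω → State d N}
    (hz : StronglyMeasurable fun p : ℝ × Ω => z p.1 p.2) :
    StronglyMeasurable fun p : ℝ × Ω => duhamel χ δ (x₀ p.2) (fun s => z s p.2) p.1 := by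
  have hm : Measurable fun q : (ℝ × Ω) × ℝ => (q.2, q.1.2) :=
    measurable_snd.prodMk (measurable_snd.comp measurable_fst)
  have hz' : StronglyMeasurable fun q : (ℝ × Ω) × ℝ => z q.2 q.1.2 := hz.comp_measurable hm
  refine stronglyMeasurable_integral_Ioo
    (f := fun (p : ℝ × Ω) s => forcing χ δ (p.1 - s) (z s p.2).1
      (position (x₀ p.2) (fun s => z s p.2) s) (z s p.2).2) measurable_fst ?_
  exact stronglyMeasurable_forcing χ δ
    ((measurable_fst.comp measurable_fst).sub measurable_snd) hz'.fst
    ((stronglyMeasurable_position hx₀ hz).comp_measurable hm) hz'.snd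

end Measurability

lemma position_congr {N : ℕ} {x₀ : Fin N → Torus d} {z z' : ℝ → State d N} {t : ℝ}
    (h : ∀ s ∈ Ioo 0 t, z s = z' s) : position x₀ z t = position x₀ z' t := by
  have e : ∫ s in Ioo 0 t, (z s).2 = ∫ s in Ioo 0 t, (z' s).2 :=
    setIntegral_congr_fun measurableSet_Ioo fun s hs => congrArg Prod.snd (h s hs)
  unfold position
  rw [e]

/-- Causality: only the path before time t enters, also through the positions. Adaptedness rests on
this. -/
lemma duhamel_congr {N : ℕ} {χ : C(ℝ, ℝ)} {δ : C(Torus d, ℝ)} {x₀ : Fin N → Torus d}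
    {z z' : ℝ → State d N} {t : ℝ} (h : ∀ s ∈ Ioo 0 t, z s = z' s) :
    duhamel χ δ x₀ z t = duhamel χ δ x₀ z' t := by
  refine setIntegral_congr_fun measurableSet_Ioo fun s hs => ?_
  simp only [h s hs]
  rw [position_congr fun r hr => h r ⟨hr.1, hr.2.trans hs.2⟩]

lemma position_congr_ae {N : ℕ} {x₀ : Fin N → Torus d} {z z' : ℝ → State d N} {T t : ℝ}
    (h : z =ᵐ[volume.restrict (Ioo 0 T)] z') (ht : t ≤ T) :
    position x₀ z t = position x₀ z' t := by
  have h' : z =ᵐ[volume.restrict (Ioo 0 t)] z' :=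
    ae_restrict_of_ae_restrict_of_subset (Ioo_subset_Ioo_right ht) h
  have e : ∫ s in Ioo 0 t, (z s).2 = ∫ s in Ioo 0 t, (z' s).2 :=
    integral_congr_ae (h'.mono fun s hs => congrArg Prod.snd hs)
  unfold position
  rw [e]

/-! ### Estimates on the Duhamel operator -/

section Duhamel

variable {N : ℕ} {χ : C(ℝ, ℝ)} {δ : C(Torus d, ℝ)} {κ T : ℝ}

/-- The weight is chosen so that the growth constant is multiplied by at most 1/2. The induced map R
↦ R₀ + (1 + R)/2 then fixes R = 2R₀ + 1, the bound of all Picard iterates. -/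
lemma IsForcing.exists_norm_duhamel_le (h : IsForcing N χ δ κ T) :
    ∃ l : ℝ, 0 ≤ l ∧ ∀ R : ℝ, 0 ≤ R → ∀ (x₀ : Fin N → Torus d) (z : ℝ → State d N) (t : ℝ),
      0 ≤ t → t ≤ T → (∀ s ∈ Ioo 0 t, ‖z s‖ ≤ R * Real.exp (l * s)) →
      ‖duhamel χ δ x₀ z t‖ ≤ (1 + R) / 2 * Real.exp (l * t) := by
  obtain ⟨C, hC, hG⟩ := h.growth
  obtain ⟨l, hl, hw⟩ := exists_exp_weight h.nonneg h.lt_one T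
    (ρ := 1 / (2 * (C + 1))) (by positivity)
  refine ⟨l, hl, fun R hR x₀ z t ht htT hz => ?_⟩
  obtain ⟨⟨hi, hb⟩, -⟩ := hw t ht htT
  refine (norm_setIntegral_Ioo_le (c := C * (1 + R)) (by positivity) hi hb
    fun s hs => ?_).trans ?_
  · have h0 : 0 < t - s := sub_pos.2 hs.2
    have hp := Real.rpow_nonneg h0.le (-κ)
    have he : 1 ≤ Real.exp (l * s) := Real.one_le_exp (mul_nonneg hl hs.1.le)
    refine (hG (t - s) h0 (by linarith [hs.1]) _ _ _).trans ?_
    calc C * (t - s) ^ (-κ) * (1 + ‖z s‖) ≤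
        C * (t - s) ^ (-κ) * (1 * Real.exp (l * s) + R * Real.exp (l * s)) := by
          gcongr
          · linarith
          · exact hz s hs
      _ = _ := by ring
  · have : C * (1 / (2 * (C + 1))) ≤ 1 / 2 := by
      rw [mul_one_div, div_le_div_iff₀ (by positivity) (by norm_num)]
      linarith
    calc _ = C * (1 / (2 * (C + 1))) * ((1 + R) * Real.exp (l * t)) := by ring
      _ ≤ 1 / 2 * ((1 + R) * Real.exp (l * t)) := by gcongr
      _ = _ := by ring

/-- Evaluation of the fluid velocity at a point. -/
def evalFluid (x : Torus d) : State d N →L[ℝ] Vel d :=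
  ContinuousLinearMap.comp (ContinuousMap.evalCLM ℝ x : C(Torus d, Vel d) →L[ℝ] Vel d)
    (ContinuousLinearMap.fst ℝ _ _)

lemma evalFluid_apply (x : Torus d) (w : State d N) : evalFluid x w = w.1 x := rfl

/-- Increments are images under the continuous linear maps `evalFluid`, which commute with the
integral. If `F` is not integrable the integral is 0 and the claim is trivial. -/
lemma isLip_integral {F : ℝ → State d N} {t c B : ℝ} {g : ℝ → ℝ} (hc : 0 ≤ c)
    (hB0 : 0 ≤ B) (hg : IntegrableOn g (Ioo 0 t)) (hB : ∫ s in Ioo 0 t, g s ≤ B)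
    (h : ∀ s ∈ Ioo 0 t, IsLip (c * g s) (F s).1) :
    IsLip (c * B) (∫ s in Ioo 0 t, F s : State d N).1 := by
  intro x y
  by_cases hF : IntegrableOn F (Ioo 0 t)
  · let E : State d N →L[ℝ] Vel d := evalFluid (x + toTorus y) - evalFluid x
    have hE : ∀ w : State d N, w.1 (x + toTorus y) - w.1 x = E w := fun w => rfl
    rw [hE, ← E.integral_comp_comm hF, mul_right_comm]
    refine norm_setIntegral_Ioo_le (by positivity) hg hB fun s hs => ?_
    rw [← hE, mul_right_comm]
    exact h s hs x y
  · rw [integral_undef hF]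
    simpa using mul_nonneg (mul_nonneg hc hB0) (norm_nonneg y)

/-- Same principle for Lipschitz constants, with the weight t^(-κ') e^(lt), which the singular
integral preserves up to a small factor. The map A ↦ A₀ + (T^κ' + A)/2 fixes A = 2A₀ + T^κ'. -/
lemma IsForcing.exists_isLip_duhamel (h : IsForcing N χ δ κ T) (hT : 0 < T) {M : ℝ}
    (hM : 0 ≤ M) :
    ∃ l : ℝ, 0 ≤ l ∧ ∀ A : ℝ, 0 ≤ A → ∀ (x₀ : Fin N → Torus d) (z : ℝ → State d N) (t : ℝ),
      0 < t → t ≤ T → (∀ s ∈ Ioo 0 t, ‖z s‖ ≤ M) →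
      (∀ s ∈ Ioo 0 t, IsLip (A * (s ^ (-((κ + 1) / 2)) * Real.exp (l * s))) (z s).1) →
      IsLip ((T ^ ((κ + 1) / 2) + A) / 2 * (t ^ (-((κ + 1) / 2)) * Real.exp (l * t)))
        (duhamel χ δ x₀ z t).1 := by
  obtain ⟨C, hC, hG⟩ := h.isLip M hM
  obtain ⟨l, hl, hw⟩ := exists_exp_weight h.nonneg h.lt_one T
    (ρ := 1 / (2 * (C + 1))) (by positivity)
  have hκ := h.nonneg
  set κ' := (κ + 1) / 2 with hκ'
  have hκ'0 : 0 ≤ κ' := by rw [hκ']; linarith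
  have hTp : 0 ≤ T ^ κ' := Real.rpow_nonneg hT.le _
  refine ⟨l, hl, fun A hA x₀ z t ht htT hz hlip => ?_⟩
  obtain ⟨-, hi, hb⟩ := hw t ht.le htT
  have htp := Real.rpow_nonneg ht.le (-κ')
  refine IsLip.mono (isLip_integral (c := C * (T ^ κ' + A)) (by positivity)
    (by positivity) hi hb fun s hs => ?_) ?_
  · have h0 : 0 < t - s := sub_pos.2 hs.2
    have hp := Real.rpow_nonneg h0.le (-κ)
    have hsp := Real.rpow_nonneg hs.1.le (-κ')
    have he : 1 ≤ Real.exp (l * s) := Real.one_le_exp (mul_nonneg hl hs.1.le)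
    have h1 := one_le_rpow_mul_rpow_neg hκ'0 hs.1 (hs.2.le.trans htT)
    refine (hG (t - s) h0 (by linarith [hs.1]) _ (by positivity) _ _ _ (hlip s hs)
      (hz s hs)).mono ?_
    calc C * (t - s) ^ (-κ) * (1 + A * (s ^ (-κ') * Real.exp (l * s))) ≤
        C * (t - s) ^ (-κ) * (T ^ κ' * (s ^ (-κ') * Real.exp (l * s)) +
          A * (s ^ (-κ') * Real.exp (l * s))) := by
          gcongr
          rw [← mul_assoc]
          exact one_le_mul_of_one_le_of_one_le h1 he
      _ = _ := by ring
  · have : C * (1 / (2 * (C + 1))) ≤ 1 / 2 := by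
      rw [mul_one_div, div_le_div_iff₀ (by positivity) (by norm_num)]
      linarith
    calc _ = C * (1 / (2 * (C + 1))) *
          ((T ^ κ' + A) * (t ^ (-κ') * Real.exp (l * t))) := by ring
      _ ≤ 1 / 2 * ((T ^ κ' + A) * (t ^ (-κ') * Real.exp (l * t))) := by gcongr
      _ = _ := by ring

lemma stronglyMeasurable_position_path (x₀ : Fin N → Torus d) {z : ℝ → State d N}
    (hz : StronglyMeasurable z) : StronglyMeasurable (position x₀ z) := by
  have h := stronglyMeasurable_position (Ω := Unit) (x₀ := fun _ => x₀) stronglyMeasurable_const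
    (z := fun s _ => z s) (hz.comp_measurable measurable_fst)
  exact h.comp_measurable (measurable_id.prodMk (measurable_const (a := ())))

lemma IsForcing.integrableOn_forcing (h : IsForcing N χ δ κ T) (x₀ : Fin N → Torus d)
    {z : ℝ → State d N} (hz : AEStronglyMeasurable z (volume.restrict (Ioo 0 T))) {M : ℝ}
    (hM : ∀ s ∈ Ioo 0 T, ‖z s‖ ≤ M) {t : ℝ} (ht : 0 ≤ t) (htT : t ≤ T) :
    IntegrableOn (fun s => forcing χ δ (t - s) (z s).1 (position x₀ z s) (z s).2) (Ioo 0 t) := by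
  obtain ⟨C, hC, hG⟩ := h.growth
  have hsub : Ioo 0 t ⊆ Ioo 0 T := Ioo_subset_Ioo_right htT
  refine Integrable.mono' (((integrableOn_sub_rpow h.lt_one ht).const_mul C).mul_const (1 + M))
    ?_ ?_
  · obtain ⟨w, hw, hzw⟩ := hz
    refine ⟨fun s => forcing χ δ (t - s) (w s).1 (position x₀ w s) (w s).2,
      stronglyMeasurable_forcing χ δ (by fun_prop) hw.fst
        (stronglyMeasurable_position_path x₀ hw) hw.snd, ?_⟩
    filter_upwards [ae_restrict_of_ae_restrict_of_subset hsub hzw,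
      ae_restrict_mem measurableSet_Ioo] with s hs hs'
    rw [position_congr_ae hzw (hs'.2.le.trans htT), hs]
  · refine (ae_restrict_iff' measurableSet_Ioo).2 (Eventually.of_forall fun s hs => ?_)
    have h0 : 0 < t - s := sub_pos.2 hs.2
    have hp := Real.rpow_nonneg h0.le (-κ)
    refine (hG (t - s) h0 (by linarith [hs.1]) _ _ _).trans ?_
    have := hM s (hsub hs)
    exact mul_le_mul_of_nonneg_left (by simpa using this) (by positivity)

lemma integrableOn_state {z : ℝ → State d N}
    (hz : AEStronglyMeasurable z (volume.restrict (Ioo 0 T))) {M : ℝ}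
    (hM : ∀ s ∈ Ioo 0 T, ‖z s‖ ≤ M) {t : ℝ} (htT : t ≤ T) : IntegrableOn z (Ioo 0 t) := by
  have hsub : Ioo 0 t ⊆ Ioo 0 T := Ioo_subset_Ioo_right htT
  refine Integrable.of_bound (hz.mono_measure (Measure.restrict_mono hsub le_rfl)) M ?_
  exact (ae_restrict_iff' measurableSet_Ioo).2 (Eventually.of_forall fun s hs => hM s (hsub hs))

lemma position_eq_add (x₀ : Fin N → Torus d) (z z' : ℝ → State d N) (t : ℝ) :
    position x₀ z t = fun i => position x₀ z' t i +
      toTorus (((∫ s in Ioo 0 t, (z s).2) - ∫ s in Ioo 0 t, (z' s).2) i) := by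
  ext1 i
  simp only [position]
  rw [Pi.sub_apply, toTorus_sub]
  abel

/-- The Duhamel operator is a contraction for a suitable exponential weight, provided that one of
the two fields is Lipschitz. -/
lemma IsForcing.exists_norm_duhamel_sub_le (h : IsForcing N χ δ κ T) (hT : 0 < T) {M A : ℝ}
    (hM : 0 ≤ M) (hA : 0 ≤ A) :
    ∃ l : ℝ, 0 ≤ l ∧ ∀ (x₀ : Fin N → Torus d) (z z' : ℝ → State d N),
      AEStronglyMeasurable z (volume.restrict (Ioo 0 T)) →
      AEStronglyMeasurable z' (volume.restrict (Ioo 0 T)) →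
      (∀ s ∈ Ioo 0 T, ‖z s‖ ≤ M) → (∀ s ∈ Ioo 0 T, ‖z' s‖ ≤ M) →
      (∀ s ∈ Ioo 0 T, IsLip (A * s ^ (-((κ + 1) / 2))) (z s).1) →
      ∀ D : ℝ, 0 ≤ D → (∀ s ∈ Ioo 0 T, ‖z s - z' s‖ ≤ D * Real.exp (l * s)) →
      ∀ t ∈ Icc 0 T,
        ‖duhamel χ δ x₀ z t - duhamel χ δ x₀ z' t‖ ≤ D / 2 * Real.exp (l * t) := by
  obtain ⟨C, hC, hG⟩ := h.lip M hM
  have hκ := h.nonneg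
  have hκ1 := h.lt_one
  set κ' := (κ + 1) / 2 with hκ'
  -- B bounds (1 + A s^(-κ')) s. The factor s comes from integrating the velocity difference into a
  -- displacement, and it compensates the blow-up of the Lipschitz constant at time 0.
  set B := T + A * T ^ (1 - κ') with hB
  have hTp : 0 ≤ T ^ (1 - κ') := Real.rpow_nonneg hT.le _
  have hB0 : 0 ≤ B := by positivity
  obtain ⟨l, hl, hw⟩ := exists_exp_weight h.nonneg h.lt_one T
    (ρ := 1 / (2 * (C * (1 + B) + 1))) (by positivity)
  refine ⟨l, hl, fun x₀ z z' hz hz' hzM hzM' hlip D hD hzz t ht => ?_⟩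
  obtain ⟨⟨hi, hb⟩, -⟩ := hw t ht.1 ht.2
  have hsub : Ioo 0 t ⊆ Ioo 0 T := Ioo_subset_Ioo_right ht.2
  rw [duhamel, duhamel, ← integral_sub (h.integrableOn_forcing x₀ hz hzM ht.1 ht.2)
    (h.integrableOn_forcing x₀ hz' hzM' ht.1 ht.2)]
  refine (norm_setIntegral_Ioo_le (c := C * (1 + B) * D) (by positivity) hi hb
    fun s hs => ?_).trans ?_
  · have h0 : 0 < t - s := sub_pos.2 hs.2
    have hp := Real.rpow_nonneg h0.le (-κ)
    have hsT : s ≤ T := hs.2.le.trans ht.2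
    have hsp := Real.rpow_nonneg hs.1.le (-κ')
    -- Displacement between the two families of positions, lifted to ℝ^d: both start from the same
    -- `x₀`.
    set η := (∫ r in Ioo 0 s, (z r).2) - ∫ r in Ioo 0 s, (z' r).2 with hη
    have hηle : ‖η‖ ≤ s * (D * Real.exp (l * s)) := by
      rw [hη, ← integral_sub (integrableOn_state hz hzM hsT).snd
        (integrableOn_state hz' hzM' hsT).snd]
      refine (norm_setIntegral_le_of_norm_le_const (C := D * Real.exp (l * s)) (by simp)
        fun r hr => ?_).trans_eq ?_
      · refine (norm_snd_le (z r - z' r)).trans ((hzz r ⟨hr.1, hr.2.trans_le hsT⟩).trans ?_)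
        have : l * r ≤ l * s := mul_le_mul_of_nonneg_left hr.2.le hl
        gcongr
      · simp [hs.1.le]; ring
    rw [position_eq_add x₀ z z' s]
    have h1 := hG (t - s) h0 (by linarith [hs.1, ht.2]) _ (by positivity) (z s).1 (z' s).1
      (position x₀ z' s) η (z s).2 (z' s).2 (hlip s (hsub hs)) (hzM' s (hsub hs))
    refine h1.trans ?_
    have h2 : (1 + A * s ^ (-κ')) * s ≤ B := by
      have e : s ^ (-κ') * s = s ^ (1 - κ') := by
        rw [sub_eq_neg_add, Real.rpow_add_one hs.1.ne']
      rw [add_mul, one_mul, mul_assoc, e]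
      have := Real.rpow_le_rpow hs.1.le hsT (show 0 ≤ 1 - κ' by rw [hκ']; linarith)
      rw [hB]
      gcongr
    have h3 : (1 + A * s ^ (-κ')) * ‖η‖ ≤ B * (D * Real.exp (l * s)) := by
      calc _ ≤ (1 + A * s ^ (-κ')) * (s * (D * Real.exp (l * s))) := by gcongr
        _ = ((1 + A * s ^ (-κ')) * s) * (D * Real.exp (l * s)) := by ring
        _ ≤ _ := by gcongr
    calc _ ≤ C * (t - s) ^ (-κ) * (D * Real.exp (l * s) + B * (D * Real.exp (l * s))) :=
          mul_le_mul_of_nonneg_left (add_le_add (hzz s (hsub hs)) h3) (by positivity)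
      _ = _ := by ring
  · have : C * (1 + B) * (1 / (2 * (C * (1 + B) + 1))) ≤ 1 / 2 := by
      have : 0 ≤ C * (1 + B) := by positivity
      rw [mul_one_div, div_le_div_iff₀ (by positivity) (by norm_num)]
      linarith
    calc _ = C * (1 + B) * (1 / (2 * (C * (1 + B) + 1))) * (D * Real.exp (l * t)) := by ring
      _ ≤ 1 / 2 * (D * Real.exp (l * t)) := by gcongr
      _ = _ := by ring

/-- Uniqueness for Volterra inequalities. -/
lemma IsForcing.eq_of_norm_sub_le_duhamel (h : IsForcing N χ δ κ T) (hT : 0 < T) {M A : ℝ}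
    (hM : 0 ≤ M) (hA : 0 ≤ A) (x₀ : Fin N → Torus d) {z z' : ℝ → State d N}
    (hz : AEStronglyMeasurable z (volume.restrict (Ioo 0 T)))
    (hz' : AEStronglyMeasurable z' (volume.restrict (Ioo 0 T)))
    (hzM : ∀ s ∈ Icc 0 T, ‖z s‖ ≤ M) (hzM' : ∀ s ∈ Icc 0 T, ‖z' s‖ ≤ M)
    (hlip : ∀ s ∈ Ioo 0 T, IsLip (A * s ^ (-((κ + 1) / 2))) (z s).1)
    (hle : ∀ t ∈ Icc 0 T,
      ‖z t - z' t‖ ≤ ‖duhamel χ δ x₀ z t - duhamel χ δ x₀ z' t‖) :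
    ∀ t ∈ Icc 0 T, z t = z' t := by
  obtain ⟨l, hl, hc⟩ := h.exists_norm_duhamel_sub_le hT hM hA
  have hI : Ioo 0 T ⊆ Icc 0 T := Ioo_subset_Icc_self
  -- The contraction is iterated: the weighted difference starts below 2M and is halved at each
  -- step.
  have key : ∀ n : ℕ, ∀ t ∈ Icc 0 T, ‖z t - z' t‖ ≤ 2 * M / 2 ^ n * Real.exp (l * t) := by
    intro n
    induction n with
    | zero =>
      intro t ht
      have he : 1 ≤ Real.exp (l * t) := Real.one_le_exp (mul_nonneg hl ht.1)
      calc ‖z t - z' t‖ ≤ M + M := (norm_sub_le _ _).trans (add_le_add (hzM t ht) (hzM' t ht))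
        _ = 2 * M / 2 ^ 0 * 1 := by ring
        _ ≤ _ := by gcongr
    | succ n ih =>
      intro t ht
      refine (hle t ht).trans ((hc x₀ z z' hz hz' (fun s hs => hzM s (hI hs))
        (fun s hs => hzM' s (hI hs)) hlip _ (by positivity) (fun s hs => ih s (hI hs)) t
        ht).trans_eq ?_)
      rw [pow_succ]; ring
  intro t ht
  rw [← sub_eq_zero, ← norm_le_zero_iff]
  have hlim : Tendsto (fun n : ℕ => 2 * M / 2 ^ n * Real.exp (l * t)) atTop (𝓝 0) := by
    have h1 := (tendsto_pow_atTop_nhds_zero_of_lt_one (r := (1 / 2 : ℝ)) (by norm_num)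
      (by norm_num)).const_mul (2 * M * Real.exp (l * t))
    rw [mul_zero] at h1
    refine h1.congr fun n => ?_
    rw [one_div, inv_pow]; ring
  exact ge_of_tendsto' hlim fun n => key n t ht

end Duhamel

/-! ### Picard iteration -/

section Picard

variable {N : ℕ} (χ : C(ℝ, ℝ)) (δ : C(Torus d, ℝ)) (x₀ : Fin N → Torus d) (D : ℝ → State d N)

/-- Picard iterates. -/
def picard : ℕ → ℝ → State d N
  | 0 => fun _ => 0
  | n + 1 => fun t => D t + duhamel χ δ x₀ (picard n) t

/-- The limit of the Picard iterates on `[0, T]`. -/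
def solution (T t : ℝ) : State d N :=
  limUnder atTop fun n => picard χ δ x₀ D n (max 0 (min t T))

variable {χ δ x₀ D}

lemma stronglyMeasurable_picard (hD : StronglyMeasurable D) (n : ℕ) :
    StronglyMeasurable (picard χ δ x₀ D n) := by
  induction n with
  | zero => exact stronglyMeasurable_const
  | succ n ih =>
    have h := stronglyMeasurable_duhamel (Ω := Unit) χ δ (x₀ := fun _ => x₀)
      stronglyMeasurable_const (z := fun s _ => picard χ δ x₀ D n s)
      (ih.comp_measurable measurable_fst)
    exact hD.add (h.comp_measurable (measurable_id.prodMk (measurable_const (a := ()))))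

/-- The Picard iterates converge to a solution of the integral equation, bounded and with
integrable Lipschitz constants. -/
theorem IsForcing.picard {κ T : ℝ} (h : IsForcing N χ δ κ T) (hT : 0 < T)
    (hD : StronglyMeasurable D) {R₀ A₀ : ℝ} (hR₀ : 0 ≤ R₀) (hA₀ : 0 ≤ A₀)
    (hDb : ∀ t ∈ Icc 0 T, ‖D t‖ ≤ R₀)
    (hDl : ∀ t, 0 < t → t ≤ T → IsLip (A₀ * t ^ (-((κ + 1) / 2))) (D t).1) :
    ∃ M A : ℝ, 0 ≤ M ∧ 0 ≤ A ∧ StronglyMeasurable (solution χ δ x₀ D T) ∧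
      (∀ t, Tendsto (fun n => FluidParticle.picard χ δ x₀ D n (max 0 (min t T))) atTop
        (𝓝 (solution χ δ x₀ D T t))) ∧
      (∀ t ∈ Icc 0 T, ‖solution χ δ x₀ D T t‖ ≤ M) ∧
      (∀ t, 0 < t → t ≤ T →
        IsLip (A * t ^ (-((κ + 1) / 2))) (solution χ δ x₀ D T t).1) ∧
      ∀ t ∈ Icc 0 T, solution χ δ x₀ D T t = D t + duhamel χ δ x₀ (solution χ δ x₀ D T) t := by
  set z := FluidParticle.picard χ δ x₀ D with hz
  have hκ := h.nonneg
  set κ' := (κ + 1) / 2 with hκ'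
  have hI : Ioo 0 T ⊆ Icc 0 T := Ioo_subset_Icc_self
  have hTp : 0 ≤ T ^ κ' := Real.rpow_nonneg hT.le _
  obtain ⟨l, hl, hb⟩ := h.exists_norm_duhamel_le
  -- 2R₀ + 1 is the fixed point of R ↦ R₀ + (1 + R)/2.
  have bound : ∀ n, ∀ t ∈ Icc 0 T, ‖z n t‖ ≤ (2 * R₀ + 1) * Real.exp (l * t) := by
    intro n
    induction n with
    | zero => intro t _; simp only [hz, FluidParticle.picard, norm_zero]; positivity
    | succ n ih =>
      intro t ht
      have he : 1 ≤ Real.exp (l * t) := Real.one_le_exp (mul_nonneg hl ht.1)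
      have h1 := hb (2 * R₀ + 1) (by positivity) x₀ (z n) t ht.1 ht.2
        fun s hs => ih s ⟨hs.1.le, hs.2.le.trans ht.2⟩
      calc ‖D t + duhamel χ δ x₀ (z n) t‖ ≤
          R₀ * Real.exp (l * t) + (1 + (2 * R₀ + 1)) / 2 * Real.exp (l * t) :=
            (norm_add_le _ _).trans (add_le_add ((hDb t ht).trans
              (le_mul_of_one_le_right hR₀ he)) h1)
        _ = _ := by ring
  set M := (2 * R₀ + 1) * Real.exp (l * T) with hM
  have hM0 : 0 ≤ M := by positivity
  have boundM : ∀ n, ∀ t ∈ Icc 0 T, ‖z n t‖ ≤ M := fun n t ht =>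
    (bound n t ht).trans (by
      have : l * t ≤ l * T := mul_le_mul_of_nonneg_left ht.2 hl
      rw [hM]; gcongr)
  obtain ⟨m, hm, hlipd⟩ := h.exists_isLip_duhamel hT hM0
  -- 2A₀ + T^κ' is the fixed point of A ↦ A₀ + (T^κ' + A)/2. The uniform Lipschitz bound is what
  -- allows the contraction estimate between consecutive iterates.
  have lip : ∀ n, ∀ t, 0 < t → t ≤ T →
      IsLip ((2 * A₀ + T ^ κ') * (t ^ (-κ') * Real.exp (m * t))) (z n t).1 := by
    intro n
    induction n with
    | zero =>
      intro t ht _ x y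
      have := Real.rpow_nonneg ht.le (-κ')
      simp only [hz, FluidParticle.picard, Prod.fst_zero, ContinuousMap.zero_apply, sub_zero,
        norm_zero]
      positivity
    | succ n ih =>
      intro t ht htT
      have he : 1 ≤ Real.exp (m * t) := Real.one_le_exp (mul_nonneg hm ht.le)
      have hp := Real.rpow_nonneg ht.le (-κ')
      have h1 := hlipd (2 * A₀ + T ^ κ') (by positivity) x₀ (z n) t ht htT
        (fun s hs => boundM n s ⟨hs.1.le, hs.2.le.trans htT⟩)
        fun s hs => ih s hs.1 (hs.2.le.trans htT)
      intro x y
      have e : (z (n + 1) t).1 (x + toTorus y) - (z (n + 1) t).1 x =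
          ((D t).1 (x + toTorus y) - (D t).1 x) +
          ((duhamel χ δ x₀ (z n) t).1 (x + toTorus y) - (duhamel χ δ x₀ (z n) t).1 x) := by
        simp only [hz, FluidParticle.picard, Prod.fst_add, ContinuousMap.add_apply]
        abel
      rw [e]
      refine (norm_add_le _ _).trans ((add_le_add (hDl t ht htT x y) (h1 x y)).trans ?_)
      rw [← add_mul]
      refine mul_le_mul_of_nonneg_right ?_ (norm_nonneg _)
      calc A₀ * t ^ (-κ') + _ ≤ A₀ * (t ^ (-κ') * Real.exp (m * t)) +
          (T ^ κ' + (2 * A₀ + T ^ κ')) / 2 * (t ^ (-κ') * Real.exp (m * t)) := by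
            gcongr
            exact le_mul_of_one_le_right hp he
        _ = _ := by ring
  set A := (2 * A₀ + T ^ κ') * Real.exp (m * T) with hA
  have hA0 : 0 ≤ A := by positivity
  have lipA : ∀ n, ∀ t, 0 < t → t ≤ T → IsLip (A * t ^ (-κ')) (z n t).1 := fun n t ht htT =>
    (lip n t ht htT).mono (by
      have : m * t ≤ m * T := mul_le_mul_of_nonneg_left htT hm
      have hp := Real.rpow_nonneg ht.le (-κ')
      calc _ ≤ (2 * A₀ + T ^ κ') * (t ^ (-κ') * Real.exp (m * T)) := by gcongr
        _ = _ := by rw [hA]; ring)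
  obtain ⟨q, hq, hcon⟩ := h.exists_norm_duhamel_sub_le hT hM0 hA0
  have hmeas : ∀ n, StronglyMeasurable (z n) := stronglyMeasurable_picard hD
  have step : ∀ n, ∀ t ∈ Icc 0 T, ‖z n t - z (n + 1) t‖ ≤ 2 * M * Real.exp (q * t) / 2 ^ n := by
    intro n
    induction n with
    | zero =>
      intro t ht
      have he : 1 ≤ Real.exp (q * t) := Real.one_le_exp (mul_nonneg hq ht.1)
      calc _ ≤ M + M := (norm_sub_le _ _).trans (add_le_add (boundM 0 t ht) (boundM 1 t ht))
        _ = 2 * M * 1 / 2 ^ 0 := by ring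
        _ ≤ _ := by gcongr
    | succ n ih =>
      intro t ht
      have h1 := hcon x₀ (z n) (z (n + 1)) (hmeas n).aestronglyMeasurable
        (hmeas (n + 1)).aestronglyMeasurable (fun s hs => boundM n s (hI hs))
        (fun s hs => boundM (n + 1) s (hI hs)) (fun s hs => lipA n s hs.1 hs.2.le)
        (2 * M / 2 ^ n) (by positivity) (fun s hs => (ih s (hI hs)).trans_eq (by ring)) t ht
      have e : z (n + 1) t - z (n + 1 + 1) t =
          duhamel χ δ x₀ (z n) t - duhamel χ δ x₀ (z (n + 1)) t := by
        simp only [hz, FluidParticle.picard, add_sub_add_left_eq_sub]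
      rw [e]
      refine h1.trans_eq ?_
      rw [pow_succ]; ring
  have stepd : ∀ t ∈ Icc 0 T, ∀ n, dist (z n t) (z (n + 1) t) ≤
      4 * M * Real.exp (q * t) / 2 / 2 ^ n := fun t ht n => by
    rw [dist_eq_norm]
    exact (step n t ht).trans_eq (by ring)
  -- Clamping the time makes the limit exist at every real time, hence strongly measurable on the
  -- whole line.
  have hclamp : ∀ t, max 0 (min t T) ∈ Icc 0 T := fun t =>
    ⟨le_max_left _ _, max_le hT.le (min_le_right _ _)⟩
  have hclamp_eq : ∀ t ∈ Icc 0 T, max 0 (min t T) = t := fun t ht => by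
    rw [min_eq_left ht.2, max_eq_right ht.1]
  have hlim : ∀ t, Tendsto (fun n => z n (max 0 (min t T))) atTop
      (𝓝 (solution χ δ x₀ D T t)) := fun t =>
    (cauchySeq_of_le_geometric_two (stepd _ (hclamp t))).tendsto_limUnder
  set w := solution χ δ x₀ D T with hw
  have hlim' : ∀ t ∈ Icc 0 T, Tendsto (fun n => z n t) atTop (𝓝 (w t)) := fun t ht => by
    have := hlim t
    rwa [hclamp_eq t ht] at this
  have hwm : StronglyMeasurable w := by
    refine stronglyMeasurable_of_tendsto atTop (f := fun n t => z n (max 0 (min t T)))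
      (fun n => (hmeas n).comp_measurable (by fun_prop)) ?_
    rw [tendsto_pi_nhds]
    exact hlim
  have hwM : ∀ t ∈ Icc 0 T, ‖w t‖ ≤ M := fun t ht =>
    le_of_tendsto (hlim' t ht).norm (Eventually.of_forall fun n => boundM n t ht)
  have hwl : ∀ t, 0 < t → t ≤ T → IsLip (A * t ^ (-κ')) (w t).1 := fun t ht htT x y => by
    have hev : ∀ x, Tendsto (fun n => (z n t).1 x) atTop (𝓝 ((w t).1 x)) := fun x =>
      ((evalFluid x : State d N →L[ℝ] Vel d).continuous.tendsto _).comp (hlim' t ⟨ht.le, htT⟩)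
    exact le_of_tendsto ((hev (x + toTorus y)).sub (hev x)).norm
      (Eventually.of_forall fun n => lipA n t ht htT x y)
  refine ⟨M, A, hM0, hA0, hwm, hlim, hwM, hwl, fun t ht => ?_⟩
  have hdist : ∀ n, ∀ s ∈ Icc 0 T, ‖w s - z n s‖ ≤ 4 * M / 2 ^ n * Real.exp (q * s) :=
    fun n s hs => by
      rw [norm_sub_rev, ← dist_eq_norm]
      exact (dist_le_of_le_geometric_two_of_tendsto (stepd s hs) (hlim' s hs) n).trans_eq
        (by ring)
  -- Both sides of the Picard recursion pass to the limit; the right one converges by the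
  -- contraction estimate with the geometric error of `z n`.
  refine tendsto_nhds_unique ((tendsto_add_atTop_iff_nat 1).2 (hlim' t ht)) ?_
  refine Tendsto.const_add (D t) (f := fun n => duhamel χ δ x₀ (z n) t) ?_
  rw [tendsto_iff_norm_sub_tendsto_zero]
  have hz0 : Tendsto (fun n : ℕ => 4 * M / 2 ^ n / 2 * Real.exp (q * t)) atTop (𝓝 0) := by
    have h1 := (tendsto_pow_atTop_nhds_zero_of_lt_one (r := (1 / 2 : ℝ)) (by norm_num)
      (by norm_num)).const_mul (2 * M * Real.exp (q * t))
    rw [mul_zero] at h1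
    refine h1.congr fun n => ?_
    rw [one_div, inv_pow]; ring
  refine squeeze_zero (fun _ => norm_nonneg _) (fun n => ?_) hz0
  rw [norm_sub_rev]
  exact hcon x₀ w (z n) hwm.aestronglyMeasurable (hmeas n).aestronglyMeasurable
    (fun s hs => hwM s (hI hs)) (fun s hs => boundM n s (hI hs))
    (fun s hs => hwl s hs.1 hs.2.le) (4 * M / 2 ^ n) (by positivity)
    (fun s hs => hdist n s (hI hs)) t ht

end Picard

/-! ### From the integral equation to mild solutions -/

lemma isMatrixMultiplier_zero {C : ℝ} (hC : 0 ≤ C) :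
    IsMatrixMultiplier (d := d) (fun _ _ _ => 0) C where
  nonneg := hC
  isMultiplier _ _ := isMultiplier_zero.mono hC
  hermitian _ _ k := by simp

/-- Setting one symbol to zero in `nonlin` isolates the convection or the drag, so that the
integrability of each term follows from the joint statement. -/
lemma vecOp_zero_symbol (f : C(Torus d, Vel d)) :
    vecOp (fun _ _ _ => 0 : Fin d → Fin d → (Fin d → ℤ) → ℂ) f = 0 := by
  ext x j
  rw [vecOp_apply]
  simp_rw [mulOp_apply (m := fun _ => 0) (by simp)]
  simp

/-- Initial data, free evolution of the fluid and noise. -/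
def freeEvolution {N : ℕ} (u₀ : C(Torus d, Vel d)) (w : ℝ → Fin N → Vel d) (t : ℝ) : State d N :=
  (if 0 < t then vecOp (heatMat t) u₀ else u₀, w t)

/-! ### Integrability in time of the nonlinear terms, for general families of symbols -/

section Nonlin

variable {N : ℕ} {χ : C(ℝ, ℝ)} {δ : C(Torus d, ℝ)} {K L κ T C : ℝ}
  {Mc : ℝ → Fin d → Fin d → Fin d → (Fin d → ℤ) → ℂ} {Ml : ℝ → Fin d → Fin d → (Fin d → ℤ) → ℂ}

lemma IsAdmissible.aestronglyMeasurable_nonlin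
    (hMcm : ∀ l j i k, Measurable fun τ => Mc τ l j i k)
    (hMlm : ∀ j i k, Measurable fun τ => Ml τ j i k)
    (hc : ∀ τ, 0 < τ → τ ≤ T → ∀ l, IsMatrixMultiplier (Mc τ l) (C * τ ^ (-κ)))
    (hl : ∀ τ, 0 < τ → τ ≤ T → IsMatrixMultiplier (Ml τ) (C * τ ^ (-κ)))
    {z : ℝ → State d N} {x : ℝ → Fin N → Torus d} {t : ℝ} (htT : t ≤ T)
    (hz : AEStronglyMeasurable z (volume.restrict (Ioo 0 t)))
    (hx : AEStronglyMeasurable x (volume.restrict (Ioo 0 t))) :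
    AEStronglyMeasurable
      (fun s => nonlin χ δ (Mc (t - s)) (Ml (t - s)) (z s).1 (x s) (z s).2)
      (volume.restrict (Ioo 0 t)) := by
  classical
  -- The symbols are known to be summable only for τ in (0, T]; truncating outside gives families to
  -- which the measurability lemma applies at every time.
  set Mc' : ℝ → Fin d → Fin d → Fin d → (Fin d → ℤ) → ℂ := fun τ l j i k =>
    if τ ∈ Ioc 0 T then Mc τ l j i k else 0 with hMc'
  set Ml' : ℝ → Fin d → Fin d → (Fin d → ℤ) → ℂ := fun τ j i k =>
    if τ ∈ Ioc 0 T then Ml τ j i k else 0 with hMl'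
  have e1 : ∀ τ ∈ Ioc 0 T, Mc' τ = Mc τ := fun τ hτ => by
    funext l j i k; simp only [hMc', hτ, if_true]
  have e2 : ∀ τ ∈ Ioc 0 T, Ml' τ = Ml τ := fun τ hτ => by
    funext j i k; simp only [hMl', hτ, if_true]
  have m1 : ∀ l j i k, Measurable fun τ => Mc' τ l j i k := fun l j i k =>
    Measurable.ite measurableSet_Ioc (hMcm l j i k) measurable_const
  have m2 : ∀ j i k, Measurable fun τ => Ml' τ j i k := fun j i k =>
    Measurable.ite measurableSet_Ioc (hMlm j i k) measurable_const
  have s1 : ∀ τ l j i, Summable fun k => ‖Mc' τ l j i k‖ := fun τ l j i => by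
    by_cases hτ : τ ∈ Ioc 0 T
    · rw [e1 τ hτ]; exact ((hc τ hτ.1 hτ.2 l).isMultiplier j i).1
    · simpa only [hMc', hτ, if_false, norm_zero] using summable_zero
  have s2 : ∀ τ j i, Summable fun k => ‖Ml' τ j i k‖ := fun τ j i => by
    by_cases hτ : τ ∈ Ioc 0 T
    · rw [e2 τ hτ]; exact ((hl τ hτ.1 hτ.2).isMultiplier j i).1
    · simpa only [hMl', hτ, if_false, norm_zero] using summable_zero
  obtain ⟨z', hz', hzz⟩ := hz
  obtain ⟨x', hx', hxx⟩ := hx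
  have hsub : Measurable fun s : ℝ => t - s := by fun_prop
  refine ⟨fun s => nonlin χ δ (Mc' (t - s)) (Ml' (t - s)) (z' s).1 (x' s) (z' s).2,
    stronglyMeasurable_nonlin χ δ (Mc := fun s => Mc' (t - s)) (Ml := fun s => Ml' (t - s))
      (fun l j i k => (m1 l j i k).comp hsub) (fun j i k => (m2 j i k).comp hsub)
      (fun s => s1 (t - s)) (fun s => s2 (t - s)) hz'.fst hx' hz'.snd, ?_⟩
  filter_upwards [hzz, hxx, ae_restrict_mem measurableSet_Ioo] with s h1 h2 hs
  have hτ : t - s ∈ Ioc 0 T := ⟨sub_pos.2 hs.2, by linarith [hs.1]⟩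
  rw [h1, h2, e1 _ hτ, e2 _ hτ]

/-- Stated for arbitrary symbols because it serves four times: with the operators of the equation,
with their Bessel-composed versions, and with either of the two terms alone. -/
lemma IsAdmissible.integrableOn_nonlin (h : IsAdmissible χ δ K L) (hκ : κ < 1) (hC : 0 ≤ C)
    (hMcm : ∀ l j i k, Measurable fun τ => Mc τ l j i k)
    (hMlm : ∀ j i k, Measurable fun τ => Ml τ j i k)
    (hc : ∀ τ, 0 < τ → τ ≤ T → ∀ l, IsMatrixMultiplier (Mc τ l) (C * τ ^ (-κ)))
    (hl : ∀ τ, 0 < τ → τ ≤ T → IsMatrixMultiplier (Ml τ) (C * τ ^ (-κ)))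
    {z : ℝ → State d N} {x : ℝ → Fin N → Torus d} {t : ℝ} (ht : 0 ≤ t) (htT : t ≤ T)
    (hz : AEStronglyMeasurable z (volume.restrict (Ioo 0 t)))
    (hx : AEStronglyMeasurable x (volume.restrict (Ioo 0 t))) {M : ℝ} (hM : 0 ≤ M)
    (hzM : ∀ s ∈ Ioo 0 t, ‖z s‖ ≤ M) :
    IntegrableOn (fun s => nonlin χ δ (Mc (t - s)) (Ml (t - s)) (z s).1 (x s) (z s).2)
      (Ioo 0 t) ∧
    ‖∫ s in Ioo 0 t, nonlin χ δ (Mc (t - s)) (Ml (t - s)) (z s).1 (x s) (z s).2‖ ≤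
      (d : ℝ) ^ 2 * C * ((d : ℝ) ^ 2 * K * M + ‖δ‖ * (d * K + M)) *
        (T ^ (1 - κ) / (1 - κ)) := by
  have hK := h.bdd_nonneg
  have hb : ∀ s ∈ Ioo 0 t, ‖nonlin χ δ (Mc (t - s)) (Ml (t - s)) (z s).1 (x s) (z s).2‖ ≤
      (d : ℝ) ^ 2 * C * ((d : ℝ) ^ 2 * K * M + ‖δ‖ * (d * K + M)) * (t - s) ^ (-κ) :=
    fun s hs => by
      have hτ : 0 < t - s := sub_pos.2 hs.2
      have hτT : t - s ≤ T := by linarith [hs.1]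
      have hp := Real.rpow_nonneg hτ.le (-κ)
      have h1 : ‖(z s).1‖ ≤ M := (norm_fst_le (z s)).trans (hzM s hs)
      have h2 : ‖(z s).2‖ ≤ M := (norm_snd_le (z s)).trans (hzM s hs)
      refine (h.norm_nonlin_le (hc _ hτ hτT) (hl _ hτ hτT) _ _ _).trans ?_
      calc _ ≤ (d : ℝ) ^ 2 * (C * (t - s) ^ (-κ)) *
            ((d : ℝ) ^ 2 * K * M + ‖δ‖ * (d * K + M)) := by gcongr
        _ = _ := by ring
  have hi := integrableOn_sub_rpow hκ ht
  refine ⟨Integrable.mono' (hi.const_mul _)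
    (aestronglyMeasurable_nonlin hMcm hMlm hc hl htT hz hx)
    ((ae_restrict_iff' measurableSet_Ioo).2 (Eventually.of_forall hb)), ?_⟩
  refine norm_setIntegral_Ioo_le (by positivity) hi ?_ hb
  rw [setIntegral_sub_rpow hκ ht]
  exact div_le_div_of_nonneg_right (Real.rpow_le_rpow ht htT (by linarith)) (by linarith)

lemma vecCoeff_nonlin_bessel {γ C' : ℝ} {Mc : Fin d → Fin d → Fin d → (Fin d → ℤ) → ℂ}
    {Ml : Fin d → Fin d → (Fin d → ℤ) → ℂ}
    (hc : ∀ l, IsMatrixMultiplier (Mc l) C') (hl : IsMatrixMultiplier Ml C')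
    (hcb : ∀ l, IsMatrixMultiplier (besselMat γ (Mc l)) C')
    (hlb : IsMatrixMultiplier (besselMat γ Ml) C') (u : C(Torus d, Vel d))
    (x : Fin N → Torus d) (v : Fin N → Vel d) (k : Fin d → ℤ) (j : Fin d) :
    vecCoeffCLM k j (nonlin χ δ (fun l => besselMat γ (Mc l)) (besselMat γ Ml) u x v) =
      (besselMul γ k : ℂ) * vecCoeffCLM k j (nonlin χ δ Mc Ml u x v) := by
  have e : ∀ {M : Fin d → Fin d → (Fin d → ℤ) → ℂ} (_ : IsMatrixMultiplier M C')
      (_ : IsMatrixMultiplier (besselMat γ M) C') (f : C(Torus d, Vel d)),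
      vecCoeffCLM k j (vecOp (besselMat γ M) f) =
        (besselMul γ k : ℂ) * vecCoeffCLM k j (vecOp M f) := fun h1 h2 f => by
    rw [vecCoeffCLM_apply, vecCoeffCLM_apply, h1.vecCoeff_vecOp, h2.vecCoeff_vecOp,
      Finset.mul_sum]
    simp only [besselMat, mul_assoc]
  simp only [nonlin, map_add, map_sum, e (hc _) (hcb _), e hl hlb, mul_add, Finset.mul_sum]

/-- Every operator in `nonlin` has the Leray projector as its outer factor, so divergence-freeness
does not depend on the fields. -/
lemma isDivFree_nonlin {τ C' : ℝ} (hc : ∀ l, IsMatrixMultiplier (d := d) (convMat τ l) C')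
    (hl : IsMatrixMultiplier (d := d) (lerayMul τ) C') (u : C(Torus d, Vel d))
    (x : Fin N → Torus d) (v : Fin N → Vel d) :
    IsDivFree (nonlin χ δ (convMat τ) (lerayMul τ) u x v) := by
  refine IsDivFree.add (isDivFree_sum _ fun l _ => isDivFree_vecOp (hc l) (fun i k => ?_) _)
    (isDivFree_vecOp hl (fun i k => sum_mul_lerayMul τ i k) _)
  simp only [convMat]
  simp_rw [mul_left_comm (k _ : ℂ)]
  rw [← Finset.mul_sum, sum_mul_lerayMul, mul_zero]

end Nonlin

section Mild

variable {N : ℕ} {χ : C(ℝ, ℝ)} {δ : C(Torus d, ℝ)} {K L T γ p : ℝ}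

lemma snd_integral_apply {F : ℝ → State d N} {s : Set ℝ} (hF : IntegrableOn F s) (i : Fin N) :
    (∫ r in s, F r : State d N).2 i = ∫ r in s, (F r).2 i := by
  let E : State d N →L[ℝ] Vel d :=
    (ContinuousLinearMap.proj i).comp (ContinuousLinearMap.snd ℝ C(Torus d, Vel d) (Fin N → Vel d))
  exact (E.integral_comp_comm hF).symm

lemma setIntegral_Ioo_eq_interval {F : Type*} [NormedAddCommGroup F] [NormedSpace ℝ F]
    {t : ℝ} (ht : 0 ≤ t) (f : ℝ → F) : ∫ s in Ioo 0 t, f s = ∫ s in (0 : ℝ)..t, f s := by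
  rw [intervalIntegral.integral_of_le ht, integral_Ioc_eq_integral_Ioo]

lemma fst_duhamel_apply {x₀ : Fin N → Torus d} {z : ℝ → State d N} {t : ℝ}
    (hF : IntegrableOn (fun s => forcing χ δ (t - s) (z s).1 (position x₀ z s) (z s).2) (Ioo 0 t))
    (y : Torus d) : (duhamel χ δ x₀ z t).1 y =
      -∫ s in Ioo 0 t,
        nonlin χ δ (convMat (t - s)) (lerayMul (t - s)) (z s).1 (position x₀ z s) (z s).2 y := by
  rw [← evalFluid_apply, duhamel, ← (evalFluid y).integral_comp_comm hF, ← integral_neg]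
  rfl

lemma nonlin_apply_eq {s t : ℝ} (hs : s < t) (u : C(Torus d, Vel d)) (x : Fin N → Torus d)
    (v : Fin N → Vel d) (y : Torus d) :
    nonlin χ δ (convMat (t - s)) (lerayMul (t - s)) u x v y =
      heat (t - s) (leray (convection u fun z => vecCutoff χ (u z))) y +
      heat (t - s) (leray (vecCoeff (dragForce χ δ u x v))) y := by
  have h1 := heat_leray_convection (sub_pos.2 hs) u (cutField χ u) y
  have h2 := heat_leray_vecCoeff (sub_pos.2 hs) (dragField χ δ u x v) y
  rw [nonlin, ContinuousMap.add_apply]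
  exact congrArg₂ (· + ·) h1.symm h2.symm

/-- Mild solutions satisfy the integral equation. -/
lemma IsMildSolution.fst_eq {u₀ : C(Torus d, Vel d)} {x : Fin N → ℝ → Torus d}
    {v : Fin N → ℝ → Vel d} {u : ℝ → C(Torus d, Vel d)}
    (hu : IsMildSolution γ p T χ δ u₀ x v u) {x₀ : Fin N → Torus d} {z : ℝ → State d N}
    (hzu : ∀ s ∈ Icc 0 T, z s = (u s, fun i => v i s))
    (hx : ∀ s ∈ Icc 0 T, position x₀ z s = fun i => x i s) (w : ℝ → Fin N → Vel d) {t : ℝ}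
    (ht : t ∈ Icc 0 T)
    (hF : IntegrableOn (fun s => forcing χ δ (t - s) (z s).1 (position x₀ z s) (z s).2)
      (Ioo 0 t)) :
    u t = (freeEvolution u₀ w t + duhamel χ δ x₀ z t).1 := by
  rcases ht.1.eq_or_lt with rfl | h0
  · simp [freeEvolution, duhamel, hu.initial]
  · ext1 y
    rw [Prod.fst_add, ContinuousMap.add_apply, fst_duhamel_apply hF]
    have e : ∫ s in Ioo 0 t,
        nonlin χ δ (convMat (t - s)) (lerayMul (t - s)) (z s).1 (position x₀ z s) (z s).2 y =
        ∫ s in Ioo 0 t, (heat (t - s) (leray (convection (u s) fun z => vecCutoff χ (u s z))) y +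
          heat (t - s) (leray (vecCoeff
            (dragForce χ δ (u s) (fun i => x i s) fun i => v i s))) y) := by
      refine setIntegral_congr_fun measurableSet_Ioo fun s hs => ?_
      have hs' : s ∈ Icc 0 T := ⟨hs.1.le, hs.2.le.trans ht.2⟩
      rw [nonlin_apply_eq hs.2, hx s hs', hzu s hs']
    have i1 := (intervalIntegrable_iff_integrableOn_Ioo_of_le h0.le).1
      (hu.integrable_convection t ⟨h0, ht.2⟩ y)
    have i2 := (intervalIntegrable_iff_integrableOn_Ioo_of_le h0.le).1
      (hu.integrable_drag t ⟨h0, ht.2⟩ y)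
    rw [e, integral_add i1 i2, setIntegral_Ioo_eq_interval h0.le, setIntegral_Ioo_eq_interval h0.le,
      hu.mild t ⟨h0, ht.2⟩ y, heat_vecCoeff h0]
    simp only [freeEvolution, h0, if_true]
    abel

/-- Solutions of the particle equations satisfy the integral equation. -/
lemma snd_eq_of_isParticleSolution {x₀ : Fin N → Torus d} {v₀ : Fin N → Vel d}
    {b : Fin N → ℝ → Vel d} {σ : ℝ} {x : Fin N → ℝ → Torus d}
    {v : Fin N → ℝ → Vel d} {u : ℝ → C(Torus d, Vel d)}
    (h : ∀ i, IsParticleSolution T χ σ u (x₀ i) (v₀ i) (b i) (x i) (v i)) {z : ℝ → State d N}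
    (hzu : ∀ s ∈ Icc 0 T, z s = (u s, fun i => v i s))
    (hx : ∀ s ∈ Icc 0 T, position x₀ z s = fun i => x i s) (u₀ : C(Torus d, Vel d)) {t : ℝ}
    (ht : t ∈ Icc 0 T)
    (hF : IntegrableOn (fun s => forcing χ δ (t - s) (z s).1 (position x₀ z s) (z s).2)
      (Ioo 0 t)) :
    (fun i => v i t) =
      (freeEvolution u₀ (fun t i => v₀ i + σ • b i t) t + duhamel χ δ x₀ z t).2 := by
  ext1 i
  rw [(h i).velocity t ht, Prod.snd_add, Pi.add_apply, duhamel, snd_integral_apply hF,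
    ← setIntegral_Ioo_eq_interval ht.1]
  have e : ∫ s in Ioo 0 t, (vecCutoff χ (u s (x i s)) - v i s) =
      ∫ s in Ioo 0 t, (forcing χ δ (t - s) (z s).1 (position x₀ z s) (z s).2).2 i := by
    refine setIntegral_congr_fun measurableSet_Ioo fun s hs => ?_
    have hs' : s ∈ Icc 0 T := ⟨hs.1.le, hs.2.le.trans ht.2⟩
    rw [hx s hs', hzu s hs']
    rfl
  rw [e]
  simp only [freeEvolution]
  abel

lemma position_eq_of_isParticleSolution {x₀ : Fin N → Torus d} {v₀ : Fin N → Vel d}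
    {b : Fin N → ℝ → Vel d} {σ : ℝ} {x : Fin N → ℝ → Torus d}
    {v : Fin N → ℝ → Vel d} {u : ℝ → C(Torus d, Vel d)}
    (h : ∀ i, IsParticleSolution T χ σ u (x₀ i) (v₀ i) (b i) (x i) (v i)) {z : ℝ → State d N}
    (hzu : ∀ s ∈ Icc 0 T, z s = (u s, fun i => v i s)) (hz : IntegrableOn z (Ioo 0 T)) {t : ℝ}
    (ht : t ∈ Icc 0 T) : position x₀ z t = fun i => x i t := by
  ext1 i
  have hz' : IntegrableOn z (Ioo 0 t) := hz.mono_set (Ioo_subset_Ioo_right ht.2)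
  rw [(h i).position t ht, position, ← setIntegral_Ioo_eq_interval ht.1]
  congr 2
  have e1 : (∫ s in Ioo 0 t, (z s).2) = (∫ s in Ioo 0 t, z s : State d N).2 :=
    (snd_integral hz').symm
  rw [e1, snd_integral_apply hz']
  refine setIntegral_congr_fun measurableSet_Ioo fun s hs => ?_
  have hs' : s ∈ Icc 0 T := ⟨hs.1.le, hs.2.le.trans ht.2⟩
  simp only [hzu s hs']

end Mild

/-! ### Well-posedness along one path of the noise -/

lemma stronglyMeasurable_freeEvolution {α : Type*} [MeasurableSpace α] {N : ℕ} {τ : α → ℝ}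
    {u₀ : α → C(Torus d, Vel d)} {w : α → ℝ → Fin N → Vel d} (hτ : Measurable τ)
    (hu₀ : StronglyMeasurable u₀) (hw : StronglyMeasurable fun a => w a (τ a)) :
    StronglyMeasurable fun a => freeEvolution (u₀ a) (w a) (τ a) := by
  refine StronglyMeasurable.prodMk (StronglyMeasurable.ite (measurableSet_lt measurable_const hτ)
    (stronglyMeasurable_vecOp (M := fun a => heatMat (τ a))
      (fun j i k => (measurable_heatMat j i k).comp hτ)
      (fun a j i => ((isMatrixMultiplier_heatMat (τ a)).isMultiplier j i).1) hu₀) hu₀) hw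

section FreeEvolution

variable {N : ℕ} {T : ℝ}

lemma norm_freeEvolution_le {u₀ : C(Torus d, Vel d)} {w : ℝ → Fin N → Vel d} {R : ℝ} {t : ℝ}
    (hw : ‖w t‖ ≤ R) : ‖freeEvolution u₀ w t‖ ≤ ((d : ℝ) ^ 2 + 1) * ‖u₀‖ + R := by
  have hR : 0 ≤ R := (norm_nonneg _).trans hw
  refine max_le ?_ (hw.trans (le_add_of_nonneg_left (by positivity)))
  refine le_add_of_le_of_nonneg ?_ hR
  simp only [freeEvolution]
  split_ifs
  · refine ((isMatrixMultiplier_heatMat t).norm_vecOp_le u₀).trans ?_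
    rw [mul_one]
    exact mul_le_mul_of_nonneg_right (by linarith) (norm_nonneg _)
  · exact le_mul_of_one_le_left (norm_nonneg _) (le_add_of_nonneg_left (by positivity))

/-- The heat flow of a bounded field has Lipschitz constant O(t^(-1/2)), at most a constant times
t^(-κ') on (0, T] since κ' ≥ 1/2. -/
lemma isLip_freeEvolution {κ' : ℝ} (hκ' : 1 / 2 ≤ κ') (u₀ : C(Torus d, Vel d))
    (w : ℝ → Fin N → Vel d) {t : ℝ} (ht : 0 < t) (htT : t ≤ T) :
    IsLip ((d : ℝ) ^ 2 * (d * (4 * Real.pi)) * T ^ (κ' - 1 / 2) * ‖u₀‖ * t ^ (-κ'))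
      (freeEvolution u₀ w t).1 := by
  simp only [freeEvolution, ht, if_true]
  refine (isLip_heat ht u₀).mono ?_
  have e : t ^ (-(1 / 2) : ℝ) = t ^ (κ' - 1 / 2) * t ^ (-κ') := by
    rw [← Real.rpow_add ht]; congr 1; ring
  have h1 : t ^ (κ' - 1 / 2) ≤ T ^ (κ' - 1 / 2) := Real.rpow_le_rpow ht.le htT (by linarith)
  have hp := Real.rpow_nonneg ht.le (-κ')
  have hpi := Real.pi_pos
  rw [e]
  calc _ = (d : ℝ) ^ 2 * (d * (4 * Real.pi)) * t ^ (κ' - 1 / 2) * ‖u₀‖ * t ^ (-κ') := by ring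
    _ ≤ _ := by gcongr

end FreeEvolution

section Solution

variable {N : ℕ} {χ : C(ℝ, ℝ)} {δ : C(Torus d, ℝ)} {K L T γ p : ℝ}

/-- Bounded solutions of the integral equation are mild solutions. -/
lemma IsAdmissible.isMildSolution (h : IsAdmissible χ δ K L) (hγ : 0 ≤ γ) (hγ1 : γ < 1)
    (hT : 0 < T) (hp : 1 ≤ p) {u₀ : C(Torus d, Vel d)} (hu₀ : besselNorm γ p u₀ < ∞)
    (hdiv : IsDivFree u₀) {x₀ : Fin N → Torus d} {w : ℝ → Fin N → Vel d} {z : ℝ → State d N}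
    (hz : StronglyMeasurable z) {M : ℝ} (hM : 0 ≤ M) (hzM : ∀ s ∈ Icc 0 T, ‖z s‖ ≤ M)
    (hfix : ∀ t ∈ Icc 0 T, z t = freeEvolution u₀ w t + duhamel χ δ x₀ z t) :
    IsMildSolution γ p T χ δ u₀ (fun i t => position x₀ z t i) (fun i t => (z t).2 i)
      (fun t => (z t).1) := by
  obtain ⟨C, hC, hsm⟩ := exists_smoothing_bound (d := d) hγ hγ1 hT
  have hfor := h.isForcing N hγ hγ1 hT
  set κ := (3 + γ) / 4 with hκ
  have hκ1 : κ < 1 := by rw [hκ]; linarith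
  have hx : StronglyMeasurable (position x₀ z) := stronglyMeasurable_position_path x₀ hz
  have hsub : ∀ {t}, t ≤ T → Ioo 0 t ⊆ Icc 0 T := fun ht s hs => ⟨hs.1.le, hs.2.le.trans ht⟩
  have h0c : ∀ τ : ℝ, 0 < τ → τ ≤ T → ∀ _ : Fin d,
      IsMatrixMultiplier (d := d) (fun _ _ _ => 0) (C * τ ^ (-κ)) := fun τ hτ _ _ =>
    isMatrixMultiplier_zero (mul_nonneg hC (Real.rpow_nonneg hτ.le _))
  have hint : ∀ t ∈ Icc 0 T,
      IntegrableOn (fun s => forcing χ δ (t - s) (z s).1 (position x₀ z s) (z s).2) (Ioo 0 t) :=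
    fun t ht => hfor.integrableOn_forcing x₀ hz.aestronglyMeasurable
      (fun s hs => hzM s (Ioo_subset_Icc_self hs)) ht.1 ht.2
  have hA : ∀ t ∈ Icc 0 T, _ := fun t ht => h.integrableOn_nonlin hκ1 hC (Mc := convMat)
    (Ml := lerayMul) (fun l j i k => measurable_convMat l j i k) (fun j i k => measurable_lerayMul j i k)
    (fun τ h1 h2 => (hsm τ h1 h2).2.2.1) (fun τ h1 h2 => (hsm τ h1 h2).1) ht.1 ht.2
    hz.aestronglyMeasurable hx.aestronglyMeasurable hM fun s hs => hzM s (hsub ht.2 hs)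
  -- The Bessel-composed operators have the same singularity of order κ < 1, so the Bessel potential
  -- of the integral term is a continuous field bounded uniformly in t.
  have hB : ∀ t ∈ Icc 0 T, _ := fun t ht => h.integrableOn_nonlin hκ1 hC
    (Mc := fun τ l => besselMat γ (convMat τ l)) (Ml := fun τ => besselMat γ (lerayMul τ))
    (fun l j i k => measurable_besselMat (measurable_convMat l j i k))
    (fun j i k => measurable_besselMat (measurable_lerayMul j i k))
    (fun τ h1 h2 => (hsm τ h1 h2).2.2.2) (fun τ h1 h2 => (hsm τ h1 h2).2.1) ht.1 ht.2
    hz.aestronglyMeasurable hx.aestronglyMeasurable hM fun s hs => hzM s (hsub ht.2 hs)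
  have hconv : ∀ t ∈ Icc 0 T, ∀ y, IntegrableOn (fun s => heat (t - s)
      (leray (convection (z s).1 fun q => vecCutoff χ ((z s).1 q))) y) (Ioo 0 t) :=
    fun t ht y => by
      have h1 := (h.integrableOn_nonlin hκ1 hC (Mc := convMat) (Ml := fun _ _ _ _ => 0)
        (fun l j i k => measurable_convMat l j i k) (fun j i k => measurable_const)
        (fun τ h1 h2 => (hsm τ h1 h2).2.2.1)
        (fun τ hτ _ => isMatrixMultiplier_zero (mul_nonneg hC (Real.rpow_nonneg hτ.le _)))
        ht.1 ht.2 hz.aestronglyMeasurable hx.aestronglyMeasurable hM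
        fun s hs => hzM s (hsub ht.2 hs)).1
      refine IntegrableOn.congr_fun ((ContinuousMap.evalCLM ℝ y).integrable_comp h1)
        (fun s hs => ?_) measurableSet_Ioo
      rw [nonlin, vecOp_zero_symbol, add_zero]
      exact (heat_leray_convection (sub_pos.2 hs.2) (z s).1 (cutField χ (z s).1) y).symm
  have hdrag : ∀ t ∈ Icc 0 T, ∀ y, IntegrableOn (fun s => heat (t - s)
      (leray (vecCoeff (dragForce χ δ (z s).1 (fun i => position x₀ z s i) fun i => (z s).2 i))) y)
      (Ioo 0 t) :=
    fun t ht y => by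
      have h1 := (h.integrableOn_nonlin hκ1 hC (Mc := fun _ _ _ _ _ => 0) (Ml := lerayMul)
        (fun l j i k => measurable_const) (fun j i k => measurable_lerayMul j i k) h0c
        (fun τ h1 h2 => (hsm τ h1 h2).1)
        ht.1 ht.2 hz.aestronglyMeasurable hx.aestronglyMeasurable hM
        fun s hs => hzM s (hsub ht.2 hs)).1
      refine IntegrableOn.congr_fun ((ContinuousMap.evalCLM ℝ y).integrable_comp h1)
        (fun s hs => ?_) measurableSet_Ioo
      simp only [nonlin, vecOp_zero_symbol, Finset.sum_const_zero, zero_add]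
      exact (heat_leray_vecCoeff (sub_pos.2 hs.2)
        (dragField χ δ (z s).1 (position x₀ z s) (z s).2) y).symm
  have hfst : ∀ t ∈ Ioc 0 T, (z t).1 = vecOp (heatMat t) u₀ - ∫ s in Ioo 0 t,
      nonlin χ δ (convMat (t - s)) (lerayMul (t - s)) (z s).1 (position x₀ z s) (z s).2 :=
    fun t ht => by
      have ht' : t ∈ Icc 0 T := ⟨ht.1.le, ht.2⟩
      ext1 y
      rw [hfix t ht', Prod.fst_add, ContinuousMap.add_apply, fst_duhamel_apply (hint t ht'),
        ContinuousMap.sub_apply, sub_eq_add_neg]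
      congr 1
      · simp only [freeEvolution, ht.1, if_true]
      · congr 1
        exact (ContinuousMap.evalCLM ℝ y : C(Torus d, Vel d) →L[ℝ] Vel d).integral_comp_comm
          (hA t ht').1
  obtain ⟨g, hg, hgn⟩ : ∃ g, IsBesselPotential γ p u₀ g ∧
      eLpNorm g (ENNReal.ofReal p) (torusMeasure d) < ∞ := by
    simp only [besselNorm, iInf_lt_iff] at hu₀
    obtain ⟨g, hg, hgn⟩ := hu₀
    exact ⟨g, hg, hgn⟩
  have hzero : (z 0).1 = u₀ := by
    rw [hfix 0 ⟨le_rfl, hT.le⟩]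
    simp [freeEvolution, duhamel]
  refine ⟨hz.fst.aestronglyMeasurable, ?_, fun t ht => ?_, hzero, fun t ht y => ?_,
    fun t ht y => ?_, fun t ht y => ?_⟩
  · set c := (d : ℝ) ^ 2 * C * ((d : ℝ) ^ 2 * K * M + ‖δ‖ * (d * K + M)) *
      (T ^ (1 - κ) / (1 - κ)) with hc
    refine ⟨(eLpNorm g (ENNReal.ofReal p) (torusMeasure d)).toNNReal + c.toNNReal,
      fun t ht => ?_⟩
    rw [ENNReal.coe_add, ENNReal.coe_toNNReal hgn.ne]
    rcases ht.1.eq_or_lt with rfl | h0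
    · rw [hzero]
      exact (iInf₂_le g hg).trans le_self_add
    · have hb := (hB t ht).2
      rw [hfst t ⟨h0, ht.2⟩]
      -- The potential of the integral term is the integral of the potentials; equality is checked
      -- on Fourier coefficients, which are continuous linear functionals.
      refine (besselNorm_heat_sub_le hp h0 hg (B := ∫ s in Ioo 0 t,
        nonlin χ δ (fun l => besselMat γ (convMat (t - s) l)) (besselMat γ (lerayMul (t - s)))
          (z s).1 (position x₀ z s) (z s).2) fun k j => ?_).trans ?_
      · rw [← vecCoeffCLM_apply, ← vecCoeffCLM_apply,
          ← (vecCoeffCLM k j).integral_comp_comm (hB t ht).1,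
          ← (vecCoeffCLM k j).integral_comp_comm (hA t ht).1, ← integral_const_mul]
        refine setIntegral_congr_fun measurableSet_Ioo fun s hs => ?_
        obtain ⟨h1, h2, h3, h4⟩ := hsm (t - s) (sub_pos.2 hs.2) (by linarith [hs.1, ht.2])
        exact vecCoeff_nonlin_bessel h3 h1 h4 h2 _ _ _ k j
      · exact add_le_add le_rfl (ENNReal.ofReal_le_ofReal hb)
  · rcases ht.1.eq_or_lt with rfl | h0
    · rw [hzero]; exact hdiv
    · rw [hfst t ⟨h0, ht.2⟩]
      refine (isDivFree_heat hdiv t).sub (isDivFree_integral (hA t ht).1 ?_)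
      refine (ae_restrict_iff' measurableSet_Ioo).2 (Eventually.of_forall fun s hs => ?_)
      obtain ⟨h1, h2, h3, h4⟩ := hsm (t - s) (sub_pos.2 hs.2) (by linarith [hs.1, ht.2])
      exact isDivFree_nonlin h3 h1 _ _ _
  · exact (intervalIntegrable_iff_integrableOn_Ioo_of_le ht.1.le).2 (hconv t ⟨ht.1.le, ht.2⟩ y)
  · exact (intervalIntegrable_iff_integrableOn_Ioo_of_le ht.1.le).2 (hdrag t ⟨ht.1.le, ht.2⟩ y)
  · have ht' : t ∈ Icc 0 T := ⟨ht.1.le, ht.2⟩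
    rw [hfix t ht', Prod.fst_add, ContinuousMap.add_apply, fst_duhamel_apply (hint t ht'),
      ← setIntegral_Ioo_eq_interval ht.1.le, ← setIntegral_Ioo_eq_interval ht.1.le, sub_sub,
      ← integral_add (hconv t ht' y) (hdrag t ht' y), sub_eq_add_neg, heat_vecCoeff ht.1]
    congr 1
    · simp only [freeEvolution, ht.1, if_true]
    · congr 1
      exact setIntegral_congr_fun measurableSet_Ioo fun s hs => nonlin_apply_eq hs.2 _ _ _ _

lemma continuousOn_setIntegral_Ioo {F : Type*} [NormedAddCommGroup F] [NormedSpace ℝ F]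
    {f : ℝ → F} (hT : 0 ≤ T) (hf : IntegrableOn f (Ioo 0 T)) :
    ContinuousOn (fun t => ∫ s in Ioo 0 t, f s) (Icc 0 T) := by
  have h1 : IntegrableOn f (uIcc 0 T) := by
    rw [uIcc_of_le hT]; exact (integrableOn_Icc_iff_integrableOn_Ioo).2 hf
  have h2 := intervalIntegral.continuousOn_primitive_interval h1
  rw [uIcc_of_le hT] at h2
  exact h2.congr fun t ht => setIntegral_Ioo_eq_interval ht.1 f

/-- The particle components of solutions of the integral equation. -/
lemma IsForcing.isParticleSolution {κ : ℝ} (h : IsForcing N χ δ κ T)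
    (hT : 0 < T) {u₀ : C(Torus d, Vel d)} {x₀ : Fin N → Torus d} {v₀ : Fin N → Vel d} {σ : ℝ}
    {b : Fin N → ℝ → Vel d} (hb : ∀ i, Continuous (b i)) {z : ℝ → State d N}
    (hz : StronglyMeasurable z) {M : ℝ} (hzM : ∀ s ∈ Icc 0 T, ‖z s‖ ≤ M)
    (hfix : ∀ t ∈ Icc 0 T, z t =
      freeEvolution u₀ (fun t i => v₀ i + σ • b i t) t + duhamel χ δ x₀ z t) (i : Fin N) :
    IsParticleSolution T χ σ (fun t => (z t).1) (x₀ i) (v₀ i) (b i) (fun t => position x₀ z t i)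
      (fun t => (z t).2 i) := by
  have hzi : IntegrableOn z (Ioo 0 T) := integrableOn_state hz.aestronglyMeasurable
    (fun s hs => hzM s (Ioo_subset_Icc_self hs)) le_rfl
  have hint : ∀ t ∈ Icc 0 T,
      IntegrableOn (fun s => forcing χ δ (t - s) (z s).1 (position x₀ z s) (z s).2) (Ioo 0 t) :=
    fun t ht => h.integrableOn_forcing x₀ hz.aestronglyMeasurable
      (fun s hs => hzM s (Ioo_subset_Icc_self hs)) ht.1 ht.2
  have hdi : ∀ t ∈ Icc 0 T, IntegrableOn
      (fun s => vecCutoff χ ((z s).1 (position x₀ z s i)) - (z s).2 i) (Ioo 0 t) := fun t ht =>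
    ((ContinuousLinearMap.proj i : (Fin N → Vel d) →L[ℝ] Vel d).comp
      (ContinuousLinearMap.snd ℝ C(Torus d, Vel d) (Fin N → Vel d))).integrable_comp (hint t ht)
  have hvel : ∀ t ∈ Icc 0 T, (z t).2 i = v₀ i +
      (∫ s in Ioo 0 t, (vecCutoff χ ((z s).1 (position x₀ z s i)) - (z s).2 i)) + σ • b i t :=
    fun t ht => by
      rw [hfix t ht, Prod.snd_add, Pi.add_apply, duhamel, snd_integral_apply (hint t ht)]
      simp only [freeEvolution, forcing, drift]
      abel
  have hTm : T ∈ Icc 0 T := ⟨hT.le, le_rfl⟩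
  have hpos : ∀ t ∈ Icc 0 T, position x₀ z t i = x₀ i + toTorus (∫ s in Ioo 0 t, (z s).2 i) :=
    fun t ht => by
      have hz' : IntegrableOn z (Ioo 0 t) := hzi.mono_set (Ioo_subset_Ioo_right ht.2)
      rw [position, show (∫ s in Ioo 0 t, (z s).2) = (∫ s in Ioo 0 t, z s : State d N).2 from
        (snd_integral hz').symm, snd_integral_apply hz']
  have hvi : IntegrableOn (fun s => (z s).2 i) (Ioo 0 T) :=
    ((ContinuousLinearMap.proj i : (Fin N → Vel d) →L[ℝ] Vel d).comp
      (ContinuousLinearMap.snd ℝ C(Torus d, Vel d) (Fin N → Vel d))).integrable_comp hzi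
  refine ⟨?_, ?_, fun t ht => ?_, fun t ht => ?_, fun t ht => ?_⟩
  · refine ContinuousOn.congr ?_ hpos
    exact continuousOn_const.add
      (continuous_toTorus.comp_continuousOn (continuousOn_setIntegral_Ioo hT.le hvi))
  · refine ContinuousOn.congr ?_ hvel
    exact (continuousOn_const.add (continuousOn_setIntegral_Ioo hT.le (hdi T hTm))).add
      ((hb i).const_smul σ).continuousOn
  · rw [hpos t ht, setIntegral_Ioo_eq_interval ht.1]
  · exact (intervalIntegrable_iff_integrableOn_Ioo_of_le ht.1).2 (hdi t ht)
  · rw [hvel t ht, setIntegral_Ioo_eq_interval ht.1]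

end Solution

section Wellposed

variable {N : ℕ} {χ : C(ℝ, ℝ)} {δ : C(Torus d, ℝ)} {K L T γ p : ℝ}

/-- The integral equation has a solution for continuous noise. -/
lemma IsAdmissible.exists_solution (h : IsAdmissible χ δ K L) (hγ : 0 ≤ γ) (hγ1 : γ < 1)
    (hT : 0 < T) (u₀ : C(Torus d, Vel d)) (x₀ : Fin N → Torus d) {w : ℝ → Fin N → Vel d}
    (hw : Continuous w) :
    ∃ M A : ℝ, 0 ≤ M ∧ 0 ≤ A ∧ StronglyMeasurable (solution χ δ x₀ (freeEvolution u₀ w) T) ∧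
      (∀ t, Tendsto (fun n => picard χ δ x₀ (freeEvolution u₀ w) n (max 0 (min t T))) atTop
        (𝓝 (solution χ δ x₀ (freeEvolution u₀ w) T t))) ∧
      (∀ t ∈ Icc 0 T, ‖solution χ δ x₀ (freeEvolution u₀ w) T t‖ ≤ M) ∧
      (∀ t, 0 < t → t ≤ T → IsLip (A * t ^ (-(((3 + γ) / 4 + 1) / 2)))
        (solution χ δ x₀ (freeEvolution u₀ w) T t).1) ∧
      ∀ t ∈ Icc 0 T, solution χ δ x₀ (freeEvolution u₀ w) T t =
        freeEvolution u₀ w t + duhamel χ δ x₀ (solution χ δ x₀ (freeEvolution u₀ w) T) t := by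
  obtain ⟨R, hR⟩ := isCompact_Icc.exists_bound_of_continuousOn (s := Icc 0 T) hw.continuousOn
  have hR0 : 0 ≤ R := (norm_nonneg _).trans (hR 0 ⟨le_rfl, hT.le⟩)
  have hTp := Real.rpow_nonneg hT.le (((3 + γ) / 4 + 1) / 2 - 1 / 2)
  have hpi := Real.pi_pos
  refine (h.isForcing N hγ hγ1 hT).picard hT ?_
    (R₀ := ((d : ℝ) ^ 2 + 1) * ‖u₀‖ + R) (A₀ := (d : ℝ) ^ 2 * (d * (4 * Real.pi)) *
      T ^ (((3 + γ) / 4 + 1) / 2 - 1 / 2) * ‖u₀‖) (by positivity) (by positivity)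
    (fun t ht => norm_freeEvolution_le (hR t ht))
    (fun t ht htT => isLip_freeEvolution (by linarith) u₀ w ht htT)
  exact stronglyMeasurable_freeEvolution (u₀ := fun _ => u₀) (w := fun _ => w) measurable_id
    stronglyMeasurable_const hw.stronglyMeasurable

/-- Uniqueness for the fluid equation, given the particles. -/
lemma IsAdmissible.mild_unique (h : IsAdmissible χ δ K L) (hγ : γ ∈ Set.Ioo ((d : ℝ) / p) 1)
    (hT : 0 < T) (hp : (d : ℝ) < p) (hp1 : 1 ≤ p) {u₀ : C(Torus d, Vel d)}
    {x₀ : Fin N → Torus d} {w : ℝ → Fin N → Vel d} {z : ℝ → State d N}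
    (hz : StronglyMeasurable z) {M A : ℝ} (hA : 0 ≤ A) (hzM : ∀ s ∈ Icc 0 T, ‖z s‖ ≤ M)
    (hlip : ∀ t, 0 < t → t ≤ T → IsLip (A * t ^ (-(((3 + γ) / 4 + 1) / 2))) (z t).1)
    (hfix : ∀ t ∈ Icc 0 T, z t = freeEvolution u₀ w t + duhamel χ δ x₀ z t)
    {u' : ℝ → C(Torus d, Vel d)} (hu' : IsMildSolution γ p T χ δ u₀
      (fun i t => position x₀ z t i) (fun i t => (z t).2 i) u') :
    ∀ t ∈ Icc 0 T, u' t = (z t).1 := by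
  have hγ0 : 0 ≤ γ := (show (0 : ℝ) ≤ d / p by positivity).trans hγ.1.le
  have hfor := h.isForcing N hγ0 hγ.2 hT
  obtain ⟨C, hC⟩ := hu'.bounded
  -- The class L^∞(H^γ_p) enters uniqueness through this sup bound: the competitor needs no
  -- Lipschitz regularity.
  obtain ⟨M', hM', hb⟩ := exists_norm_le_of_besselNorm_le hp hp1 hγ C
  -- The competitor carries the velocities of the given particles, so its positions are the given
  -- ones by definition.
  set z' : ℝ → State d N := fun t => (u' t, (z t).2) with hz'
  have hz'm : AEStronglyMeasurable z' (volume.restrict (Ioo 0 T)) :=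
    (hu'.aestronglyMeasurable.mono_measure (Measure.restrict_mono Ioo_subset_Icc_self le_rfl)).prodMk
      hz.snd.aestronglyMeasurable
  have hz'M : ∀ s ∈ Icc 0 T, ‖z' s‖ ≤ max M M' := fun s hs =>
    max_le ((hb _ (hC s hs)).trans (le_max_right _ _))
      ((norm_snd_le (z s)).trans ((hzM s hs).trans (le_max_left _ _)))
  have hmain := hfor.eq_of_norm_sub_le_duhamel hT (hM'.trans (le_max_right M M')) hA x₀
    hz.aestronglyMeasurable hz'm (fun s hs => (hzM s hs).trans (le_max_left _ _)) hz'M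
    (fun s hs => hlip s hs.1 hs.2.le) fun t ht => ?_
  · exact fun t ht => (congrArg Prod.fst (hmain t ht)).symm
  · have e1 : (z t).1 = _ := congrArg Prod.fst (hfix t ht)
    have e2 : u' t = _ := hu'.fst_eq (x₀ := x₀) (z := z') (fun s _ => rfl) (fun s _ => rfl) w ht
      (hfor.integrableOn_forcing x₀ hz'm (fun s hs => hz'M s (Ioo_subset_Icc_self hs)) ht.1 ht.2)
    refine max_le ?_ ?_
    · refine le_trans (le_of_eq ?_) (norm_fst_le (duhamel χ δ x₀ z t - duhamel χ δ x₀ z' t))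
      rw [Prod.fst_sub, Prod.fst_sub, e1, show (z' t).1 = u' t from rfl, e2, Prod.fst_add,
        Prod.fst_add, add_sub_add_left_eq_sub]
    · simp [hz']

/-- Uniqueness for the coupled system. -/
lemma IsAdmissible.system_unique (h : IsAdmissible χ δ K L) (hγ : γ ∈ Set.Ioo ((d : ℝ) / p) 1)
    (hT : 0 < T) (hp : (d : ℝ) < p) (hp1 : 1 ≤ p) {u₀ : C(Torus d, Vel d)}
    {x₀ : Fin N → Torus d} {v₀ : Fin N → Vel d} {σ : ℝ} {b : Fin N → ℝ → Vel d}
    {z : ℝ → State d N}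
    (hz : StronglyMeasurable z) {M A : ℝ} (hA : 0 ≤ A) (hzM : ∀ s ∈ Icc 0 T, ‖z s‖ ≤ M)
    (hlip : ∀ t, 0 < t → t ≤ T → IsLip (A * t ^ (-(((3 + γ) / 4 + 1) / 2))) (z t).1)
    (hfix : ∀ t ∈ Icc 0 T, z t =
      freeEvolution u₀ (fun t i => v₀ i + σ • b i t) t + duhamel χ δ x₀ z t)
    {u' : ℝ → C(Torus d, Vel d)} {x' : Fin N → ℝ → Torus d} {v' : Fin N → ℝ → Vel d}
    (hu' : IsSystemSolution γ p T χ δ σ u₀ x₀ v₀ b u' x' v') :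
    ∀ t ∈ Icc 0 T, u' t = (z t).1 ∧ ∀ i, x' i t = position x₀ z t i ∧ v' i t = (z t).2 i := by
  have hγ0 : 0 ≤ γ := (show (0 : ℝ) ≤ d / p by positivity).trans hγ.1.le
  have hfor := h.isForcing N hγ0 hγ.2 hT
  obtain ⟨hu', hpart⟩ := hu'
  obtain ⟨C, hC⟩ := hu'.bounded
  obtain ⟨M', hM', hb⟩ := exists_norm_le_of_besselNorm_le hp hp1 hγ C
  have hvc : ContinuousOn (fun t i => v' i t) (Icc 0 T) :=
    continuousOn_pi.2 fun i => (hpart i).continuousOn_velocity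
  obtain ⟨R, hR⟩ := isCompact_Icc.exists_bound_of_continuousOn hvc
  -- Here the velocities are those of the competitor, and its positions are recovered from them by
  -- the first particle equation.
  set z' : ℝ → State d N := fun t => (u' t, fun i => v' i t) with hz'
  have hz'm : AEStronglyMeasurable z' (volume.restrict (Ioo 0 T)) :=
    (hu'.aestronglyMeasurable.prodMk (hvc.aestronglyMeasurable measurableSet_Icc)).mono_measure
      (Measure.restrict_mono Ioo_subset_Icc_self le_rfl)
  have hz'M : ∀ s ∈ Icc 0 T, ‖z' s‖ ≤ max M (max M' R) := fun s hs =>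
    max_le ((hb _ (hC s hs)).trans ((le_max_left _ _).trans (le_max_right _ _)))
      ((hR s hs).trans ((le_max_right _ _).trans (le_max_right _ _)))
  have hpos : ∀ t ∈ Icc 0 T, position x₀ z' t = fun i => x' i t := fun t ht =>
    position_eq_of_isParticleSolution hpart (fun s _ => rfl)
      (integrableOn_state hz'm (fun s hs => hz'M s (Ioo_subset_Icc_self hs)) le_rfl) ht
  have hmain := hfor.eq_of_norm_sub_le_duhamel hT
    (hM'.trans ((le_max_left M' R).trans (le_max_right M _))) hA x₀
    hz.aestronglyMeasurable hz'm (fun s hs => (hzM s hs).trans (le_max_left _ _)) hz'M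
    (fun s hs => hlip s hs.1 hs.2.le) fun t ht => ?_
  · intro t ht
    have e := hmain t ht
    have e' : position x₀ z t = fun i => x' i t := by
      rw [← hpos t ht]
      exact position_congr fun s hs => hmain s ⟨hs.1.le, hs.2.le.trans ht.2⟩
    refine ⟨(congrArg Prod.fst e).symm, fun i => ⟨?_, ?_⟩⟩
    · rw [e']
    · rw [e]
  · have hF := hfor.integrableOn_forcing x₀ hz'm (fun s hs => hz'M s (Ioo_subset_Icc_self hs))
      ht.1 ht.2
    have e : z' t = freeEvolution u₀ (fun t i => v₀ i + σ • b i t) t + duhamel χ δ x₀ z' t :=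
      Prod.ext (hu'.fst_eq (x₀ := x₀) (z := z') (fun s _ => rfl) hpos _ ht hF)
        (snd_eq_of_isParticleSolution hpart (fun s _ => rfl) hpos u₀ ht hF)
    rw [e, hfix t ht, add_sub_add_left_eq_sub]

end Wellposed

/-! ### Dependence on the randomness -/

section Randomness

variable {N : ℕ} {χ : C(ℝ, ℝ)} {δ : C(Torus d, ℝ)} {K L T γ : ℝ}

lemma stronglyMeasurable_picard_random {Ω : Type*} [MeasurableSpace Ω]
    {u₀ : Ω → C(Torus d, Vel d)} (hu₀ : StronglyMeasurable u₀) {x₀ : Ω → Fin N → Torus d}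
    (hx₀ : StronglyMeasurable x₀) {w : Ω → ℝ → Fin N → Vel d}
    (hw : StronglyMeasurable fun q : ℝ × Ω => w q.2 q.1) (n : ℕ) :
    StronglyMeasurable fun q : ℝ × Ω =>
      picard χ δ (x₀ q.2) (freeEvolution (u₀ q.2) (w q.2)) n q.1 := by
  induction n with
  | zero => exact stronglyMeasurable_const
  | succ n ih =>
    exact (stronglyMeasurable_freeEvolution (u₀ := fun q : ℝ × Ω => u₀ q.2)
      (w := fun q : ℝ × Ω => w q.2) measurable_fst (hu₀.comp_measurable measurable_snd) hw).add
      (stronglyMeasurable_duhamel χ δ hx₀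
        (z := fun s ω => picard χ δ (x₀ ω) (freeEvolution (u₀ ω) (w ω)) n s) ih)

lemma IsAdmissible.stronglyMeasurable_solution (h : IsAdmissible χ δ K L) (hγ : 0 ≤ γ)
    (hγ1 : γ < 1) (hT : 0 < T) {Ω : Type*} [MeasurableSpace Ω]
    {u₀ : Ω → C(Torus d, Vel d)} (hu₀ : StronglyMeasurable u₀) {x₀ : Ω → Fin N → Torus d}
    (hx₀ : StronglyMeasurable x₀) {w : Ω → ℝ → Fin N → Vel d}
    (hw : StronglyMeasurable fun q : ℝ × Ω => w q.2 q.1) (hwc : ∀ ω, Continuous (w ω)) :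
    StronglyMeasurable fun q : ℝ × Ω =>
      solution χ δ (x₀ q.2) (freeEvolution (u₀ q.2) (w q.2)) T q.1 := by
  refine stronglyMeasurable_of_tendsto atTop (f := fun n (q : ℝ × Ω) =>
    picard χ δ (x₀ q.2) (freeEvolution (u₀ q.2) (w q.2)) n (max 0 (min q.1 T))) (fun n => ?_) ?_
  · exact (stronglyMeasurable_picard_random hu₀ hx₀ hw n).comp_measurable
      (g := fun q : ℝ × Ω => (max 0 (min q.1 T), q.2)) (by fun_prop)
  · rw [tendsto_pi_nhds]
    intro q
    obtain ⟨-, -, -, -, -, hlim, -⟩ := h.exists_solution hγ hγ1 hT (u₀ q.2) (x₀ q.2) (hwc q.2)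
    exact hlim q.1

/-- The Picard iterates are causal. -/
lemma picard_congr {x₀ : Fin N → Torus d} {D D' : ℝ → State d N} {t : ℝ}
    (h : ∀ s ≤ t, D s = D' s) (n : ℕ) :
    ∀ s ≤ t, picard χ δ x₀ D n s = picard χ δ x₀ D' n s := by
  induction n with
  | zero => intro s _; rfl
  | succ n ih =>
    intro s hs
    simp only [picard]
    rw [h s hs, duhamel_congr fun r hr => ih r (hr.2.le.trans hs)]

lemma solution_congr {x₀ : Fin N → Torus d} {D D' : ℝ → State d N} {t : ℝ} (ht : 0 ≤ t)
    (h : ∀ s ≤ t, D s = D' s) :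
    ∀ s ≤ t, solution χ δ x₀ D T s = solution χ δ x₀ D' T s := by
  intro s hs
  simp only [solution]
  congr 1
  ext1 n
  exact picard_congr h n _ (max_le ht ((min_le_left _ _).trans hs))

end Randomness

/-! ### The convection term as a function -/

lemma coeff_toLp {f : Torus d → ℂ} (hf : MemLp f 2 (torusMeasure d)) (k : Fin d → ℤ) :
    mFourierCoeff hf.toLp k = mFourierCoeff f k := by
  rw [coeff_def, coeff_def]
  exact integral_congr_ae (hf.coeFn_toLp.mono fun x hx => by simp only [hx])

lemma hasSum_conj_coeff_mul_coeff {f g : Torus d → ℂ} (hf : MemLp f 2 (torusMeasure d))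
    (hg : MemLp g 2 (torusMeasure d)) :
    HasSum (fun m => (starRingEnd ℂ) (mFourierCoeff f m) * mFourierCoeff g m)
      (∫ x, (starRingEnd ℂ) (f x) * g x ∂torusMeasure d) := by
  have h : HasSum (fun m => (starRingEnd ℂ) (mFourierCoeff (hf.toLp f) m) * mFourierCoeff (hg.toLp g) m)
      (∫ x, (starRingEnd ℂ) (hf.toLp f x) * hg.toLp g x ∂torusMeasure d) :=
    hasSum_prod_mFourierCoeff (d := Fin d) hf.toLp hg.toLp
  simp_rw [coeff_toLp] at h
  convert h using 1
  refine integral_congr_ae ?_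
  filter_upwards [hf.coeFn_toLp, hg.coeFn_toLp] with x h1 h2
  rw [h1, h2]

lemma memLp_of_continuous {E : Type*} [NormedAddCommGroup E] {f : Torus d → E}
    (hf : Continuous f) (q : ℝ≥0∞) : MemLp f q (torusMeasure d) := by
  have := (integrable_of_continuous hf).aestronglyMeasurable
  refine MemLp.of_bound this ‖(⟨f, hf⟩ : C(Torus d, E))‖ (Eventually.of_forall fun x => ?_)
  exact (⟨f, hf⟩ : C(Torus d, E)).norm_coe_le_norm x

/-- Bessel's inequality, followed by the bound of the L² norm by the sup norm on a probability
space. -/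
lemma sum_sq_coeff_le (f : C(Torus d, ℂ)) (F : Finset (Fin d → ℤ)) :
    ∑ k ∈ F, ‖mFourierCoeff f k‖ ^ 2 ≤ ‖f‖ ^ 2 := by
  have hf := memLp_of_continuous f.continuous 2
  have h : HasSum (fun m => ‖mFourierCoeff (hf.toLp f) m‖ ^ 2) (∫ x, ‖hf.toLp f x‖ ^ 2 ∂torusMeasure d) :=
    hasSum_sq_mFourierCoeff (d := Fin d) hf.toLp
  simp_rw [coeff_toLp] at h
  refine (sum_le_hasSum F (fun _ _ => sq_nonneg _) h).trans ?_
  have e : ∫ t, ‖hf.toLp f t‖ ^ 2 ∂torusMeasure d = ∫ t, ‖f t‖ ^ 2 ∂torusMeasure d :=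
    integral_congr_ae (hf.coeFn_toLp.mono fun x hx => by simp only [hx])
  rw [e]
  refine (integral_mono_of_nonneg (Eventually.of_forall fun x => sq_nonneg _)
    (integrable_const (‖f‖ ^ 2)) (Eventually.of_forall fun x => ?_)).trans_eq (by simp)
  exact pow_le_pow_left₀ (norm_nonneg _) (f.norm_coe_le_norm x) 2

/-- Fourier coefficients of the product of a real continuous function and an `L²` function. -/
lemma hasSum_coeff_mul {f : Torus d → ℝ} (hf : Continuous f) {g : Torus d → ℂ}
    (hg : MemLp g 2 (torusMeasure d)) (k : Fin d → ℤ) :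
    HasSum (fun m => mFourierCoeff (fun x => (f x : ℂ)) (k - m) * mFourierCoeff g m)
      (mFourierCoeff (fun x => (f x : ℂ) * g x) k) := by
  have hF : MemLp (fun x => mFourier k x * (f x : ℂ)) 2 (torusMeasure d) :=
    memLp_of_continuous (by fun_prop) 2
  have h := hasSum_conj_coeff_mul_coeff hF hg
  have e1 : ∀ m, (starRingEnd ℂ) (mFourierCoeff (fun x => mFourier k x * (f x : ℂ)) m) =
      mFourierCoeff (fun x => (f x : ℂ)) (k - m) := fun m => by
    rw [← neg_sub m k, coeff_neg_of_real]
    congr 1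
    rw [coeff_def, coeff_def]
    congr 1
    ext x
    rw [neg_sub, sub_eq_neg_add, mFourier_add, mul_assoc]
  simp_rw [e1] at h
  convert h using 1
  rw [coeff_def]
  congr 1
  ext x
  rw [map_mul, ← mFourier_neg, Complex.conj_ofReal, mul_assoc]

/-- Difference quotients in the direction `l` are bounded by ℓ in sup norm, and their coefficients
are those of w times (e^(2πi k_l h) - 1)/h. On a finite set of frequencies one may let h → 0. -/
lemma sum_sq_grad_coeff_le {w : C(Torus d, Vel d)} {ℓ : ℝ} (hℓ : 0 ≤ ℓ) (hw : IsLip ℓ w)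
    (l j : Fin d) (F : Finset (Fin d → ℤ)) :
    ∑ k ∈ F, ‖2 * (Real.pi : ℂ) * Complex.I * (k l : ℂ) * vecCoeff w k j‖ ^ 2 ≤ ℓ ^ 2 := by
  have hder : ∀ k : Fin d → ℤ, Tendsto (fun h : ℝ => h⁻¹ •
      (Complex.exp (2 * Real.pi * Complex.I * ((k l : ℝ) * h : ℝ)) - 1)) (𝓝[≠] 0)
      (𝓝 (2 * (Real.pi : ℂ) * Complex.I * (k l : ℂ))) := fun k => by
    have h1 : HasDerivAt (fun h : ℝ => Complex.exp (2 * Real.pi * Complex.I * ((k l : ℝ) * h : ℝ)))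
        (Complex.exp (2 * Real.pi * Complex.I * ((k l : ℝ) * (0 : ℝ) : ℝ)) *
          (2 * Real.pi * Complex.I * ((k l : ℝ) * 1 : ℝ))) 0 :=
      ((((hasDerivAt_id (0 : ℝ)).const_mul (k l : ℝ)).ofReal_comp).const_mul _).cexp
    have h2 := hasDerivAt_iff_tendsto_slope_zero.1 h1
    simpa using h2
  have hlim : Tendsto (fun h : ℝ => ∑ k ∈ F, ‖(h⁻¹ •
      (Complex.exp (2 * Real.pi * Complex.I * ((k l : ℝ) * h : ℝ)) - 1)) * vecCoeff w k j‖ ^ 2)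
      (𝓝[≠] 0)
      (𝓝 (∑ k ∈ F, ‖2 * (Real.pi : ℂ) * Complex.I * (k l : ℂ) * vecCoeff w k j‖ ^ 2)) :=
    tendsto_finsetSum _ fun k _ => (((hder k).mul_const _).norm).pow 2
  refine le_of_tendsto hlim ?_
  filter_upwards [self_mem_nhdsWithin] with h hh
  have hh0 : h ≠ 0 := hh
  set y : Vel d := h • EuclideanSpace.single l 1 with hy
  have hny : ‖y‖ = |h| := by simp [hy, norm_smul]
  have hc : ∀ k, mFourierCoeff (ccomp j (translate (toTorus y) w - w)) k =
      (Complex.exp (2 * Real.pi * Complex.I * ((k l : ℝ) * h : ℝ)) - 1) * vecCoeff w k j :=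
    fun k => by
      have e1 := coeff_translate (fun x => ((w x j : ℝ) : ℂ)) (toTorus y) k
      have e2 : mFourier k (toTorus y) =
          Complex.exp (2 * Real.pi * Complex.I * ((k l : ℝ) * h : ℝ)) := by
        rw [mFourier_toTorus]
        congr 4
        rw [Finset.sum_eq_single l]
        · simp [hy]
        · intro i _ hi
          simp [hy, hi]
        · simp
      rw [map_sub, ← coeffCLM_apply, map_sub, sub_mul, one_mul, ← e2]
      exact congrArg₂ (· - ·) e1 rfl
  have hs := sum_sq_coeff_le (ccomp j (translate (toTorus y) w - w)) F
  have hn : ‖ccomp j (translate (toTorus y) w - w)‖ ≤ ℓ * |h| := by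
    rw [← hny]
    exact (norm_ccomp_le _ _).trans ((isLip_iff_translate hℓ).1 hw y)
  simp_rw [hc] at hs
  have hs' := hs.trans (pow_le_pow_left₀ (norm_nonneg _) hn 2)
  calc _ = (|h| ^ 2)⁻¹ * ∑ k ∈ F,
        ‖(Complex.exp (2 * Real.pi * Complex.I * ((k l : ℝ) * h : ℝ)) - 1) * vecCoeff w k j‖ ^ 2 := by
        rw [Finset.mul_sum]
        refine Finset.sum_congr rfl fun k _ => ?_
        rw [smul_mul_assoc, norm_smul, mul_pow, norm_inv, Real.norm_eq_abs, inv_pow]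
    _ ≤ (|h| ^ 2)⁻¹ * (ℓ * |h|) ^ 2 := by gcongr
    _ = ℓ ^ 2 := by
        have : |h| ≠ 0 := abs_ne_zero.2 hh0
        field_simp

/-- A hermitian square-summable family is the family of Fourier coefficients of a real function of
`L²`. -/
lemma exists_real_coeff {a : (Fin d → ℤ) → ℂ} (ha : IsHermitianSymbol a) {C : ℝ}
    (hC : ∀ F : Finset (Fin d → ℤ), ∑ k ∈ F, ‖a k‖ ^ 2 ≤ C) :
    ∃ g : Torus d → ℝ, MemLp g 2 (torusMeasure d) ∧
      ∀ k, mFourierCoeff (fun x => (g x : ℂ)) k = a k := by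
  have hm : Memℓp a 2 := memℓp_gen' (C := C) fun s => by simpa using hC s
  set f := (mFourierBasis (d := Fin d)).repr.symm ⟨a, hm⟩ with hf
  have hfc : ∀ k, mFourierCoeff f k = a k := fun k => by
    rw [← mFourierBasis_repr, hf, LinearIsometryEquiv.apply_symm_apply]
  have hfm : MemLp f 2 (torusMeasure d) := Lp.memLp f
  have hfi : Integrable f (torusMeasure d) := hfm.integrable (by norm_num)
  -- By Hermitian symmetry the conjugate of f has the same coefficients as f, so taking the real
  -- part does not change them.
  refine ⟨fun x => (f x).re, hfm.re, fun k => ?_⟩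
  have hconj : mFourierCoeff (fun x => (starRingEnd ℂ) (f x)) k = a k := by
    have e : (starRingEnd ℂ) (mFourierCoeff f (-k)) = a k := by
      rw [hfc, ha, Complex.conj_conj]
    rw [← e, coeff_def, coeff_def, ← integral_conj]
    congr 1
    ext x
    rw [map_mul, ← mFourier_neg, neg_neg]
  have hci : Integrable (fun x => (starRingEnd ℂ) (f x)) (torusMeasure d) := by
    exact (Complex.conjLIE.toContinuousLinearEquiv.toContinuousLinearMap).integrable_comp hfi
  have e : ∀ x, mFourier (-k) x * (((f x).re : ℝ) : ℂ) =
      (1 / 2 : ℂ) * (mFourier (-k) x * f x + mFourier (-k) x * (starRingEnd ℂ) (f x)) := fun x => by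
    rw [Complex.re_eq_add_conj]; ring
  rw [coeff_def]
  simp_rw [e]
  rw [integral_const_mul, integral_add (integrable_mFourier_mul hfi _)
    (integrable_mFourier_mul hci _), ← coeff_def, ← coeff_def, hconj]
  change 1 / 2 * (mFourierCoeff f k + a k) = a k
  rw [hfc]; ring

lemma exists_isWeakGradient {w : C(Torus d, Vel d)} {ℓ : ℝ} (hℓ : 0 ≤ ℓ) (hw : IsLip ℓ w) :
    ∃ G : Fin d → Torus d → Vel d, IsWeakGradient w G := by
  have h : ∀ l j : Fin d, ∃ g : Torus d → ℝ, MemLp g 2 (torusMeasure d) ∧ ∀ k,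
      mFourierCoeff (fun x => (g x : ℂ)) k =
        2 * (Real.pi : ℂ) * Complex.I * (k l : ℂ) * vecCoeff w k j := fun l j => by
    refine exists_real_coeff (fun k => ?_) (sum_sq_grad_coeff_le hℓ hw l j)
    have e : vecCoeff w (-k) j = (starRingEnd ℂ) (vecCoeff w k j) :=
      coeff_neg_of_real (fun x => w x j) k
    rw [e]
    simp [map_ofNat]
  choose g hg hgc using h
  refine ⟨fun l x => WithLp.toLp 2 fun j => g l j x, fun l => ⟨?_, fun k j => hgc l j k⟩⟩
  have e : (fun x => (WithLp.toLp 2 fun j => g l j x : Vel d)) =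
      fun x => ∑ j, g l j x • (EuclideanSpace.single j 1 : Vel d) := by
    ext x i
    simp [Pi.single_apply]
  change MemLp (fun x => (WithLp.toLp 2 fun j => g l j x : Vel d)) 2 (torusMeasure d)
  rw [e]
  exact memLp_finsetSum _ fun j _ =>
    ((ContinuousLinearMap.id ℝ ℝ).smulRight (EuclideanSpace.single j 1 : Vel d)).comp_memLp' (hg l j)

/-- The product rule in Fourier space: in the convolution of û_l(k - m) with ŵ(m) write k_l = m_l +
(k - m)_l. The first part is the coefficient of u_l ∂_l w, and the second sums over l to (k - m) ·
û(k - m) = 0. -/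
lemma IsDivFree.isConvectionFunction {u w : C(Torus d, Vel d)} (hu : IsDivFree u) {ℓ : ℝ}
    (hℓ : 0 ≤ ℓ) (hw : IsLip ℓ w) : IsConvectionFunction u w := by
  obtain ⟨G, hG⟩ := exists_isWeakGradient hℓ hw
  have hmem : ∀ l, MemLp (fun x => u x l • G l x) 2 (torusMeasure d) := fun l => by
    have hc : Continuous fun x => u x l := by fun_prop
    refine MemLp.of_le_mul (c := ‖u‖) (hG l).1
      (hc.aestronglyMeasurable.smul (hG l).1.aestronglyMeasurable)
      (Eventually.of_forall fun x => ?_)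
    rw [norm_smul, Real.norm_eq_abs]
    exact mul_le_mul_of_nonneg_right ((norm_apply_le _ _).trans (u.norm_coe_le_norm x))
      (norm_nonneg _)
  refine ⟨G, hG, memLp_finsetSum _ fun l _ => hmem l, ?_⟩
  ext k j
  have hcomp : ∀ l, MemLp (fun x => ((G l x j : ℝ) : ℂ)) 2 (torusMeasure d) := fun l =>
    ((Complex.ofRealCLM.comp (EuclideanSpace.proj j : Vel d →L[ℝ] ℝ))).comp_memLp' (hG l).1
  have hwc : MemLp (fun x => ((w x j : ℝ) : ℂ)) 2 (torusMeasure d) :=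
    memLp_of_continuous (by fun_prop) 2
  have hul : ∀ l, Continuous fun x => u x l := fun l => by fun_prop
  have h1 := hasSum_sum fun l (_ : l ∈ Finset.univ) => hasSum_coeff_mul (hul l) (hcomp l) k
  have h2 := hasSum_sum fun l (_ : l ∈ Finset.univ) => (hasSum_coeff_mul (hul l) hwc k).mul_left
    (2 * (Real.pi : ℂ) * Complex.I * (k l : ℂ))
  have e1 : vecCoeff (fun x => ∑ l, u x l • G l x) k j =
      ∑ l, mFourierCoeff (fun x => (u x l : ℂ) * ((G l x j : ℝ) : ℂ)) k := by
    have hi : ∀ l, Integrable (fun x => (u x l : ℂ) * ((G l x j : ℝ) : ℂ)) (torusMeasure d) :=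
      fun l => by
        have := integrable_component ((hmem l).integrable (by norm_num)) j
        simpa using this
    simp only [vecCoeff, coeff_def]
    rw [← integral_finsetSum _ fun l _ => integrable_mFourier_mul (hi l) _]
    congr 1
    ext x
    simp [Finset.mul_sum]
  have e2 : convection u w k j = ∑ l, 2 * (Real.pi : ℂ) * Complex.I * (k l : ℂ) *
      mFourierCoeff (fun x => (u x l : ℂ) * ((w x j : ℝ) : ℂ)) k := by
    simp only [convection, Complex.ofReal_mul]
  rw [e1, e2]
  refine h2.unique (h1.congr_fun fun m => ?_)
  have hdiv := hu (k - m)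
  have hGl : ∀ l, mFourierCoeff (fun x => ((G l x j : ℝ) : ℂ)) m =
      2 * (Real.pi : ℂ) * Complex.I * (m l : ℂ) * vecCoeff w m j := fun l => (hG l).2 m j
  simp_rw [hGl]
  rw [← sub_eq_zero, ← Finset.sum_sub_distrib]
  have e : ∀ l, 2 * (Real.pi : ℂ) * Complex.I * (k l : ℂ) *
      (mFourierCoeff (fun x => ((u x l : ℝ) : ℂ)) (k - m) *
        mFourierCoeff (fun x => ((w x j : ℝ) : ℂ)) m) -
      mFourierCoeff (fun x => ((u x l : ℝ) : ℂ)) (k - m) *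
        (2 * (Real.pi : ℂ) * Complex.I * (m l : ℂ) * vecCoeff w m j) =
      2 * (Real.pi : ℂ) * Complex.I * vecCoeff w m j *
        (((k - m) l : ℤ) * vecCoeff u (k - m) l) := fun l => by
    simp only [vecCoeff, Pi.sub_apply]
    push_cast
    ring
  simp_rw [e]
  rw [← Finset.mul_sum, hdiv, mul_zero]

/-! ### The cut-off and the mollifier are admissible -/

lemma IsCutoff.abs_sub_le {A : ℝ} {χ : ℝ → ℝ} (h : IsCutoff A χ) (x y : ℝ) :
    |χ x - χ y| ≤ |x - y| := by
  have h1 := Convex.norm_image_sub_le_of_norm_deriv_le (f := χ) (s := univ) (C := 1)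
    (fun z _ => (h.contDiff.differentiable (by norm_num)) z) (fun z _ => h.deriv_le z) convex_univ
    (mem_univ y) (mem_univ x)
  simpa using h1

/-- Outside [-(1 + A), 1 + A] the values are ±A; inside, χ 0 = 0 and χ is 1-Lipschitz. -/
lemma IsCutoff.abs_le {A : ℝ} (hA : 0 < A) {χ : ℝ → ℝ} (h : IsCutoff A χ) (x : ℝ) :
    |χ x| ≤ 1 + A := by
  rcases lt_or_ge (1 + A) x with hx | hx
  · rw [h.eq_right x hx, abs_of_pos hA]; linarith
  rcases lt_or_ge x (-(1 + A)) with hx' | hx'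
  · rw [h.eq_left x hx', abs_neg, abs_of_pos hA]; linarith
  · have h0 : χ 0 = 0 := h.eq_id 0 ⟨by linarith, hA.le⟩
    have := h.abs_sub_le x 0
    rw [h0, sub_zero, sub_zero] at this
    exact this.trans (_root_.abs_le.2 ⟨hx', hx⟩)

lemma torusRep_mem (z : Torus d) (j : Fin d) : torusRep z j ∈ Ico (-(1 / 2) : ℝ) (1 / 2) := by
  have h : torusRep z j ∈ Ico (-(1 / 2) : ℝ) (-(1 / 2) + 1) :=
    (AddCircle.equivIco (1 : ℝ) (-(1 / 2)) (z j)).2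
  exact ⟨h.1, h.2.trans_eq (by norm_num)⟩

lemma norm_apply_eq_abs_torusRep (z : Torus d) (j : Fin d) : ‖z j‖ = |torusRep z j| := by
  have h := torusRep_mem z j
  have h2 : ((torusRep z j : ℝ) : UnitAddCircle) = z j := congrFun (toTorus_torusRep z) j
  have h3 : |torusRep z j| ≤ |(1 : ℝ)| / 2 := by
    rw [abs_one, _root_.abs_le]
    exact ⟨h.1, h.2.le⟩
  rw [← h2]
  exact (AddCircle.norm_coe_eq_abs_iff (1 : ℝ) one_ne_zero).2 h3

/-- The increment x - x₀ is lifted by `torusRep`, whose components have the same size as those of x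
- x₀ on the circle. -/
lemma IsLip.continuous {F : Type*} [NormedAddCommGroup F] {L : ℝ} (hL : 0 ≤ L) {f : Torus d → F}
    (h : IsLip L f) : Continuous f := by
  rw [continuous_iff_continuousAt]
  intro x₀
  rw [ContinuousAt, tendsto_iff_norm_sub_tendsto_zero]
  have hlim : Tendsto (fun x : Torus d => L * ∑ j, ‖(x - x₀) j‖) (𝓝 x₀) (𝓝 0) := by
    have hc : Continuous fun x : Torus d => L * ∑ j, ‖(x - x₀) j‖ := by fun_prop
    simpa using hc.tendsto x₀
  refine squeeze_zero (fun _ => norm_nonneg _) (fun x => ?_) hlim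
  have h1 := h x₀ (torusRep (x - x₀))
  rw [toTorus_torusRep, add_sub_cancel] at h1
  refine h1.trans (mul_le_mul_of_nonneg_left ?_ hL)
  refine (norm_le_sum _).trans_eq (Finset.sum_congr rfl fun j _ => ?_)
  rw [norm_apply_eq_abs_torusRep]

/-- Periodisation of a Lipschitz function supported in the open unit cube. -/
lemma isLip_comp_torusRep {η : Vel d → ℝ} {L : ℝ}
    (hL : ∀ x y, |η x - η y| ≤ L * ‖x - y‖) (hsupp : ∀ y j, 1 / 2 ≤ |y j| → η y = 0) :
    IsLip (2 * L) fun x : Torus d => η (torusRep x) := by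
  intro x y
  set a := torusRep x with ha
  set a' := torusRep (x + toTorus y) with ha'
  -- The integers `n j` record how many faces of the cube the segment from a to a + y has crossed.
  have hn : ∀ j, ∃ n : ℤ, (n : ℝ) = a' j - (a j + y j) := fun j => by
    have e : ((a' j - (a j + y j) : ℝ) : UnitAddCircle) = 0 := by
      have e1 : toTorus (a' - (a + y)) = 0 := by
        rw [toTorus_sub, toTorus_add, ha, ha', toTorus_torusRep, toTorus_torusRep, sub_self]
      exact congrFun e1 j
    obtain ⟨n, hn⟩ := (AddCircle.coe_eq_zero_iff (1 : ℝ)).1 e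
    exact ⟨n, by simpa using hn⟩
  choose n hn using hn
  have hL0 : 0 ≤ L * ‖y‖ := by
    have := hL y 0
    rw [sub_zero] at this
    exact (abs_nonneg _).trans this
  change |η a' - η a| ≤ 2 * L * ‖y‖
  by_cases h0 : ∀ j, n j = 0
  · have e : a' = a + y := by
      ext j
      have := hn j
      rw [h0 j, Int.cast_zero] at this
      simp only [PiLp.add_apply]
      linarith
    rw [e]
    have := hL (a + y) a
    rw [add_sub_cancel_left] at this
    linarith
  -- If a face is crossed in direction j, then a + y and a' - y have a coordinate of size at least
  -- 1/2, so η vanishes there. Both η a and η a' are then at most L‖y‖, whence the factor 2.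
  · push Not at h0
    obtain ⟨j, hj⟩ := h0
    have hj1 : (1 : ℝ) ≤ |(n j : ℝ)| := by
      exact_mod_cast Int.one_le_abs hj
    have h1 := torusRep_mem x j
    have h2 := torusRep_mem (x + toTorus y) j
    rw [← ha] at h1
    rw [← ha'] at h2
    have hnj := hn j
    have z1 : η (a + y) = 0 := by
      refine hsupp _ j ?_
      rw [PiLp.add_apply]
      rcases le_abs'.1 hj1 with h | h
      · exact le_abs.2 (Or.inl (by linarith [h1.1, h1.2, h2.1, h2.2]))
      · exact le_abs.2 (Or.inr (by linarith [h1.1, h1.2, h2.1, h2.2]))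
    have z2 : η (a' - y) = 0 := by
      refine hsupp _ j ?_
      rw [PiLp.sub_apply]
      rcases le_abs'.1 hj1 with h | h
      · exact le_abs.2 (Or.inr (by linarith [h1.1, h1.2, h2.1, h2.2]))
      · exact le_abs.2 (Or.inl (by linarith [h1.1, h1.2, h2.1, h2.2]))
    have b1 := hL a (a + y)
    have b2 := hL a' (a' - y)
    rw [z1, sub_zero, sub_add_cancel_left, norm_neg] at b1
    rw [z2, sub_zero, sub_sub_cancel] at b2
    have := abs_sub (η a') (η a)
    linarith

lemma IsMollifierProfile.hasCompactSupport {θ : Vel d → ℝ} (h : IsMollifierProfile θ) :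
    HasCompactSupport θ := by
  refine Metric.isCompact_of_isClosed_isBounded (isClosed_tsupport θ) ?_
  refine (Metric.isBounded_closedBall (x := (0 : Vel d)) (r := d)).subset fun y hy => ?_
  rw [mem_closedBall_zero_iff]
  refine (norm_le_sum y).trans ((Finset.sum_le_card_nsmul _ _ 1 fun j _ => ?_).trans_eq (by simp))
  have h1 : |y j| < 1 / 2 := h.support_subset hy j
  linarith

lemma IsMollifierProfile.exists_isLip {θ : Vel d → ℝ} (h : IsMollifierProfile θ) {β : ℝ}
    (hβ : 0 ≤ β) {N : ℕ} (hN : 1 ≤ N) : ∃ L : ℝ, 0 ≤ L ∧ IsLip L (mollifier θ β N) := by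
  obtain ⟨C, hC⟩ := h.smooth.lipschitzWith_of_hasCompactSupport h.hasCompactSupport (by simp)
  have hN1 : (1 : ℝ) ≤ N := by exact_mod_cast hN
  set c := (N : ℝ) ^ ((d : ℝ) * β) with hc
  set r := (N : ℝ) ^ β with hr
  have hc0 : 0 ≤ c := Real.rpow_nonneg (by linarith) _
  have hr1 : 1 ≤ r := Real.one_le_rpow hN1 hβ
  refine ⟨2 * (c * C * r), by positivity, ?_⟩
  refine isLip_comp_torusRep (η := fun y => c * θ (r • y)) (fun x y => ?_) fun y j hy => ?_
  · have h1 := hC.dist_le_mul (r • x) (r • y)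
    rw [Real.dist_eq, dist_eq_norm, ← smul_sub, norm_smul, Real.norm_eq_abs,
      abs_of_nonneg (by linarith : 0 ≤ r)] at h1
    rw [← mul_sub, abs_mul, abs_of_nonneg hc0]
    calc _ ≤ c * (C * (r * ‖x - y‖)) := by gcongr
      _ = _ := by ring
  -- As N^β ≥ 1, dilation moves points outside the open cube further out, so the rescaled profile
  -- keeps its support in the cube.
  · have h1 : r • y ∉ tsupport θ := fun hmem => by
      have h2 : |(r • y) j| < 1 / 2 := h.support_subset hmem j
      rw [PiLp.smul_apply, smul_eq_mul, abs_mul, abs_of_nonneg (by linarith : 0 ≤ r)] at h2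
      nlinarith [abs_nonneg (y j)]
    simp only [image_eq_zero_of_notMem_tsupport h1, mul_zero]

/-- The cut-off and the mollifier of the fluid-particle system, as continuous functions. -/
lemma exists_isAdmissible {A : ℝ} (hA : 0 < A) {χ : ℝ → ℝ} (hχ : IsCutoff A χ) {θ : Vel d → ℝ}
    (hθ : IsMollifierProfile θ) {β : ℝ} (hβ : 0 ≤ β) {N : ℕ} (hN : 1 ≤ N) :
    ∃ (χ' : C(ℝ, ℝ)) (δ : C(Torus d, ℝ)) (K L : ℝ),
      ⇑χ' = χ ∧ ⇑δ = mollifier θ β N ∧ IsAdmissible χ' δ K L := by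
  obtain ⟨L, hL, hlip⟩ := hθ.exists_isLip hβ hN
  exact ⟨⟨χ, hχ.contDiff.continuous⟩, ⟨mollifier θ β N, hlip.continuous hL⟩, 1 + A, L, rfl, rfl,
    hχ.abs_le hA, hχ.abs_sub_le, hL, hlip⟩

/-! ### Finiteness of the Bessel norm by mollification -/

lemma hasSum_sq_coeff {f : Torus d → ℂ} (hf : MemLp f 2 (torusMeasure d)) :
    HasSum (fun k => ‖mFourierCoeff f k‖ ^ 2) ((eLpNorm f 2 (torusMeasure d)).toReal ^ 2) := by
  have h : HasSum (fun m => ‖mFourierCoeff (hf.toLp f) m‖ ^ 2)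
      (∫ x, ‖hf.toLp f x‖ ^ 2 ∂torusMeasure d) :=
    hasSum_sq_mFourierCoeff (d := Fin d) hf.toLp
  simp_rw [coeff_toLp] at h
  convert h using 1
  have e : ∫ t, ‖hf.toLp f t‖ ^ 2 ∂torusMeasure d = ∫ t, ‖f t‖ ^ 2 ∂torusMeasure d :=
    integral_congr_ae (hf.coeFn_toLp.mono fun x hx => by simp only [hx])
  have h0 : 0 ≤ ∫ t, ‖f t‖ ^ 2 ∂torusMeasure d := integral_nonneg fun x => sq_nonneg _
  rw [e, hf.eLpNorm_eq_integral_rpow_norm (by norm_num) (by norm_num)]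
  simp only [ENNReal.toReal_ofNat, Real.rpow_ofNat]
  rw [ENNReal.toReal_ofReal (by positivity), ← Real.rpow_natCast, ← Real.rpow_mul h0]
  norm_num

/-- An ℓ¹ bound from (1 + |k|²)^(γ/2) ≤ 1 + |k|²; its dependence on τ is irrelevant here. -/
lemma isMatrixMultiplier_besselMat_heatMat {γ : ℝ} (hγ2 : γ ≤ 2) (τ : ℝ) :
    ∃ C, IsMatrixMultiplier (d := d) (besselMat γ (heatMat τ)) C := by
  have hs : Summable fun k : Fin d → ℤ => ‖((besselMul γ k * heatMul τ k : ℝ) : ℂ)‖ := by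
    refine Summable.of_nonneg_of_le (fun _ => norm_nonneg _) (fun k => ?_)
      (summable_pow_mul_heatMul (d := d) 1 τ)
    have h1 : (1 : ℝ) ≤ 1 + freqSq k := by linarith [freqSq_nonneg k]
    have hb : besselMul γ k ≤ (1 + freqSq k) ^ 1 := by
      rw [pow_one]
      exact (Real.rpow_le_rpow_of_exponent_le h1 (by linarith)).trans_eq (Real.rpow_one _)
    have hb0 : 0 ≤ besselMul γ k := Real.rpow_nonneg (by linarith) _
    rw [Complex.norm_real, Real.norm_of_nonneg (mul_nonneg hb0 (heatMul_nonneg _ _))]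
    exact mul_le_mul_of_nonneg_right hb (heatMul_nonneg _ _)
  refine ⟨∑' k : Fin d → ℤ, ‖((besselMul γ k * heatMul τ k : ℝ) : ℂ)‖,
    tsum_nonneg fun k => norm_nonneg _, fun j i => ?_,
    fun j i => isHermitian_besselMat (isHermitian_heatMat τ j i)⟩
  by_cases h : i = j
  · have e : besselMat γ (heatMat τ) j i = fun k : Fin d → ℤ =>
        ((besselMul γ k * heatMul τ k : ℝ) : ℂ) := by
      ext k; simp [besselMat, heatMat, h]
    rw [e]
    exact isMultiplier_of_summable hs
  · have e : besselMat γ (heatMat τ) j i = fun k : Fin d → ℤ => (0 : ℂ) := by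
      ext k; simp [besselMat, heatMat, h]
    rw [e]
    exact isMultiplier_zero.mono (tsum_nonneg fun k => norm_nonneg _)

/-- The smoothed Bessel potential `(I - Δ)^{γ/2} e^{τΔ} f`. -/
def smoothBessel (γ τ : ℝ) (f : C(Torus d, Vel d)) : C(Torus d, Vel d) :=
  vecOp (besselMat γ (heatMat τ)) f

lemma vecCoeff_smoothBessel {γ : ℝ} (hγ2 : γ ≤ 2) (τ : ℝ) (f : C(Torus d, Vel d))
    (k : Fin d → ℤ) (j : Fin d) : vecCoeff (smoothBessel γ τ f) k j =
      (heatMul τ k : ℂ) * ((besselMul γ k : ℂ) * vecCoeff f k j) := by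
  obtain ⟨C, hC⟩ := isMatrixMultiplier_besselMat_heatMat (d := d) hγ2 τ
  rw [smoothBessel, hC.vecCoeff_vecOp]
  simp [besselMat, heatMat]
  ring

/-- For every potential g of f, `smoothBessel γ τ f` is the heat flow of g, which contracts L^p;
then take the infimum over g. -/
lemma eLpNorm_smoothBessel_le {γ p τ : ℝ} (hγ2 : γ ≤ 2) (hp : 1 ≤ p) (hτ : 0 < τ)
    (f : C(Torus d, Vel d)) :
    eLpNorm (smoothBessel γ τ f) (ENNReal.ofReal p) (torusMeasure d) ≤ besselNorm γ p f := by
  obtain ⟨C, hC⟩ := isMatrixMultiplier_besselMat_heatMat (d := d) hγ2 τ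
  refine le_iInf₂ fun g hg => ?_
  have e : (smoothBessel γ τ f : Torus d → Vel d) = heat τ (vecCoeff g) := by
    ext1 x
    refine (heat_eq_vecOp hτ (fun j i => (hC.isMultiplier j i).1) f (fun j k => ?_) x).symm
    rw [hg.2]
    simp [besselMat, heatMat, besselMul]
    ring
  rw [e]
  exact eLpNorm_heat_le hτ hp hg.1

lemma tendsto_heatMul (k : Fin d → ℤ) :
    Tendsto (fun n : ℕ => heatMul (1 / ((n : ℝ) + 1)) k) atTop (𝓝 1) := by
  have h : ∀ n : ℕ, heatMul (1 / ((n : ℝ) + 1)) k =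
      Real.exp (-(4 * Real.pi ^ 2 * freqSq k * (1 / ((n : ℝ) + 1)))) := fun n =>
    heatMul_of_pos (by positivity) k
  simp_rw [h]
  have := ((tendsto_one_div_add_atTop_nhds_zero_nat (𝕜 := ℝ)).const_mul
    (4 * Real.pi ^ 2 * freqSq k)).neg
  simpa [Function.comp_def] using (Real.continuous_exp.tendsto _).comp this

lemma heatMul_le_one (τ : ℝ) (k : Fin d → ℤ) : heatMul τ k ≤ 1 := by
  rw [heatMul]
  split_ifs with h
  · rw [Real.exp_le_one_iff, neg_nonpos]
    have := freqSq_nonneg k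
    positivity
  · exact zero_le_one

lemma memLp_component {q : ℝ≥0∞} {g : Torus d → Vel d} (hg : MemLp g q (torusMeasure d))
    (j : Fin d) : MemLp (fun x => ((g x j : ℝ) : ℂ)) q (torusMeasure d) :=
  (Complex.ofRealCLM.comp (EuclideanSpace.proj j : Vel d →L[ℝ] ℝ)).comp_memLp' hg

lemma eLpNorm_le_sum_component {q : ℝ≥0∞} (hq : 1 ≤ q) {g : Torus d → Vel d}
    (hg : MemLp g q (torusMeasure d)) : eLpNorm g q (torusMeasure d) ≤
      ∑ j, eLpNorm (fun x => ((g x j : ℝ) : ℂ)) q (torusMeasure d) := by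
  refine (eLpNorm_mono (g := fun x => ∑ j, ‖((g x j : ℝ) : ℂ)‖) fun x => ?_).trans ?_
  · rw [Real.norm_of_nonneg (Finset.sum_nonneg fun _ _ => norm_nonneg _)]
    simpa using norm_le_sum (g x)
  · have e : (fun x => ∑ j, ‖((g x j : ℝ) : ℂ)‖) = ∑ j, fun x => ‖((g x j : ℝ) : ℂ)‖ := by
      ext x; simp
    rw [e]
    refine (eLpNorm_sum_le (fun j _ => (memLp_component hg j).1.norm) hq).trans_eq ?_
    simp only [eLpNorm_norm]

lemma eLpNorm_component_le {q : ℝ≥0∞} (g : Torus d → Vel d) (j : Fin d) :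
    eLpNorm (fun x => ((g x j : ℝ) : ℂ)) q (torusMeasure d) ≤ eLpNorm g q (torusMeasure d) :=
  eLpNorm_mono fun x => by simpa using norm_apply_le (g x) j

lemma memLp_of_components {q : ℝ≥0∞} {g : Fin d → Torus d → ℝ}
    (hg : ∀ j, MemLp (g j) q (torusMeasure d)) :
    MemLp (fun x => (WithLp.toLp 2 fun j => g j x : Vel d)) q (torusMeasure d) := by
  have e : (fun x => (WithLp.toLp 2 fun j => g j x : Vel d)) =
      fun x => ∑ j, g j x • (EuclideanSpace.single j 1 : Vel d) := by
    ext x i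
    simp [Pi.single_apply]
  rw [e]
  exact memLp_finsetSum _ fun j _ =>
    ((ContinuousLinearMap.id ℝ ℝ).smulRight (EuclideanSpace.single j 1 : Vel d)).comp_memLp' (hg j)

/-- If the smoothed Bessel potentials of `f` are bounded in `L²`, they converge in `L²` to the
Bessel potential of `f`. -/
lemma exists_tendsto_smoothBessel {γ : ℝ} (hγ2 : γ ≤ 2) {f : C(Torus d, Vel d)} {C : ℝ≥0}
    (hC : ∀ n : ℕ, eLpNorm (smoothBessel γ (1 / ((n : ℝ) + 1)) f) 2 (torusMeasure d) ≤ C) :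
    ∃ g : Torus d → Vel d, MemLp g 2 (torusMeasure d) ∧
      (∀ k j, vecCoeff g k j = (besselMul γ k : ℂ) * vecCoeff f k j) ∧
      Tendsto (fun n : ℕ => eLpNorm
        (fun x => smoothBessel γ (1 / ((n : ℝ) + 1)) f x - g x) 2 (torusMeasure d))
        atTop (𝓝 0) := by
  have hK : ∀ τ, MemLp (smoothBessel γ τ f) 2 (torusMeasure d) := fun τ =>
    memLp_of_continuous (smoothBessel γ τ f).continuous 2
  -- Parseval bounds the smoothed coefficients on each finite set of frequencies; letting the
  -- smoothing time tend to 0 gives an ℓ² bound for the coefficients of the sought potential.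
  have hbound : ∀ (j : Fin d) (F : Finset (Fin d → ℤ)),
      ∑ k ∈ F, ‖(besselMul γ k : ℂ) * vecCoeff f k j‖ ^ 2 ≤ (C : ℝ) ^ 2 := fun j F => by
    have hlim : Tendsto (fun n : ℕ => ∑ k ∈ F, ‖(heatMul (1 / ((n : ℝ) + 1)) k : ℂ) *
        ((besselMul γ k : ℂ) * vecCoeff f k j)‖ ^ 2) atTop
        (𝓝 (∑ k ∈ F, ‖((1 : ℝ) : ℂ) * ((besselMul γ k : ℂ) * vecCoeff f k j)‖ ^ 2)) :=
      tendsto_finsetSum _ fun k _ => ((((Complex.continuous_ofReal.tendsto _).comp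
        (tendsto_heatMul k)).mul_const _).norm).pow 2
    simp only [Complex.ofReal_one, one_mul] at hlim
    refine le_of_tendsto' hlim fun n => ?_
    have h := hasSum_sq_coeff (memLp_component (hK (1 / ((n : ℝ) + 1))) j)
    have h2 := sum_le_hasSum F (fun _ _ => sq_nonneg _) h
    have e : ∀ k, mFourierCoeff (fun x => ((smoothBessel γ (1 / ((n : ℝ) + 1)) f x j : ℝ) : ℂ)) k =
      (heatMul (1 / ((n : ℝ) + 1)) k : ℂ) * ((besselMul γ k : ℂ) * vecCoeff f k j) := fun k =>
        vecCoeff_smoothBessel hγ2 _ f k j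
    simp_rw [e] at h2
    refine h2.trans (pow_le_pow_left₀ ENNReal.toReal_nonneg ?_ 2)
    exact ENNReal.toReal_mono ENNReal.coe_ne_top ((eLpNorm_component_le _ j).trans (hC n))
  have hherm : ∀ j : Fin d, IsHermitianSymbol fun k => (besselMul γ k : ℂ) * vecCoeff f k j :=
    fun j k => by
      have e : vecCoeff f (-k) j = (starRingEnd ℂ) (vecCoeff f k j) :=
        coeff_neg_of_real (fun x => f x j) k
      simp only [e, besselMul_neg, map_mul, Complex.conj_ofReal]
  choose g hg hgc using fun j => exists_real_coeff (hherm j) (hbound j)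
  have hgv := memLp_of_components hg
  refine ⟨_, hgv, fun k j => hgc j k, ?_⟩
  have hdiff : ∀ n : ℕ, MemLp (fun x => smoothBessel γ (1 / ((n : ℝ) + 1)) f x -
      (WithLp.toLp 2 fun j => g j x : Vel d)) 2 (torusMeasure d) := fun n => (hK _).sub hgv
  have hcomp : ∀ j : Fin d, Tendsto (fun n : ℕ => eLpNorm (fun x =>
      (((smoothBessel γ (1 / ((n : ℝ) + 1)) f x - (WithLp.toLp 2 fun j => g j x : Vel d)) j : ℝ)
        : ℂ)) 2 (torusMeasure d)) atTop (𝓝 0) := fun j => by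
    have hm := fun n => memLp_component (hdiff n) j
    rw [← ENNReal.tendsto_toReal_iff (fun n => (hm n).2.ne) ENNReal.zero_ne_top,
      ENNReal.toReal_zero]
    -- By Parseval the squared L² distance is a series with factors |heatMul - 1|² ≤ 1, and
    -- dominated convergence applies.
    have hsq : ∀ n : ℕ, (eLpNorm (fun x => (((smoothBessel γ (1 / ((n : ℝ) + 1)) f x -
        (WithLp.toLp 2 fun j => g j x : Vel d)) j : ℝ) : ℂ)) 2 (torusMeasure d)).toReal ^ 2 =
        ∑' k, ‖((heatMul (1 / ((n : ℝ) + 1)) k : ℂ) - 1) *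
          ((besselMul γ k : ℂ) * vecCoeff f k j)‖ ^ 2 := fun n => by
      rw [← (hasSum_sq_coeff (hm n)).tsum_eq]
      refine tsum_congr fun k => ?_
      congr 2
      rw [sub_mul, one_mul, ← vecCoeff_smoothBessel hγ2, ← hgc, coeff_def]
      have i1 := integrable_mFourier_mul
        ((memLp_component (hK (1 / ((n : ℝ) + 1))) j).integrable (by norm_num)) (-k)
      have i2 := integrable_mFourier_mul ((memLp_component hgv j).integrable (by norm_num)) (-k)
      simp only [PiLp.sub_apply, Complex.ofReal_sub, mul_sub]
      exact integral_sub i1 i2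
    have hs : Summable fun k => ‖(besselMul γ k : ℂ) * vecCoeff f k j‖ ^ 2 :=
      summable_of_sum_le (fun _ => sq_nonneg _) (hbound j)
    have ht : Tendsto (fun n : ℕ => ∑' k, ‖((heatMul (1 / ((n : ℝ) + 1)) k : ℂ) - 1) *
        ((besselMul γ k : ℂ) * vecCoeff f k j)‖ ^ 2) atTop (𝓝 (∑' _ : Fin d → ℤ, (0 : ℝ))) := by
      refine tendsto_tsum_of_dominated_convergence hs (fun k => ?_)
        (Eventually.of_forall fun n k => ?_)
      · have h1 : Tendsto (fun n : ℕ => (heatMul (1 / ((n : ℝ) + 1)) k : ℂ) - 1) atTop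
            (𝓝 (((1 : ℝ) : ℂ) - 1)) :=
          ((Complex.continuous_ofReal.tendsto _).comp (tendsto_heatMul k)).sub_const _
        simpa using ((h1.mul_const ((besselMul γ k : ℂ) * vecCoeff f k j)).norm).pow 2
      · rw [Real.norm_of_nonneg (sq_nonneg _), norm_mul]
        have h1 : ‖(heatMul (1 / ((n : ℝ) + 1)) k : ℂ) - 1‖ ≤ 1 := by
          rw [← Complex.ofReal_one, ← Complex.ofReal_sub, Complex.norm_real, Real.norm_eq_abs,
            abs_le]
          constructor <;> linarith [heatMul_nonneg (1 / ((n : ℝ) + 1)) k,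
            heatMul_le_one (1 / ((n : ℝ) + 1)) k]
        exact pow_le_pow_left₀ (by positivity)
          (mul_le_of_le_one_left (norm_nonneg _) h1) 2
    rw [tsum_zero] at ht
    simp_rw [← hsq] at ht
    have := (Real.continuous_sqrt.tendsto _).comp ht
    simpa [Function.comp_def, Real.sqrt_sq ENNReal.toReal_nonneg] using this
  refine tendsto_of_tendsto_of_tendsto_of_le_of_le tendsto_const_nhds
    (g := fun _ => 0) (h := fun n : ℕ => ∑ j, eLpNorm (fun x =>
      (((smoothBessel γ (1 / ((n : ℝ) + 1)) f x - (WithLp.toLp 2 fun j => g j x : Vel d)) j : ℝ)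
        : ℂ)) 2 (torusMeasure d)) ?_ (fun _ => bot_le) fun n =>
      eLpNorm_le_sum_component (by norm_num) (hdiff n)
  simpa using tendsto_finsetSum Finset.univ fun j _ => hcomp j

/-- Since p ≥ 2 the L^p bounds imply L² bounds, so the smoothed potentials converge in L² to a
potential g. Fatou's lemma along an almost everywhere convergent subsequence puts g in L^p. -/
lemma besselNorm_lt_top_of_smoothBessel {γ p : ℝ} (hγ2 : γ ≤ 2) (hp : 2 ≤ p)
    {f : C(Torus d, Vel d)} {C : ℝ≥0}
    (hC : ∀ n : ℕ, eLpNorm (smoothBessel γ (1 / ((n : ℝ) + 1)) f) (ENNReal.ofReal p)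
      (torusMeasure d) ≤ C) : besselNorm γ p f < ∞ := by
  have hp2 : (2 : ℝ≥0∞) ≤ ENNReal.ofReal p := by
    rw [← ENNReal.ofReal_ofNat 2]
    exact ENNReal.ofReal_le_ofReal hp
  have hm : ∀ n : ℕ, AEStronglyMeasurable (smoothBessel γ (1 / ((n : ℝ) + 1)) f)
      (torusMeasure d) := fun n => (integrable_of_continuous
        (smoothBessel γ (1 / ((n : ℝ) + 1)) f).continuous).aestronglyMeasurable
  obtain ⟨g, hg, hgc, hlim⟩ := exists_tendsto_smoothBessel hγ2 (f := f) (C := C) fun n =>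
    (eLpNorm_le_eLpNorm_of_exponent_le hp2 (hm n)).trans (hC n)
  obtain ⟨ns, -, hns⟩ := (tendstoInMeasure_of_tendsto_eLpNorm (by norm_num) hm
    hg.aestronglyMeasurable hlim).exists_seq_tendsto_ae
  have hgp : eLpNorm g (ENNReal.ofReal p) (torusMeasure d) ≤ C :=
    Lp.eLpNorm_le_of_ae_tendsto (Eventually.of_forall fun n => hC (ns n)) (fun n => hm (ns n)) hns
  have hgm : MemLp g (ENNReal.ofReal p) (torusMeasure d) :=
    ⟨hg.aestronglyMeasurable, hgp.trans_lt ENNReal.coe_lt_top⟩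
  exact (iInf₂_le g ⟨hgm, hgc⟩).trans_lt hgm.2

lemma stronglyMeasurable_smoothBessel {Ω : Type*} [MeasurableSpace Ω] {γ : ℝ} (hγ2 : γ ≤ 2)
    (τ : ℝ) {u : Ω → C(Torus d, Vel d)} (hu : StronglyMeasurable u) :
    StronglyMeasurable fun ω => smoothBessel γ τ (u ω) := by
  obtain ⟨C, hC⟩ := isMatrixMultiplier_besselMat_heatMat (d := d) hγ2 τ
  exact stronglyMeasurable_vecOp (M := fun _ => besselMat γ (heatMat τ))
    (fun _ _ _ => measurable_const) (fun _ j i => (hC.isMultiplier j i).1) hu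

/-- A random field whose Bessel norm has a finite moment has almost surely a finite Bessel norm.
The Bessel norm is not assumed to be measurable. -/
lemma ae_besselNorm_lt_top {Ω : Type*} [MeasurableSpace Ω] {P : Measure Ω} {γ p : ℝ}
    (hγ2 : γ ≤ 2) (hp : 2 ≤ p) {u : Ω → C(Torus d, Vel d)} (hu : StronglyMeasurable u)
    (hmom : ∫⁻ ω, besselNorm γ p (u ω) ^ p ∂P ≠ ∞) : ∀ᵐ ω ∂P, besselNorm γ p (u ω) < ∞ := by
  have hp0 : 0 < p := by linarith
  -- This supremum is measurable and lies below the p-th power of the Bessel norm, so it has a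
  -- finite integral and is almost surely finite; its finiteness suffices by
  -- `besselNorm_lt_top_of_smoothBessel`.
  have hmeas : Measurable fun ω => ⨆ n : ℕ,
      ∫⁻ y, ‖smoothBessel γ (1 / ((n : ℝ) + 1)) (u ω) y‖ₑ ^ p ∂torusMeasure d := by
    refine Measurable.iSup fun n => Measurable.lintegral_prod_right' (ν := torusMeasure d)
      (f := fun z : Ω × Torus d => ‖smoothBessel γ (1 / ((n : ℝ) + 1)) (u z.1) z.2‖ₑ ^ p) ?_
    have h1 := (stronglyMeasurable_smoothBessel hγ2 (1 / ((n : ℝ) + 1)) hu).comp_measurable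
      (measurable_fst : Measurable fun z : Ω × Torus d => z.1)
    have h2 : StronglyMeasurable fun z : Ω × Torus d => z.2 :=
      measurable_snd.stronglyMeasurable
    have h3 := continuous_eval.comp_stronglyMeasurable (h1.prodMk h2)
    exact (h3.measurable.enorm).pow_const p
  have hle : ∀ ω, ⨆ n : ℕ, ∫⁻ y, ‖smoothBessel γ (1 / ((n : ℝ) + 1)) (u ω) y‖ₑ ^ p ∂torusMeasure d
      ≤ besselNorm γ p (u ω) ^ p := fun ω => iSup_le fun n => by
    rw [← eLpNorm_rpow_eq hp0]
    exact ENNReal.rpow_le_rpow (eLpNorm_smoothBessel_le hγ2 (by linarith) (by positivity) _) hp0.le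
  filter_upwards [ae_lt_top hmeas ((lintegral_mono hle).trans_lt hmom.lt_top).ne] with ω hω
  set H := ⨆ n : ℕ, ∫⁻ y, ‖smoothBessel γ (1 / ((n : ℝ) + 1)) (u ω) y‖ₑ ^ p ∂torusMeasure d with hH
  have hHt : H ^ p⁻¹ ≠ ∞ := ENNReal.rpow_ne_top_of_nonneg (by positivity) hω.ne
  refine besselNorm_lt_top_of_smoothBessel hγ2 hp (C := (H ^ p⁻¹).toNNReal) fun n => ?_
  rw [ENNReal.coe_toNNReal hHt, ENNReal.le_rpow_inv_iff hp0, eLpNorm_rpow_eq hp0]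
  exact le_iSup (fun n : ℕ =>
    ∫⁻ y, ‖smoothBessel γ (1 / ((n : ℝ) + 1)) (u ω) y‖ₑ ^ p ∂torusMeasure d) n

/-! ### Adaptedness and the full-measure event -/

lemma stronglyMeasurable_noise {Ω : Type*} {m : MeasurableSpace Ω} {N : ℕ}
    {w : Ω → ℝ → Fin N → Vel d} (hw : ∀ s, StronglyMeasurable[m] fun ω => w ω s)
    (hwc : ∀ ω, Continuous (w ω)) : StronglyMeasurable fun q : ℝ × Ω => w q.2 q.1 :=
  stronglyMeasurable_uncurry_of_continuous_of_stronglyMeasurable (u := fun s ω => w ω s) hwc hw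

/-- The noise stopped at t is jointly measurable for the σ-algebra `m`, which only knows the noise
up to t. By causality the solution driven by the stopped noise is the same up to time t. -/
lemma IsAdmissible.stronglyMeasurable_solution_at {N : ℕ} {χ : C(ℝ, ℝ)} {δ : C(Torus d, ℝ)}
    {K L T γ : ℝ} (h : IsAdmissible χ δ K L) (hγ : 0 ≤ γ) (hγ1 : γ < 1) (hT : 0 < T)
    {Ω : Type*} {m : MeasurableSpace Ω} {u₀ : Ω → C(Torus d, Vel d)}
    (hu₀ : StronglyMeasurable[m] u₀) {x₀ : Ω → Fin N → Torus d} (hx₀ : StronglyMeasurable[m] x₀)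
    {w : Ω → ℝ → Fin N → Vel d} (hwc : ∀ ω, Continuous (w ω)) {t : ℝ} (ht : 0 ≤ t)
    (hw : ∀ s ≤ t, StronglyMeasurable[m] fun ω => w ω s) :
    (StronglyMeasurable[m] fun ω => solution χ δ (x₀ ω) (freeEvolution (u₀ ω) (w ω)) T t) ∧
      StronglyMeasurable[m] fun ω =>
        position (x₀ ω) (solution χ δ (x₀ ω) (freeEvolution (u₀ ω) (w ω)) T) t := by
  have hc : ∀ ω, Continuous fun s => w ω (min s t) := fun ω =>
    (hwc ω).comp (continuous_id.min continuous_const)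
  have hj := h.stronglyMeasurable_solution hγ hγ1 hT hu₀ hx₀
    (stronglyMeasurable_noise (fun s => hw (min s t) (min_le_right s t)) hc) hc
  have hst : ∀ ω, ∀ s ≤ t, solution χ δ (x₀ ω) (freeEvolution (u₀ ω) (w ω)) T s =
      solution χ δ (x₀ ω) (freeEvolution (u₀ ω) fun s => w ω (min s t)) T s := fun ω =>
    solution_congr ht fun s hs => by simp only [freeEvolution, min_eq_left hs]
  constructor
  · simp_rw [fun ω => hst ω t le_rfl]
    exact hj.comp_measurable measurable_prodMk_left
  · have e : (fun ω => position (x₀ ω) (solution χ δ (x₀ ω) (freeEvolution (u₀ ω) (w ω)) T) t) =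
        fun ω => position (x₀ ω)
          (solution χ δ (x₀ ω) (freeEvolution (u₀ ω) fun s => w ω (min s t)) T) t := by
      ext1 ω
      exact position_congr fun s hs => hst ω s hs.2.le
    rw [e]
    exact (stronglyMeasurable_position hx₀ (z := fun s ω => solution χ δ (x₀ ω)
      (freeEvolution (u₀ ω) fun s => w ω (min s t)) T s) hj).comp_measurable measurable_prodMk_left

/-- The complement is a null set, and 𝓕 0 contains all of those; no measurability of the predicate
is needed. -/
lemma UsualConditions.measurableSet_of_ae {Ω : Type*} {mΩ : MeasurableSpace Ω} {P : Measure Ω}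
    {𝓕 : Filtration ℝ≥0 mΩ} (h𝓕 : UsualConditions 𝓕 P) {q : Ω → Prop} (hq : ∀ᵐ ω ∂P, q ω) :
    MeasurableSet[𝓕 0] {ω | q ω} := by
  have h : MeasurableSet[𝓕 0] {ω | q ω}ᶜ := h𝓕.complete _ (by simpa [ae_iff, Set.compl_ofPred] using hq)
  simpa using h.compl

end FluidParticle

end

/-! ### The process on the full-measure event, its measurability and adaptedness -/

open FluidParticle in
theorem proposition3 {d : ℕ} (hd : d = 2 ∨ d = 3) {T : ℝ} (hT : 0 < T)
    {p γ : ℝ} (hp : (d : ℝ) < p) (hγ : γ ∈ Set.Ioo ((d : ℝ) / p) 1)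
    {A : ℝ} (hA : 0 < A) {χ : ℝ → ℝ} (hχ : FluidParticle.IsCutoff A χ)
    {θ : FluidParticle.Vel d → ℝ} (hθ : FluidParticle.IsMollifierProfile θ)
    {β : ℝ} (hβ : β ∈ Set.Ioc (0 : ℝ) 1)
    {σ : ℕ → ℝ} (hσ : ∀ N, 1 ≤ N → 0 < σ N)
    {Ω : Type*} {mΩ : MeasurableSpace Ω} {P : Measure Ω} [IsProbabilityMeasure P]
    {𝓕 : Filtration ℝ≥0 mΩ} (h𝓕 : FluidParticle.UsualConditions 𝓕 P)
    {B : ℕ → ℝ≥0 → Ω → FluidParticle.Vel d}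
    (hB : ∀ i, FluidParticle.IsFiltrationBrownian 𝓕 P (B i))
    (hBindep : iIndepFun (fun i ω (t : ℝ≥0) => B i t ω) P)
    {X₀ : ℕ → Ω → FluidParticle.Torus d} (hX₀ : ∀ i, Measurable[𝓕 0] (X₀ i))
    {V₀ : ℕ → Ω → FluidParticle.Vel d} (hV₀ : ∀ i, Measurable[𝓕 0] (V₀ i))
    {u₀ : ℕ → Ω → C(FluidParticle.Torus d, FluidParticle.Vel d)}
    (hu₀ : ∀ N, 1 ≤ N → StronglyMeasurable[𝓕 0] (u₀ N))
    (hu₀div : ∀ N, 1 ≤ N → ∀ᵐ ω ∂P, FluidParticle.IsDivFree (u₀ N ω))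
    (hu₀mom : FluidParticle.InitialMoments γ p P u₀)
    (N : ℕ) (hN : 1 ≤ N) :
    ∃ (ΩN : Set Ω) (u : ℝ → Ω → C(FluidParticle.Torus d, FluidParticle.Vel d))
      (X : Fin N → ℝ → Ω → FluidParticle.Torus d) (V : Fin N → ℝ → Ω → FluidParticle.Vel d),
      MeasurableSet ΩN ∧ P ΩN = 1 ∧
      (∀ ω ∈ ΩN,
        -- the fluid velocity solves the mild equation
        FluidParticle.IsMildSolution γ p T χ (FluidParticle.mollifier θ β N) (u₀ N ω)
          (fun i t => X i t ω) (fun i t => V i t ω) (fun t => u t ω) ∧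
        -- in that equation the convection term is a function, for almost every time
        (∀ᵐ t ∂(volume.restrict (Icc 0 T)), FluidParticle.IsConvectionFunction (u t ω)
          fun y => FluidParticle.vecCutoff χ (u t ω y)) ∧
        -- and the solution of the mild equation is unique, given the particles
        (∀ u' : ℝ → C(FluidParticle.Torus d, FluidParticle.Vel d),
          FluidParticle.IsMildSolution γ p T χ (FluidParticle.mollifier θ β N) (u₀ N ω)
            (fun i t => X i t ω) (fun i t => V i t ω) u' →
          ∀ t ∈ Icc 0 T, u' t = u t ω) ∧
        -- the particles solve their equations
        (∀ i : Fin N, FluidParticle.IsParticleSolution T χ (σ N) (fun t => u t ω)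
          (X₀ i ω) (V₀ i ω) (fun t => B i t.toNNReal ω) (fun t => X i t ω) fun t => V i t ω) ∧
        -- the solution of the coupled system is unique
        (∀ (u' : ℝ → C(FluidParticle.Torus d, FluidParticle.Vel d))
          (x' : Fin N → ℝ → FluidParticle.Torus d) (v' : Fin N → ℝ → FluidParticle.Vel d),
          FluidParticle.IsSystemSolution γ p T χ (FluidParticle.mollifier θ β N) (σ N) (u₀ N ω)
            (fun i => X₀ i ω) (fun i => V₀ i ω) (fun i t => B i t.toNNReal ω) u' x' v' →
          ∀ t ∈ Icc 0 T, u' t = u t ω ∧ ∀ i, x' i t = X i t ω ∧ v' i t = V i t ω)) ∧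
      -- the process is jointly measurable in time and randomness
      StronglyMeasurable (fun z : Icc (0 : ℝ) T × Ω => u z.1 z.2) ∧
      (∀ i, Measurable fun z : Icc (0 : ℝ) T × Ω => X i z.1 z.2) ∧
      (∀ i, Measurable fun z : Icc (0 : ℝ) T × Ω => V i z.1 z.2) ∧
      -- and adapted
      (∀ t : ℝ≥0, (t : ℝ) ≤ T → StronglyMeasurable[𝓕 t] (u t) ∧
        ∀ i, Measurable[𝓕 t] (X i t) ∧ Measurable[𝓕 t] (V i t)) := by
  obtain ⟨χ, δ, K, L, rfl, hδ, hadm⟩ := exists_isAdmissible hA hχ hθ hβ.1.le hN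
  rw [← hδ]
  have hd2 : (2 : ℝ) ≤ d := by
    rcases hd with rfl | rfl <;> norm_num
  have hp2 : 2 ≤ p := hd2.trans hp.le
  have hp1 : 1 ≤ p := by linarith
  have hγ0 : 0 ≤ γ := (show (0 : ℝ) ≤ d / p by positivity).trans hγ.1.le
  have hbessel : ∀ᵐ ω ∂P, besselNorm γ p (u₀ N ω) < ∞ := by
    -- The moment of order q = p matches the p-th power used in the measurable lower bound of the
    -- Bessel norm.
    obtain ⟨C, hC⟩ := hu₀mom p hp1
    exact ae_besselNorm_lt_top (by linarith [hγ.2]) hp2 ((hu₀ N hN).mono (𝓕.le 0))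
      ((hC N hN).2.trans_lt ENNReal.coe_lt_top).ne
  have hBc : ∀ᵐ ω ∂P, ∀ i, Continuous fun t => B i t ω :=
    ae_all_iff.2 fun i => (hB i).continuous_paths
  have hae : ∀ᵐ ω ∂P, (∀ i, Continuous fun t => B i t ω) ∧ IsDivFree (u₀ N ω) ∧
      besselNorm γ p (u₀ N ω) < ∞ := hBc.and ((hu₀div N hN).and hbessel)
  have hS := h𝓕.measurableSet_of_ae hae
  set S := {ω | (∀ i, Continuous fun t => B i t ω) ∧ IsDivFree (u₀ N ω) ∧
    besselNorm γ p (u₀ N ω) < ∞} with hSdef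
  -- Off S the initial field and the noise are replaced by 0, so that the construction works for
  -- every ω. As S belongs to 𝓕 0, this keeps measurability and adaptedness.
  set U : Ω → C(Torus d, Vel d) := S.indicator (u₀ N) with hU
  set b : Ω → Fin N → ℝ → Vel d := fun ω i t => S.indicator (B i t.toNNReal) ω with hb
  set w : Ω → ℝ → Fin N → Vel d := fun ω t i => V₀ i ω + σ N • b ω i t with hw
  set x : Ω → Fin N → Torus d := fun ω i => X₀ i ω with hx
  have hbc : ∀ ω i, Continuous (b ω i) := fun ω i => by
    by_cases hω : ω ∈ S
    · simp only [hb, indicator_of_mem hω]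
      exact (hω.1 i).comp continuous_real_toNNReal
    · simp only [hb, indicator_of_notMem hω]
      exact continuous_const
  have hwc : ∀ ω, Continuous (w ω) := fun ω =>
    continuous_pi fun i => by
      have := hbc ω i
      simp only [hw]
      fun_prop
  have hUm : StronglyMeasurable[𝓕 0] U := (hu₀ N hN).indicator hS
  have hxm : Measurable[𝓕 0] x := (@measurable_pi_iff _ _ _ (𝓕 0) _ _).2 fun i => hX₀ i
  have hwm : ∀ t : ℝ≥0, ∀ s ≤ (t : ℝ), Measurable[𝓕 t] fun ω => w ω s := fun t s hs => by
    refine (@measurable_pi_iff _ _ _ (𝓕 t) _ _).2 fun i => ?_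
    have h1 : Measurable[𝓕 t] (V₀ i) := (hV₀ i).mono (𝓕.mono zero_le) le_rfl
    have h2 : Measurable[𝓕 t] (B i s.toNNReal) :=
      ((hB i).adapted _).mono (𝓕.mono (Real.toNNReal_le_iff_le_coe.2 hs)) le_rfl
    exact h1.add ((h2.indicator (𝓕.mono (zero_le (a := t)) _ hS)).const_smul (σ N))
  set Z : ℝ → Ω → State d N := fun t ω => solution χ δ (x ω) (freeEvolution (U ω) (w ω)) T t with hZ
  have hZm : StronglyMeasurable fun q : ℝ × Ω => Z q.1 q.2 :=
    hadm.stronglyMeasurable_solution hγ0 hγ.2 hT (hUm.mono (𝓕.le 0))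
      (hxm.mono (𝓕.le 0) le_rfl).stronglyMeasurable
      (stronglyMeasurable_noise (fun s => ((hwm (Real.toNNReal s) s (Real.le_coe_toNNReal s)).mono
        (𝓕.le _) le_rfl).stronglyMeasurable) hwc) hwc
  have hPm := stronglyMeasurable_position (hxm.mono (𝓕.le 0) le_rfl).stronglyMeasurable hZm
  have hincl : Measurable fun z : Icc (0 : ℝ) T × Ω => ((z.1 : ℝ), z.2) :=
    (measurable_subtype_coe.comp measurable_fst).prodMk measurable_snd
  refine ⟨S, fun t ω => (Z t ω).1, fun i t ω => position (x ω) (fun s => Z s ω) t i,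
    fun i t ω => (Z t ω).2 i, 𝓕.le 0 _ hS, ?_, fun ω hω => ?_, ?_, fun i => ?_, fun i => ?_,
    fun t htT => ?_⟩
  · exact (mem_ae_iff_prob_eq_one (𝓕.le 0 _ hS)).1 hae
  · obtain ⟨M, A', hM, hA', hzm, -, hzM, hlip, hfix⟩ :=
      hadm.exists_solution hγ0 hγ.2 hT (U ω) (x ω) (hwc ω)
    have hUω : U ω = u₀ N ω := indicator_of_mem hω _
    have hbω : ∀ i, b ω i = fun t : ℝ => B i t.toNNReal ω := fun i => by
      ext1 t
      exact indicator_of_mem hω _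
    have hwω : w ω = fun (t : ℝ) (i : Fin N) => V₀ i ω + σ N • B i t.toNNReal ω := by
      ext1 t
      ext1 i
      simp only [hw, hbω]
    have hcB : ∀ i : Fin N, Continuous fun t : ℝ => B i t.toNNReal ω := fun i =>
      (hω.1 i).comp continuous_real_toNNReal
    have hZω : (fun s => Z s ω) = solution χ δ (x ω) (freeEvolution (U ω) (w ω)) T := rfl
    rw [← hZω] at hzm hzM hlip hfix
    rw [hUω, hwω] at hfix
    have hsol : IsMildSolution γ p T χ δ (u₀ N ω) (fun i t => position (x ω) (fun s => Z s ω) t i)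
        (fun i t => (Z t ω).2 i) (fun t => (Z t ω).1) :=
      hadm.isMildSolution hγ0 hγ.2 hT hp1 hω.2.2 hω.2.1 hzm hM hzM hfix
    refine ⟨hsol, ?_, fun u' => hadm.mild_unique hγ hT hp hp1 hzm hA' hzM hlip hfix,
      fun i => (hadm.isForcing N hγ0 hγ.2 hT).isParticleSolution hT hcB hzm hzM hfix i,
      fun u' x' v' => hadm.system_unique hγ hT hp hp1 hzm hA' hzM hlip hfix⟩
    -- The Lipschitz constant blows up at t = 0, where the initial datum need not be Lipschitz; this
    -- single time is negligible.
    rw [restrict_Ioc_eq_restrict_Icc.symm]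
    refine (ae_restrict_iff' measurableSet_Ioc).2 (ae_of_all _ fun t ht => ?_)
    exact (hsol.divFree t (Ioc_subset_Icc_self ht)).isConvectionFunction
      (mul_nonneg (Nat.cast_nonneg d) (mul_nonneg hA' (Real.rpow_nonneg ht.1.le _)))
      (hadm.isLip_cutField (hlip t ht.1 ht.2))
  · exact continuous_fst.comp_stronglyMeasurable (hZm.comp_measurable hincl)
  · exact (((continuous_apply i).comp_stronglyMeasurable hPm).measurable).comp hincl
  · exact ((continuous_apply i).comp continuous_snd).comp_stronglyMeasurable
      (hZm.comp_measurable hincl) |>.measurable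
  · obtain ⟨h1, h2⟩ := hadm.stronglyMeasurable_solution_at hγ0 hγ.2 hT
      (hUm.mono (𝓕.mono (zero_le (a := t)))) (hxm.mono (𝓕.mono (zero_le (a := t))) le_rfl).stronglyMeasurable
      hwc t.2 (fun s hs => (hwm t s hs).stronglyMeasurable)
    exact ⟨continuous_fst.comp_stronglyMeasurable h1, fun i =>
      ⟨((continuous_apply i).comp_stronglyMeasurable h2).measurable,
      (((continuous_apply i).comp continuous_snd).comp_stronglyMeasurable h1).measurable⟩⟩
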